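/- Let $n\ge 3$, let $R_0\ge 0$, let $\mathcal K\subset B(0,R_0)\subset\mathbb R^n$ be compact (possibly empty), and put $\Omega=\mathbb R^n\setminus\mathcal K$, $M=[0,\infty)\times\Omega$ with points $(t,x)$, $r=|x|$. All norms below are over $t\ge 0$ and $x\in\Omega$ with respect to $dt$ and $dx$. Write $\partial=(\partial_0,\dots,\partial_n)=(\partial_t,\nabla_x)$, $\Omega_{ij}=x^i\partial_j-x^j\partial_i$ $(1\le i<j\le n)$, $Y=(\nabla_x,(\Omega_{ij}))$, $Z=(\partial_t,Y)$. For a family $X$ of vector fields and a word $a$ in its members, $X^a$ is the corresponding composition, and $\|X^{\le k}u\|_A=\sum_{|a|\le k}\|X^au\|_A$; derivatives at $t=0$ are one-sided. Let $(\varphi_j)_{j\ge 0}$ be smooth functions on $\mathbb R^n$ with $\sum_j\varphi_j^2=1$, $\varphi_0$ supported in $|x|\le 2$ and $\varphi_j$ supported in $2^{j-1}\le|x|\le 2^{j+1}$ for $j\ge1$, and let $\|u\|_{\ell^s_q(A)}=\big\|\big(2^{js}\|\varphi_ju\|_A\big)_{j\ge 0}\big\|_{\ell^q}$. (H1) Let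 $g=g_{\alpha\beta}\,dx^\alpha dx^\beta$ be a smooth Lorentzian metric on $M$ of the form $g=m+g_1+g_2$, where $m=\mathrm{diag}(-1,1,\dots,1)$, $g_1,g_2$ are smooth, $g_1$ is radial, i.e. $g_1=\tilde g_{00}(t,r)dt^2+2\tilde g_{01}(t,r)dt\,dr+\tilde g_{11}(t,r)dr^2+\tilde g_{22}(t,r)r^2d\omega^2$, and $\|\partial^ag_{j,\alpha\beta}\|_{\ell^{|a|+j-1}_1L^\infty_{t,x}}<\infty$ for $j=1,2$ and all $a,\alpha,\beta$. Let $\Box_gu=|g|^{-1/2}\partial_\alpha\big(g^{\alpha\beta}|g|^{1/2}\partial_\beta u\big)$ with $|g|=-\det(g_{\alpha\beta})$. Let $\mathcal S$ be a set of real functions on $M$, the class in which solutions are taken (for example all functions, or those satisfying a boundary condition on $\partial\mathcal K$). For $k\ge0$, a solution of $\Box_gu=F$ at level $k$ means a function $u\in\mathcal S$ of class $C^{k+2}$ on $M$ (up to $t=0$) with $\Box_gu=F$ on $M$. Let $R_1>R_0$, let $\psi$ be a smooth nonnegative function on $\mathbb R^n$ with $\psi=1$ for $r>R_1+1$ and $\psi=0$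 for $r<R_1$, and let $$\|u\|_{LE_g}=\|\partial u\|_{L^\infty_tL^2_x}+\|\psi\,\partial u\|_{\ell^{-1/2}_\infty L^2_tL^2_x}+\|u\|_{\ell^{-3/2}_\infty L^2_tL^2_x}.$$ (H2) Assume that for every $k\ge0$ there is a constant $C_k$ such that all solutions $u$ of $\Box_gu=F$ at level $k$ satisfy $$\|\partial^{\le k}u\|_{LE_g}\le C_k\Big(\|u(0,\cdot)\|_{H^{k+1}}+\|\partial_tu(0,\cdot)\|_{H^k}+\|\partial^{\le k}F\|_{L^1_tL^2_x}\Big).$$ Then for every $k\ge0$ there is a constant $C$ such that all solutions $u$ of $\Box_gu=F$ at level $k$ satisfy $$\|Z^{\le k}u\|_{LE_g}\le C\Big(\|Y^{\le k}u(0,\cdot)\|_{H^1}+\|Y^{\le k}\partial_tu(0,\cdot)\|_{L^2}+\|Z^{\le k}F\|_{L^1_tL^2_x}\Big).$$ Here both sides of the inequalities may be infinite. -/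

import Mathlib

open MeasureTheory
open scoped ENNReal NNReal ContDiff

namespace AFWave

noncomputable section

/-- Space `ℝⁿ` with its Euclidean structure. -/
abbrev Space (n : ℕ) : Type := EuclideanSpace ℝ (Fin n)

/-- Space-time `ℝ × ℝⁿ`, with points `(t, x)`. -/
abbrev SpaceTime (n : ℕ) : Type := ℝ × Space n

/-- The manifold `M = [0, ∞) × (ℝⁿ \ K)`. The case `K = ∅` is `[0, ∞) × ℝⁿ`. -/
def region {n : ℕ} (K : Set (Space n)) : Set (SpaceTime n) := Set.Ici (0 : ℝ) ×ˢ Kᶜ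

/-! ### Vector fields and iterated derivatives -/

/-- The derivative `X f` on the set `S` of a function `f` along the vector field `X`.
At boundary points of `S` (such as `t = 0`) this is the one-sided derivative. -/
def along {V : Type*} [NormedAddCommGroup V] [NormedSpace ℝ V]
    (S : Set V) (X : V → V) (f : V → ℝ) (p : V) : ℝ :=
  fderivWithin ℝ f S p (X p)

/-- For a family `X` of vector fields and a word `a = [i₁, …, i_m]`, the iterated derivative
`X^a f = X_{i₁} (X_{i₂} (⋯ (X_{i_m} f)))` on `S`. -/
def iterAlong {V ι : Type*} [NormedAddCommGroup V] [NormedSpace ℝ V]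
    (S : Set V) (X : ι → V → V) (a : List ι) (f : V → ℝ) : V → ℝ :=
  a.foldr (fun i h => along S (X i) h) f

/-- `∑_{|a| ≤ k} N a`, the sum over all words `a` of length at most `k`. With
`N a = ‖X^a u‖_A` this is `‖X^{≤ k} u‖_A`. -/
def sumUpTo {ι : Type*} [Fintype ι] (k : ℕ) (N : List ι → ℝ≥0∞) : ℝ≥0∞ :=
  ∑ m ∈ Finset.range (k + 1), ∑ a : Fin m → ι, N (List.ofFn a)

/-- The spatial coordinate fields `∇_x = (∂₁, …, ∂ₙ)`. -/
def spaceField {n : ℕ} (i : Fin n) : Space n → Space n :=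
  fun _ => EuclideanSpace.single i (1 : ℝ)

/-- The space-time coordinate fields `∂ = (∂₀, …, ∂ₙ)` with `∂₀ = ∂_t`. -/
def coordField {n : ℕ} (α : Fin (n + 1)) : SpaceTime n → SpaceTime n :=
  fun p => Fin.cases (motive := fun _ => SpaceTime n)
    ((1 : ℝ), (0 : Space n)) (fun i => ((0 : ℝ), spaceField i p.2)) α

/-- Labels `i < j` of the rotation fields. -/
abbrev RotIndex (n : ℕ) : Type := {q : Fin n × Fin n // q.1 < q.2}

/-- The rotation field `Ω_{ij} = x^i ∂_j - x^j ∂_i`. -/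
def rotField {n : ℕ} (q : RotIndex n) : Space n → Space n :=
  fun x => x q.1.1 • spaceField q.1.2 x - x q.1.2 • spaceField q.1.1 x

/-- Labels of the fields `Y = (∇_x, Ω)`. -/
abbrev YIndex (n : ℕ) : Type := Fin n ⊕ RotIndex n

/-- The fields `Y = (∇_x, Ω)` on space. -/
def yField {n : ℕ} : YIndex n → Space n → Space n :=
  Sum.elim spaceField rotField

/-- Labels of the fields `Z = (∂_t, Y) = (∂, Ω)`; `none` stands for `∂_t`. -/
abbrev ZIndex (n : ℕ) : Type := Option (YIndex n)

/-- The fields `Z = (∂_t, Y)` on space-time. -/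
def zField {n : ℕ} : ZIndex n → SpaceTime n → SpaceTime n
  | none => fun _ => ((1 : ℝ), (0 : Space n))
  | some y => fun p => ((0 : ℝ), yField y p.2)

/-! ### Norms -/

/-- `‖f‖_{L^q_t L^2_x}` over `t ≥ 0` and `x ∈ ℝⁿ \ K`. -/
def mixedNorm {n : ℕ} (K : Set (Space n)) (q : ℝ≥0∞) (f : SpaceTime n → ℝ) : ℝ≥0∞ :=
  eLpNorm (fun t : ℝ => eLpNorm (fun x : Space n => f (t, x)) 2 (volume.restrict Kᶜ)) q
    (volume.restrict (Set.Ici (0 : ℝ)))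

/-- `‖f‖_{L^∞_{t,x}}` over `M`; it is only used for continuous functions, for which the
supremum and the essential supremum agree. -/
def supNorm {n : ℕ} (K : Set (Space n)) (f : SpaceTime n → ℝ) : ℝ≥0∞ :=
  ⨆ p ∈ region K, ‖f p‖ₑ

/-- The norm of `H^k(ℝⁿ \ K)`; it is only used for functions of class `C^k` on that open set,
whose weak derivatives are the classical ones. -/
def sobolevNorm {n : ℕ} (K : Set (Space n)) (k : ℕ) (f : Space n → ℝ) : ℝ≥0∞ :=
  sumUpTo k fun a : List (Fin n) =>
    eLpNorm (iterAlong Kᶜ spaceField a f) 2 (volume.restrict Kᶜ)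

/-- A smooth partition of unity `∑_j φ_j² = 1` subordinate to the inhomogeneous dyadic
decomposition of space: the ball `|x| ≤ 2` and the annuli `2^{j-1} ≤ |x| ≤ 2^{j+1}`, `j ≥ 1`. -/
structure IsDyadicPartition {n : ℕ} (φ : ℕ → Space n → ℝ) : Prop where
  smooth : ∀ j, ContDiff ℝ ∞ (φ j)
  sum_sq : ∀ x, HasSum (fun j => φ j x ^ 2) 1
  outer : ∀ j x, φ j x ≠ 0 → ‖x‖ ≤ 2 ^ (j + 1)
  inner : ∀ j x, φ (j + 1) x ≠ 0 → 2 ^ j ≤ ‖x‖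

/-- `‖f‖_{ℓ^s_∞(A)} = sup_{j ≥ 0} 2^{js} ‖φ_j f‖_A`. -/
def ellInf {n : ℕ} (φ : ℕ → Space n → ℝ) (s : ℝ) (A : (SpaceTime n → ℝ) → ℝ≥0∞)
    (f : SpaceTime n → ℝ) : ℝ≥0∞ :=
  ⨆ j : ℕ, (2 : ℝ≥0∞) ^ ((j : ℝ) * s) * A (fun p => φ j p.2 * f p)

/-- `‖f‖_{ℓ^s_1(A)} = ∑_{j ≥ 0} 2^{js} ‖φ_j f‖_A`. -/
def ellOne {n : ℕ} (φ : ℕ → Space n → ℝ) (s : ℝ) (A : (SpaceTime n → ℝ) → ℝ≥0∞)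
    (f : SpaceTime n → ℝ) : ℝ≥0∞ :=
  ∑' j : ℕ, (2 : ℝ≥0∞) ^ ((j : ℝ) * s) * A (fun p => φ j p.2 * f p)

/-- `ψ` is a smooth nonnegative function which is `1` for `r > R + 1` and `0` for `r < R`. -/
structure IsCutoff {n : ℕ} (R : ℝ) (ψ : Space n → ℝ) : Prop where
  smooth : ContDiff ℝ ∞ ψ
  nonneg : ∀ x, 0 ≤ ψ x
  eq_one : ∀ x, R + 1 < ‖x‖ → ψ x = 1
  eq_zero : ∀ x, ‖x‖ < R → ψ x = 0

/-- The local energy norm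
`‖u‖_{LE_g} = ‖∂u‖_{L^∞_t L^2_x} + ‖ψ ∂u‖_{ℓ^{-1/2}_∞ L^2_t L^2_x} + ‖u‖_{ℓ^{-3/2}_∞ L^2_t L^2_x}`,
where a norm of `∂u` is the sum of the norms of its components. -/
def leNorm {n : ℕ} (φ : ℕ → Space n → ℝ) (ψ : Space n → ℝ) (K : Set (Space n))
    (u : SpaceTime n → ℝ) : ℝ≥0∞ :=
  (∑ α : Fin (n + 1), mixedNorm K ⊤ (along (region K) (coordField α) u))
    + (∑ α : Fin (n + 1), ellInf φ (-1 / 2) (mixedNorm K 2)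
        (fun p => ψ p.2 * along (region K) (coordField α) u p))
    + ellInf φ (-3 / 2) (mixedNorm K 2) u

/-! ### The metric and the d'Alembertian -/

/-- A field of `(1 + n) × (1 + n)` matrices on space-time, with row and column `0` for time. -/
abbrev MatrixField (n : ℕ) : Type := SpaceTime n → Matrix (Fin (n + 1)) (Fin (n + 1)) ℝ

/-- The Minkowski metric `m = diag(-1, 1, …, 1)`. -/
def minkowski (n : ℕ) : Matrix (Fin (n + 1)) (Fin (n + 1)) ℝ :=
  Matrix.diagonal (Fin.cons (-1) (fun _ => 1))

/-- The matrix field `h` has smooth components on `M` (up to `t = 0`). -/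
def IsSmoothField {n : ℕ} (K : Set (Space n)) (h : MatrixField n) : Prop :=
  ∀ α β, ContDiffOn ℝ ∞ (fun p => h p α β) (region K)

/-- `g = g_{αβ} dx^α dx^β` is a smooth Lorentzian metric on `M`: at every point it is a symmetric
form of signature `(-, +, …, +)`. -/
structure IsLorentzianMetric {n : ℕ} (K : Set (Space n)) (g : MatrixField n) : Prop where
  smooth : IsSmoothField K g
  symm : ∀ p ∈ region K, (g p).IsSymm
  signature : ∀ p ∈ region K, ∃ P : Matrix (Fin (n + 1)) (Fin (n + 1)) ℝ,
    IsUnit P ∧ P.transpose * g p * P = minkowski n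

/-- `h` is radial on `M`:
`h = h₀₀(t,r) dt² + 2 h₀₁(t,r) dt dr + h₁₁(t,r) dr² + h₂₂(t,r) r² dω²`, written in Cartesian
coordinates through `dr = (x_i / r) dx^i` and `r² dω² = |dx|² - dr²`. -/
def IsRadial {n : ℕ} (K : Set (Space n)) (h : MatrixField n) : Prop :=
  ∃ h00 h01 h11 h22 : ℝ → ℝ → ℝ, ∀ (t : ℝ) (x : Space n), (t, x) ∈ region K → x ≠ 0 →
    h (t, x) 0 0 = h00 t ‖x‖ ∧
    (∀ i : Fin n, h (t, x) 0 i.succ = h01 t ‖x‖ * (x i / ‖x‖) ∧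
      h (t, x) i.succ 0 = h01 t ‖x‖ * (x i / ‖x‖)) ∧
    ∀ i j : Fin n, h (t, x) i.succ j.succ =
      h11 t ‖x‖ * (x i * x j / ‖x‖ ^ 2) +
        h22 t ‖x‖ * ((if i = j then 1 else 0) - x i * x j / ‖x‖ ^ 2)

/-- `∂^a h_{αβ} ∈ ℓ^{|a| + s}_1 L^∞_{t,x}` for all multi-indices `a` and all `α`, `β`. -/
def HasDyadicDecay {n : ℕ} (φ : ℕ → Space n → ℝ) (K : Set (Space n)) (s : ℝ)
    (h : MatrixField n) : Prop :=
  ∀ (a : List (Fin (n + 1))) (α β : Fin (n + 1)),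
    ellOne φ (a.length + s) (supNorm K)
      (iterAlong (region K) coordField a (fun p => h p α β)) < ⊤

/-- Asymptotic flatness: `g = m + g₁ + g₂` on `M` with `g₁` radial and
`∂^a g_{j,αβ} ∈ ℓ^{|a| + j - 1}_1 L^∞_{t,x}` for `j = 1, 2`. -/
def IsAsymptoticallyFlat {n : ℕ} (φ : ℕ → Space n → ℝ) (K : Set (Space n))
    (g : MatrixField n) : Prop :=
  ∃ g₁ g₂ : MatrixField n,
    (∀ p ∈ region K, g p = minkowski n + g₁ p + g₂ p) ∧
    IsSmoothField K g₁ ∧ IsSmoothField K g₂ ∧ IsRadial K g₁ ∧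
    HasDyadicDecay φ K 0 g₁ ∧ HasDyadicDecay φ K 1 g₂

/-- `|g| = -det(g_{αβ})`. -/
def volDensity {n : ℕ} (g : MatrixField n) (p : SpaceTime n) : ℝ := -(g p).det

/-- The d'Alembertian `□_g u = |g|^{-1/2} ∂_α (g^{αβ} |g|^{1/2} ∂_β u)` on `M`. -/
def box {n : ℕ} (K : Set (Space n)) (g : MatrixField n) (u : SpaceTime n → ℝ)
    (p : SpaceTime n) : ℝ :=
  (√(volDensity g p))⁻¹ * ∑ α : Fin (n + 1), ∑ β : Fin (n + 1),
    along (region K) (coordField α)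
      (fun q => (g q)⁻¹ α β * √(volDensity g q) * along (region K) (coordField β) u q) p

/-! ### Initial data, solutions, and the two estimates -/

/-- `u(0, ·)`. -/
def initialValue {n : ℕ} (u : SpaceTime n → ℝ) : Space n → ℝ := fun x => u (0, x)

/-- `∂_t u(0, ·)`. -/
def initialVelocity {n : ℕ} (K : Set (Space n)) (u : SpaceTime n → ℝ) : Space n → ℝ :=
  fun x => along (region K) (coordField 0) u (0, x)

/-- `u` is a solution of `□_g u = F` on `M` which lies in the class `S` and is of class
`C^{k+2}` on `M` (up to `t = 0`). -/
structure IsSolution {n : ℕ} (K : Set (Space n)) (g : MatrixField n)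
    (S : Set (SpaceTime n → ℝ)) (k : ℕ) (u F : SpaceTime n → ℝ) : Prop where
  mem : u ∈ S
  contDiffOn : ContDiffOn ℝ ((k + 2 : ℕ) : WithTop ℕ∞) u (region K)
  eqn : ∀ p ∈ region K, box K g u p = F p

/-- The local energy assumption: for every `k`,
`‖∂^{≤k} u‖_{LE_g} ≲ ‖u(0)‖_{H^{k+1}} + ‖∂_t u(0)‖_{H^k} + ‖∂^{≤k} F‖_{L^1_t L^2_x}`
for all solutions `u ∈ S` of `□_g u = F`. -/
def LocalEnergyAssumption {n : ℕ} (φ : ℕ → Space n → ℝ) (ψ : Space n → ℝ) (K : Set (Space n))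
    (g : MatrixField n) (S : Set (SpaceTime n → ℝ)) : Prop :=
  ∀ k : ℕ, ∃ C : ℝ≥0, ∀ u F : SpaceTime n → ℝ, IsSolution K g S k u F →
    sumUpTo k (fun a : List (Fin (n + 1)) =>
        leNorm φ ψ K (iterAlong (region K) coordField a u)) ≤
      C * (sobolevNorm K (k + 1) (initialValue u)
        + sobolevNorm K k (initialVelocity K u)
        + sumUpTo k (fun a : List (Fin (n + 1)) =>
            mixedNorm K 1 (iterAlong (region K) coordField a F)))

end

end AFWave

/-! The proof is an induction on the number of rotations in a word `Z^a`.

A word without rotations is a coordinate derivative, and `H2` bounds it directly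
(`LocalEnergyAssumption.ctrl`). For the step (`FarMetric.leCtrl_succ`) let `ρ` be so large that the
metric is close to the Minkowski one on `|x| > ρ`. On `|x| ≤ 3 ρ` the fields `Z` are combinations of
the coordinate derivatives with bounded coefficients (`exists_near_grad`, `exists_near_zw`), so that
`H2` suffices there. On `|x| > 3 ρ` an estimate that does not see the obstacle is used.

This is the exterior estimate (`exterior_estimate`): for functions `w` supported in a compact subset
of `|x| > ρ`, the energy and the local energy at every dyadic scale are bounded by the initial
energy and the integral of `|h^{αβ} ∂_α ∂_β w|` times `|∂w| + |w| / |x|`. It comes from the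
multipliers `∂_t w` and `q (x · ∇w + (n - 1) / 2 w)` with `q = (|x|² + 4^i)^{-1/2}`. For the
Minkowski metric the second one has a positive bulk term (`bulk_minkowski_ge`) and its fluxes are
bounded by the energy through Hardy's inequality (`hardy`); both use `n ≥ 3`. The deviation of the
coefficients from the Minkowski ones has dyadic weights with a small sum, so that the errors it
causes, estimated by the supremum over the scales, are absorbed.

The estimate is applied to `w = ζ Z^a u` for the words `a` with `j + 1` rotations, where `ζ` is a
cutoff to `|x| > 2 ρ` and to a large ball. Three kinds of errors occur.

* The commutators of `□_g` and `Z` have coefficients in the symbol class `𝒜₁`, that is, of the size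
  of `1 / |x|` times a summable dyadic weight, and so do their iterates (`FarMetric.exists_box_zw`).
  For the rotations this is where the radial part `g₁` is special: its Lie derivative vanishes
  (`lieDer_rot_radial`), while `g₂` has one more power of decay. Beyond a large radius the weights
  are small (`FarMetric.exists_commuted`), and the errors are absorbed.
* The derivatives of `ζ` multiply `Z^a u` and `∂ Z^a u`. As `a` contains a rotation, both are at
  most `|x|` times a gradient of words with fewer rotations (`exists_pull_bound`). Near the inner
  transition of `ζ`, where `|x| ≤ 3 ρ`, the induction hypothesis therefore covers these terms.
* The outer transition of `ζ` is logarithmic with a parameter `ε` (`exists_cutoff`), and its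
  contribution is at most `ε` times an `L¹_t L²_x` norm of words with fewer rotations. On `[0, T]`
  with `ε T ≤ 1` the induction hypothesis in `L^∞_t L²_x` bounds it. The resulting
  constants depend neither on `ε` nor on `T` (`NearFlat.exists_far_cut`).

All quantities for the cut off functions are finite, since these have compact support in space. This
is what permits the absorption (`absorb`) without any a priori finiteness for `u`. Afterwards
`ε → 0` and `T → ∞` by monotone convergence (`FarMetric.exists_far_estimate`).

It remains to bound the initial energies of the `Z^a u` by the given data
(`FarMetric.exists_abs_le_dataAt`, `FarMetric.ctrl_farData`). Second and higher time derivatives are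
removed by means of the equation. This leaves traces of `Z^c F` at `t = 0`, with `c` shorter than
`a`, and these are bounded by the `L¹_t L²_x` norms of `Z^c F` and `∂_t Z^c F` (`sl_zero_le`).

The quantities estimated take values in `[0, ∞]` throughout, so that an infinite right side needs no
separate treatment. -/

namespace AFWave

noncomputable section

variable {n : ℕ} {K : Set (Space n)}

/-! ### Calculus on the region -/

/-- The coordinate derivative `∂_α f` on the region. -/
abbrev dd (K : Set (Space n)) (α : Fin (n + 1)) (f : SpaceTime n → ℝ) : SpaceTime n → ℝ :=
  along (region K) (coordField α) f

/-- The derivative `Z_i f` on the region. -/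
abbrev zz (K : Set (Space n)) (i : ZIndex n) (f : SpaceTime n → ℝ) : SpaceTime n → ℝ :=
  along (region K) (zField i) f

/-- The iterated derivative `Z^a f` on the region. -/
abbrev zw (K : Set (Space n)) (a : List (ZIndex n)) (f : SpaceTime n → ℝ) : SpaceTime n → ℝ :=
  iterAlong (region K) zField a f

/-- `f` is of class `C^m` on the region. -/
abbrev CD (K : Set (Space n)) (m : ℕ) (f : SpaceTime n → ℝ) : Prop :=
  ContDiffOn ℝ (m : WithTop ℕ∞) f (region K)

/-- `f` is smooth on the region. -/
abbrev Smooth (K : Set (Space n)) (f : SpaceTime n → ℝ) : Prop :=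
  ContDiffOn ℝ ∞ f (region K)

lemma uniqueDiffOn_region (hK : IsClosed K) : UniqueDiffOn ℝ (region K) :=
  (uniqueDiffOn_Ici 0).prod hK.isOpen_compl.uniqueDiffOn

lemma region_subset_closure_interior (hK : IsClosed K) :
    region K ⊆ closure (interior (region K)) := by
  intro p hp
  rw [region, interior_prod_eq, closure_prod_eq, interior_Ici, closure_Ioi,
    hK.isOpen_compl.interior_eq]
  exact ⟨hp.1, subset_closure hp.2⟩

lemma CD.of_le {m m' : ℕ} {f : SpaceTime n → ℝ} (hf : CD K m f) (h : m' ≤ m) : CD K m' f :=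
  ContDiffOn.of_le hf (by exact_mod_cast h)

lemma Smooth.cd {f : SpaceTime n → ℝ} (hf : Smooth K f) (m : ℕ) : CD K m f :=
  ContDiffOn.of_le hf (by exact_mod_cast le_top)

lemma CD.differentiableOn {m : ℕ} {f : SpaceTime n → ℝ} (hf : CD K (m + 1) f) :
    DifferentiableOn ℝ f (region K) :=
  ContDiffOn.differentiableOn (n := ((m + 1 : ℕ) : WithTop ℕ∞)) hf (by norm_cast)

lemma contDiff_coordField (α : Fin (n + 1)) : ContDiff ℝ ∞ (coordField (n := n) α) := by
  refine Fin.cases ?_ (fun i => ?_) α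
  · exact contDiff_const (c := ((1 : ℝ), (0 : Space n)))
  · exact contDiff_const (c := ((0 : ℝ), EuclideanSpace.single i (1 : ℝ)))

lemma coordField_eq (α : Fin (n + 1)) (p q : SpaceTime n) : coordField α p = coordField α q := by
  refine Fin.cases ?_ (fun i => ?_) α <;> rfl

lemma contDiff_coord (c : Fin n) : ContDiff ℝ ∞ fun p : SpaceTime n => p.2 c :=
  ((EuclideanSpace.proj (𝕜 := ℝ) c).comp (ContinuousLinearMap.snd ℝ ℝ (Space n))).contDiff

lemma contDiff_zField (i : ZIndex n) : ContDiff ℝ ∞ (zField (n := n) i) := by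
  rcases i with _ | (i | q)
  · exact contDiff_const (c := ((1 : ℝ), (0 : Space n)))
  · exact contDiff_const (c := ((0 : ℝ), EuclideanSpace.single i (1 : ℝ)))
  · exact contDiff_const.prodMk (((contDiff_coord _).smul contDiff_const).sub
      ((contDiff_coord _).smul contDiff_const))

lemma contDiffOn_along {m m' : WithTop ℕ∞} (hK : IsClosed K) {X : SpaceTime n → SpaceTime n}
    (hX : ContDiff ℝ ∞ X) {f : SpaceTime n → ℝ} (hf : ContDiffOn ℝ m' f (region K))
    (hm : m + 1 ≤ m') (hm' : m ≤ (∞ : WithTop ℕ∞)) : ContDiffOn ℝ m (along (region K) X f) (region K) :=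
  (hf.fderivWithin (uniqueDiffOn_region hK) hm).clm_apply (hX.of_le hm').contDiffOn

lemma CD.dd (hK : IsClosed K) {m : ℕ} {f : SpaceTime n → ℝ} (hf : CD K (m + 1) f)
    (α : Fin (n + 1)) : CD K m (dd K α f) :=
  contDiffOn_along hK (contDiff_coordField α) hf (by norm_cast) (by exact_mod_cast le_top)

lemma CD.zz (hK : IsClosed K) {m : ℕ} {f : SpaceTime n → ℝ} (hf : CD K (m + 1) f)
    (i : ZIndex n) : CD K m (zz K i f) :=
  contDiffOn_along hK (contDiff_zField i) hf (by norm_cast) (by exact_mod_cast le_top)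

lemma Smooth.dd (hK : IsClosed K) {f : SpaceTime n → ℝ} (hf : Smooth K f)
    (α : Fin (n + 1)) : Smooth K (dd K α f) :=
  contDiffOn_along hK (contDiff_coordField α) hf (by norm_cast) le_rfl

lemma Smooth.zz (hK : IsClosed K) {f : SpaceTime n → ℝ} (hf : Smooth K f)
    (i : ZIndex n) : Smooth K (zz K i f) :=
  contDiffOn_along hK (contDiff_zField i) hf (by norm_cast) le_rfl

lemma CD.zw (hK : IsClosed K) {m : ℕ} {f : SpaceTime n → ℝ} (a : List (ZIndex n))
    (hf : CD K (m + a.length) f) : CD K m (zw K a f) := by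
  induction a generalizing m with
  | nil => exact hf
  | cons i a ih => exact CD.zz hK (ih (hf.of_le (by simp; omega))) i

lemma along_mul (hK : IsClosed K) {X : SpaceTime n → SpaceTime n} {f g : SpaceTime n → ℝ}
    (hf : DifferentiableOn ℝ f (region K)) (hg : DifferentiableOn ℝ g (region K))
    {p : SpaceTime n} (hp : p ∈ region K) :
    along (region K) X (fun q => f q * g q) p =
      along (region K) X f p * g p + f p * along (region K) X g p := by
  simp only [along]
  rw [fderivWithin_fun_mul (uniqueDiffOn_region hK p hp) (hf p hp) (hg p hp)]
  simp
  ring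

lemma along_add (hK : IsClosed K) {X : SpaceTime n → SpaceTime n} {f g : SpaceTime n → ℝ}
    (hf : DifferentiableOn ℝ f (region K)) (hg : DifferentiableOn ℝ g (region K))
    {p : SpaceTime n} (hp : p ∈ region K) :
    along (region K) X (fun q => f q + g q) p =
      along (region K) X f p + along (region K) X g p := by
  simp only [along]
  rw [fderivWithin_fun_add (uniqueDiffOn_region hK p hp) (hf p hp) (hg p hp)]
  simp

lemma along_sum (hK : IsClosed K) {X : SpaceTime n → SpaceTime n} {ι : Type*} (s : Finset ι)
    {f : ι → SpaceTime n → ℝ} (hf : ∀ i ∈ s, DifferentiableOn ℝ (f i) (region K))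
    {p : SpaceTime n} (hp : p ∈ region K) :
    along (region K) X (fun q => ∑ i ∈ s, f i q) p = ∑ i ∈ s, along (region K) X (f i) p := by
  simp only [along]
  rw [fderivWithin_fun_sum (uniqueDiffOn_region hK p hp) (fun i hi => hf i hi p hp)]
  simp

lemma along_const {X : SpaceTime n → SpaceTime n} (c : ℝ) (p : SpaceTime n) :
    along (region K) X (fun _ => c) p = 0 := by
  simp [along]

lemma along_const_mul (hK : IsClosed K) {X : SpaceTime n → SpaceTime n} {f : SpaceTime n → ℝ}
    (c : ℝ) (hf : DifferentiableOn ℝ f (region K)) {p : SpaceTime n} (hp : p ∈ region K) :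
    along (region K) X (fun q => c * f q) p = c * along (region K) X f p := by
  rw [along_mul hK (differentiableOn_const c) hf hp, along_const]
  ring

lemma along_congr {X : SpaceTime n → SpaceTime n} {f g : SpaceTime n → ℝ}
    (h : Set.EqOn f g (region K)) {p : SpaceTime n} (hp : p ∈ region K) :
    along (region K) X f p = along (region K) X g p := by
  simp only [along]
  rw [fderivWithin_congr h (h hp)]

lemma along_congr_of_eventuallyEq {X : SpaceTime n → SpaceTime n} {f g : SpaceTime n → ℝ}
    {p : SpaceTime n} (h : f =ᶠ[nhdsWithin p (region K)] g) (hp : p ∈ region K) :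
    along (region K) X f p = along (region K) X g p := by
  simp only [along]
  rw [h.fderivWithin_eq (h.self_of_nhdsWithin hp)]

lemma zw_congr {f g : SpaceTime n → ℝ} (h : Set.EqOn f g (region K)) (a : List (ZIndex n)) :
    Set.EqOn (zw K a f) (zw K a g) (region K) := by
  induction a with
  | nil => exact h
  | cons i a ih => exact fun p hp => along_congr ih hp

/-- The component along `∂_γ` of the field `Z_i`. -/
def zCoef (i : ZIndex n) (γ : Fin (n + 1)) (p : SpaceTime n) : ℝ :=
  Fin.cases (motive := fun _ => ℝ) (zField i p).1 (fun c => (zField i p).2 c) γ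

lemma zField_eq_sum (i : ZIndex n) (p : SpaceTime n) :
    zField i p = ∑ γ, zCoef i γ p • coordField γ p := by
  rw [Fin.sum_univ_succ]
  refine Prod.ext ?_ ?_
  · simp [zCoef, coordField, Prod.fst_sum]
  · ext c
    simp [zCoef, coordField, Prod.snd_sum, spaceField, Pi.single_apply]

lemma zz_eq_sum (i : ZIndex n) (f : SpaceTime n → ℝ) (p : SpaceTime n) :
    zz K i f p = ∑ γ, zCoef i γ p * dd K γ f p := by
  simp only [zz, along]
  conv_lhs => rw [zField_eq_sum]
  simp

/-- The label of the coordinate field `∂_α` among the fields `Z`. -/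
def cz (α : Fin (n + 1)) : ZIndex n := Fin.cases (motive := fun _ => ZIndex n) none
  (fun i => some (Sum.inl i)) α

lemma zField_cz (α : Fin (n + 1)) : zField (cz α) = coordField (n := n) α := by
  refine Fin.cases ?_ (fun i => ?_) α <;> rfl

lemma zz_cz (α : Fin (n + 1)) (f : SpaceTime n → ℝ) : zz K (cz α) f = dd K α f := by
  simp only [zz, dd, zField_cz]

/-- The constants in `[∂_α, Z_i] = ∑_γ strC i α γ ∂_γ`. -/
def strC (i : ZIndex n) (α γ : Fin (n + 1)) : ℝ := zCoef i γ (coordField α 0) - zCoef i γ 0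

lemma dd_coord_snd (hK : IsClosed K) (α : Fin (n + 1)) (c : Fin n) {p : SpaceTime n}
    (hp : p ∈ region K) : dd K α (fun q => q.2 c) p = (coordField α p).2 c := by
  have h : HasFDerivWithinAt (fun q : SpaceTime n => q.2 c)
      ((EuclideanSpace.proj (𝕜 := ℝ) c).comp (ContinuousLinearMap.snd ℝ ℝ (Space n)))
      (region K) p :=
    ((EuclideanSpace.proj (𝕜 := ℝ) c).comp
      (ContinuousLinearMap.snd ℝ ℝ (Space n))).hasFDerivWithinAt
  simp only [dd, along]
  rw [h.fderivWithin (uniqueDiffOn_region hK p hp)]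
  rfl

lemma contDiff_zCoef (i : ZIndex n) (γ : Fin (n + 1)) : ContDiff ℝ ∞ (zCoef (n := n) i γ) := by
  refine Fin.cases ?_ (fun c => ?_) γ
  · exact contDiff_fst.comp (contDiff_zField i)
  · exact ((EuclideanSpace.proj (𝕜 := ℝ) c).contDiff).comp (contDiff_snd.comp (contDiff_zField i))

/-- The coefficients of the fields `Z` are affine. -/
lemma zCoef_affine (i : ZIndex n) (γ : Fin (n + 1)) :
    ∃ c₀ : ℝ, ∃ c : Fin n → ℝ, ∀ p : SpaceTime n, zCoef i γ p = c₀ + ∑ l, c l * p.2 l := by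
  rcases i with _ | (i | q)
  · exact ⟨zCoef none γ 0, 0, fun p => by
      refine Fin.cases ?_ (fun c => ?_) γ <;> simp [zCoef, zField]⟩
  · exact ⟨zCoef (some (Sum.inl i)) γ 0, 0, fun p => by
      refine Fin.cases ?_ (fun c => ?_) γ <;> simp [zCoef, zField, yField, spaceField]⟩
  · refine Fin.cases ⟨0, 0, fun p => by simp [zCoef, zField]⟩ (fun c => ?_) γ
    refine ⟨0, fun l => (if l = q.1.1 then (if c = q.1.2 then 1 else 0) else 0) -
      (if l = q.1.2 then (if c = q.1.1 then 1 else 0) else 0), fun p => ?_⟩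
    simp [zCoef, zField, yField, rotField, spaceField, sub_mul, Finset.sum_sub_distrib]

lemma dd_zCoef (hK : IsClosed K) (i : ZIndex n) (α γ : Fin (n + 1)) {p : SpaceTime n}
    (hp : p ∈ region K) : dd K α (zCoef i γ) p = strC i α γ := by
  obtain ⟨c₀, c, h⟩ := zCoef_affine i γ
  have hd : ∀ l : Fin n, DifferentiableOn ℝ (fun q : SpaceTime n => q.2 l) (region K) := fun l =>
    (((EuclideanSpace.proj (𝕜 := ℝ) l).differentiable).comp
      differentiable_snd).differentiableOn
  have h' : zCoef i γ = fun p : SpaceTime n => c₀ + ∑ l, c l * p.2 l := funext h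
  rw [strC, h']
  rw [dd, along_add hK (differentiableOn_const _)
    (DifferentiableOn.fun_sum fun l _ => (hd l).const_mul _) hp, along_const,
    along_sum hK _ (fun l _ => (hd l).const_mul _) hp]
  have : ∀ l, along (region K) (coordField α) (fun q => c l * q.2 l) p
      = c l * (coordField α (0 : SpaceTime n)).2 l := by
    intro l
    have h1 : along (region K) (coordField α) (fun q => q.2 l) p = _ := dd_coord_snd hK α l hp
    rw [along_const_mul hK _ (hd l) hp, h1]
    rw [coordField_eq α p 0]
  simp [this]

lemma dd_comm (hK : IsClosed K) {f : SpaceTime n → ℝ} (hf : CD K 2 f) (α β : Fin (n + 1))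
    {p : SpaceTime n} (hp : p ∈ region K) : dd K α (dd K β f) p = dd K β (dd K α f) p := by
  have hs := uniqueDiffOn_region hK
  have h2 : DifferentiableWithinAt ℝ (fderivWithin ℝ f (region K)) (region K) p :=
    (hf.fderivWithin (m := 1) hs (by norm_num)).differentiableOn (by norm_num) p hp
  have key : ∀ α β : Fin (n + 1), dd K α (dd K β f) p =
      fderivWithin ℝ (fderivWithin ℝ f (region K)) (region K) p (coordField α p)
        (coordField β p) := by
    intro α β
    have h1 : dd K β f = fun q => fderivWithin ℝ f (region K) q (coordField β p) := by
      funext q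
      simp only [dd, along, coordField_eq β q p]
    rw [h1, dd, along, fderivWithin_clm_apply (hs p hp) h2 (differentiableWithinAt_const _)]
    simp [fderivWithin_const_apply]
  rw [key, key]
  exact (hf.contDiffWithinAt hp).isSymmSndFDerivWithinAt (by simp) hs
    (region_subset_closure_interior hK hp) hp _ _

/-- `∂_α Z_i = Z_i ∂_α + ∑_γ strC i α γ ∂_γ`. -/
lemma dd_zz (hK : IsClosed K) {f : SpaceTime n → ℝ} (hf : CD K 2 f) (α : Fin (n + 1))
    (i : ZIndex n) {p : SpaceTime n} (hp : p ∈ region K) :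
    dd K α (zz K i f) p = zz K i (dd K α f) p + ∑ γ, strC i α γ * dd K γ f p := by
  have hz : ∀ γ, DifferentiableOn ℝ (zCoef (n := n) i γ) (region K) := fun γ =>
    ((contDiff_zCoef i γ).differentiable (by simp)).differentiableOn
  have hd : ∀ γ, DifferentiableOn ℝ (dd K γ f) (region K) := fun γ =>
    CD.differentiableOn (m := 0) (CD.dd hK hf γ)
  have : dd K α (zz K i f) p = dd K α (fun q => ∑ γ, zCoef i γ q * dd K γ f q) p :=
    along_congr (fun q _ => zz_eq_sum i f q) hp
  rw [this, dd, along_sum (f := fun γ q => zCoef i γ q * dd K γ f q) hK _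
    (fun γ _ => (hz γ).mul (hd γ)) hp, zz_eq_sum,
    ← Finset.sum_add_distrib]
  refine Finset.sum_congr rfl fun γ _ => ?_
  rw [along_mul hK (hz γ) (hd γ) hp]
  change dd K α (zCoef i γ) p * _ + _ * dd K α (dd K γ f) p = _
  rw [dd_zCoef hK i α γ hp, dd_comm hK hf α γ hp]
  ring

/-! ### Coefficients with summable dyadic decay -/

/-- The index `j` of the dyadic annulus `2^j ≤ |x| < 2^{j+1}` that contains `x`; it is `0` on the
whole ball `|x| < 2`. -/
def dyIdx (x : Space n) : ℕ := Nat.log 2 ⌊‖x‖⌋₊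

lemma two_pow_dyIdx_le {x : Space n} (hx : 1 ≤ ‖x‖) : (2 : ℝ) ^ dyIdx x ≤ ‖x‖ := by
  have h0 : ⌊‖x‖⌋₊ ≠ 0 := by
    have := (Nat.one_le_floor_iff ‖x‖).2 hx
    omega
  have := Nat.pow_log_le_self 2 h0
  calc (2 : ℝ) ^ dyIdx x ≤ (⌊‖x‖⌋₊ : ℝ) := by exact_mod_cast this
    _ ≤ ‖x‖ := Nat.floor_le (norm_nonneg x)

lemma lt_two_pow_dyIdx (x : Space n) : ‖x‖ < (2 : ℝ) ^ (dyIdx x + 1) := by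
  have := Nat.lt_pow_succ_log_self (b := 2) (by norm_num) ⌊‖x‖⌋₊
  have h2 := Nat.lt_floor_add_one ‖x‖
  have h3 : (⌊‖x‖⌋₊ : ℝ) + 1 ≤ (2 : ℝ) ^ (dyIdx x + 1) := by exact_mod_cast this
  linarith

/-- `f` is bounded by `|x|^{-s}` times a weight that depends on the dyadic annulus only and is
summable over the annuli, on the part `|x| > ρ` of the region. -/
def DecW (K : Set (Space n)) (ρ : ℝ) (s : ℕ) (f : SpaceTime n → ℝ) : Prop :=
  ∃ κ : ℕ → ℝ, Summable κ ∧ (∀ j, 0 ≤ κ j) ∧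
    ∀ p ∈ region K, ρ < ‖p.2‖ → ‖p.2‖ ^ s * |f p| ≤ κ (dyIdx p.2)

/-- Each derivative `∂^a f` with `|a| ≤ k` decays like `DecW` with exponent `s + |a|`. -/
def IsSym (K : Set (Space n)) (ρ : ℝ) : ℕ → ℕ → (SpaceTime n → ℝ) → Prop
  | 0, s, f => DecW K ρ s f
  | k + 1, s, f => DecW K ρ s f ∧ ∀ α, IsSym K ρ k (s + 1) (dd K α f)

/-- The symbol class `𝒜_s`: smooth functions with `∂^a f ∈ ℓ^{s + |a|}_1 L^∞` for all `a`, on the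
part `|x| > ρ` of the region. -/
structure Sym (K : Set (Space n)) (ρ : ℝ) (s : ℕ) (f : SpaceTime n → ℝ) : Prop where
  smooth : Smooth K f
  isSym : ∀ k, IsSym K ρ k s f

lemma Smooth.diff {f : SpaceTime n → ℝ} (hf : Smooth K f) :
    DifferentiableOn ℝ f (region K) := CD.differentiableOn (m := 0) (hf.cd 1)

variable {ρ : ℝ} {s s' k : ℕ} {f f' : SpaceTime n → ℝ}

lemma DecW.mono_right {f g : SpaceTime n → ℝ} {C : ℝ} (hf : DecW K ρ s f) (hC : 0 ≤ C)
    (h : ∀ p ∈ region K, ρ < ‖p.2‖ → ‖p.2‖ ^ s' * |g p| ≤ C * (‖p.2‖ ^ s * |f p|)) :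
    DecW K ρ s' g := by
  obtain ⟨κ, hs, h0, hb⟩ := hf
  exact ⟨fun j => C * κ j, hs.mul_left C, fun j => mul_nonneg hC (h0 j), fun p hp hr =>
    (h p hp hr).trans (mul_le_mul_of_nonneg_left (hb p hp hr) hC)⟩

lemma DecW.add (hf : DecW K ρ s f) (hf' : DecW K ρ s f') :
    DecW K ρ s (fun p => f p + f' p) := by
  obtain ⟨κ, hs, h0, hb⟩ := hf
  obtain ⟨κ', hs', h0', hb'⟩ := hf'
  refine ⟨fun j => κ j + κ' j, hs.add hs', fun j => add_nonneg (h0 j) (h0' j), fun p hp hr => ?_⟩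
  calc ‖p.2‖ ^ s * |f p + f' p| ≤ ‖p.2‖ ^ s * (|f p| + |f' p|) := by gcongr; exact abs_add_le _ _
    _ = ‖p.2‖ ^ s * |f p| + ‖p.2‖ ^ s * |f' p| := by ring
    _ ≤ _ := add_le_add (hb p hp hr) (hb' p hp hr)

lemma DecW.bounded (hf : DecW K ρ s f) :
    ∃ C : ℝ, 0 ≤ C ∧ ∀ p ∈ region K, ρ < ‖p.2‖ → ‖p.2‖ ^ s * |f p| ≤ C := by
  obtain ⟨κ, hs, h0, hb⟩ := hf
  exact ⟨∑' j, κ j, tsum_nonneg h0, fun p hp hr =>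
    (hb p hp hr).trans (hs.le_tsum _ fun j _ => h0 j)⟩

lemma DecW.mul (hf : DecW K ρ s f) (hf' : DecW K ρ s' f') :
    DecW K ρ (s + s') (fun p => f p * f' p) := by
  obtain ⟨C, hC, hb⟩ := hf.bounded
  refine hf'.mono_right hC fun p hp hr => ?_
  calc ‖p.2‖ ^ (s + s') * |f p * f' p|
      = (‖p.2‖ ^ s * |f p|) * (‖p.2‖ ^ s' * |f' p|) := by rw [abs_mul, pow_add]; ring
    _ ≤ _ := mul_le_mul_of_nonneg_right (hb p hp hr) (by positivity)

lemma IsSym.decW (hf : IsSym K ρ k s f) : DecW K ρ s f := by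
  cases k with
  | zero => exact hf
  | succ k => exact hf.1

lemma IsSym.of_succ (hf : IsSym K ρ (k + 1) s f) : IsSym K ρ k s f := by
  induction k generalizing s f with
  | zero => exact hf.1
  | succ k ih => exact ⟨hf.1, fun α => ih (hf.2 α)⟩

lemma isSym_congr (h : ∀ p ∈ region K, ρ < ‖p.2‖ → f p = f' p) (hf : IsSym K ρ k s f) :
    IsSym K ρ k s f' := by
  have hW : DecW K ρ s f' := hf.decW.mono_right (C := 1) zero_le_one fun p hp hr => by
    rw [h p hp hr, one_mul]
  induction k generalizing s f f' with
  | zero => exact hW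
  | succ k ih =>
    have h' : ∀ α, ∀ p ∈ region K, ρ < ‖p.2‖ → dd K α f p = dd K α f' p := by
      intro α p hp hr
      refine along_congr_of_eventuallyEq ?_ hp
      have ho : {q : SpaceTime n | ρ < ‖q.2‖} ∈ nhds p :=
        (isOpen_lt continuous_const continuous_snd.norm).mem_nhds hr
      filter_upwards [self_mem_nhdsWithin, mem_nhdsWithin_of_mem_nhds ho] with q hq hq'
        using h q hq hq'
    exact ⟨hW, fun α => ih (h' α) (hf.2 α) ((hf.2 α).decW.mono_right (C := 1) zero_le_one
      fun p hp hr => by rw [h' α p hp hr, one_mul])⟩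

lemma isSym_congr_region (h : Set.EqOn f f' (region K)) (hf : IsSym K ρ k s f) :
    IsSym K ρ k s f' := isSym_congr (fun _ hp _ => h hp) hf

lemma IsSym.add (hK : IsClosed K) (hf : IsSym K ρ k s f) (hf' : IsSym K ρ k s f')
    (h : Smooth K f) (h' : Smooth K f') : IsSym K ρ k s (fun p => f p + f' p) := by
  induction k generalizing s f f' with
  | zero => exact DecW.add hf hf'
  | succ k ih =>
    exact ⟨hf.1.add hf'.1, fun α => isSym_congr_region
      (fun p hp => (along_add hK h.diff h'.diff hp).symm)
      (ih (hf.2 α) (hf'.2 α) (h.dd hK α) (h'.dd hK α))⟩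

lemma IsSym.const_mul (hK : IsClosed K) (hf : IsSym K ρ k s f) (h : Smooth K f) (c : ℝ) :
    IsSym K ρ k s (fun p => c * f p) := by
  have hW : ∀ {s : ℕ} {f : SpaceTime n → ℝ}, DecW K ρ s f → DecW K ρ s (fun p => c * f p) :=
    fun hf => hf.mono_right (abs_nonneg c) fun p _ _ => by rw [abs_mul]; apply le_of_eq; ring
  induction k generalizing s f with
  | zero => exact hW hf
  | succ k ih =>
    exact ⟨hW hf.1, fun α => isSym_congr_region
      (fun p hp => (along_const_mul hK c h.diff hp).symm) (ih (hf.2 α) (h.dd hK α))⟩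

lemma IsSym.mul (hK : IsClosed K) (hf : IsSym K ρ k s f) (hf' : IsSym K ρ k s' f')
    (h : Smooth K f) (h' : Smooth K f') : IsSym K ρ k (s + s') (fun p => f p * f' p) := by
  induction k generalizing s s' f f' with
  | zero => exact DecW.mul hf hf'
  | succ k ih =>
    refine ⟨hf.1.mul hf'.1, fun α => isSym_congr_region
      (fun p hp => (along_mul hK h.diff h'.diff hp).symm) ?_⟩
    have h1 := ih (hf.2 α) hf'.of_succ (h.dd hK α) h'
    have h2 := ih hf.of_succ (hf'.2 α) h (h'.dd hK α)
    rw [show s + 1 + s' = s + s' + 1 by ring] at h1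
    exact h1.add hK h2 ((h.dd hK α).mul h') (h.mul (h'.dd hK α))

lemma IsSym.mono (hρ : 1 ≤ ρ) (hf : IsSym K ρ k (s + 1) f) : IsSym K ρ k s f := by
  have hW : ∀ {s : ℕ} {f : SpaceTime n → ℝ}, DecW K ρ (s + 1) f → DecW K ρ s f :=
    fun {s f} hf => hf.mono_right zero_le_one fun p _ hr => by
      have : ‖p.2‖ ^ s ≤ ‖p.2‖ ^ (s + 1) := pow_le_pow_right₀ (by linarith) (by omega)
      rw [one_mul]
      gcongr
  induction k generalizing s f with
  | zero => exact hW hf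
  | succ k ih => exact ⟨hW hf.1, fun α => ih (hf.2 α)⟩

lemma smooth_coord (c : Fin n) : Smooth K (fun p => p.2 c) := (contDiff_coord c).contDiffOn

lemma abs_coord_le (x : Space n) (c : Fin n) : |x c| ≤ ‖x‖ := by
  simpa using EuclideanSpace.norm_eq x ▸ PiLp.norm_apply_le x c

lemma IsSym.coord_mul (hK : IsClosed K) (c : Fin n) (hf : IsSym K ρ k (s + 1) f)
    (h : Smooth K f) : IsSym K ρ k s (fun p => p.2 c * f p) := by
  have hW : ∀ {s : ℕ} {f : SpaceTime n → ℝ}, DecW K ρ (s + 1) f →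
      DecW K ρ s (fun p => p.2 c * f p) :=
    fun {s f} hf => hf.mono_right zero_le_one fun p _ hr => by
      have := abs_coord_le p.2 c
      rw [one_mul, abs_mul, pow_succ, mul_assoc]
      gcongr
  induction k generalizing s f with
  | zero => exact hW hf
  | succ k ih =>
    refine ⟨hW hf.1, fun α => isSym_congr_region
      (fun p hp => (along_mul hK (smooth_coord c).diff h.diff hp).symm) ?_⟩
    refine isSym_congr_region (f := fun p => (coordField α (0 : SpaceTime n)).2 c * f p +
      p.2 c * dd K α f p) (fun p hp => ?_)
      ((hf.of_succ.const_mul hK h _).add hK (ih (hf.2 α) (h.dd hK α)) (contDiffOn_const.mul h)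
        ((smooth_coord c).mul (h.dd hK α)))
    have := dd_coord_snd hK α c hp
    simp only [dd] at this ⊢
    rw [this, coordField_eq α p 0]

namespace Sym

lemma congr (hf : Sym K ρ s f) (h : Smooth K f')
    (he : ∀ p ∈ region K, ρ < ‖p.2‖ → f p = f' p) : Sym K ρ s f' :=
  ⟨h, fun k => isSym_congr he (hf.isSym k)⟩

lemma congr_region (hf : Sym K ρ s f) (he : Set.EqOn f f' (region K)) : Sym K ρ s f' :=
  hf.congr (hf.smooth.congr fun _ hp => (he hp).symm) fun _ hp _ => he hp

lemma add (hK : IsClosed K) (hf : Sym K ρ s f) (hf' : Sym K ρ s f') :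
    Sym K ρ s (fun p => f p + f' p) :=
  ⟨hf.smooth.add hf'.smooth, fun k => (hf.isSym k).add hK (hf'.isSym k) hf.smooth hf'.smooth⟩

lemma const_mul (hK : IsClosed K) (c : ℝ) (hf : Sym K ρ s f) : Sym K ρ s (fun p => c * f p) :=
  ⟨contDiffOn_const.mul hf.smooth, fun k => (hf.isSym k).const_mul hK hf.smooth c⟩

lemma neg (hK : IsClosed K) (hf : Sym K ρ s f) : Sym K ρ s (fun p => - f p) :=
  (hf.const_mul hK (-1)).congr_region fun p _ => by ring

lemma sub (hK : IsClosed K) (hf : Sym K ρ s f) (hf' : Sym K ρ s f') :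
    Sym K ρ s (fun p => f p - f' p) :=
  (hf.add hK (hf'.neg hK)).congr_region fun p _ => by ring

lemma mul (hK : IsClosed K) (hf : Sym K ρ s f) (hf' : Sym K ρ s' f') :
    Sym K ρ (s + s') (fun p => f p * f' p) :=
  ⟨hf.smooth.mul hf'.smooth, fun k => (hf.isSym k).mul hK (hf'.isSym k) hf.smooth hf'.smooth⟩

lemma decW (hf : Sym K ρ s f) : DecW K ρ s f := (hf.isSym 0).decW

lemma zero : Sym K ρ s (fun _ => 0) := by
  have h0 : DecW K ρ s (fun _ : SpaceTime n => 0) :=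
    ⟨0, summable_zero, fun _ => le_rfl, fun p _ _ => by simp⟩
  refine ⟨contDiffOn_const, fun k => ?_⟩
  induction k generalizing s with
  | zero => exact h0
  | succ k ih =>
    have h0' : ∀ s, DecW K ρ s (fun _ : SpaceTime n => 0) := fun s =>
      ⟨0, summable_zero, fun _ => le_rfl, fun p _ _ => by simp⟩
    exact ⟨h0, fun α => isSym_congr_region (fun p _ => (along_const 0 p).symm) (ih (h0' _))⟩

lemma sum (hK : IsClosed K) {ι : Type*} (t : Finset ι) {f : ι → SpaceTime n → ℝ}
    (hf : ∀ i ∈ t, Sym K ρ s (f i)) : Sym K ρ s (fun p => ∑ i ∈ t, f i p) := by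
  classical
  induction t using Finset.induction_on with
  | empty => simpa using zero
  | insert i t hi ih =>
    simp only [Finset.sum_insert hi]
    exact (hf i (Finset.mem_insert_self _ _)).add hK
      (ih fun j hj => hf j (Finset.mem_insert_of_mem hj))

lemma dd (hK : IsClosed K) (hf : Sym K ρ s f) (α : Fin (n + 1)) :
    Sym K ρ (s + 1) (dd K α f) :=
  ⟨hf.smooth.dd hK α, fun k => (hf.isSym (k + 1)).2 α⟩

lemma mono (hρ : 1 ≤ ρ) (hf : Sym K ρ (s + 1) f) : Sym K ρ s f :=
  ⟨hf.smooth, fun k => (hf.isSym k).mono hρ⟩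

lemma coord_mul (hK : IsClosed K) (c : Fin n) (hf : Sym K ρ (s + 1) f) :
    Sym K ρ s (fun p => p.2 c * f p) :=
  ⟨(smooth_coord c).mul hf.smooth, fun k => (hf.isSym k).coord_mul hK c hf.smooth⟩

lemma zCoef_mul (hK : IsClosed K) (hρ : 1 ≤ ρ) (i : ZIndex n) (γ : Fin (n + 1))
    (hf : Sym K ρ (s + 1) f) : Sym K ρ s (fun p => zCoef i γ p * f p) := by
  obtain ⟨c₀, c, h⟩ := zCoef_affine i γ
  refine (((hf.mono hρ).const_mul hK c₀).add hK (sum hK Finset.univ fun l _ =>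
    (hf.coord_mul hK l).const_mul hK (c l))).congr_region fun p _ => ?_
  simp only [h, add_mul, Finset.sum_mul]
  simp [mul_assoc]

/-- The fields `Z` preserve the symbol classes. -/
lemma zz (hK : IsClosed K) (hρ : 1 ≤ ρ) (hf : Sym K ρ s f) (i : ZIndex n) :
    Sym K ρ s (zz K i f) :=
  (sum hK Finset.univ fun γ _ => (hf.dd hK γ).zCoef_mul hK hρ i γ).congr_region
    fun p _ => (zz_eq_sum i f p).symm

end Sym

/-- The class `c + 𝒜₀` of functions that tend to the constant `c` at spatial infinity. -/
def Sc (K : Set (Space n)) (ρ : ℝ) (c : ℝ) (f : SpaceTime n → ℝ) : Prop :=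
  Sym K ρ 0 (fun p => f p - c)

namespace Sc

variable {c c' : ℝ}

lemma smooth (hf : Sc K ρ c f) : Smooth K f :=
  (hf.1.add (contDiffOn_const (c := c))).congr fun p _ => by ring

lemma const : Sc K ρ c (fun _ => c) :=
  Sym.zero.congr_region fun p _ => by ring

lemma congr_region (hf : Sc K ρ c f) (he : Set.EqOn f f' (region K)) : Sc K ρ c f' :=
  Sym.congr_region hf fun p hp => by simp only [he hp]

lemma mul_sym (hK : IsClosed K) (hf : Sc K ρ c f) (hf' : Sym K ρ s f') :
    Sym K ρ s (fun p => f p * f' p) := by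
  have h := Sym.mul hK hf hf'
  rw [zero_add] at h
  exact (h.add hK (hf'.const_mul hK c)).congr_region fun p _ => by ring

lemma mul (hK : IsClosed K) (hf : Sc K ρ c f) (hf' : Sc K ρ c' f') :
    Sc K ρ (c * c') (fun p => f p * f' p) :=
  ((hf.mul_sym hK hf').add hK (Sym.const_mul hK c' hf)).congr_region fun p _ => by ring

lemma sum (hK : IsClosed K) {ι : Type*} (t : Finset ι) {f : ι → SpaceTime n → ℝ} {c : ι → ℝ}
    (hf : ∀ i ∈ t, Sc K ρ (c i) (f i)) : Sc K ρ (∑ i ∈ t, c i) (fun p => ∑ i ∈ t, f i p) :=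
  (Sym.sum hK t hf).congr_region fun p _ => by simp

lemma prod (hK : IsClosed K) {ι : Type*} (t : Finset ι) {f : ι → SpaceTime n → ℝ} {c : ι → ℝ}
    (hf : ∀ i ∈ t, Sc K ρ (c i) (f i)) : Sc K ρ (∏ i ∈ t, c i) (fun p => ∏ i ∈ t, f i p) := by
  classical
  induction t using Finset.induction_on with
  | empty => simpa using const
  | insert i t hi ih =>
    simp only [Finset.prod_insert hi]
    exact (hf i (Finset.mem_insert_self _ _)).mul hK
      (ih fun j hj => hf j (Finset.mem_insert_of_mem hj))

lemma dd (hK : IsClosed K) (hf : Sc K ρ c f) (α : Fin (n + 1)) : Sym K ρ 1 (dd K α f) :=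
  (Sym.dd hK hf α).congr_region fun p hp => by
    have := along_add hK (X := coordField α) hf.smooth.diff
      (differentiableOn_const (c := -c)) hp
    rw [along_const, add_zero] at this
    simpa [AFWave.dd, sub_eq_add_neg] using this

lemma det (hK : IsClosed K) {m : ℕ} {A : SpaceTime n → Matrix (Fin m) (Fin m) ℝ}
    {C : Matrix (Fin m) (Fin m) ℝ} (h : ∀ i j, Sc K ρ (C i j) (fun p => A p i j)) :
    Sc K ρ C.det (fun p => (A p).det) := by
  simp only [Matrix.det_apply']
  exact sum hK _ fun σ _ => const.mul hK (prod hK _ fun i _ => h _ _)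

/-- `1/f` belongs to `1/c + 𝒜₀` where `f ∈ c + 𝒜₀` is bounded away from zero. -/
lemma inv (hK : IsClosed K) (hf : Sc K ρ c f) (hc : c ≠ 0) (hf0 : ∀ p ∈ region K, f p ≠ 0)
    (hb : ∀ p ∈ region K, ρ < ‖p.2‖ → |c| / 2 ≤ |f p|) : Sc K ρ c⁻¹ (fun p => (f p)⁻¹) := by
  have hsm : Smooth K (fun p => (f p)⁻¹ - c⁻¹) := (hf.smooth.inv hf0).sub contDiffOn_const
  refine ⟨hsm, fun k => ?_⟩
  have h0 : DecW K ρ 0 (fun p => (f p)⁻¹ - c⁻¹) := by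
    refine hf.decW.mono_right (C := 2 / c ^ 2) (by positivity) fun p hp hr => ?_
    have h1 := hb p hp hr
    have h2 := hf0 p hp
    have h3 : (f p)⁻¹ - c⁻¹ = -(f p - c) * ((f p)⁻¹ * c⁻¹) := by field_simp; ring
    have h4 : 0 < |c| := abs_pos.2 hc
    rw [h3, abs_mul, abs_neg, abs_mul, abs_inv, abs_inv]
    have h5 : |f p|⁻¹ ≤ 2 / |c| := by
      rw [inv_le_comm₀ (by positivity) (by positivity)]
      simpa using h1
    calc ‖p.2‖ ^ 0 * (|f p - c| * (|f p|⁻¹ * |c|⁻¹))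
        ≤ ‖p.2‖ ^ 0 * (|f p - c| * (2 / |c| * |c|⁻¹)) := by gcongr
      _ = _ := by
        rw [← sq_abs c]
        field_simp
  induction k with
  | zero => exact h0
  | succ k ih =>
    refine ⟨h0, fun α => ?_⟩
    have hD := hf.dd hK α
    have h1 := (ih.mul hK ih hsm hsm).mul hK (hD.isSym k) (hsm.mul hsm) hD.smooth
    have h2 := (ih.mul hK (hD.isSym k) hsm hD.smooth).const_mul hK (hsm.mul hD.smooth) (2 * c⁻¹)
    have h3 := (hD.isSym k).const_mul hK hD.smooth (c⁻¹ ^ 2)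
    simp only [zero_add] at h1 h2 h3 ⊢
    refine isSym_congr_region (fun p hp => ?_) (((h1.add hK h2 ((hsm.mul hsm).mul hD.smooth)
      (contDiffOn_const.mul (hsm.mul hD.smooth))).add hK h3
      (((hsm.mul hsm).mul hD.smooth).add (contDiffOn_const.mul (hsm.mul hD.smooth)))
      (contDiffOn_const.mul hD.smooth)).const_mul hK
      ((((hsm.mul hsm).mul hD.smooth).add (contDiffOn_const.mul (hsm.mul hD.smooth))).add
        (contDiffOn_const.mul hD.smooth)) (-1))
    -- `∂ (1/f) = - (1/f)² ∂ f`, from `(1/f) f = 1`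
    have hi : Smooth K (fun q => (f q)⁻¹) := hf.smooth.inv hf0
    have e1 := along_mul hK (X := coordField α) hi.diff hf.smooth.diff hp
    have e2 : along (region K) (coordField α) (fun q => (f q)⁻¹ * f q) p = 0 := by
      rw [along_congr (g := fun _ => 1) (fun q hq => inv_mul_cancel₀ (hf0 q hq)) hp, along_const]
    have e3 := along_add hK (X := coordField α) hi.diff
      (differentiableOn_const (c := -c⁻¹)) hp
    rw [along_const, add_zero] at e3
    have e4 : AFWave.dd K α (fun p => (f p)⁻¹ - c⁻¹) p =
        along (region K) (coordField α) (fun q => (f q)⁻¹) p := by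
      simpa [AFWave.dd, sub_eq_add_neg] using e3
    rw [e2] at e1
    rw [e4]
    have h2 := hf0 p hp
    have e5 : along (region K) (coordField α) (fun q => (f q)⁻¹) p =
        - ((f p)⁻¹ * (f p)⁻¹ * along (region K) (coordField α) f p) := by
      have : along (region K) (coordField α) (fun q => (f q)⁻¹) p * f p * (f p)⁻¹ =
        - ((f p)⁻¹ * (along (region K) (coordField α) f p)) * (f p)⁻¹ := by
        linear_combination (-(f p)⁻¹) * e1
      rw [mul_assoc, mul_inv_cancel₀ h2] at this
      linarith
    rw [e5]
    simp only [AFWave.dd]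
    ring

end Sc

/-! ### The metric as a symbol -/

lemma IsDyadicPartition.index_le {φ : ℕ → Space n → ℝ} (hφ : IsDyadicPartition φ) {j : ℕ}
    {x : Space n} (h : φ j x ≠ 0) : dyIdx x ≤ j + 1 ∧ j ≤ dyIdx x + 1 := by
  constructor
  · by_cases hx : 1 ≤ ‖x‖
    · exact (pow_le_pow_iff_right₀ (by norm_num : (1 : ℝ) < 2)).1
        ((two_pow_dyIdx_le hx).trans (hφ.outer j x h))
    · have : dyIdx x = 0 := by
        rw [dyIdx, Nat.floor_eq_zero.2 (not_le.1 hx)]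
        simp
      omega
  · cases j with
    | zero => omega
    | succ j =>
      have := (pow_lt_pow_iff_right₀ (by norm_num : (1 : ℝ) < 2)).1
        ((hφ.inner j x h).trans_lt (lt_two_pow_dyIdx x))
      omega

lemma IsDyadicPartition.sum_near {φ : ℕ → Space n → ℝ} (hφ : IsDyadicPartition φ)
    (x : Space n) : ∑ j ∈ Finset.Icc (dyIdx x - 1) (dyIdx x + 1), φ j x ^ 2 = 1 := by
  refine (hasSum_sum_of_ne_finset_zero fun j hj => ?_).unique (hφ.sum_sq x)
  by_contra h
  have h' : φ j x ≠ 0 := fun h0 => h (by rw [h0]; ring)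
  have := hφ.index_le h'
  exact hj (Finset.mem_Icc.2 (by omega))

lemma IsDyadicPartition.abs_le_one {φ : ℕ → Space n → ℝ} (hφ : IsDyadicPartition φ)
    (j : ℕ) (x : Space n) : |φ j x| ≤ 1 := by
  have h := le_hasSum (hφ.sum_sq x) j fun i _ => sq_nonneg (φ i x)
  exact (sq_le_one_iff_abs_le_one _).1 h

lemma sum_Icc_le {m : ℕ → ℝ} (hm : ∀ j, 0 ≤ m j) (J : ℕ) :
    ∑ j ∈ Finset.Icc (J - 1) (J + 1), m j ≤ m (J - 1) + m J + m (J + 1) := by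
  cases J with
  | zero =>
    rw [Finset.sum_Icc_succ_top (by omega)]
    simp [hm 0]
  | succ J =>
    rw [Finset.sum_Icc_succ_top (by omega), Nat.add_sub_cancel, Finset.sum_Icc_succ_top (by omega)]
    simp

/-- The dyadic norm `ℓ^s_1 L^∞` controls the pointwise decay of `DecW`. -/
lemma decW_of_ellOne {φ : ℕ → Space n → ℝ} (hφ : IsDyadicPartition φ) {ρ : ℝ} (s : ℕ)
    {f : SpaceTime n → ℝ} (h : ellOne φ (s : ℝ) (supNorm K) f < ⊤) : DecW K ρ s f := by
  set M : ℕ → ℝ≥0∞ := fun j => (2 : ℝ≥0∞) ^ ((j : ℝ) * (s : ℝ)) *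
    supNorm K (fun p => φ j p.2 * f p) with hM
  have hsum : ∑' j, M j ≠ ⊤ := h.ne
  have hMf : ∀ j, M j ≠ ⊤ := fun j => ENNReal.ne_top_of_tsum_ne_top hsum j
  set m : ℕ → ℝ := fun j => (M j).toReal with hm
  have hms : Summable m := ENNReal.summable_toReal hsum
  have hm0 : ∀ j, 0 ≤ m j := fun j => ENNReal.toReal_nonneg
  refine ⟨fun J => 4 ^ s * ∑ j ∈ Finset.Icc (J - 1) (J + 1), m j, ?_, fun J =>
    mul_nonneg (by positivity) (Finset.sum_nonneg fun j _ => hm0 j), fun p hp _ => ?_⟩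
  · refine Summable.mul_left _ (Summable.of_nonneg_of_le
      (fun J => Finset.sum_nonneg fun j _ => hm0 j) (sum_Icc_le hm0) ?_)
    refine (Summable.add ?_ hms).add ((summable_nat_add_iff 1).2 hms)
    exact (summable_nat_add_iff 1).1 (by simpa using hms)
  · set J := dyIdx p.2 with hJ
    have hterm : ∀ j, (2 : ℝ) ^ (j * s) * |φ j p.2 * f p| ≤ m j := by
      intro j
      have h1 : ‖φ j p.2 * f p‖ₑ ≤ supNorm K (fun p => φ j p.2 * f p) :=
        le_iSup₂ (f := fun (q : SpaceTime n) (_ : q ∈ region K) => ‖φ j q.2 * f q‖ₑ) p hp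
      have h2 : (2 : ℝ≥0∞) ^ ((j : ℝ) * (s : ℝ)) * ‖φ j p.2 * f p‖ₑ ≤ M j := by
        exact mul_le_mul' le_rfl h1
      have h3 := ENNReal.toReal_mono (hMf j) h2
      have h4 : (2 : ℝ≥0∞) ^ ((j : ℝ) * (s : ℝ)) = 2 ^ (j * s) := by
        rw [← ENNReal.rpow_natCast]; push_cast; rfl
      rw [ENNReal.toReal_mul, h4] at h3
      simpa using h3
    have habs : |f p| ≤ ∑ j ∈ Finset.Icc (J - 1) (J + 1), |φ j p.2 * f p| := by
      have h1 : (1 : ℝ) ≤ ∑ j ∈ Finset.Icc (J - 1) (J + 1), |φ j p.2| := by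
        rw [← hφ.sum_near p.2]
        refine Finset.sum_le_sum fun j _ => ?_
        rw [← sq_abs]
        nlinarith [hφ.abs_le_one j p.2, abs_nonneg (φ j p.2)]
      simp only [abs_mul, ← Finset.sum_mul]
      nlinarith [abs_nonneg (f p)]
    have hx : ‖p.2‖ ^ s ≤ ((2 : ℝ) ^ (J + 1)) ^ s :=
      pow_le_pow_left₀ (norm_nonneg _) (lt_two_pow_dyIdx p.2).le s
    calc ‖p.2‖ ^ s * |f p| ≤ ((2 : ℝ) ^ (J + 1)) ^ s *
          ∑ j ∈ Finset.Icc (J - 1) (J + 1), |φ j p.2 * f p| := by gcongr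
      _ = ∑ j ∈ Finset.Icc (J - 1) (J + 1), ((2 : ℝ) ^ (J + 1)) ^ s * |φ j p.2 * f p| := by
        rw [Finset.mul_sum]
      _ ≤ ∑ j ∈ Finset.Icc (J - 1) (J + 1), 4 ^ s * m j := by
        refine Finset.sum_le_sum fun j hj => ?_
        have hj' := Finset.mem_Icc.1 hj
        refine le_trans ?_ (mul_le_mul_of_nonneg_left (hterm j) (by positivity))
        rw [← mul_assoc]
        gcongr
        have : (4 : ℝ) ^ s * 2 ^ (j * s) = (2 ^ (j + 2)) ^ s := by
          rw [pow_add, mul_pow, ← pow_mul, mul_comm]; norm_num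
        rw [this]
        exact pow_le_pow_left₀ (by positivity)
          (pow_le_pow_right₀ (by norm_num) (by omega)) s
      _ = _ := by simp only [Finset.mul_sum]

lemma isSym_of_words {ρ : ℝ} {s k : ℕ} {f : SpaceTime n → ℝ}
    (h : ∀ a : List (Fin (n + 1)), DecW K ρ (s + a.length) (iterAlong (region K) coordField a f)) :
    IsSym K ρ k s f := by
  induction k generalizing s f with
  | zero => exact h []
  | succ k ih =>
    refine ⟨h [], fun α => ih fun a => ?_⟩
    have := h (a ++ [α])
    simpa [iterAlong, add_comm, add_left_comm, add_assoc] using this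

lemma sym_of_decay {φ : ℕ → Space n → ℝ} (hφ : IsDyadicPartition φ) (ρ : ℝ) (s : ℕ)
    {h : MatrixField n} (hs : IsSmoothField K h) (hd : HasDyadicDecay φ K s h)
    (α β : Fin (n + 1)) : Sym K ρ s (fun p => h p α β) :=
  ⟨hs α β, fun _ => isSym_of_words fun a => decW_of_ellOne hφ _ (by
    have := hd a α β
    push_cast
    rwa [add_comm] at this)⟩

lemma DecW.small {ρ : ℝ} {s : ℕ} {f : SpaceTime n → ℝ} (hf : DecW K ρ s f) {ε : ℝ} (hε : 0 < ε) :
    ∃ ρ' ≥ ρ, ∀ p ∈ region K, ρ' < ‖p.2‖ → ‖p.2‖ ^ s * |f p| ≤ ε := by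
  obtain ⟨κ, hs, -, hb⟩ := hf
  obtain ⟨J, hJ⟩ := Filter.eventually_atTop.1 (hs.tendsto_atTop_zero.eventually (gt_mem_nhds hε))
  refine ⟨max ρ (2 ^ J), le_max_left _ _, fun p hp hr => ?_⟩
  refine (hb p hp ((le_max_left _ _).trans_lt hr)).trans (hJ _ ?_).le
  have := (pow_lt_pow_iff_right₀ (by norm_num : (1 : ℝ) < 2)).1
    (((le_max_right _ _).trans_lt hr).trans (lt_two_pow_dyIdx p.2))
  omega

lemma minkowski_mul_self (n : ℕ) : minkowski n * minkowski n = 1 := by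
  rw [minkowski, Matrix.diagonal_mul_diagonal, ← Matrix.diagonal_one]
  congr 1
  funext α
  refine Fin.cases ?_ (fun i => ?_) α <;> simp

lemma det_minkowski (n : ℕ) : (minkowski n).det = -1 := by
  simp [minkowski, Matrix.det_diagonal, Fin.prod_univ_succ]

variable {g : MatrixField n}

lemma volDensity_pos (hg : IsLorentzianMetric K g) {p : SpaceTime n} (hp : p ∈ region K) :
    0 < volDensity g p := by
  obtain ⟨P, -, hP⟩ := hg.signature p hp
  have := congrArg Matrix.det hP
  rw [Matrix.det_mul, Matrix.det_mul, Matrix.det_transpose, det_minkowski] at this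
  rw [volDensity]
  by_contra h
  nlinarith [mul_self_nonneg P.det, mul_nonneg (mul_self_nonneg P.det)
    (by linarith : 0 ≤ (g p).det)]

lemma det_ne_zero (hg : IsLorentzianMetric K g) {p : SpaceTime n} (hp : p ∈ region K) :
    (g p).det ≠ 0 := by
  have := volDensity_pos hg hp
  rw [volDensity] at this
  linarith

lemma smooth_det (hg : IsLorentzianMetric K g) : Smooth K (fun p => (g p).det) := by
  simp only [Matrix.det_apply']
  exact ContDiffOn.sum fun σ _ => contDiffOn_const.mul (contDiffOn_prod fun i _ => hg.smooth _ _)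

lemma sc_metric {φ : ℕ → Space n → ℝ} (hφ : IsDyadicPartition φ) (hK : IsClosed K)
    (H1 : IsAsymptoticallyFlat φ K g) {ρ : ℝ} (hρ : 1 ≤ ρ) (α β : Fin (n + 1)) :
    Sc K ρ (minkowski n α β) (fun p => g p α β) := by
  obtain ⟨g₁, g₂, hsum, hs1, hs2, -, hd1, hd2⟩ := H1
  have h1 := sym_of_decay hφ ρ 0 hs1 (by simpa using hd1) α β
  have h2 := sym_of_decay hφ ρ 1 hs2 (by simpa using hd2) α β
  refine (h1.add hK (h2.mono hρ)).congr_region fun p hp => ?_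
  simp only [hsum p hp, Matrix.add_apply]
  ring

/-- Far out the inverse metric is a symbol, equal to the Minkowski metric at infinity. -/
lemma exists_sc_inverse {φ : ℕ → Space n → ℝ} (hφ : IsDyadicPartition φ) (hK : IsClosed K)
    (hg : IsLorentzianMetric K g) (H1 : IsAsymptoticallyFlat φ K g) (R : ℝ) :
    ∃ ρ ≥ R, 1 ≤ ρ ∧ Sc K ρ (-1) (fun p => ((g p).det)⁻¹) ∧
      ∀ α β, Sc K ρ (minkowski n α β) (fun p => (g p)⁻¹ α β) := by
  have hR : (1 : ℝ) ≤ max R 1 := le_max_right _ _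
  have hdet := Sc.det (ρ := max R 1) (C := minkowski n) hK (sc_metric hφ hK H1 hR)
  obtain ⟨ρ, hρ, hb⟩ := hdet.decW.small (ε := 1 / 2) (by norm_num)
  have hρ1 : 1 ≤ ρ := hR.trans hρ
  have hdet' := Sc.det (ρ := ρ) (C := minkowski n) hK (sc_metric hφ hK H1 hρ1)
  have hinv := hdet'.inv hK (by simp [det_minkowski]) (fun p hp => det_ne_zero hg hp)
    (fun p hp hr => by
      have := hb p hp hr
      rw [det_minkowski] at this ⊢
      simp only [pow_zero, one_mul] at this
      have h1 := abs_sub_abs_le_abs_sub (-1 : ℝ) ((g p).det)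
      rw [abs_sub_comm] at h1
      norm_num at h1 ⊢
      have h2 : |(g p).det - -1| = |(g p).det + 1| := by congr 1; ring
      rw [h2] at this
      linarith)
  refine ⟨ρ, (le_max_left _ _).trans hρ, hρ1, ?_, fun α β => ?_⟩
  · simpa [det_minkowski] using hinv
  · have hadj : Sc K ρ ((minkowski n).adjugate α β) (fun p => (g p).adjugate α β) := by
      simp only [Matrix.adjugate_apply]
      refine Sc.det hK fun i j => ?_
      by_cases h : i = β
      · subst h
        simp only [Matrix.updateRow_self]
        exact Sc.const
      · simp only [Matrix.updateRow_ne h]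
        exact sc_metric hφ hK H1 hρ1 i j
    have hc : minkowski n α β = (minkowski n).det⁻¹ * (minkowski n).adjugate α β := by
      have : (minkowski n)⁻¹ = minkowski n := Matrix.inv_eq_right_inv (minkowski_mul_self n)
      conv_lhs => rw [← this, Matrix.inv_def]
      simp
    rw [hc]
    refine (hinv.mul hK hadj).congr_region fun p _ => ?_
    simp [Matrix.inv_def]

/-- The coefficients `b^β = |g|^{-1/2} ∂_α (g^{αβ} |g|^{1/2})` of the first order part of `□_g`. -/
def boxLower (K : Set (Space n)) (g : MatrixField n) (β : Fin (n + 1)) (p : SpaceTime n) : ℝ :=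
  ∑ α, (√(volDensity g p))⁻¹ * dd K α (fun q => (g q)⁻¹ α β * √(volDensity g q)) p

lemma smooth_volDensity (hg : IsLorentzianMetric K g) : Smooth K (volDensity g) :=
  (smooth_det hg).neg

lemma smooth_sqrt (hg : IsLorentzianMetric K g) : Smooth K (fun p => √(volDensity g p)) :=
  (smooth_volDensity hg).sqrt fun _ hp => (volDensity_pos hg hp).ne'

lemma smooth_inverse (hg : IsLorentzianMetric K g) (α β : Fin (n + 1)) :
    Smooth K (fun p => (g p)⁻¹ α β) := by
  have h : Smooth K (fun p => (g p).adjugate α β) := by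
    simp only [Matrix.adjugate_apply, Matrix.det_apply']
    refine ContDiffOn.sum fun σ _ => contDiffOn_const.mul (contDiffOn_prod fun i _ => ?_)
    by_cases h : σ i = β
    · simp only [h, Matrix.updateRow_self]
      exact contDiffOn_const
    · simp only [Matrix.updateRow_ne h]
      exact hg.smooth _ _
  refine (((smooth_det hg).inv fun p hp => det_ne_zero hg hp).mul h).congr fun p _ => ?_
  simp [Matrix.inv_def]

lemma box_eq (hK : IsClosed K) (hg : IsLorentzianMetric K g) {u : SpaceTime n → ℝ} (hu : CD K 2 u)
    {p : SpaceTime n} (hp : p ∈ region K) :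
    box K g u p = ∑ α, ∑ β, (g p)⁻¹ α β * dd K α (dd K β u) p +
      ∑ β, boxLower K g β p * dd K β u p := by
  have hv : √(volDensity g p) ≠ 0 := (Real.sqrt_pos.2 (volDensity_pos hg hp)).ne'
  have h1 : ∀ α β, along (region K) (coordField α) (fun q => (g q)⁻¹ α β *
      √(volDensity g q) * along (region K) (coordField β) u q) p =
      dd K α (fun q => (g q)⁻¹ α β * √(volDensity g q)) p * dd K β u p +
        (g p)⁻¹ α β * √(volDensity g p) * dd K α (dd K β u) p := fun α β =>
    along_mul hK (Smooth.diff ((smooth_inverse hg α β).mul (smooth_sqrt hg)))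
      (CD.differentiableOn (m := 0) (CD.dd hK hu β)) hp
  simp only [box, h1, Finset.sum_add_distrib, mul_add, boxLower, Finset.sum_mul, Finset.mul_sum]
  rw [add_comm, Finset.sum_comm (f := fun β α => (√(volDensity g p))⁻¹ *
    dd K α (fun q => (g q)⁻¹ α β * √(volDensity g q)) p * dd K β u p)]
  congr 1
  · refine Finset.sum_congr rfl fun α _ => Finset.sum_congr rfl fun β _ => ?_
    field_simp
  · refine Finset.sum_congr rfl fun α _ => Finset.sum_congr rfl fun β _ => ?_
    ring

/-- The first order coefficients `|g|^{-1/2} ∂_α (g^{αβ} |g|^{1/2})` of `□_g` are in `𝒜₁`. -/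
lemma sym_boxLower (hK : IsClosed K) (hg : IsLorentzianMetric K g) {ρ : ℝ}
    (hdet : Sc K ρ (-1) (fun p => ((g p).det)⁻¹))
    (hm : ∀ α β, Sc K ρ (minkowski n α β) (fun p => g p α β))
    (hi : ∀ α β, Sc K ρ (minkowski n α β) (fun p => (g p)⁻¹ α β)) (β : Fin (n + 1)) :
    Sym K ρ 1 (boxLower K g β) := by
  have hD := fun α => (Sc.det (C := minkowski n) hK hm).dd hK α
  refine (Sym.sum hK Finset.univ fun α _ => ((hi α β).dd hK α).add hK
    ((hi α β).mul_sym hK ((hdet.mul_sym hK (hD α)).const_mul hK (1 / 2)))).congr_region ?_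
  intro p hp
  refine Finset.sum_congr rfl fun α _ => ?_
  have hv0 := volDensity_pos hg hp
  have hv : √(volDensity g p) ≠ 0 := (Real.sqrt_pos.2 hv0).ne'
  have e1 := along_mul hK (X := coordField α) (smooth_inverse hg α β).diff (smooth_sqrt hg).diff hp
  -- `∂ |g| = 2 |g|^{1/2} ∂ |g|^{1/2}`
  have e2 := along_mul hK (X := coordField α) (smooth_sqrt hg).diff (smooth_sqrt hg).diff hp
  have e3 : along (region K) (coordField α) (fun q => √(volDensity g q) * √(volDensity g q)) p =
      along (region K) (coordField α) (fun q => (-1) * (g q).det) p :=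
    along_congr (fun q hq => by
      rw [Real.mul_self_sqrt (volDensity_pos hg hq).le, volDensity]; ring) hp
  rw [along_const_mul hK _ (smooth_det hg).diff hp, e2] at e3
  have e4 : (g p).det = - (√(volDensity g p) * √(volDensity g p)) := by
    rw [Real.mul_self_sqrt hv0.le, volDensity]; ring
  simp only [dd] at *
  rw [e1, e4]
  have e5 : along (region K) (coordField α) (fun q => (g q).det) p =
    - (2 * √(volDensity g p) * along (region K) (coordField α) (fun q => √(volDensity g q)) p) := by
    linarith
  rw [e5]
  field_simp

/-! ### Commutators with the d'Alembertian -/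

/-- The rotation of `x` by the angle `s` in the plane of `q`. -/
def rotCurve (q : RotIndex n) (x : Space n) (s : ℝ) : Space n :=
  x + (((Real.cos s - 1) * x q.1.1 - Real.sin s * x q.1.2) • EuclideanSpace.single q.1.1 (1 : ℝ) +
    ((Real.cos s - 1) * x q.1.2 + Real.sin s * x q.1.1) • EuclideanSpace.single q.1.2 (1 : ℝ))

lemma rotCurve_zero (q : RotIndex n) (x : Space n) : rotCurve q x 0 = x := by
  simp [rotCurve]

lemma hasDerivAt_rotCurve (q : RotIndex n) (x : Space n) :
    HasDerivAt (rotCurve q x) (rotField q x) 0 := by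
  have hc : HasDerivAt (fun s => Real.cos s - 1) 0 0 := by
    simpa using (Real.hasDerivAt_cos 0).sub_const 1
  have hs : HasDerivAt Real.sin 1 0 := by simpa using Real.hasDerivAt_sin 0
  have h1 := ((hc.mul_const (x q.1.1)).sub (hs.mul_const (x q.1.2))).smul_const
    (EuclideanSpace.single q.1.1 (1 : ℝ))
  have h2 := ((hc.mul_const (x q.1.2)).add (hs.mul_const (x q.1.1))).smul_const
    (EuclideanSpace.single q.1.2 (1 : ℝ))
  refine ((h1.add h2).const_add x).congr_deriv ?_
  simp [rotField, spaceField]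
  abel

lemma norm_rotCurve (q : RotIndex n) (x : Space n) (s : ℝ) : ‖rotCurve q x s‖ = ‖x‖ := by
  have hne : q.1.1 ≠ q.1.2 := q.2.ne
  rw [EuclideanSpace.norm_eq, EuclideanSpace.norm_eq]
  congr 1
  rw [← sub_eq_zero, ← Finset.sum_sub_distrib]
  have : ∀ l : Fin n, ‖rotCurve q x s l‖ ^ 2 - ‖x l‖ ^ 2 =
      (if l = q.1.1 then (Real.cos s * x q.1.1 - Real.sin s * x q.1.2) ^ 2 - x q.1.1 ^ 2 else 0) +
      (if l = q.1.2 then (Real.cos s * x q.1.2 + Real.sin s * x q.1.1) ^ 2 - x q.1.2 ^ 2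
        else 0) := by
    intro l
    by_cases h1 : l = q.1.1
    · have h2 : l ≠ q.1.2 := h1 ▸ hne
      simp [rotCurve, h1, hne]
      ring
    · by_cases h2 : l = q.1.2
      · simp [rotCurve, h2, hne.symm]
        ring
      · simp [rotCurve, h1, h2]
  rw [Finset.sum_congr rfl fun l _ => this l, Finset.sum_add_distrib]
  simp only [Finset.sum_ite_eq', Finset.mem_univ, if_true]
  linear_combination (x q.1.1 ^ 2 + x q.1.2 ^ 2) * Real.sin_sq_add_cos_sq s

/-- The rotation fields are derivatives along rotations. -/
lemma hasDerivAt_comp_rotCurve {ρ : ℝ} (hKρ : ∀ x ∈ K, ‖x‖ ≤ ρ) {f : SpaceTime n → ℝ}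
    {p : SpaceTime n} (hp : p ∈ region K) (hr : ρ < ‖p.2‖)
    (hf : DifferentiableWithinAt ℝ f (region K) p) (q : RotIndex n) :
    HasDerivAt (fun s => f (p.1, rotCurve q p.2 s)) (zz K (some (Sum.inr q)) f p) 0 := by
  have h1 : HasDerivWithinAt (fun s => (p.1, rotCurve q p.2 s)) ((0 : ℝ), rotField q p.2)
      Set.univ 0 :=
    ((hasDerivAt_const (0 : ℝ) p.1).prodMk (hasDerivAt_rotCurve q p.2)).hasDerivWithinAt
  have hp' : (p.1, rotCurve q p.2 0) = p := by rw [rotCurve_zero]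
  have h2 : HasFDerivWithinAt f (fderivWithin ℝ f (region K) p) (region K)
      (p.1, rotCurve q p.2 0) := by
    rw [hp']
    exact hf.hasFDerivWithinAt
  have hm : Set.MapsTo (fun s => (p.1, rotCurve q p.2 s)) Set.univ (region K) := by
    intro s _
    refine ⟨hp.1, fun hs => ?_⟩
    have := hKρ _ hs
    rw [norm_rotCurve] at this
    linarith
  exact (h2.comp_hasDerivWithinAt (0 : ℝ) h1 hm).hasDerivAt Filter.univ_mem

/-- The matrix of the structure constants of `Z_i`. -/
def strM (i : ZIndex n) : Matrix (Fin (n + 1)) (Fin (n + 1)) ℝ := Matrix.of (strC i)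

lemma strC_cz (α β γ : Fin (n + 1)) : strC (cz α) β γ = 0 := by
  have : ∀ p : SpaceTime n, zCoef (cz α) γ p = zCoef (cz α) γ 0 := fun p => by
    simp only [zCoef, zField_cz, coordField_eq α p 0]
  rw [strC, this]
  ring

lemma strC_zero (i : ZIndex n) (γ : Fin (n + 1)) : strC i 0 γ = 0 := by
  have : ∀ p : SpaceTime n, zCoef i γ p = zCoef i γ (0, p.2) := fun p => by
    rcases i with _ | (i | q) <;> rfl
  rw [strC, this (coordField 0 0)]
  change zCoef i γ ((0 : ℝ), (0 : Space n)) - zCoef i γ ((0 : ℝ), (0 : Space n)) = 0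
  ring

lemma strC_right_zero (i : ZIndex n) (α : Fin (n + 1)) : strC i α 0 = 0 := by
  rcases i with _ | (i | q) <;> simp [strC, zCoef, zField]

lemma strC_rot (q : RotIndex n) (i j : Fin n) : strC (some (Sum.inr q)) i.succ j.succ =
    (if i = q.1.1 then (if j = q.1.2 then 1 else 0) else 0) -
      (if i = q.1.2 then (if j = q.1.1 then 1 else 0) else 0) := by
  have h1 : ∀ p : SpaceTime n, zCoef (some (Sum.inr q)) j.succ p =
      p.2 q.1.1 * (if j = q.1.2 then 1 else 0) - p.2 q.1.2 * (if j = q.1.1 then 1 else 0) := by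
    intro p
    simp [zCoef, zField, yField, rotField, spaceField]
  have h2 : ∀ l : Fin n, (coordField i.succ (0 : SpaceTime n)).2 l = if i = l then 1 else 0 := by
    intro l
    simp [coordField, spaceField, eq_comm]
  simp only [strC, h1, h2, ite_mul, one_mul, zero_mul]
  simp

lemma strC_rot_antisymm (q : RotIndex n) (α β : Fin (n + 1)) :
    strC (some (Sum.inr q)) α β = - strC (some (Sum.inr q)) β α := by
  refine Fin.cases ?_ (fun i => ?_) α
  · rw [strC_zero, strC_right_zero]; ring
  · refine Fin.cases ?_ (fun j => ?_) β
    · rw [strC_zero, strC_right_zero]; ring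
    · rw [strC_rot, strC_rot]
      split_ifs <;> simp_all

lemma zCoef_rot (q : RotIndex n) (j : Fin n) (p : SpaceTime n) :
    zCoef (some (Sum.inr q)) j.succ p = ∑ l, p.2 l * strC (some (Sum.inr q)) l.succ j.succ := by
  simp only [strC_rot]
  simp [zCoef, zField, yField, rotField, spaceField, mul_sub, Finset.sum_sub_distrib]

/-- The Lie derivative of a `(0,2)` tensor `h` along `Z_i`. -/
def lieDer (K : Set (Space n)) (i : ZIndex n) (h : MatrixField n) (p : SpaceTime n) :
    Matrix (Fin (n + 1)) (Fin (n + 1)) ℝ :=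
  Matrix.of (fun α β => zz K i (fun q => h q α β) p) + h p * (strM i).transpose + strM i * h p

lemma lieDer_apply (i : ZIndex n) (h : MatrixField n) (p : SpaceTime n) (α β : Fin (n + 1)) :
    lieDer K i h p α β = zz K i (fun q => h q α β) p + ∑ μ, h p α μ * strC i β μ +
      ∑ μ, strC i α μ * h p μ β := by
  simp [lieDer, Matrix.mul_apply, strM]

/-- Radial tensors are invariant under rotations. -/
lemma lieDer_rot_radial {ρ : ℝ} (hρ : 0 ≤ ρ) (hKρ : ∀ x ∈ K, ‖x‖ ≤ ρ) {h : MatrixField n}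
    (hs : IsSmoothField K h) (hrad : IsRadial K h) (q : RotIndex n) {p : SpaceTime n}
    (hp : p ∈ region K) (hr : ρ < ‖p.2‖) (α β : Fin (n + 1)) :
    lieDer K (some (Sum.inr q)) h p α β = 0 := by
  obtain ⟨h00, h01, h11, h22, H⟩ := hrad
  obtain ⟨t, x⟩ := p
  simp only at hr
  have hx : ‖x‖ ≠ 0 := by linarith
  have hcur : ∀ s, (t, rotCurve q x s) ∈ region K ∧ rotCurve q x s ≠ 0 := fun s => by
    have := norm_rotCurve q x s
    refine ⟨⟨hp.1, fun hs => ?_⟩, fun h0 => ?_⟩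
    · have := hKρ _ hs
      linarith
    · rw [h0, norm_zero] at this
      exact hx this.symm
  have hH := fun s => H t _ (hcur s).1 (hcur s).2
  have hH0 := H t x hp (by simpa using hx)
  simp only [norm_rotCurve] at hH
  have hd := fun α β => hasDerivAt_comp_rotCurve hKρ hp hr
    ((hs α β).differentiableOn (by simp) _ hp) q
  have hcoord : ∀ c : Fin n, HasDerivAt (fun s => rotCurve q x s c)
      (zCoef (some (Sum.inr q)) c.succ (t, x)) 0 := fun c =>
    ((EuclideanSpace.proj (𝕜 := ℝ) c).hasFDerivAt.comp_hasDerivAt (0 : ℝ)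
      (hasDerivAt_rotCurve q x))
  have hV : ∀ c : Fin n, ∑ l, strC (some (Sum.inr q)) c.succ l.succ * x l =
      - zCoef (some (Sum.inr q)) c.succ (t, x) := fun c => by
    rw [zCoef_rot, ← Finset.sum_neg_distrib]
    refine Finset.sum_congr rfl fun l _ => ?_
    rw [strC_rot_antisymm]
    ring
  have hx0 : ∀ c, rotCurve q x 0 c = x c := fun c => by rw [rotCurve_zero]
  rw [lieDer_apply]
  refine Fin.cases ?_ (fun i => ?_) α
  · refine Fin.cases ?_ (fun j => ?_) β
    · simp only [strC_zero, mul_zero, zero_mul, Finset.sum_const_zero, add_zero]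
      refine (hd 0 0).unique ?_
      simp only [(hH _).1]
      exact hasDerivAt_const _ _
    · have h1 : zz K (some (Sum.inr q)) (fun p => h p 0 j.succ) (t, x) =
          h01 t ‖x‖ * (zCoef (some (Sum.inr q)) j.succ (t, x) / ‖x‖) := by
        refine (hd 0 j.succ).unique ?_
        simp only [((hH _).2.1 j).1]
        exact ((hcoord j).div_const _).const_mul _
      rw [h1, Fin.sum_univ_succ]
      simp only [strC_zero, strC_right_zero, mul_zero, zero_mul, Finset.sum_const_zero, add_zero,
        zero_add, (hH0.2.1 _).1]
      have h2 := hV j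
      have h3 : ∑ l : Fin n, h01 t ‖x‖ * (x l / ‖x‖) * strC (some (Sum.inr q)) j.succ l.succ =
          h01 t ‖x‖ / ‖x‖ * ∑ l, strC (some (Sum.inr q)) j.succ l.succ * x l := by
        rw [Finset.mul_sum]
        refine Finset.sum_congr rfl fun l _ => ?_
        ring
      rw [h3, h2]
      ring
  · refine Fin.cases ?_ (fun j => ?_) β
    · have h1 : zz K (some (Sum.inr q)) (fun p => h p i.succ 0) (t, x) =
          h01 t ‖x‖ * (zCoef (some (Sum.inr q)) i.succ (t, x) / ‖x‖) := by
        refine (hd i.succ 0).unique ?_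
        simp only [((hH _).2.1 i).2]
        exact ((hcoord i).div_const _).const_mul _
      rw [h1, Fin.sum_univ_succ (f := fun μ => strC (some (Sum.inr q)) i.succ μ * h (t, x) μ 0)]
      simp only [strC_zero, strC_right_zero, mul_zero, zero_mul, Finset.sum_const_zero, add_zero,
        zero_add, (hH0.2.1 _).2]
      have h2 := hV i
      have h3 : ∑ l : Fin n, strC (some (Sum.inr q)) i.succ l.succ * (h01 t ‖x‖ * (x l / ‖x‖)) =
          h01 t ‖x‖ / ‖x‖ * ∑ l, strC (some (Sum.inr q)) i.succ l.succ * x l := by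
        rw [Finset.mul_sum]
        refine Finset.sum_congr rfl fun l _ => ?_
        ring
      rw [h3, h2]
      ring
    · set V := fun c : Fin n => zCoef (some (Sum.inr q)) c.succ (t, x) with hVdef
      set A := (h11 t ‖x‖ - h22 t ‖x‖) / ‖x‖ ^ 2 with hA
      have hform : ∀ (y : Space n) (i j : Fin n), h11 t ‖x‖ * (y i * y j / ‖x‖ ^ 2) +
          h22 t ‖x‖ * ((if i = j then 1 else 0) - y i * y j / ‖x‖ ^ 2) =
          A * (y i * y j) + h22 t ‖x‖ * (if i = j then 1 else 0) := fun y i j => by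
        rw [hA]; ring
      have h1 : zz K (some (Sum.inr q)) (fun p => h p i.succ j.succ) (t, x) =
          A * (V i * x j + x i * V j) := by
        refine (hd i.succ j.succ).unique ?_
        simp only [(hH _).2.2 i j, hform]
        have := (((hcoord i).mul (hcoord j)).const_mul A).add_const
          (h22 t ‖x‖ * (if i = j then 1 else 0))
        simpa only [hx0, Pi.mul_apply] using this
      rw [h1, Fin.sum_univ_succ, Fin.sum_univ_succ]
      simp only [strC_right_zero, mul_zero, zero_mul, zero_add, hH0.2.2, hform]
      have h2 := hV i
      have h3 := hV j
      have h4 : ∑ l : Fin n, (A * (x i * x l) + h22 t ‖x‖ * (if i = l then 1 else 0)) *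
          strC (some (Sum.inr q)) j.succ l.succ =
          A * x i * ∑ l, strC (some (Sum.inr q)) j.succ l.succ * x l +
            h22 t ‖x‖ * strC (some (Sum.inr q)) j.succ i.succ := by
        rw [Finset.mul_sum]
        have : h22 t ‖x‖ * strC (some (Sum.inr q)) j.succ i.succ =
          ∑ l : Fin n, h22 t ‖x‖ * (if i = l then 1 else 0) *
            strC (some (Sum.inr q)) j.succ l.succ := by simp
        rw [this, ← Finset.sum_add_distrib]
        refine Finset.sum_congr rfl fun l _ => ?_
        ring
      have h5 : ∑ l : Fin n, strC (some (Sum.inr q)) i.succ l.succ *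
          (A * (x l * x j) + h22 t ‖x‖ * (if l = j then 1 else 0)) =
          A * x j * ∑ l, strC (some (Sum.inr q)) i.succ l.succ * x l +
            h22 t ‖x‖ * strC (some (Sum.inr q)) i.succ j.succ := by
        rw [Finset.mul_sum]
        have : h22 t ‖x‖ * strC (some (Sum.inr q)) i.succ j.succ =
          ∑ l : Fin n, strC (some (Sum.inr q)) i.succ l.succ *
            (h22 t ‖x‖ * (if l = j then 1 else 0)) := by simp [mul_comm]
        rw [this, ← Finset.sum_add_distrib]
        refine Finset.sum_congr rfl fun l _ => ?_
        ring
      rw [h4, h5, h2, h3, strC_rot_antisymm q j.succ i.succ]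
      ring

/-- What the exterior analysis uses about the metric on `|x| > ρ`: the inverse metric tends to the
Minkowski one, with difference in `𝒜₀`, and the first order coefficients of `□_g` as well as the
Lie derivatives of `g` along the fields `Z` are in `𝒜₁`. The ball of radius `ρ` contains `K`. -/
structure FarMetric (K : Set (Space n)) (ρ : ℝ) (g : MatrixField n) : Prop where
  one_le : 1 ≤ ρ
  closed : IsClosed K
  bound : ∀ x ∈ K, ‖x‖ ≤ ρ
  lorentz : IsLorentzianMetric K g
  inv : ∀ α β, Sc K ρ (minkowski n α β) (fun p => (g p)⁻¹ α β)
  lower : ∀ β, Sym K ρ 1 (boxLower K g β)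
  lie : ∀ i α β, Sym K ρ 1 (fun p => lieDer K i g p α β)

lemma sym_lieDer_cz (hK : IsClosed K) {ρ : ℝ} {g : MatrixField n}
    (hm : ∀ α β, Sc K ρ (minkowski n α β) (fun p => g p α β)) (γ α β : Fin (n + 1)) :
    Sym K ρ 1 (fun p => lieDer K (cz γ) g p α β) :=
  ((hm α β).dd hK γ).congr_region fun p _ => by
    simp only [lieDer_apply, strC_cz, zz_cz]
    simp

lemma sym_lieDer (hK : IsClosed K) {ρ : ℝ} (hρ : 1 ≤ ρ) {h : MatrixField n}
    (hh : ∀ α β, Sym K ρ 1 (fun p => h p α β)) (i : ZIndex n) (α β : Fin (n + 1)) :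
    Sym K ρ 1 (fun p => lieDer K i h p α β) :=
  ((((hh α β).zz hK hρ i).add hK (Sym.sum hK Finset.univ fun μ _ =>
      (hh α μ).const_mul hK (strC i β μ))).add hK (Sym.sum hK Finset.univ fun μ _ =>
      (hh μ β).const_mul hK (strC i α μ))).congr_region fun p _ => by
    rw [lieDer_apply]
    simp only [mul_comm]

lemma lieDer_add (hK : IsClosed K) {h h' : MatrixField n} (hs : IsSmoothField K h)
    (hs' : IsSmoothField K h') (i : ZIndex n) {p : SpaceTime n} (hp : p ∈ region K)
    (α β : Fin (n + 1)) :
    lieDer K i (fun q => h q + h' q) p α β = lieDer K i h p α β + lieDer K i h' p α β := by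
  have := along_add hK (X := zField i) (Smooth.diff (hs α β)) (Smooth.diff (hs' α β)) hp
  simp only [lieDer_apply, Matrix.add_apply, zz, this, add_mul, mul_add, Finset.sum_add_distrib]
  ring

lemma lieDer_rot_minkowski (q : RotIndex n) (p : SpaceTime n) (α β : Fin (n + 1)) :
    lieDer K (some (Sum.inr q)) (fun _ => minkowski n) p α β = 0 := by
  rw [lieDer_apply, zz, along_const]
  simp only [minkowski, Matrix.diagonal_apply, ite_mul, zero_mul, mul_ite, mul_zero,
    Finset.sum_ite_eq, Finset.sum_ite_eq', Finset.mem_univ, if_true]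
  refine Fin.cases ?_ (fun i => ?_) α <;> refine Fin.cases ?_ (fun j => ?_) β <;>
    simp only [strC_zero, strC_right_zero, Fin.cons_succ, Fin.cons_zero]
  · ring
  · ring
  · ring
  · rw [strC_rot_antisymm]
    ring

/-- Far from the obstacle every asymptotically flat metric is as `FarMetric` demands. -/
lemma exists_farMetric {φ : ℕ → Space n → ℝ} (hφ : IsDyadicPartition φ) (hK : IsClosed K)
    {g : MatrixField n} (hg : IsLorentzianMetric K g) (H1 : IsAsymptoticallyFlat φ K g) {R : ℝ}
    (hR : ∀ x ∈ K, ‖x‖ ≤ R) : ∃ ρ ≥ R, FarMetric K ρ g := by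
  obtain ⟨ρ, hρR, hρ, hdet, hinv⟩ := exists_sc_inverse hφ hK hg H1 R
  have hm := sc_metric hφ hK H1 hρ
  have hKρ : ∀ x ∈ K, ‖x‖ ≤ ρ := fun x hx => (hR x hx).trans hρR
  refine ⟨ρ, hρR, hρ, hK, hKρ, hg, hinv, fun β => sym_boxLower hK hg hdet hm hinv β, ?_⟩
  rintro (_ | (i | q)) α β
  · exact sym_lieDer_cz hK hm 0 α β
  · exact sym_lieDer_cz hK hm i.succ α β
  · obtain ⟨g₁, g₂, hsum, hs1, hs2, hrad, hd1, hd2⟩ := H1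
    have h2 := sym_of_decay hφ ρ 1 hs2 (by simpa using hd2)
    have hms : IsSmoothField K (fun _ => minkowski n) := fun _ _ => contDiffOn_const
    have hm1 : IsSmoothField K (fun q => minkowski n + g₁ q) := fun α β =>
      (hms α β).add (hs1 α β)
    have e : ∀ p ∈ region K, lieDer K (some (Sum.inr q)) g p α β =
        lieDer K (some (Sum.inr q)) (fun q => minkowski n) p α β +
          lieDer K (some (Sum.inr q)) g₁ p α β + lieDer K (some (Sum.inr q)) g₂ p α β := by
      intro p hp
      rw [← lieDer_add hK hms hs1 _ hp, ← lieDer_add hK hm1 hs2 _ hp]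
      simp only [lieDer_apply]
      rw [hsum p hp]
      congr 2
      exact along_congr (fun q hq => by rw [hsum q hq]) hp
    refine (sym_lieDer hK hρ h2 (some (Sum.inr q)) α β).congr ?_ fun p hp hr => ?_
    · have hsm : ∀ {h : MatrixField n}, IsSmoothField K h →
          Smooth K (fun p => lieDer K (some (Sum.inr q)) h p α β) := fun hs => by
        simp only [lieDer_apply]
        exact ((Smooth.zz hK (hs α β) _).add (ContDiffOn.sum fun μ _ => (hs α μ).mul
          contDiffOn_const)).add (ContDiffOn.sum fun μ _ => contDiffOn_const.mul (hs μ β))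
      exact hsm hg.smooth
    · rw [e p hp, lieDer_rot_minkowski, lieDer_rot_radial (by linarith) hKρ hs1 hrad q hp hr]
      ring

lemma FarMetric.isUnit_det {ρ : ℝ} {g : MatrixField n} (hg : FarMetric K ρ g) {p : SpaceTime n}
    (hp : p ∈ region K) : IsUnit (g p).det := (det_ne_zero hg.lorentz hp).isUnit

lemma FarMetric.sym_conj {ρ : ℝ} {g : MatrixField n} (hg : FarMetric K ρ g) (i : ZIndex n)
    (α β : Fin (n + 1)) :
    Sym K ρ 1 (fun p => ((g p)⁻¹ * lieDer K i g p * (g p)⁻¹) α β) := by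
  have hK := hg.closed
  refine (Sym.sum hK Finset.univ fun ν _ => (hg.inv ν β).mul_sym hK (Sym.sum hK Finset.univ
    fun μ _ => (hg.inv α μ).mul_sym hK (hg.lie i μ ν))).congr_region fun p _ => ?_
  simp only [Matrix.mul_apply]
  refine Finset.sum_congr rfl fun ν _ => ?_
  ring

/-- The second order coefficients of `[□, Z_i]` are `g⁻¹ (L_{Z_i} g) g⁻¹`. -/
lemma FarMetric.conj_eq {ρ : ℝ} {g : MatrixField n} (hg : FarMetric K ρ g) (i : ZIndex n)
    {p : SpaceTime n} (hp : p ∈ region K) (α β : Fin (n + 1)) :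
    ((g p)⁻¹ * lieDer K i g p * (g p)⁻¹) α β =
      ∑ μ, strC i μ α * (g p)⁻¹ μ β + ∑ μ, (g p)⁻¹ α μ * strC i μ β -
        zz K i (fun q => (g q)⁻¹ α β) p := by
  have hK := hg.closed
  have hu := hg.isUnit_det hp
  set h := (g p)⁻¹ with hh
  set C := strM i with hC
  set Zg : Matrix (Fin (n + 1)) (Fin (n + 1)) ℝ :=
    Matrix.of (fun α β => zz K i (fun q => g q α β) p) with hZg
  set Zh : Matrix (Fin (n + 1)) (Fin (n + 1)) ℝ :=
    Matrix.of (fun α β => zz K i (fun q => (g q)⁻¹ α β) p) with hZh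
  have hgh : g p * h = 1 := Matrix.mul_nonsing_inv _ hu
  have hhg : h * g p = 1 := Matrix.nonsing_inv_mul _ hu
  have hder : Zh * g p + h * Zg = 0 := by
    ext α β
    have h1 : along (region K) (zField i) (fun q => ∑ μ, (g q)⁻¹ α μ * g q μ β) p = 0 := by
      rw [along_congr (g := fun _ => (1 : Matrix _ _ ℝ) α β) (fun q hq => ?_) hp, along_const]
      simp only [← Matrix.mul_apply]
      rw [Matrix.nonsing_inv_mul _ (hg.isUnit_det hq)]
    rw [along_sum (f := fun μ q => (g q)⁻¹ α μ * g q μ β) hK _ (fun μ _ =>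
      Smooth.diff ((smooth_inverse hg.lorentz α μ).mul (hg.lorentz.smooth μ β))) hp] at h1
    rw [Finset.sum_congr rfl fun μ _ => along_mul hK (smooth_inverse hg.lorentz α μ).diff
      (Smooth.diff (hg.lorentz.smooth μ β)) hp, Finset.sum_add_distrib] at h1
    simpa [Matrix.mul_apply, hZh, hZg, hh] using h1
  have hZh' : Zh = - (h * Zg * h) := by
    have : (Zh * g p + h * Zg) * h = 0 := by rw [hder, zero_mul]
    rw [add_mul, Matrix.mul_assoc Zh, hgh, Matrix.mul_one] at this
    exact eq_neg_of_add_eq_zero_left this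
  have key : h * lieDer K i g p * h = C.transpose * h + h * C - Zh := by
    have : lieDer K i g p = Zg + g p * C.transpose + C * g p := rfl
    rw [this, hZh']
    simp only [Matrix.mul_add, Matrix.add_mul, sub_neg_eq_add, ← Matrix.mul_assoc, hhg,
      Matrix.one_mul]
    rw [Matrix.mul_assoc (h * C), hgh, Matrix.mul_one]
    abel
  have := congrFun (congrFun key α) β
  rw [this]
  simp [Matrix.mul_apply, hC, strM, hZh]

/-- The commutator of `□_g` with a field `Z_i` has coefficients in `𝒜₁`. -/
lemma FarMetric.exists_commutator {ρ : ℝ} {g : MatrixField n} (hg : FarMetric K ρ g)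
    (i : ZIndex n) : ∃ (k : Fin (n + 1) → Fin (n + 1) → SpaceTime n → ℝ)
      (l : Fin (n + 1) → SpaceTime n → ℝ), (∀ α β, Sym K ρ 1 (k α β)) ∧
      (∀ β, Sym K ρ 1 (l β)) ∧ ∀ u, CD K 3 u → ∀ p ∈ region K,
        box K g (zz K i u) p = zz K i (box K g u) p +
          ∑ α, ∑ β, k α β p * dd K α (dd K β u) p + ∑ β, l β p * dd K β u p := by
  have hK := hg.closed
  refine ⟨fun α β p => ((g p)⁻¹ * lieDer K i g p * (g p)⁻¹) α β,
    fun β p => ∑ μ, strC i μ β * boxLower K g μ p - zz K i (boxLower K g β) p,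
    hg.sym_conj i, fun β => (Sym.sum hK Finset.univ fun μ _ =>
      (hg.lower μ).const_mul hK _).sub hK ((hg.lower β).zz hK hg.one_le i), fun u hu p hp => ?_⟩
  have hu2 : CD K 2 u := hu.of_le (by norm_num)
  have hd1 : ∀ β, CD K 2 (dd K β u) := fun β => CD.dd hK hu β
  have hd1' : ∀ β, DifferentiableOn ℝ (dd K β u) (region K) := fun β =>
    CD.differentiableOn (m := 1) (hd1 β)
  have hd2' : ∀ α β, DifferentiableOn ℝ (dd K α (dd K β u)) (region K) := fun α β =>
    CD.differentiableOn (m := 0) (CD.dd hK (hd1 β) α)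
  have hdz : ∀ β, DifferentiableOn ℝ (zz K i (dd K β u)) (region K) := fun β =>
    CD.differentiableOn (m := 0) (CD.zz hK (hd1 β) i)
  have hlow : ∀ β, DifferentiableOn ℝ (boxLower K g β) (region K) := fun β =>
    (hg.lower β).smooth.diff
  have hinv : ∀ α β, DifferentiableOn ℝ (fun q => (g q)⁻¹ α β) (region K) := fun α β =>
    (smooth_inverse hg.lorentz α β).diff
  have e1 : ∀ β, Set.EqOn (dd K β (zz K i u))
      (fun q => zz K i (dd K β u) q + ∑ γ, strC i β γ * dd K γ u q) (region K) := fun β q hq =>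
    dd_zz hK hu2 β i hq
  have e2 : ∀ α β, dd K α (dd K β (zz K i u)) p = zz K i (dd K α (dd K β u)) p +
      ∑ γ, strC i α γ * dd K γ (dd K β u) p + ∑ γ, strC i β γ * dd K α (dd K γ u) p := by
    intro α β
    rw [dd, along_congr (e1 β) hp, along_add hK (hdz β)
      (DifferentiableOn.fun_sum fun γ _ => (hd1' γ).const_mul _) hp,
      along_sum (f := fun γ q => strC i β γ * dd K γ u q) hK _
        (fun γ _ => (hd1' γ).const_mul _) hp]
    congr 1
    · exact dd_zz hK (hd1 β) α i hp
    · exact Finset.sum_congr rfl fun γ _ => along_const_mul hK _ (hd1' γ) hp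
  have e3 : zz K i (box K g u) p =
      ∑ α, ∑ β, (zz K i (fun q => (g q)⁻¹ α β) p * dd K α (dd K β u) p +
        (g p)⁻¹ α β * zz K i (dd K α (dd K β u)) p) +
      ∑ β, (zz K i (boxLower K g β) p * dd K β u p +
        boxLower K g β p * zz K i (dd K β u) p) := by
    have hA : ∀ α β, DifferentiableOn ℝ (fun q => (g q)⁻¹ α β * dd K α (dd K β u) q)
      (region K) := fun α β => (hinv α β).mul (hd2' α β)
    have hB : ∀ β, DifferentiableOn ℝ (fun q => boxLower K g β q * dd K β u q) (region K) :=
      fun β => (hlow β).mul (hd1' β)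
    rw [zz, along_congr (fun q hq => box_eq hK hg.lorentz hu2 hq) hp,
      along_add hK (DifferentiableOn.fun_sum fun α _ => DifferentiableOn.fun_sum fun β _ => hA α β)
        (DifferentiableOn.fun_sum fun β _ => hB β) hp,
      along_sum (f := fun α q => ∑ β, (g q)⁻¹ α β * dd K α (dd K β u) q) hK _
        (fun α _ => DifferentiableOn.fun_sum fun β _ => hA α β) hp,
      along_sum (f := fun β q => boxLower K g β q * dd K β u q) hK _ (fun β _ => hB β) hp]
    congr 1
    · refine Finset.sum_congr rfl fun α _ => ?_
      rw [along_sum (f := fun β q => (g q)⁻¹ α β * dd K α (dd K β u) q) hK _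
        (fun β _ => hA α β) hp]
      exact Finset.sum_congr rfl fun β _ => along_mul hK (hinv α β) (hd2' α β) hp
    · exact Finset.sum_congr rfl fun β _ => along_mul hK (hlow β) (hd1' β) hp
  rw [box_eq hK hg.lorentz (CD.zz hK hu i) hp, e3]
  simp only [e2, e1 _ hp, hg.conj_eq i hp]
  simp only [mul_add, add_mul, sub_mul, Finset.sum_add_distrib, Finset.sum_sub_distrib]
  have s1 : ∑ α, ∑ β, (g p)⁻¹ α β * ∑ γ, strC i α γ * dd K γ (dd K β u) p =
      ∑ α, ∑ β, (∑ μ, strC i μ α * (g p)⁻¹ μ β) * dd K α (dd K β u) p := by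
    simp only [Finset.mul_sum, Finset.sum_mul]
    rw [Finset.sum_comm, Finset.sum_congr rfl fun β _ => Finset.sum_comm, Finset.sum_comm]
    refine Finset.sum_congr rfl fun α _ => Finset.sum_congr rfl fun β _ =>
      Finset.sum_congr rfl fun μ _ => ?_
    ring
  have s2 : ∑ α, ∑ β, (g p)⁻¹ α β * ∑ γ, strC i β γ * dd K α (dd K γ u) p =
      ∑ α, ∑ β, (∑ μ, (g p)⁻¹ α μ * strC i μ β) * dd K α (dd K β u) p := by
    simp only [Finset.mul_sum, Finset.sum_mul]
    refine Finset.sum_congr rfl fun α _ => ?_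
    rw [Finset.sum_comm]
    refine Finset.sum_congr rfl fun β _ => Finset.sum_congr rfl fun μ _ => ?_
    ring
  have s3 : ∑ β, boxLower K g β p * ∑ γ, strC i β γ * dd K γ u p =
      ∑ β, (∑ μ, strC i μ β * boxLower K g μ p) * dd K β u p := by
    simp only [Finset.mul_sum, Finset.sum_mul]
    rw [Finset.sum_comm]
    refine Finset.sum_congr rfl fun β _ => Finset.sum_congr rfl fun μ _ => ?_
    ring
  rw [s1, s2, s3]
  ring

/-! ### Words and the operators they generate -/

/-- The finite set of all words of length at most `k`. -/
def wordsLe (ι : Type*) [Fintype ι] (k : ℕ) : Finset (List ι) := by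
  classical
  exact (Finset.range (k + 1)).biUnion fun m =>
    Finset.univ.image (List.ofFn : (Fin m → ι) → List ι)

lemma mem_wordsLe {ι : Type*} [Fintype ι] {k : ℕ} {a : List ι} :
    a ∈ wordsLe ι k ↔ a.length ≤ k := by
  classical
  simp only [wordsLe, Finset.mem_biUnion, Finset.mem_range, Finset.mem_image, Finset.mem_univ,
    true_and]
  constructor
  · rintro ⟨m, hm, b, rfl⟩
    simp only [List.length_ofFn]
    omega
  · intro h
    exact ⟨a.length, by omega, a.get, List.ofFn_get a⟩

lemma sumUpTo_eq {ι : Type*} [Fintype ι] (k : ℕ) (N : List ι → ℝ≥0∞) :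
    sumUpTo k N = ∑ a ∈ wordsLe ι k, N a := by
  classical
  rw [wordsLe, Finset.sum_biUnion]
  · refine Finset.sum_congr rfl fun m _ => ?_
    rw [Finset.sum_image fun a _ b _ h => List.ofFn_injective h]
  · intro m _ m' _ hne
    refine Finset.disjoint_left.2 fun a ha ha' => hne ?_
    obtain ⟨b, -, rfl⟩ := Finset.mem_image.1 ha
    obtain ⟨b', -, h⟩ := Finset.mem_image.1 ha'
    have := congrArg List.length h
    simpa using this.symm

/-- Whether `Z_i` is a rotation field. -/
def isRot : ZIndex n → Bool
  | some (Sum.inr _) => true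
  | _ => false

/-- The number of rotation fields in a word. -/
def rot (a : List (ZIndex n)) : ℕ := a.countP isRot

@[simp] lemma rot_nil : rot ([] : List (ZIndex n)) = 0 := rfl

lemma rot_cons (i : ZIndex n) (a : List (ZIndex n)) :
    rot (i :: a) = rot a + if isRot i then 1 else 0 := List.countP_cons

lemma isRot_cz (α : Fin (n + 1)) : isRot (cz (n := n) α) = false := by
  refine Fin.cases ?_ (fun i => ?_) α <;> rfl

@[simp] lemma rot_cz_cons (α : Fin (n + 1)) (a : List (ZIndex n)) : rot (cz α :: a) = rot a := by
  simp [rot_cons, isRot_cz]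

lemma exists_cz_of_not_isRot {i : ZIndex n} (h : isRot i = false) : ∃ α, i = cz α := by
  rcases i with _ | (i | q)
  · exact ⟨0, rfl⟩
  · exact ⟨i.succ, rfl⟩
  · simp [isRot] at h

lemma rot_le_length (a : List (ZIndex n)) : rot a ≤ a.length := List.countP_le_length

lemma exists_map_cz {a : List (ZIndex n)} (h : rot a = 0) :
    ∃ c : List (Fin (n + 1)), a = c.map cz := by
  induction a with
  | nil => exact ⟨[], rfl⟩
  | cons i a ih =>
    rw [rot_cons] at h
    obtain ⟨c, rfl⟩ := ih (by omega)
    obtain ⟨α, rfl⟩ := exists_cz_of_not_isRot (i := i) (by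
      by_contra h'
      simp at h'
      simp [h'] at h)
    exact ⟨α :: c, rfl⟩

lemma zw_map_cz (c : List (Fin (n + 1))) (u : SpaceTime n → ℝ) :
    zw K (c.map cz) u = iterAlong (region K) coordField c u := by
  induction c with
  | nil => rfl
  | cons α c ih =>
    change along (region K) (zField (cz α)) (zw K (c.map cz) u) = _
    rw [ih, zField_cz]
    rfl

/-- Finite sums of operators `u ↦ c ∂_α Z^b u` with coefficients in the class `Cf` and
`(α, b)` in the class `Wd`. -/
inductive LinOp (K : Set (Space n)) (Cf : (SpaceTime n → ℝ) → Prop)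
    (Wd : Fin (n + 1) → List (ZIndex n) → Prop) :
    ((SpaceTime n → ℝ) → SpaceTime n → ℝ) → Prop
  | zero : LinOp K Cf Wd (fun _ _ => 0)
  | add {Φ Ψ} : LinOp K Cf Wd Φ → LinOp K Cf Wd Ψ → LinOp K Cf Wd (fun u p => Φ u p + Ψ u p)
  | term {c α b} : Cf c → Wd α b → LinOp K Cf Wd (fun u p => c p * dd K α (zw K b u) p)

namespace LinOp

variable {Cf Cf' : (SpaceTime n → ℝ) → Prop} {Wd Wd' : Fin (n + 1) → List (ZIndex n) → Prop}
  {Φ : (SpaceTime n → ℝ) → SpaceTime n → ℝ}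

lemma mono (h : LinOp K Cf Wd Φ) (hC : ∀ c, Cf c → Cf' c) (hW : ∀ α b, Wd α b → Wd' α b) :
    LinOp K Cf' Wd' Φ := by
  induction h with
  | zero => exact .zero
  | add _ _ h1 h2 => exact .add h1 h2
  | term hc hb => exact .term (hC _ hc) (hW _ _ hb)

lemma sum {ι : Type*} (t : Finset ι) {Φ : ι → (SpaceTime n → ℝ) → SpaceTime n → ℝ}
    (h : ∀ i ∈ t, LinOp K Cf Wd (Φ i)) : LinOp K Cf Wd (fun u p => ∑ i ∈ t, Φ i u p) := by
  classical
  induction t using Finset.induction_on with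
  | empty => simpa using LinOp.zero
  | insert i t hi ih =>
    simp only [Finset.sum_insert hi]
    exact (h i (Finset.mem_insert_self _ _)).add
      (ih fun j hj => h j (Finset.mem_insert_of_mem hj))

lemma mul_left (h : LinOp K Cf Wd Φ) (w : SpaceTime n → ℝ)
    (hC : ∀ c, Cf c → Cf' (fun p => w p * c p)) :
    LinOp K Cf' Wd (fun u p => w p * Φ u p) := by
  induction h with
  | zero => simpa using LinOp.zero
  | add _ _ h1 h2 => simpa only [mul_add] using h1.add h2
  | term hc hb => simpa only [mul_assoc] using LinOp.term (hC _ hc) hb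

lemma cd (hK : IsClosed K) (h : LinOp K Cf Wd Φ) (hC : ∀ c, Cf c → Smooth K c) {N : ℕ}
    (hW : ∀ α b, Wd α b → b.length ≤ N) {m : ℕ} {u : SpaceTime n → ℝ} (hu : CD K (m + 1 + N) u) :
    CD K m (Φ u) := by
  induction h with
  | zero => exact contDiffOn_const
  | add _ _ h1 h2 => exact ContDiffOn.add h1 h2
  | term hc hb =>
    exact ContDiffOn.mul ((hC _ hc).cd m)
      (CD.dd hK (CD.zw hK _ (hu.of_le (by have := hW _ _ hb; omega))) _)

/-- Applying a field `Z_i` to an operator of this kind gives another one. -/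
lemma zz (hK : IsClosed K) (h : LinOp K Cf Wd Φ) (i : ZIndex n) (hC : ∀ c, Cf c → Smooth K c)
    (hCz : ∀ c, Cf c → Cf' (zz K i c)) (hCm : ∀ c (r : ℝ), Cf c → Cf' (fun p => r * c p))
    {N : ℕ} (hW : ∀ α b, Wd α b → b.length ≤ N) (hW1 : ∀ α b, Wd α b → Wd' α b)
    (hW2 : ∀ α b, Wd α b → Wd' α (i :: b))
    (hW3 : ∀ α b γ, Wd α b → strC i α γ ≠ 0 → Wd' γ b) :
    ∃ Φ', LinOp K Cf' Wd' Φ' ∧ ∀ u, CD K (N + 2) u → ∀ p ∈ region K,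
      AFWave.zz K i (Φ u) p = Φ' u p := by
  induction h with
  | zero => exact ⟨_, .zero, fun u _ p _ => along_const 0 p⟩
  | @add Φ Ψ hΦ hΨ h1 h2 =>
    obtain ⟨Φ', hΦ', e1⟩ := h1
    obtain ⟨Ψ', hΨ', e2⟩ := h2
    refine ⟨_, hΦ'.add hΨ', fun u hu p hp => ?_⟩
    have hu' : CD K (0 + 1 + 1 + N) u := hu.of_le (by omega)
    have d1 := CD.differentiableOn (m := 0) (hΦ.cd hK hC hW hu')
    have d2 := CD.differentiableOn (m := 0) (hΨ.cd hK hC hW hu')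
    rw [← e1 u hu p hp, ← e2 u hu p hp]
    exact along_add hK d1 d2 hp
  | @term c α b hc hb =>
    have hex : ∀ γ, ∃ Ψ, LinOp K Cf' Wd' Ψ ∧ ∀ u p,
        (-(strC i α γ) * c p) * dd K γ (zw K b u) p = Ψ u p := by
      intro γ
      by_cases h0 : strC i α γ = 0
      · exact ⟨_, .zero, fun u p => by simp [h0]⟩
      · exact ⟨_, .term (hCm _ (-(strC i α γ)) hc) (hW3 _ _ γ hb h0), fun u p => rfl⟩
    choose Ψ hΨ eΨ using hex
    have h1 : LinOp K Cf' Wd' (fun u p => (1 * c p) * dd K α (zw K (i :: b) u) p) :=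
      .term (hCm _ 1 hc) (hW2 _ _ hb)
    refine ⟨_, ((LinOp.term (hCz _ hc) (hW1 _ _ hb)).add h1).add
      (LinOp.sum Finset.univ fun γ _ => hΨ γ), fun u hu p hp => ?_⟩
    have hv : CD K 2 (zw K b u) := CD.zw hK b (hu.of_le (by have := hW _ _ hb; omega))
    have e1 := dd_zz hK hv α i hp
    rw [AFWave.zz, along_mul hK (hC _ hc).diff (CD.differentiableOn (m := 0) (CD.dd hK hv α)) hp]
    simp only [← eΨ]
    have e2 : dd K α (zw K (i :: b) u) p = dd K α (AFWave.zz K i (zw K b u)) p := rfl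
    rw [e2, e1]
    have e3 : ∑ γ, -strC i α γ * c p * dd K γ (zw K b u) p =
        - c p * ∑ γ, strC i α γ * dd K γ (zw K b u) p := by
      rw [Finset.mul_sum]
      exact Finset.sum_congr rfl fun γ _ => by ring
    rw [e3]
    simp only [AFWave.zz]
    ring

/-- Pointwise bound of an operator whose coefficients are bounded on a set. -/
lemma bound (h : LinOp K Cf Wd Φ) {A : Set (SpaceTime n)}
    (hC : ∀ c, Cf c → ∃ C : ℝ, ∀ p ∈ A, |c p| ≤ C) (W : Finset (List (ZIndex n)))
    (hW : ∀ α b, Wd α b → b ∈ W) :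
    ∃ C : ℝ, 0 ≤ C ∧ ∀ u, ∀ p ∈ A, |Φ u p| ≤ C * ∑ b ∈ W, ∑ α, |dd K α (zw K b u) p| := by
  induction h with
  | zero => exact ⟨0, le_rfl, fun u p _ => by simp⟩
  | add _ _ h1 h2 =>
    obtain ⟨C, hC, h1⟩ := h1
    obtain ⟨C', hC', h2⟩ := h2
    refine ⟨C + C', by positivity, fun u p hp => ?_⟩
    rw [add_mul]
    exact (abs_add_le _ _).trans (add_le_add (h1 u p hp) (h2 u p hp))
  | @term c α b hc hb =>
    obtain ⟨C, h⟩ := hC _ hc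
    refine ⟨max C 0, le_max_right _ _, fun u p hp => ?_⟩
    rw [abs_mul]
    refine mul_le_mul ((h p hp).trans (le_max_left _ _)) ?_ (abs_nonneg _) (le_max_right _ _)
    refine le_trans ?_ (Finset.single_le_sum (f := fun b => ∑ α, |dd K α (zw K b u) p|)
      (fun b _ => Finset.sum_nonneg fun α _ => abs_nonneg _) (hW α b hb))
    exact Finset.single_le_sum (f := fun α => |dd K α (zw K b u) p|)
      (fun α _ => abs_nonneg _) (Finset.mem_univ α)

/-- Pointwise bound of an operator with coefficients in `𝒜₁`. -/
lemma bound_sym {ρ : ℝ} (h : LinOp K (Sym K ρ 1) Wd Φ) (W : Finset (List (ZIndex n)))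
    (hW : ∀ α b, Wd α b → b ∈ W) :
    ∃ κ : ℕ → ℝ, Summable κ ∧ (∀ j, 0 ≤ κ j) ∧ ∀ u, ∀ p ∈ region K, ρ < ‖p.2‖ →
      ‖p.2‖ * |Φ u p| ≤ κ (dyIdx p.2) * ∑ b ∈ W, ∑ α, |dd K α (zw K b u) p| := by
  induction h with
  | zero => exact ⟨0, summable_zero, fun _ => le_rfl, fun u p _ _ => by simp⟩
  | add _ _ h1 h2 =>
    obtain ⟨κ, hs, h0, h1⟩ := h1
    obtain ⟨κ', hs', h0', h2⟩ := h2
    refine ⟨fun j => κ j + κ' j, hs.add hs', fun j => add_nonneg (h0 j) (h0' j),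
      fun u p hp hr => ?_⟩
    rw [add_mul]
    refine le_trans ?_ (add_le_add (h1 u p hp hr) (h2 u p hp hr))
    rw [← mul_add]
    exact mul_le_mul_of_nonneg_left (abs_add_le _ _) (norm_nonneg _)
  | @term c α b hc hb =>
    obtain ⟨κ, hs, h0, h⟩ := hc.decW
    refine ⟨κ, hs, h0, fun u p hp hr => ?_⟩
    have h1 := h p hp hr
    rw [pow_one] at h1
    rw [abs_mul, ← mul_assoc]
    refine mul_le_mul h1 ?_ (abs_nonneg _) (h0 _)
    refine le_trans ?_ (Finset.single_le_sum (f := fun b => ∑ α, |dd K α (zw K b u) p|)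
      (fun b _ => Finset.sum_nonneg fun α _ => abs_nonneg _) (hW α b hb))
    exact Finset.single_le_sum (f := fun α => |dd K α (zw K b u) p|)
      (fun α _ => abs_nonneg _) (Finset.mem_univ α)

end LinOp

lemma CD.box (hK : IsClosed K) {g : MatrixField n} (hg : IsLorentzianMetric K g) {m : ℕ}
    (hl : ∀ β, Smooth K (boxLower K g β)) {u : SpaceTime n → ℝ} (hu : CD K (m + 2) u) :
    CD K m (box K g u) := by
  refine ContDiffOn.congr ?_ fun p hp => box_eq hK hg (hu.of_le (by omega)) hp
  exact (ContDiffOn.sum fun α _ => ContDiffOn.sum fun β _ => ((smooth_inverse hg α β).cd m).mul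
    (CD.dd hK (CD.dd hK hu β) α)).add
    (ContDiffOn.sum fun β _ => ((hl β).cd m).mul (CD.dd hK (hu.of_le (by omega)) β))

/-- `□ Z^a u = Z^a □ u + Φ u`, where `Φ` has coefficients in `𝒜₁` and involves first derivatives
of `Z^b u` only for `b` that are no longer than `a` and have no more rotations. -/
lemma FarMetric.exists_box_zw {ρ : ℝ} {g : MatrixField n} (hg : FarMetric K ρ g)
    (a : List (ZIndex n)) : ∃ Φ, LinOp K (Sym K ρ 1)
        (fun _ b => b.length ≤ a.length ∧ rot b ≤ rot a) Φ ∧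
      ∀ u, CD K (a.length + 2) u → ∀ p ∈ region K,
        box K g (zw K a u) p = zw K a (box K g u) p + Φ u p := by
  have hK := hg.closed
  induction a with
  | nil => exact ⟨_, .zero, fun u _ p _ => (add_zero _).symm⟩
  | cons i a ih =>
    obtain ⟨Φ, hΦ, e⟩ := ih
    obtain ⟨k, l, hk, hl, hc⟩ := hg.exists_commutator i
    have hri : rot a ≤ rot (i :: a) := by rw [rot_cons]; omega
    obtain ⟨Φ', hΦ', e'⟩ := hΦ.zz (Cf' := Sym K ρ 1)
      (Wd' := fun _ b => b.length ≤ (i :: a).length ∧ rot b ≤ rot (i :: a)) hK i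
      (fun c hc => hc.smooth) (fun c hc => hc.zz hK hg.one_le i)
      (fun c r hc => hc.const_mul hK r) (N := a.length) (fun α b hb => hb.1)
      (fun α b hb => ⟨by simp; omega, hb.2.trans hri⟩)
      (fun α b hb => ⟨by simpa using hb.1, by rw [rot_cons, rot_cons]; omega⟩)
      (fun α b γ hb _ => ⟨by simp; omega, hb.2.trans hri⟩)
    refine ⟨_, (hΦ'.add (LinOp.sum Finset.univ fun α _ => LinOp.sum Finset.univ fun β _ =>
      LinOp.term (α := α) (b := cz β :: a) (hk α β) ⟨by simp, by simpa using hri⟩)).add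
      (LinOp.sum Finset.univ fun β _ => LinOp.term (α := β) (b := a) (hl β)
        ⟨by simp, hri⟩), fun u hu p hp => ?_⟩
    simp only [List.length_cons] at hu
    have hv : CD K 3 (zw K a u) := CD.zw hK a (hu.of_le (by omega))
    have h1 := hc _ hv p hp
    have h2 : AFWave.zz K i (box K g (zw K a u)) p =
        AFWave.zz K i (zw K a (box K g u)) p + AFWave.zz K i (Φ u) p := by
      rw [AFWave.zz, along_congr (fun q hq => e u (hu.of_le (by omega)) q hq) hp]
      refine along_add hK (CD.differentiableOn (m := 0) (CD.zw hK a ?_))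
        (CD.differentiableOn (m := 0) (hΦ.cd hK (fun c hc => hc.smooth)
          (fun α b hb => hb.1) (hu.of_le (by omega)))) hp
      exact CD.box hK hg.lorentz (fun β => (hg.lower β).smooth) (hu.of_le (by omega))
    rw [h2, e' u (hu.of_le (by omega)) p hp] at h1
    have h3 : ∀ β, zw K (cz β :: a) u = dd K β (zw K a u) := fun β => zz_cz β _
    simp only [h3]
    change box K g (AFWave.zz K i (zw K a u)) p = AFWave.zz K i (zw K a (box K g u)) p + _
    rw [h1]
    ring

/-! ### Comparison of words -/

/-- Coefficients that are smooth functions of `x` alone. -/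
def SpaceCoef (K : Set (Space n)) (c : SpaceTime n → ℝ) : Prop :=
  ∃ f : Space n → ℝ, ContDiff ℝ ∞ f ∧ ∀ p ∈ region K, c p = f p.2

lemma SpaceCoef.smooth {c : SpaceTime n → ℝ} (h : SpaceCoef K c) : Smooth K c := by
  obtain ⟨f, hf, h⟩ := h
  exact (hf.comp contDiff_snd).contDiffOn.congr h

lemma SpaceCoef.mul {c c' : SpaceTime n → ℝ} (h : SpaceCoef K c) (h' : SpaceCoef K c') :
    SpaceCoef K (fun p => c p * c' p) := by
  obtain ⟨f, hf, h⟩ := h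
  obtain ⟨f', hf', h'⟩ := h'
  exact ⟨fun x => f x * f' x, hf.mul hf', fun p hp => by simp only [h p hp, h' p hp]⟩

lemma SpaceCoef.const (r : ℝ) : SpaceCoef K (fun _ => r) := ⟨fun _ => r, contDiff_const, by simp⟩

lemma SpaceCoef.zCoef (i : ZIndex n) (γ : Fin (n + 1)) : SpaceCoef K (zCoef i γ) := by
  obtain ⟨c₀, c, h⟩ := zCoef_affine i γ
  refine ⟨fun x => c₀ + ∑ l, c l * x l, ?_, fun p _ => h p⟩
  exact contDiff_const.add (ContDiff.sum fun l _ => contDiff_const.mul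
    (EuclideanSpace.proj (𝕜 := ℝ) l).contDiff)

/-- Derivative of a function of `x` alone. -/
lemma dd_comp_snd (hK : IsClosed K) {f : Space n → ℝ} {p : SpaceTime n} (hp : p ∈ region K)
    (hf : DifferentiableAt ℝ f p.2) (α : Fin (n + 1)) :
    dd K α (fun q => f q.2) p = fderiv ℝ f p.2 (coordField α (0 : SpaceTime n)).2 := by
  have h1 : HasFDerivWithinAt (fun q : SpaceTime n => f q.2)
      ((fderiv ℝ f p.2).comp (ContinuousLinearMap.snd ℝ ℝ (Space n))) (region K) p :=
    (hf.hasFDerivAt.comp p hasFDerivAt_snd).hasFDerivWithinAt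
  simp only [dd, along]
  rw [h1.fderivWithin (uniqueDiffOn_region hK p hp), coordField_eq α p 0]
  rfl

lemma SpaceCoef.dd (hK : IsClosed K) {c : SpaceTime n → ℝ} (h : SpaceCoef K c)
    (α : Fin (n + 1)) : SpaceCoef K (dd K α c) := by
  obtain ⟨f, hf, h⟩ := h
  refine ⟨fun x => fderiv ℝ f x (coordField α (0 : SpaceTime n)).2,
    (hf.fderiv_right (m := ∞) (by norm_cast)).clm_apply contDiff_const, fun p hp => ?_⟩
  rw [AFWave.dd, along_congr (f := c) (g := fun q => f q.2) h hp]
  exact dd_comp_snd hK hp (hf.differentiable (by simp) _) α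

/-- On bounded sets the fields `Z` are controlled by the coordinate derivatives. -/
lemma exists_linOp_near (hK : IsClosed K) (b : List (ZIndex n)) (α : Fin (n + 1)) :
    ∃ Φ, LinOp K (SpaceCoef K) (fun _ c => c.length ≤ b.length ∧ rot c = 0) Φ ∧
      ∀ u, CD K (b.length + 1) u → ∀ p ∈ region K, dd K α (zw K b u) p = Φ u p := by
  induction b generalizing α with
  | nil => exact ⟨_, .term (SpaceCoef.const 1) ⟨le_rfl, rfl⟩, fun u _ p _ => (one_mul _).symm⟩
  | cons i b ih =>
    have h1 : ∀ δ, ∃ Φ, LinOp K (SpaceCoef K) (fun _ c => c.length ≤ (i :: b).length ∧ rot c = 0)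
        Φ ∧ ∀ u, CD K (b.length + 2) u → ∀ p ∈ region K,
          dd K δ (dd K α (zw K b u)) p = Φ u p := by
      intro δ
      obtain ⟨Φ, hΦ, e⟩ := ih α
      obtain ⟨Φ', hΦ', e'⟩ := hΦ.zz (Cf' := SpaceCoef K)
        (Wd' := fun _ c => c.length ≤ (i :: b).length ∧ rot c = 0) hK (cz δ)
        (fun c hc => hc.smooth) (fun c hc => by rw [zz_cz]; exact hc.dd hK δ)
        (fun c r hc => (SpaceCoef.const r).mul hc) (N := b.length) (fun α b hb => hb.1)
        (fun α b hb => ⟨by simp; omega, hb.2⟩)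
        (fun α b hb => ⟨by simpa using hb.1, by simpa using hb.2⟩)
        (fun α b γ hb h => absurd (strC_cz δ α γ) h)
      refine ⟨Φ', hΦ', fun u hu p hp => ?_⟩
      rw [← e' u hu p hp, zz_cz]
      exact along_congr (fun q hq => e u (hu.of_le (by omega)) q hq) hp
    choose Φ hΦ e using h1
    choose Ψ hΨ e' using ih
    refine ⟨_, (LinOp.sum Finset.univ fun δ _ => (hΦ δ).mul_left (Cf' := SpaceCoef K)
      (AFWave.zCoef i δ) fun c hc => (SpaceCoef.zCoef i δ).mul hc).add
      (LinOp.sum Finset.univ fun γ _ => ((hΨ γ).mul_left (Cf' := SpaceCoef K)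
        (fun _ => strC i α γ) fun c hc => (SpaceCoef.const _).mul hc).mono (fun _ h => h)
        fun _ c hc => ⟨by simp; omega, hc.2⟩), fun u hu p hp => ?_⟩
    simp only [List.length_cons] at hu
    have hv : CD K 2 (zw K b u) := CD.zw hK b (hu.of_le (by omega))
    have h2 := dd_zz hK hv α i hp
    rw [zz_eq_sum] at h2
    change dd K α (AFWave.zz K i (zw K b u)) p = _
    rw [h2]
    congr 1
    · exact Finset.sum_congr rfl fun δ _ => by rw [e δ u (hu.of_le (by omega)) p hp]
    · exact Finset.sum_congr rfl fun γ _ => by rw [e' γ u (hu.of_le (by omega)) p hp]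

/-- Coefficients that are affine functions of `x`. -/
def AffineCoef (K : Set (Space n)) (c : SpaceTime n → ℝ) : Prop :=
  ∃ (c₀ : ℝ) (d : Fin n → ℝ), ∀ p ∈ region K, c p = c₀ + ∑ l, d l * p.2 l

lemma AffineCoef.smooth {c : SpaceTime n → ℝ} (h : AffineCoef K c) : Smooth K c := by
  obtain ⟨c₀, d, h⟩ := h
  refine ContDiffOn.congr ?_ h
  exact contDiffOn_const.add (ContDiffOn.sum fun l _ => contDiffOn_const.mul (smooth_coord l))

lemma AffineCoef.const_mul {c : SpaceTime n → ℝ} (h : AffineCoef K c) (r : ℝ) :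
    AffineCoef K (fun p => r * c p) := by
  obtain ⟨c₀, d, h⟩ := h
  refine ⟨r * c₀, fun l => r * d l, fun p hp => ?_⟩
  simp only [h p hp, mul_add, Finset.mul_sum, mul_assoc]

lemma AffineCoef.dd (hK : IsClosed K) {c : SpaceTime n → ℝ} (h : AffineCoef K c)
    (α : Fin (n + 1)) : AffineCoef K (dd K α c) := by
  obtain ⟨c₀, d, h⟩ := h
  refine ⟨∑ l, d l * (coordField α (0 : SpaceTime n)).2 l, 0, fun p hp => ?_⟩
  have hd := fun l => (smooth_coord (K := K) l).diff
  rw [AFWave.dd, along_congr (f := c) h hp, along_add hK (differentiableOn_const _)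
    (DifferentiableOn.fun_sum fun l _ => (hd l).const_mul _) hp, along_const,
    along_sum (f := fun l q => d l * q.2 l) hK _ (fun l _ => (hd l).const_mul _) hp]
  simp only [Pi.zero_apply, zero_mul, Finset.sum_const_zero, add_zero, zero_add]
  refine Finset.sum_congr rfl fun l _ => ?_
  rw [along_const_mul hK _ (hd l) hp, ← coordField_eq α p 0]
  congr 1
  exact dd_coord_snd hK α l hp

/-- A word with a rotation can be traded for first derivatives of words with one rotation less, at
the price of one power of `|x|`. -/
lemma exists_linOp_pull (hK : IsClosed K) (a : List (ZIndex n)) (ha : 1 ≤ rot a) :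
    ∃ Φ, LinOp K (AffineCoef K) (fun _ b => b.length + 1 ≤ a.length ∧ rot b + 1 ≤ rot a) Φ ∧
      ∀ u, CD K a.length u → ∀ p ∈ region K, zw K a u p = Φ u p := by
  induction a with
  | nil => simp at ha
  | cons i a ih =>
    by_cases hi : isRot i = true
    · refine ⟨_, LinOp.sum Finset.univ fun γ _ => LinOp.term (α := γ) (b := a) (c := zCoef i γ) ?_
        ⟨by simp, by simp [rot_cons, hi]⟩, fun u _ p _ => zz_eq_sum i _ p⟩
      obtain ⟨c₀, c, h⟩ := zCoef_affine i γ
      exact ⟨c₀, c, fun p _ => h p⟩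
    · obtain ⟨μ, rfl⟩ := exists_cz_of_not_isRot (by simpa using hi)
      rw [rot_cz_cons] at ha
      obtain ⟨Φ, hΦ, e⟩ := ih ha
      have hpos : 1 ≤ a.length := ha.trans (rot_le_length a)
      obtain ⟨Φ', hΦ', e'⟩ := hΦ.zz (Cf' := AffineCoef K)
        (Wd' := fun _ b => b.length + 1 ≤ (cz μ :: a).length ∧ rot b + 1 ≤ rot (cz μ :: a)) hK (cz μ)
        (fun c hc => hc.smooth) (fun c hc => by rw [zz_cz]; exact hc.dd hK μ)
        (fun c r hc => hc.const_mul r) (N := a.length - 1) (fun α b hb => by omega)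
        (fun α b hb => ⟨by simp; omega, by simpa using hb.2⟩)
        (fun α b hb => ⟨by simpa using hb.1, by simpa using hb.2⟩)
        (fun α b γ hb h => absurd (strC_cz μ α γ) h)
      refine ⟨Φ', hΦ', fun u hu p hp => ?_⟩
      simp only [List.length_cons] at hu
      rw [← e' u (hu.of_le (by omega)) p hp]
      exact along_congr (fun q hq => e u (hu.of_le (by omega)) q hq) hp

/-! ### Integration over the region -/

/-- `f` vanishes on the region outside `x ∈ B`. -/
def SuppIn (K B : Set (Space n)) (f : SpaceTime n → ℝ) : Prop :=
  ∀ p ∈ region K, p.2 ∉ B → f p = 0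

variable {B : Set (Space n)} {f f' : SpaceTime n → ℝ}

lemma SuppIn.along (hB : IsClosed B) (hf : SuppIn K B f) (X : SpaceTime n → SpaceTime n) :
    SuppIn K B (along (region K) X f) := by
  intro p hp hpB
  have : f =ᶠ[nhdsWithin p (region K)] fun _ => 0 := by
    have ho : {q : SpaceTime n | q.2 ∈ Bᶜ} ∈ nhds p :=
      (hB.isOpen_compl.preimage continuous_snd).mem_nhds hpB
    filter_upwards [self_mem_nhdsWithin, mem_nhdsWithin_of_mem_nhds ho] with q hq hq'
      using hf q hq hq'
  rw [along_congr_of_eventuallyEq this hp, along_const]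

lemma SuppIn.mul_left (hf : SuppIn K B f) (c : SpaceTime n → ℝ) :
    SuppIn K B (fun p => c p * f p) := fun p hp h => by simp [hf p hp h]

lemma SuppIn.sum {ι : Type*} {t : Finset ι} {f : ι → SpaceTime n → ℝ}
    (hf : ∀ i ∈ t, SuppIn K B (f i)) : SuppIn K B (fun p => ∑ i ∈ t, f i p) :=
  fun p hp h => Finset.sum_eq_zero fun i hi => hf i hi p hp h

lemma measurableSet_region_slab (hK : IsClosed K) (T : ℝ) :
    MeasurableSet (Set.Icc 0 T ×ˢ Kᶜ : Set (SpaceTime n)) :=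
  measurableSet_Icc.prod hK.measurableSet.compl

lemma slab_subset (T : ℝ) : (Set.Icc 0 T ×ˢ Kᶜ : Set (SpaceTime n)) ⊆ region K :=
  Set.prod_mono Set.Icc_subset_Ici_self le_rfl

lemma continuousOn_slice (hf : ContinuousOn f (region K)) {t : ℝ} (ht : 0 ≤ t) :
    ContinuousOn (fun x => f (t, x)) Kᶜ :=
  ContinuousOn.comp (t := region K) hf (Continuous.continuousOn (by fun_prop))
    fun _ hx => ⟨ht, hx⟩

lemma continuousOn_timeLine (hf : ContinuousOn f (region K)) {x : Space n} (hx : x ∈ Kᶜ) (T : ℝ) :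
    ContinuousOn (fun t => f (t, x)) (Set.Icc 0 T) :=
  ContinuousOn.comp (t := region K) hf (Continuous.continuousOn (by fun_prop))
    fun _ ht => ⟨ht.1, hx⟩

lemma integrableOn_slab (hK : IsClosed K) (hB : IsCompact B) (hBK : B ⊆ Kᶜ)
    (hf : ContinuousOn f (region K)) (h0 : SuppIn K B f) (T : ℝ) :
    IntegrableOn f (Set.Icc 0 T ×ˢ Kᶜ) := by
  have h1 : IntegrableOn f (Set.Icc 0 T ×ˢ B) :=
    (hf.mono (Set.prod_mono Set.Icc_subset_Ici_self hBK)).integrableOn_compact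
      (isCompact_Icc.prod hB)
  refine h1.of_forall_sdiff_eq_zero (measurableSet_region_slab hK T) fun p hp => ?_
  exact h0 p (slab_subset T hp.1) fun h => hp.2 ⟨hp.1.1, h⟩

lemma integrableOn_slice (hK : IsClosed K) (hB : IsCompact B) (hBK : B ⊆ Kᶜ)
    (hf : ContinuousOn f (region K)) (h0 : SuppIn K B f) {t : ℝ} (ht : 0 ≤ t) :
    IntegrableOn (fun x => f (t, x)) Kᶜ := by
  have h1 : IntegrableOn (fun x => f (t, x)) B :=
    ((continuousOn_slice hf ht).mono hBK).integrableOn_compact hB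
  exact h1.of_forall_sdiff_eq_zero hK.measurableSet.compl fun x hx => h0 _ ⟨ht, hx.1⟩ hx.2

lemma hasDerivWithinAt_time {p : SpaceTime n} (hp : p ∈ region K)
    (hf : DifferentiableOn ℝ f (region K)) :
    HasDerivWithinAt (fun τ => f (τ, p.2)) (dd K 0 f p) (Set.Ici 0) p.1 := by
  have h1 : HasDerivWithinAt (fun τ : ℝ => (τ, p.2)) ((1 : ℝ), (0 : Space n)) (Set.Ici 0) p.1 :=
    (hasDerivWithinAt_id _ _).prodMk (hasDerivWithinAt_const _ _ _)
  have hm : Set.MapsTo (fun τ : ℝ => (τ, p.2)) (Set.Ici 0) (region K) := fun τ hτ => ⟨hτ, hp.2⟩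
  exact (hf p hp).hasFDerivWithinAt.comp_hasDerivWithinAt p.1 h1 hm

lemma hasFDerivAt_space (hK : IsClosed K) {p : SpaceTime n} (hp : p ∈ region K)
    (hf : DifferentiableOn ℝ f (region K)) :
    HasFDerivAt (fun y => f (p.1, y)) ((fderivWithin ℝ f (region K) p).comp
      (ContinuousLinearMap.inr ℝ ℝ (Space n))) p.2 := by
  have h1 : HasFDerivWithinAt (fun y : Space n => (p.1, y))
      (ContinuousLinearMap.inr ℝ ℝ (Space n)) Kᶜ p.2 :=
    (hasFDerivAt_prodMk_right p.1 p.2).hasFDerivWithinAt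
  have hm : Set.MapsTo (fun y : Space n => (p.1, y)) Kᶜ (region K) := fun y hy => ⟨hp.1, hy⟩
  exact ((hf p hp).hasFDerivWithinAt.comp p.2 h1 hm).hasFDerivAt
    (hK.isOpen_compl.mem_nhds hp.2)

lemma integral_dd_space (hK : IsClosed K) (hB : IsCompact B) (hBK : B ⊆ Kᶜ) (hf : CD K 1 f)
    (h0 : SuppIn K B f) {t : ℝ} (ht : 0 ≤ t) (i : Fin n) :
    ∫ x in Kᶜ, dd K i.succ f (t, x) = 0 := by
  classical
  have hfd : DifferentiableOn ℝ f (region K) := CD.differentiableOn (m := 0) hf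
  set j : Space n → ℝ := fun x => if x ∈ B then f (t, x) else 0 with hj
  have hjB : ∀ x ∉ B, j =ᶠ[nhds x] fun _ => 0 := fun x hx => by
    filter_upwards [hB.isClosed.isOpen_compl.mem_nhds hx] with y hy
    exact if_neg hy
  have hjK : ∀ x ∉ K, j =ᶠ[nhds x] fun y => f (t, y) := fun x hx => by
    filter_upwards [hK.isOpen_compl.mem_nhds hx] with y hy
    by_cases h : y ∈ B
    · simp [hj, h]
    · simp [hj, h, h0 (t, y) ⟨ht, hy⟩ h]
  have hdiff : Differentiable ℝ j := fun x => by
    by_cases hx : x ∈ B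
    · exact ((hasFDerivAt_space hK (p := (t, x)) ⟨ht, hBK hx⟩ hfd).congr_of_eventuallyEq
        (hjK x (hBK hx))).differentiableAt
    · exact (differentiableAt_const 0).congr_of_eventuallyEq (hjB x hx)
  have hD1 : ∀ x ∈ Kᶜ, fderiv ℝ j x (EuclideanSpace.single i 1) = dd K i.succ f (t, x) :=
    fun x hx => by
      rw [((hasFDerivAt_space hK (p := (t, x)) ⟨ht, hx⟩ hfd).congr_of_eventuallyEq
        (hjK x hx)).fderiv]
      rfl
  have hD0 : ∀ x ∉ B, fderiv ℝ j x (EuclideanSpace.single i 1) = 0 := fun x hx => by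
    rw [(hjB x hx).fderiv_eq]
    simp
  have hc : ContinuousOn (dd K i.succ f) (region K) :=
    ContDiffOn.continuousOn (CD.dd (m := 0) hK hf i.succ)
  have hiK : IntegrableOn (fun x => fderiv ℝ j x (EuclideanSpace.single i 1)) Kᶜ :=
    (integrableOn_slice hK hB hBK hc (h0.along hB.isClosed _) ht).congr_fun
      (fun x hx => (hD1 x hx).symm) hK.measurableSet.compl
  have hi : Integrable (fun x => fderiv ℝ j x (EuclideanSpace.single i 1)) :=
    integrableOn_univ.1 (hiK.of_forall_sdiff_eq_zero MeasurableSet.univ fun x hx =>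
      hD0 x fun h => hx.2 (hBK h))
  have hji : Integrable j := by
    have h1 : IntegrableOn j Kᶜ := (integrableOn_slice hK hB hBK
      (ContDiffOn.continuousOn hf) h0 ht).congr_fun
      (fun x hx => (hjK x hx).self_of_nhds.symm) hK.measurableSet.compl
    exact integrableOn_univ.1 (h1.of_forall_sdiff_eq_zero MeasurableSet.univ fun x hx =>
      (hjB x fun h => hx.2 (hBK h)).self_of_nhds)
  have key := integral_mul_fderiv_eq_neg_fderiv_mul_of_integrable (𝕜 := ℝ) (μ := volume)
    (f := fun _ : Space n => (1 : ℝ)) (g := j) (v := EuclideanSpace.single i 1) (by simp)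
    (by simpa using hi) (by simpa using hji) (fun x _ => differentiableAt_const _)
    (fun x _ => hdiff x)
  simp only [one_mul, fderiv_fun_const, Pi.zero_apply, zero_apply, zero_mul,
    integral_zero, neg_zero] at key
  rw [← setIntegral_congr_fun hK.measurableSet.compl hD1, ← key]
  exact setIntegral_eq_integral_of_forall_compl_eq_zero fun x hx =>
    hD0 x fun h => hx (hBK h)

lemma integral_dd_time (hK : IsClosed K) (hB : IsCompact B) (hBK : B ⊆ Kᶜ) (hf : CD K 1 f)
    (h0 : SuppIn K B f) {T : ℝ} (hT : 0 ≤ T) :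
    ∫ p in Set.Icc 0 T ×ˢ Kᶜ, dd K 0 f p = (∫ x in Kᶜ, f (T, x)) - ∫ x in Kᶜ, f (0, x) := by
  have hfc : ContinuousOn f (region K) := ContDiffOn.continuousOn hf
  have hfd : DifferentiableOn ℝ f (region K) := CD.differentiableOn (m := 0) hf
  have hc : ContinuousOn (dd K 0 f) (region K) := ContDiffOn.continuousOn (CD.dd (m := 0) hK hf 0)
  have hint := integrableOn_slab hK hB hBK hc (h0.along hB.isClosed _) T
  rw [← integral_sub (integrableOn_slice hK hB hBK hfc h0 hT)
    (integrableOn_slice hK hB hBK hfc h0 le_rfl)]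
  rw [IntegrableOn, Measure.volume_eq_prod, ← Measure.prod_restrict] at hint
  rw [Measure.volume_eq_prod, ← Measure.prod_restrict, integral_prod_symm _ hint]
  refine setIntegral_congr_fun (f := fun x => ∫ t in Set.Icc (0 : ℝ) T, dd K 0 f (t, x))
    (g := fun x => f (T, x) - f (0, x)) hK.measurableSet.compl fun x hx => ?_
  change ∫ t in Set.Icc (0 : ℝ) T, dd K 0 f (t, x) ∂volume = f (T, x) - f (0, x)
  rw [integral_Icc_eq_integral_Ioc, ← intervalIntegral.integral_of_le hT]
  refine intervalIntegral.integral_eq_sub_of_hasDerivAt_of_le (f := fun t => f (t, x))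
    (f' := fun t => dd K 0 f (t, x)) hT ?_ (fun t ht => ?_) ?_
  · exact continuousOn_timeLine hfc hx T
  · exact (hasDerivWithinAt_time (p := (t, x)) ⟨ht.1.le, hx⟩ hfd).hasDerivAt
      (Ici_mem_nhds ht.1)
  · refine ContinuousOn.intervalIntegrable ?_
    rw [Set.uIcc_of_le hT]
    exact continuousOn_timeLine hc hx T

/-- The divergence theorem on `[0, T] × (ℝⁿ \ K)` for spatially compactly supported currents. -/
lemma integral_divergence (hK : IsClosed K) (hB : IsCompact B) (hBK : B ⊆ Kᶜ)
    {J : Fin (n + 1) → SpaceTime n → ℝ} (hJ : ∀ α, CD K 1 (J α)) (h0 : ∀ α, SuppIn K B (J α))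
    {T : ℝ} (hT : 0 ≤ T) :
    ∫ p in Set.Icc 0 T ×ˢ Kᶜ, ∑ α, dd K α (J α) p =
      (∫ x in Kᶜ, J 0 (T, x)) - ∫ x in Kᶜ, J 0 (0, x) := by
  have hc : ∀ α, ContinuousOn (dd K α (J α)) (region K) := fun α =>
    ContDiffOn.continuousOn (CD.dd (m := 0) hK (hJ α) α)
  have hint := fun α => integrableOn_slab hK hB hBK (hc α) ((h0 α).along hB.isClosed _) T
  rw [integral_finsetSum _ fun α _ => hint α, Fin.sum_univ_succ,
    integral_dd_time hK hB hBK (hJ 0) (h0 0) hT]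
  have : ∀ i : Fin n, ∫ p in Set.Icc 0 T ×ˢ Kᶜ, dd K i.succ (J i.succ) p = 0 := fun i => by
    have h1 := hint i.succ
    rw [Measure.volume_eq_prod] at h1
    rw [Measure.volume_eq_prod, setIntegral_prod _ h1]
    refine setIntegral_eq_zero_of_forall_eq_zero fun t ht => ?_
    exact integral_dd_space hK hB hBK (hJ i.succ) (h0 i.succ) ht.1 i
  simp [this]

/-! ### The multiplier identity -/

/-- The current of the multiplier `X w + c q w` for the operator `h^{αβ} ∂_α ∂_β`. -/
def current (K : Set (Space n)) (h : Fin (n + 1) → Fin (n + 1) → SpaceTime n → ℝ)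
    (X : Fin (n + 1) → SpaceTime n → ℝ) (q : SpaceTime n → ℝ) (c : ℝ) (w : SpaceTime n → ℝ)
    (α : Fin (n + 1)) (p : SpaceTime n) : ℝ :=
  (∑ β, h α β p * dd K β w p) * (∑ γ, X γ p * dd K γ w p + c * (q p * w p)) -
    1 / 2 * (X α p * ∑ μ, ∑ ν, h μ ν p * (dd K μ w p * dd K ν w p)) -
    c / 2 * ((w p * w p) * dd K α q p)

lemma quad_symm {m : ℕ} (h s : Fin m → Fin m → ℝ) (d X : Fin m → ℝ)
    (hh : ∀ μ ν, h μ ν = h ν μ) (hs : ∀ μ ν, s μ ν = s ν μ) :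
    ∑ α, (∑ β, h α β * d β) * (∑ γ, X γ * s α γ) =
      1 / 2 * ∑ α, X α * ∑ μ, ∑ ν, h μ ν * (s α μ * d ν + d μ * s α ν) := by
  have h1 : ∀ α, ∑ μ, ∑ ν, h μ ν * (s α μ * d ν + d μ * s α ν) =
      2 * ∑ μ, ∑ ν, h μ ν * (s μ α * d ν) := by
    intro α
    have h2 : ∑ μ, ∑ ν, h μ ν * (d μ * s α ν) = ∑ μ, ∑ ν, h μ ν * (s μ α * d ν) := by
      rw [Finset.sum_comm]
      refine Finset.sum_congr rfl fun ν _ => Finset.sum_congr rfl fun μ _ => ?_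
      rw [hh μ ν, hs α ν]
      ring
    simp only [mul_add, Finset.sum_add_distrib, h2]
    simp only [hs α]
    ring
  simp only [h1, Finset.mul_sum, Finset.sum_mul]
  rw [Finset.sum_comm]
  conv_lhs =>
    enter [2, γ]
  rw [Finset.sum_comm]
  rw [Finset.sum_comm]
  refine Finset.sum_congr rfl fun γ _ => Finset.sum_congr rfl fun α _ =>
    Finset.sum_congr rfl fun β _ => ?_
  ring

/-- The divergence identity for the current: the terms after the principal one are the bulk. Two
derivatives of `w` occur only in the principal term, since those of `X w` cancel by the symmetry
of `h`. -/
lemma dd_current (hK : IsClosed K) {h : Fin (n + 1) → Fin (n + 1) → SpaceTime n → ℝ}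
    {X : Fin (n + 1) → SpaceTime n → ℝ} {q w : SpaceTime n → ℝ} (c : ℝ)
    (hh : ∀ α β, Smooth K (h α β)) (hX : ∀ α, Smooth K (X α)) (hq : Smooth K q) (hw : CD K 2 w)
    (hsymm : ∀ p ∈ region K, ∀ α β, h α β p = h β α p) {p : SpaceTime n} (hp : p ∈ region K) :
    ∑ α, dd K α (current K h X q c w α) p =
      (∑ α, ∑ β, h α β p * dd K α (dd K β w) p) *
        (∑ γ, X γ p * dd K γ w p + c * (q p * w p)) +
      (∑ α, ∑ β, dd K α (h α β) p * dd K β w p) *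
        (∑ γ, X γ p * dd K γ w p + c * (q p * w p)) +
      ∑ α, (∑ β, h α β p * dd K β w p) * (∑ γ, dd K α (X γ) p * dd K γ w p) -
      1 / 2 * ((∑ α, dd K α (X α) p) * ∑ μ, ∑ ν, h μ ν p * (dd K μ w p * dd K ν w p)) -
      1 / 2 * ∑ α, X α p * ∑ μ, ∑ ν, dd K α (h μ ν) p * (dd K μ w p * dd K ν w p) +
      c * (q p * ∑ μ, ∑ ν, h μ ν p * (dd K μ w p * dd K ν w p)) +
      c * (w p * (∑ α, (∑ β, h α β p * dd K β w p) * dd K α q p - ∑ α, dd K α w p * dd K α q p)) -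
      c / 2 * ((w p * w p) * ∑ α, dd K α (dd K α q) p) := by
  have hd1 : ∀ β, DifferentiableOn ℝ (dd K β w) (region K) := fun β =>
    CD.differentiableOn (m := 0) (CD.dd hK hw β)
  have hwd : DifferentiableOn ℝ w (region K) := CD.differentiableOn (m := 1) hw
  have hhd := fun α β => (hh α β).diff
  have hXd := fun α => (hX α).diff
  have hqd := hq.diff
  have hqd' := fun α => (hq.dd hK α).diff
  have dA : ∀ α, DifferentiableOn ℝ (fun p => ∑ β, h α β p * dd K β w p) (region K) := fun α =>
    DifferentiableOn.fun_sum fun β _ => (hhd α β).fun_mul (hd1 β)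
  have dB1 : DifferentiableOn ℝ (fun p => ∑ γ, X γ p * dd K γ w p) (region K) :=
    DifferentiableOn.fun_sum fun γ _ => (hXd γ).fun_mul (hd1 γ)
  have dB : DifferentiableOn ℝ (fun p => ∑ γ, X γ p * dd K γ w p + c * (q p * w p)) (region K) :=
    dB1.fun_add ((hqd.fun_mul hwd).const_mul c)
  have dQ1 : ∀ μ ν, DifferentiableOn ℝ (fun p => h μ ν p * (dd K μ w p * dd K ν w p)) (region K) :=
    fun μ ν => (hhd μ ν).fun_mul ((hd1 μ).fun_mul (hd1 ν))
  have dQ : DifferentiableOn ℝ (fun p => ∑ μ, ∑ ν, h μ ν p * (dd K μ w p * dd K ν w p))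
      (region K) := DifferentiableOn.fun_sum fun μ _ => DifferentiableOn.fun_sum fun ν _ => dQ1 μ ν
  have eA : ∀ α, dd K α (fun p => ∑ β, h α β p * dd K β w p) p =
      ∑ β, dd K α (h α β) p * dd K β w p + ∑ β, h α β p * dd K α (dd K β w) p := by
    intro α
    rw [dd, along_sum (f := fun β p => h α β p * dd K β w p) hK _
      (fun β _ => (hhd α β).fun_mul (hd1 β)) hp, ← Finset.sum_add_distrib]
    exact Finset.sum_congr rfl fun β _ => along_mul hK (hhd α β) (hd1 β) hp
  have eB : ∀ α, dd K α (fun p => ∑ γ, X γ p * dd K γ w p + c * (q p * w p)) p =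
      ∑ γ, dd K α (X γ) p * dd K γ w p + ∑ γ, X γ p * dd K α (dd K γ w) p +
        c * (dd K α q p * w p + q p * dd K α w p) := by
    intro α
    rw [dd, along_add hK dB1 ((hqd.fun_mul hwd).const_mul c) hp,
      along_sum (f := fun γ p => X γ p * dd K γ w p) hK _
      (fun γ _ => (hXd γ).fun_mul (hd1 γ)) hp, along_const_mul (f := fun q' => q q' * w q') hK _ (hqd.fun_mul hwd) hp,
      along_mul hK hqd hwd hp, ← Finset.sum_add_distrib]
    congr 1
    exact Finset.sum_congr rfl fun γ _ => along_mul hK (hXd γ) (hd1 γ) hp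
  have eQ : ∀ α, dd K α (fun p => ∑ μ, ∑ ν, h μ ν p * (dd K μ w p * dd K ν w p)) p =
      ∑ μ, ∑ ν, dd K α (h μ ν) p * (dd K μ w p * dd K ν w p) +
      ∑ μ, ∑ ν, h μ ν p * (dd K α (dd K μ w) p * dd K ν w p +
        dd K μ w p * dd K α (dd K ν w) p) := by
    intro α
    rw [dd, along_sum (f := fun μ p => ∑ ν, h μ ν p * (dd K μ w p * dd K ν w p)) hK _
      (fun μ _ => DifferentiableOn.fun_sum fun ν _ => dQ1 μ ν) hp, ← Finset.sum_add_distrib]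
    refine Finset.sum_congr rfl fun μ _ => ?_
    rw [along_sum (f := fun ν p => h μ ν p * (dd K μ w p * dd K ν w p)) hK _
      (fun ν _ => dQ1 μ ν) hp, ← Finset.sum_add_distrib]
    refine Finset.sum_congr rfl fun ν _ => ?_
    rw [along_mul hK (hhd μ ν) ((hd1 μ).fun_mul (hd1 ν)) hp]
    congr 2
    exact along_mul hK (hd1 μ) (hd1 ν) hp
  have eW : ∀ α, dd K α (fun p => (w p * w p) * dd K α q p) p =
      (dd K α w p * w p + w p * dd K α w p) * dd K α q p +
        (w p * w p) * dd K α (dd K α q) p := by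
    intro α
    rw [dd, along_mul (f := fun p => w p * w p) hK (hwd.fun_mul hwd) (hqd' α) hp,
      along_mul hK hwd hwd hp]
  have eJ : ∀ α, dd K α (current K h X q c w α) p =
      (dd K α (fun p => ∑ β, h α β p * dd K β w p) p *
          (∑ γ, X γ p * dd K γ w p + c * (q p * w p)) +
        (∑ β, h α β p * dd K β w p) *
          dd K α (fun p => ∑ γ, X γ p * dd K γ w p + c * (q p * w p)) p) -
      1 / 2 * (dd K α (X α) p * (∑ μ, ∑ ν, h μ ν p * (dd K μ w p * dd K ν w p)) +
        X α p * dd K α (fun p => ∑ μ, ∑ ν, h μ ν p * (dd K μ w p * dd K ν w p)) p) -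
      c / 2 * dd K α (fun p => (w p * w p) * dd K α q p) p := by
    intro α
    have d1 := (dA α).fun_mul dB
    have d2 := (hXd α).fun_mul dQ
    have d3 : DifferentiableOn ℝ (fun p => (w p * w p) * dd K α q p) (region K) :=
      (hwd.fun_mul hwd).fun_mul (hqd' α)
    have d2c := d2.const_mul (-(1 / 2))
    have d3c := d3.const_mul (-(c / 2))
    have e0 : dd K α (current K h X q c w α) p = dd K α (fun p =>
        ((∑ β, h α β p * dd K β w p) * (∑ γ, X γ p * dd K γ w p + c * (q p * w p)) +
        (-(1 / 2)) * (X α p * ∑ μ, ∑ ν, h μ ν p * (dd K μ w p * dd K ν w p))) +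
        (-(c / 2)) * ((w p * w p) * dd K α q p)) p :=
      along_congr (fun q' _ => by simp only [current]; ring) hp
    rw [e0, dd, along_add hK (d1.fun_add (d2c)) (d3c) hp,
      along_add hK d1 (d2c) hp, along_const_mul hK _ d2 hp,
      along_const_mul hK _ d3 hp, along_mul hK (dA α) dB hp, along_mul hK (hXd α) dQ hp]
    simp only [dd]
    ring
  simp only [eJ, eA, eB, eQ, eW]
  have hs := quad_symm (fun μ ν => h μ ν p) (fun μ ν => dd K μ (dd K ν w) p)
    (fun μ => dd K μ w p) (fun μ => X μ p) (fun μ ν => hsymm p hp μ ν)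
    (fun μ ν => dd_comm hK hw μ ν hp)
  have hqQ : ∑ α, (∑ β, h α β p * dd K β w p) * dd K α w p =
      ∑ μ, ∑ ν, h μ ν p * (dd K μ w p * dd K ν w p) := by
    refine Finset.sum_congr rfl fun α _ => ?_
    rw [Finset.sum_mul]
    exact Finset.sum_congr rfl fun β _ => by ring
  generalize hY : (∑ γ, X γ p * dd K γ w p + c * (q p * w p)) = Y
  generalize hQ : ∑ μ, ∑ ν, h μ ν p * (dd K μ w p * dd K ν w p) = Q at *
  generalize hA : (fun α => ∑ β, h α β p * dd K β w p) = A at *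
  have hA' : ∀ α, ∑ β, h α β p * dd K β w p = A α := fun α => congrFun hA α
  simp only [hA'] at *
  simp only [mul_add, add_mul, mul_sub, Finset.sum_add_distrib, Finset.sum_sub_distrib,
    ← Finset.mul_sum, ← Finset.sum_mul] at *
  have r1 : ∑ α, A α * (c * (dd K α q p * w p)) = c * (w p * ∑ α, A α * dd K α q p) := by
    simp only [Finset.mul_sum]
    exact Finset.sum_congr rfl fun α _ => by ring
  have r2 : ∑ α, A α * (c * (q p * dd K α w p)) = c * (q p * Q) := by
    rw [← hqQ]
    simp only [Finset.mul_sum]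
    exact Finset.sum_congr rfl fun α _ => by ring
  have r3 : ∑ α, dd K α w p * w p * dd K α q p = w p * ∑ α, dd K α w p * dd K α q p := by
    simp only [Finset.mul_sum]
    exact Finset.sum_congr rfl fun α _ => by ring
  have r4 : ∑ α, w p * dd K α w p * dd K α q p = w p * ∑ α, dd K α w p * dd K α q p := by
    simp only [Finset.mul_sum]
    exact Finset.sum_congr rfl fun α _ => by ring
  rw [r1, r2, r3, r4, hs]
  ring

/-! ### Pointwise bounds for the multipliers -/

lemma abs_sum_le_card {m : ℕ} {f : Fin m → ℝ} {M : ℝ} (h : ∀ i, |f i| ≤ M) :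
    |∑ i, f i| ≤ m * M := by
  refine (Finset.abs_sum_le_sum_abs _ _).trans ?_
  calc ∑ i, |f i| ≤ ∑ _i : Fin m, M := Finset.sum_le_sum fun i _ => h i
    _ = m * M := by simp

/-- The indicator of the spatial indices. -/
def sp (α : Fin (n + 1)) : ℝ := if α = 0 then 0 else 1

/-- The bulk term in the divergence of `current`, in terms of the values at a point. -/
def bulk (h : Fin (n + 1) → Fin (n + 1) → ℝ) (Dh : Fin (n + 1) → Fin (n + 1) → Fin (n + 1) → ℝ)
    (DX : Fin (n + 1) → Fin (n + 1) → ℝ) (X Dq d : Fin (n + 1) → ℝ) (c q w Δq : ℝ) : ℝ :=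
  (∑ α, ∑ β, Dh α α β * d β) * (∑ γ, X γ * d γ + c * (q * w)) +
  ∑ α, (∑ β, h α β * d β) * (∑ γ, DX α γ * d γ) -
  1 / 2 * ((∑ α, DX α α) * ∑ μ, ∑ ν, h μ ν * (d μ * d ν)) -
  1 / 2 * ∑ α, X α * ∑ μ, ∑ ν, Dh α μ ν * (d μ * d ν) +
  c * (q * ∑ μ, ∑ ν, h μ ν * (d μ * d ν)) +
  c * (w * (∑ α, (∑ β, h α β * d β) * Dq α - ∑ α, d α * Dq α)) -
  c / 2 * ((w * w) * Δq)

/-- The bulk term is affine in the metric; the remainder `bulk - bulk₀`, with `bulk₀` the value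
for the Minkowski metric, is small in the region where the metric is close to it. -/
lemma abs_bulk_sub_le {P : Fin (n + 1) → Fin (n + 1) → ℝ}
    {Dh : Fin (n + 1) → Fin (n + 1) → Fin (n + 1) → ℝ}
    {DX : Fin (n + 1) → Fin (n + 1) → ℝ} {X Dq d : Fin (n + 1) → ℝ} {c q w Δq κ r D : ℝ}
    (hκ : 0 ≤ κ) (hr : 0 < r) (hD : 0 ≤ D) (hP : ∀ α β, |P α β| ≤ κ)
    (hDh : ∀ α β γ, |Dh α β γ| ≤ κ / r) (hX : ∀ α, |X α| ≤ 1) (hDX : ∀ α β, |DX α β| ≤ 2 / r)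
    (hDq : ∀ α, |Dq α| ≤ 1 / r ^ 2) (hd : ∀ α, |d α| ≤ D) (hw : |w| ≤ r * D)
    (hq0 : 0 ≤ q) (hq : q ≤ 1 / r) (hc : 0 ≤ c) (hcn : c ≤ n + 1) :
    |bulk (fun α β => minkowski n α β + P α β) Dh DX X Dq d c q w Δq -
      bulk (fun α β => minkowski n α β) 0 DX X Dq d c q w Δq| ≤
      9 * (n + 1 : ℝ) ^ 3 * (κ / r * D ^ 2) := by
  set N : ℝ := ((n + 1 : ℕ) : ℝ) with hN
  have hN' : (n : ℝ) + 1 = N := by rw [hN]; push_cast; ring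
  rw [hN'] at hcn ⊢
  have hN0 : 1 ≤ N := by rw [← hN']; linarith [(Nat.cast_nonneg n : (0 : ℝ) ≤ n)]
  have hκr : 0 ≤ κ / r := by positivity
  have hPd : ∀ α, |∑ β, P α β * d β| ≤ N * (κ * D) := fun α => abs_sum_le_card fun β => by
    rw [abs_mul]
    exact mul_le_mul (hP α β) (hd β) (abs_nonneg _) hκ
  have hQP : |∑ μ, ∑ ν, P μ ν * (d μ * d ν)| ≤ N * (N * (κ * D ^ 2)) :=
    abs_sum_le_card fun μ => abs_sum_le_card fun ν => by
      rw [abs_mul, abs_mul, sq]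
      exact mul_le_mul (hP μ ν) (mul_le_mul (hd μ) (hd ν) (abs_nonneg _) hD) (by positivity) hκ
  have hY : |∑ γ, X γ * d γ + c * (q * w)| ≤ 2 * N * D := by
    refine (abs_add_le _ _).trans ?_
    have h1 : |∑ γ, X γ * d γ| ≤ N * (1 * D) := abs_sum_le_card fun γ => by
      rw [abs_mul]
      exact mul_le_mul (hX γ) (hd γ) (abs_nonneg _) zero_le_one
    have h2 : |c * (q * w)| ≤ N * (1 / r * (r * D)) := by
      rw [abs_mul, abs_mul, abs_of_nonneg hc, abs_of_nonneg hq0]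
      exact mul_le_mul hcn (mul_le_mul hq hw (abs_nonneg _) (by positivity)) (by positivity)
        (by positivity)
    have h3 : 1 / r * (r * D) = D := by field_simp
    rw [h3] at h2
    linarith
  have hT1 : |(∑ α, ∑ β, Dh α α β * d β) * (∑ γ, X γ * d γ + c * (q * w))| ≤
      (N * (N * (κ / r * D))) * (2 * N * D) := by
    rw [abs_mul]
    refine mul_le_mul (abs_sum_le_card fun α => abs_sum_le_card fun β => ?_) hY (abs_nonneg _)
      (by positivity)
    rw [abs_mul]
    exact mul_le_mul (hDh α α β) (hd β) (abs_nonneg _) hκr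
  have hT2 : |∑ α, (∑ β, P α β * d β) * (∑ γ, DX α γ * d γ)| ≤
      N * ((N * (κ * D)) * (N * (2 / r * D))) := abs_sum_le_card fun α => by
    rw [abs_mul]
    refine mul_le_mul (hPd α) (abs_sum_le_card fun γ => ?_) (abs_nonneg _) (by positivity)
    rw [abs_mul]
    exact mul_le_mul (hDX α γ) (hd γ) (abs_nonneg _) (by positivity)
  have hT3 : |(∑ α, DX α α) * ∑ μ, ∑ ν, P μ ν * (d μ * d ν)| ≤
      (N * (2 / r)) * (N * (N * (κ * D ^ 2))) := by
    rw [abs_mul]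
    exact mul_le_mul (abs_sum_le_card fun α => hDX α α) hQP (abs_nonneg _) (by positivity)
  have hT4 : |∑ α, X α * ∑ μ, ∑ ν, Dh α μ ν * (d μ * d ν)| ≤
      N * (1 * (N * (N * (κ / r * (D * D))))) := abs_sum_le_card fun α => by
    rw [abs_mul]
    refine mul_le_mul (hX α) (abs_sum_le_card fun μ => abs_sum_le_card fun ν => ?_)
      (abs_nonneg _) zero_le_one
    rw [abs_mul, abs_mul]
    exact mul_le_mul (hDh α μ ν) (mul_le_mul (hd μ) (hd ν) (abs_nonneg _) hD) (by positivity) hκr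
  have hT5 : |c * (q * ∑ μ, ∑ ν, P μ ν * (d μ * d ν))| ≤ N * (1 / r * (N * (N * (κ * D ^ 2)))) := by
    rw [abs_mul, abs_mul, abs_of_nonneg hc, abs_of_nonneg hq0]
    exact mul_le_mul hcn (mul_le_mul hq hQP (abs_nonneg _) (by positivity)) (by positivity)
      (by positivity)
  have hT6 : |c * (w * ∑ α, (∑ β, P α β * d β) * Dq α)| ≤
      N * ((r * D) * (N * (N * (κ * D) * (1 / r ^ 2)))) := by
    rw [abs_mul, abs_mul, abs_of_nonneg hc]
    refine mul_le_mul hcn (mul_le_mul hw (abs_sum_le_card fun α => ?_) (abs_nonneg _)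
      (by positivity)) (by positivity) (by positivity)
    rw [abs_mul]
    exact mul_le_mul (hPd α) (hDq α) (abs_nonneg _) (by positivity)
  have e1 : N * ((N * (κ * D)) * (N * (2 / r * D))) = 2 * N ^ 3 * (κ / r * D ^ 2) := by
    field_simp
  have e2 : (N * (2 / r)) * (N * (N * (κ * D ^ 2))) = 2 * N ^ 3 * (κ / r * D ^ 2) := by field_simp
  have e3 : N * (1 / r * (N * (N * (κ * D ^ 2)))) = N ^ 3 * (κ / r * D ^ 2) := by field_simp
  have e4 : N * ((r * D) * (N * (N * (κ * D) * (1 / r ^ 2)))) = N ^ 3 * (κ / r * D ^ 2) := by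
    field_simp
  rw [e1] at hT2
  rw [e2] at hT3
  rw [e3] at hT5
  rw [e4] at hT6
  have key : bulk (fun α β => minkowski n α β + P α β) Dh DX X Dq d c q w Δq -
      bulk (fun α β => minkowski n α β) 0 DX X Dq d c q w Δq =
      (∑ α, ∑ β, Dh α α β * d β) * (∑ γ, X γ * d γ + c * (q * w)) +
      ∑ α, (∑ β, P α β * d β) * (∑ γ, DX α γ * d γ) -
      1 / 2 * ((∑ α, DX α α) * ∑ μ, ∑ ν, P μ ν * (d μ * d ν)) -
      1 / 2 * (∑ α, X α * ∑ μ, ∑ ν, Dh α μ ν * (d μ * d ν)) +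
      c * (q * ∑ μ, ∑ ν, P μ ν * (d μ * d ν)) +
      c * (w * ∑ α, (∑ β, P α β * d β) * Dq α) := by
    simp only [bulk, add_mul, Finset.sum_add_distrib, Pi.zero_apply, zero_mul,
      Finset.sum_const_zero, mul_zero, mul_add]
    ring
  rw [key]
  rw [abs_le] at hT1 hT2 hT3 hT4 hT5 hT6 ⊢
  have e5 : N * (N * (κ / r * D)) * (2 * N * D) = 2 * N ^ 3 * (κ / r * D ^ 2) := by ring
  have e6 : N * (1 * (N * (N * (κ / r * (D * D))))) = N ^ 3 * (κ / r * D ^ 2) := by ring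
  rw [e5] at hT1
  rw [e6] at hT4
  have hpos : 0 ≤ N ^ 3 * (κ / r * D ^ 2) := by positivity
  constructor <;> linarith [hT1.1, hT1.2, hT2.1, hT2.2, hT3.1, hT3.2, hT4.1, hT4.2, hT5.1, hT5.2,
    hT6.1, hT6.2]

lemma minkowski_apply (α β : Fin (n + 1)) :
    minkowski n α β = if α = β then 2 * sp α - 1 else 0 := by
  rw [minkowski, Matrix.diagonal_apply]
  split_ifs
  · refine Fin.cases ?_ (fun i => ?_) α
    · simp [sp]
    · simp [sp, Fin.succ_ne_zero]
      norm_num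
  · rfl

/-- The bulk term for the Minkowski metric and the multiplier `q (x · ∇w + c w)`, `e` standing for
the Laplacian of `q`. -/
lemma bulk_minkowski_eq {x d : Fin (n + 1) → ℝ} {q r w c e : ℝ} (hx0 : x 0 = 0)
    (hxr : ∑ α, x α ^ 2 = r ^ 2) :
    bulk (fun α β => minkowski n α β) 0
        (fun α γ => (if α = γ then sp α else 0) * q - x α * x γ * q ^ 3) (fun α => x α * q)
        (fun α => - (x α * q ^ 3)) d c q w e =
      (q * (∑ i : Fin n, d i.succ ^ 2) - q ^ 3 * (∑ i : Fin n, x i.succ * d i.succ) ^ 2) -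
        1 / 2 * ((n * q - r ^ 2 * q ^ 3) * ((∑ i : Fin n, d i.succ ^ 2) - d 0 ^ 2)) +
        c * (q * ((∑ i : Fin n, d i.succ ^ 2) - d 0 ^ 2)) - c / 2 * ((w * w) * e) := by
  have hsp0 : sp (0 : Fin (n + 1)) = 0 := by simp [sp]
  have hspS : ∀ i : Fin n, sp i.succ = 1 := fun i => by simp [sp, Fin.succ_ne_zero]
  set S := ∑ i : Fin n, d i.succ ^ 2 with hS
  set z := ∑ i : Fin n, x i.succ * d i.succ with hz
  have hQ : ∑ μ, ∑ ν, minkowski n μ ν * (d μ * d ν) = S - d 0 ^ 2 := by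
    simp only [minkowski_apply, ite_mul, zero_mul, Finset.sum_ite_eq, Finset.mem_univ, if_true]
    rw [Fin.sum_univ_succ, hsp0, hS]
    simp only [hspS]
    rw [Finset.sum_congr rfl fun i _ => show (2 * (1 : ℝ) - 1) * (d i.succ * d i.succ) =
      d i.succ ^ 2 by ring]
    ring
  have hmd : ∀ α, ∑ β, minkowski n α β * d β = (2 * sp α - 1) * d α := fun α => by
    simp only [minkowski_apply, ite_mul, zero_mul, Finset.sum_ite_eq, Finset.mem_univ, if_true]
  have hDXd : ∀ α, ∑ γ, ((if α = γ then sp α else 0) * q - x α * x γ * q ^ 3) * d γ =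
      sp α * q * d α - x α * q ^ 3 * z := fun α => by
    simp only [sub_mul, Finset.sum_sub_distrib, ite_mul, zero_mul, Finset.sum_ite_eq,
      Finset.mem_univ, if_true]
    congr 1
    rw [Fin.sum_univ_succ, hx0, hz, Finset.mul_sum]
    simp only [mul_zero, zero_mul, zero_add]
    exact Finset.sum_congr rfl fun i _ => by ring
  have hT2 : ∑ α, (2 * sp α - 1) * d α * (sp α * q * d α - x α * q ^ 3 * z) =
      q * S - q ^ 3 * z ^ 2 := by
    rw [Fin.sum_univ_succ, hsp0, hx0]
    simp only [hspS]
    rw [Finset.sum_congr rfl fun i _ => show (2 * (1 : ℝ) - 1) * d i.succ *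
      (1 * q * d i.succ - x i.succ * q ^ 3 * z) = q * d i.succ ^ 2 -
        q ^ 3 * z * (x i.succ * d i.succ) by ring, Finset.sum_sub_distrib, ← Finset.mul_sum,
      ← Finset.mul_sum]
    ring
  have hdiv : ∑ α : Fin (n + 1), ((if α = α then sp α else 0) * q - x α * x α * q ^ 3) =
      n * q - r ^ 2 * q ^ 3 := by
    simp only [if_true, Finset.sum_sub_distrib, ← Finset.sum_mul]
    rw [Fin.sum_univ_succ, hsp0, ← hxr]
    simp [hspS, sq]
  have hT6 : ∑ α, (2 * sp α - 1) * d α * -(x α * q ^ 3) - ∑ α, d α * -(x α * q ^ 3) = 0 := by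
    rw [Fin.sum_univ_succ, Fin.sum_univ_succ, hx0]
    simp only [hspS]
    norm_num
  have hz1 : ∑ α, ∑ β, (0 : Fin (n + 1) → Fin (n + 1) → Fin (n + 1) → ℝ) α α β * d β = 0 := by
    simp
  have hz2 : ∑ α, x α * q * ∑ μ, ∑ ν,
      (0 : Fin (n + 1) → Fin (n + 1) → Fin (n + 1) → ℝ) α μ ν * (d μ * d ν) = 0 := by
    simp
  unfold bulk
  rw [hdiv]
  simp only [hQ, hmd, hDXd, hT2, hT6, hz1, hz2]
  ring

/-- Positivity of the Morawetz bulk term as an inequality between numbers: `m` is the dimension, `S`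
and `e` are `|∇w|²` and `(∂_t w)²`, `z` is `x · ∇w`. The coefficient of `w²` has the right sign for
`m ≥ 3`. -/
lemma morawetz_scalar {m q r w l S e z : ℝ} (hn : 3 ≤ m) (hz2 : z ^ 2 ≤ r ^ 2 * S)
    (hq : 0 < q) (hql : q ^ 2 * (r ^ 2 + l ^ 2) = 1) :
    1 / 2 * l ^ 2 * q ^ 3 * (e + S) + 3 / 2 * l ^ 2 * q ^ 5 * w ^ 2 ≤
      (q * S - q ^ 3 * z ^ 2) - 1 / 2 * ((m * q - r ^ 2 * q ^ 3) * (S - e)) +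
        (m - 1) / 2 * (q * (S - e)) -
        (m - 1) / 2 / 2 * ((w * w) * (-(m * q ^ 3) + 3 * r ^ 2 * q ^ 5)) := by
  have hq3 : 0 < q ^ 3 := by positivity
  have h5 : 0 < q ^ 5 := by positivity
  -- `q = q³ (r² + l²)` makes all terms multiples of `q³` and `q⁵`
  have e1 : q = q ^ 3 * (r ^ 2 + l ^ 2) := by linear_combination (-q) * hql
  have e2 : q ^ 3 = q ^ 5 * (r ^ 2 + l ^ 2) := by linear_combination (-q ^ 3) * hql
  have f1 : q ^ 3 * l ^ 2 * S ≤ q * S - q ^ 3 * z ^ 2 := by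
    have h1 : q * S = q ^ 3 * (r ^ 2 * S) + q ^ 3 * l ^ 2 * S := by linear_combination S * e1
    have h2 := mul_le_mul_of_nonneg_left hz2 hq3.le
    linarith
  have f2 : - (1 / 2 * ((m * q - r ^ 2 * q ^ 3) * (S - e))) + (m - 1) / 2 * (q * (S - e)) =
      1 / 2 * (q ^ 3 * l ^ 2 * e) - 1 / 2 * (q ^ 3 * l ^ 2 * S) := by
    linear_combination (-(1 / 2) * (S - e)) * e1
  have f3 : (m - 1) / 2 / 2 * ((w * w) * (-(m * q ^ 3) + 3 * r ^ 2 * q ^ 5)) ≤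
      - (3 / 2 * l ^ 2 * q ^ 5 * w ^ 2) := by
    have g1 : -(m * q ^ 3) + 3 * r ^ 2 * q ^ 5 ≤ -3 * (l ^ 2 * q ^ 5) := by
      have : 3 * q ^ 3 ≤ m * q ^ 3 := mul_le_mul_of_nonneg_right hn hq3.le
      linarith
    have g2 := mul_le_mul_of_nonneg_left g1 (mul_self_nonneg w)
    have g3 : 0 ≤ (w * w) * (l ^ 2 * q ^ 5) :=
      mul_nonneg (mul_self_nonneg w) (mul_nonneg (sq_nonneg l) h5.le)
    have g4 := mul_le_mul_of_nonneg_left g2 (show 0 ≤ (m - 1) / 2 / 2 by linarith)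
    have g5 := mul_le_mul_of_nonneg_right (show 1 / 2 ≤ (m - 1) / 2 / 2 by linarith) g3
    linarith
  linarith

/-- The Minkowski bulk term of the Morawetz multiplier `X = x q`, `q = (|x|² + l²)^{-1/2}`, is
positive. -/
lemma bulk_minkowski_ge (hn : 3 ≤ n) {x d : Fin (n + 1) → ℝ} {q r w l : ℝ} (hx0 : x 0 = 0)
    (hxr : ∑ α, x α ^ 2 = r ^ 2) (hq : 0 < q) (hql : q ^ 2 * (r ^ 2 + l ^ 2) = 1) :
    1 / 2 * l ^ 2 * q ^ 3 * (∑ α, d α ^ 2) + 3 / 2 * l ^ 2 * q ^ 5 * w ^ 2 ≤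
      bulk (fun α β => minkowski n α β) 0
        (fun α γ => (if α = γ then sp α else 0) * q - x α * x γ * q ^ 3) (fun α => x α * q)
        (fun α => - (x α * q ^ 3)) d (((n : ℝ) - 1) / 2) q w (-(n * q ^ 3) + 3 * r ^ 2 * q ^ 5) := by
  have hxr' : ∑ i : Fin n, x i.succ ^ 2 = r ^ 2 := by
    rw [← hxr, Fin.sum_univ_succ, hx0]; simp
  rw [bulk_minkowski_eq hx0 hxr, Fin.sum_univ_succ]
  refine morawetz_scalar (by exact_mod_cast hn) ?_ hq hql
  rw [← hxr']
  exact Finset.sum_mul_sq_le_sq_mul_sq _ _ _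

/-! ### The Morawetz weight and Hardy's inequality -/

/-- The space-time coordinates, with the time coordinate replaced by `0`. -/
def xc (α : Fin (n + 1)) (p : SpaceTime n) : ℝ :=
  Fin.cases (motive := fun _ => ℝ) 0 (fun i => p.2 i) α

/-- The weight `(|x|² + l²)^{-1/2}`. -/
def qf (l : ℝ) (p : SpaceTime n) : ℝ := (√(‖p.2‖ ^ 2 + l ^ 2))⁻¹

lemma xc_zero (p : SpaceTime n) : xc 0 p = 0 := rfl

lemma xc_succ (i : Fin n) (p : SpaceTime n) : xc i.succ p = p.2 i := rfl

lemma sum_xc_sq (p : SpaceTime n) : ∑ α, xc α p ^ 2 = ‖p.2‖ ^ 2 := by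
  rw [Fin.sum_univ_succ, EuclideanSpace.norm_sq_eq]
  simp [xc_zero, xc_succ]

lemma abs_xc_le (α : Fin (n + 1)) (p : SpaceTime n) : |xc α p| ≤ ‖p.2‖ := by
  refine Fin.cases ?_ (fun i => ?_) α
  · simp [xc_zero]
  · exact abs_coord_le p.2 i

lemma smooth_xc (α : Fin (n + 1)) : Smooth K (xc α) := by
  refine Fin.cases ?_ (fun i => ?_) α
  · exact contDiffOn_const
  · exact smooth_coord i

lemma smooth_normSq : Smooth K (fun p => ‖p.2‖ ^ 2) :=
  (contDiff_snd.norm_sq ℝ).contDiffOn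

lemma qf_pos {l : ℝ} (hl : 0 < l) (p : SpaceTime n) : 0 < qf l p :=
  inv_pos.2 (Real.sqrt_pos.2 (by positivity))

lemma qf_sq {l : ℝ} (hl : 0 < l) (p : SpaceTime n) : qf l p ^ 2 * (‖p.2‖ ^ 2 + l ^ 2) = 1 := by
  have h : 0 < ‖p.2‖ ^ 2 + l ^ 2 := by positivity
  rw [qf, inv_pow, Real.sq_sqrt h.le, inv_mul_cancel₀ h.ne']

lemma smooth_qf {l : ℝ} (hl : 0 < l) : Smooth K (qf (n := n) l) := by
  have h : ∀ p : SpaceTime n, ‖p.2‖ ^ 2 + l ^ 2 ≠ 0 := fun p => by positivity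
  have h1 : ContDiff ℝ ∞ (fun p : SpaceTime n => ‖p.2‖ ^ 2 + l ^ 2) :=
    (contDiff_snd.norm_sq ℝ).add contDiff_const
  exact ((h1.sqrt h).inv fun p => (Real.sqrt_pos.2 (by positivity)).ne').contDiffOn

lemma qf_mul_norm_le {l : ℝ} (hl : 0 < l) (p : SpaceTime n) : qf l p * ‖p.2‖ ≤ 1 := by
  have h := qf_sq hl p
  have h0 := qf_pos hl p
  refine abs_le_one_iff_mul_self_le_one.2 ?_ |> le_of_abs_le
  nlinarith [sq_nonneg (qf l p * l)]

lemma qf_anti {l l' : ℝ} (hl : 0 < l) (h : l ≤ l') (p : SpaceTime n) : qf l' p ≤ qf l p := by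
  unfold qf
  gcongr

lemma dd_xc (hK : IsClosed K) (α β : Fin (n + 1)) {p : SpaceTime n} (hp : p ∈ region K) :
    dd K α (xc β) p = if α = β then sp α else 0 := by
  refine Fin.cases ?_ (fun i => ?_) β
  · have h : dd K α (xc (0 : Fin (n + 1))) p = 0 := along_const _ _
    rw [h, sp]
    split_ifs <;> rfl
  · have h : dd K α (xc i.succ) p = _ := dd_coord_snd hK α i hp
    rw [h]
    refine Fin.cases ?_ (fun j => ?_) α
    · simp [coordField, (Fin.succ_ne_zero i).symm]
    · simp [coordField, spaceField, sp, Fin.succ_ne_zero, eq_comm]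

lemma dd_normSq (hK : IsClosed K) (α : Fin (n + 1)) {p : SpaceTime n} (hp : p ∈ region K) :
    dd K α (fun p => ‖p.2‖ ^ 2) p = 2 * xc α p := by
  have h : (fun p : SpaceTime n => ‖p.2‖ ^ 2) = fun p => ∑ β, xc β p * xc β p := by
    funext p
    rw [← sum_xc_sq]
    simp only [sq]
  rw [h, dd, along_sum (f := fun β p => xc β p * xc β p) hK Finset.univ
    (fun β _ => (smooth_xc β).diff.fun_mul (smooth_xc β).diff) hp]
  have h2 : ∀ β, along (region K) (coordField α) (fun p => xc β p * xc β p) p =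
      if α = β then 2 * (sp β * xc β p) else 0 := fun β => by
    rw [along_mul hK (smooth_xc β).diff (smooth_xc β).diff hp]
    have := dd_xc hK α β hp
    rw [dd] at this
    rw [this]
    split_ifs with h
    · rw [h]; ring
    · ring
  simp only [h2, Finset.sum_ite_eq, Finset.mem_univ, if_true]
  refine Fin.cases ?_ (fun i => ?_) α
  · simp [xc_zero]
  · simp [sp, Fin.succ_ne_zero]

lemma dd_qf (hK : IsClosed K) {l : ℝ} (hl : 0 < l) (α : Fin (n + 1)) {p : SpaceTime n}
    (hp : p ∈ region K) : dd K α (qf l) p = -(xc α p * qf l p ^ 3) := by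
  have hq := (smooth_qf (K := K) (n := n) hl).diff
  have hs := (smooth_normSq (K := K) (n := n)).diff
  have h1 : dd K α (fun p => (qf l p * qf l p) * (‖p.2‖ ^ 2 + l ^ 2)) p = 0 := by
    have : (fun p : SpaceTime n => (qf l p * qf l p) * (‖p.2‖ ^ 2 + l ^ 2)) = fun _ => 1 := by
      funext p
      rw [← sq, qf_sq hl]
    rw [this]
    exact along_const _ _
  have h2 : dd K α (fun p => ‖p.2‖ ^ 2 + l ^ 2) p = 2 * xc α p := by
    have h3 := dd_normSq hK α hp
    rw [dd] at h3
    rw [← h3, dd, along_add hK hs (differentiableOn_const _) hp, along_const, add_zero]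
  rw [dd, along_mul hK (hq.fun_mul hq) (hs.fun_add (differentiableOn_const _)) hp,
    along_mul hK hq hq hp] at h1
  rw [dd] at h2 ⊢
  rw [h2] at h1
  have h3 := qf_sq hl p
  have h4 := (qf_pos hl p).ne'
  have h5 : qf l p * (along (region K) (coordField α) (qf l) p + xc α p * qf l p ^ 3) *
      (‖p.2‖ ^ 2 + l ^ 2) = 0 := by
    linear_combination (1 / 2) * h1 + (xc α p * qf l p ^ 2) * h3
  have h6 : ‖p.2‖ ^ 2 + l ^ 2 ≠ 0 := by positivity
  have h7 := (mul_eq_zero.1 ((mul_eq_zero.1 h5).resolve_right h6)).resolve_left h4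
  linarith

lemma dd_xc_mul_qf (hK : IsClosed K) {l : ℝ} (hl : 0 < l) (α γ : Fin (n + 1)) {p : SpaceTime n}
    (hp : p ∈ region K) : dd K α (fun p => xc γ p * qf l p) p =
      (if α = γ then sp α else 0) * qf l p - xc α p * xc γ p * qf l p ^ 3 := by
  rw [dd, along_mul hK (smooth_xc γ).diff (smooth_qf hl).diff hp]
  have h1 := dd_xc hK α γ hp
  have h2 := dd_qf hK hl α hp
  rw [dd] at h1 h2
  rw [h1, h2]
  ring

lemma sum_sp : ∑ α : Fin (n + 1), sp α = n := by
  rw [Fin.sum_univ_succ]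
  simp [sp, Fin.succ_ne_zero]

lemma sum_dd_dd_qf (hK : IsClosed K) {l : ℝ} (hl : 0 < l) {p : SpaceTime n} (hp : p ∈ region K) :
    ∑ α, dd K α (dd K α (qf l)) p = -(n * qf l p ^ 3) + 3 * ‖p.2‖ ^ 2 * qf l p ^ 5 := by
  have h : ∀ α, dd K α (dd K α (qf l)) p =
      -(sp α * qf l p ^ 3) + 3 * xc α p ^ 2 * qf l p ^ 5 := fun α => by
    have hq := (smooth_qf (K := K) (n := n) hl).diff
    have hx := (smooth_xc (K := K) α).diff
    have e : dd K α (dd K α (qf l)) p =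
        dd K α (fun p => (-1) * ((xc α p * qf l p) * (qf l p * qf l p))) p :=
      along_congr (fun q hq => by rw [dd_qf hK hl α hq]; ring) hp
    rw [e, dd, along_const_mul hK _ ((hx.fun_mul hq).fun_mul (hq.fun_mul hq)) hp,
      along_mul hK (hx.fun_mul hq) (hq.fun_mul hq) hp, along_mul hK hq hq hp]
    have h1 := dd_xc_mul_qf hK hl α α hp
    have h2 := dd_qf hK hl α hp
    rw [dd] at h1 h2
    rw [h1, h2]
    simp only [if_true]
    ring
  simp only [h, Finset.sum_add_distrib, Finset.sum_neg_distrib, ← Finset.sum_mul, ← Finset.mul_sum,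
    sum_sp, sum_xc_sq]

/-- Hardy's inequality, from the vanishing of the integral of `∂_i (x_i q² w²)`. -/
lemma hardy (hn : 3 ≤ n) (hK : IsClosed K) {B : Set (Space n)} (hB : IsCompact B) (hBK : B ⊆ Kᶜ)
    {w : SpaceTime n → ℝ} (hw : CD K 1 w) (h0 : SuppIn K B w) {l : ℝ} (hl : 0 < l) {t : ℝ}
    (ht : 0 ≤ t) :
    ∫ x in Kᶜ, qf l (t, x) ^ 2 * w (t, x) ^ 2 ≤ 4 * ∫ x in Kᶜ, ∑ α, dd K α w (t, x) ^ 2 := by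
  set V : Fin n → SpaceTime n → ℝ := fun i p => ((xc i.succ p * qf l p) * qf l p) * (w p * w p)
    with hV
  have hwd : DifferentiableOn ℝ w (region K) := CD.differentiableOn (m := 0) hw
  have hq := smooth_qf (K := K) (n := n) hl
  have hX : ∀ i : Fin n, Smooth K (fun p => xc i.succ p * qf l p) := fun i =>
    (smooth_xc i.succ).mul hq
  have hVc : ∀ i, CD K 1 (V i) := fun i =>
    ContDiffOn.mul (((hX i).mul hq).of_le (by exact_mod_cast le_top)) (hw.mul hw)
  have hVs : ∀ i, SuppIn K B (V i) := fun i => (h0.mul_left w).mul_left _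
  have hwc := hw.continuousOn
  have hdc : ∀ α, ContinuousOn (dd K α w) (region K) := fun α =>
    ContDiffOn.continuousOn (CD.dd (m := 0) hK hw α)
  have i1 : IntegrableOn (fun x => qf l (t, x) ^ 2 * w (t, x) ^ 2) Kᶜ :=
    integrableOn_slice (f := fun p => qf l p ^ 2 * w p ^ 2) hK hB hBK
      ((hq.continuousOn.pow 2).mul (hwc.pow 2)) (fun p hp h => by simp [h0 p hp h]) ht
  have i2 : IntegrableOn (fun x => ∑ α, dd K α w (t, x) ^ 2) Kᶜ :=
    integrableOn_slice (f := fun p => ∑ α, dd K α w p ^ 2) hK hB hBK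
      (continuousOn_finsetSum _ fun α _ => (hdc α).pow 2)
      (SuppIn.sum fun α _ p hp h => by simp [(h0.along hB.isClosed (coordField α)) p hp h, dd]) ht
  have i3 : ∀ i : Fin n, IntegrableOn (fun x => dd K i.succ (V i) (t, x)) Kᶜ := fun i =>
    integrableOn_slice hK hB hBK (ContDiffOn.continuousOn (CD.dd (m := 0) hK (hVc i) _))
      ((hVs i).along hB.isClosed _) ht
  have hdiv : ∫ x in Kᶜ, ∑ i : Fin n, dd K i.succ (V i) (t, x) = 0 := by
    rw [integral_finsetSum _ fun i _ => i3 i]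
    exact Finset.sum_eq_zero fun i _ => integral_dd_space hK hB hBK (hVc i) (hVs i) ht i
  have hpt : ∀ x ∈ Kᶜ, 1 / 2 * (qf l (t, x) ^ 2 * w (t, x) ^ 2) - 2 * ∑ α, dd K α w (t, x) ^ 2 ≤
      ∑ i : Fin n, dd K i.succ (V i) (t, x) := by
    intro x hx
    have hp : ((t, x) : SpaceTime n) ∈ region K := ⟨ht, hx⟩
    set p : SpaceTime n := (t, x) with hpdef
    have hdV : ∀ i : Fin n, dd K i.succ (V i) p = (qf l p ^ 2 - 2 * xc i.succ p ^ 2 * qf l p ^ 4) *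
        w p ^ 2 + 2 * qf l p ^ 2 * w p * (xc i.succ p * dd K i.succ w p) := fun i => by
      rw [dd, along_mul hK ((hX i).diff.fun_mul hq.diff) (hwd.fun_mul hwd) hp,
        along_mul hK (hX i).diff hq.diff hp, along_mul hK hwd hwd hp]
      have h1 := dd_xc_mul_qf hK hl i.succ i.succ hp
      have h2 := dd_qf hK hl i.succ hp
      rw [dd] at h1 h2 ⊢
      rw [h1, h2]
      simp only [if_true, sp, Fin.succ_ne_zero, if_false]
      ring
    simp only [hdV, Finset.sum_add_distrib, ← Finset.sum_mul, ← Finset.mul_sum,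
      Finset.sum_sub_distrib, Finset.sum_const, Finset.card_univ, Fintype.card_fin, nsmul_eq_mul]
    have hr : ∑ i : Fin n, xc i.succ p ^ 2 = ‖p.2‖ ^ 2 := by
      rw [← sum_xc_sq, Fin.sum_univ_succ, xc_zero]; simp
    set S := ∑ i : Fin n, dd K i.succ w p ^ 2 with hS
    set z := ∑ i : Fin n, xc i.succ p * dd K i.succ w p with hz
    have hz2 : z ^ 2 ≤ ‖p.2‖ ^ 2 * S := by
      rw [← hr]
      exact Finset.sum_mul_sq_le_sq_mul_sq _ _ _
    rw [hr]
    have hSE : S ≤ ∑ α, dd K α w p ^ 2 := by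
      rw [Fin.sum_univ_succ]
      linarith [sq_nonneg (dd K 0 w p)]
    have hqr := qf_sq hl p
    have hn' : (3 : ℝ) ≤ n := by exact_mod_cast hn
    have hS0 : 0 ≤ S := Finset.sum_nonneg fun i _ => sq_nonneg _
    set Q := qf l p with hQ
    have a1 : ‖p.2‖ ^ 2 * Q ^ 2 ≤ 1 := by nlinarith [sq_nonneg (Q * l)]
    -- `2 |Q² w z| ≤ Q² w² / 2 + 2 Q² z²` and `Q² z² ≤ S`
    have a2 : Q ^ 2 * z ^ 2 ≤ S := by
      calc Q ^ 2 * z ^ 2 ≤ Q ^ 2 * (‖p.2‖ ^ 2 * S) := by gcongr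
        _ = (‖p.2‖ ^ 2 * Q ^ 2) * S := by ring
        _ ≤ 1 * S := by gcongr
        _ = S := one_mul S
    have a3 : 0 ≤ Q ^ 2 * (w p / 2 + z) ^ 2 := by positivity
    have a4 : 0 ≤ (n - 2 * (‖p.2‖ ^ 2 * Q ^ 2) - 1) * (Q ^ 2 * w p ^ 2) :=
      mul_nonneg (by linarith) (by positivity)
    nlinarith
  have hI := setIntegral_mono_on ((i1.const_mul (1 / 2)).sub (i2.const_mul 2))
    (integrable_finsetSum _ fun i _ => i3 i) hK.measurableSet.compl hpt
  rw [hdiv] at hI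
  simp only [Pi.sub_apply] at hI
  rw [integral_sub (i1.const_mul (1 / 2)) (i2.const_mul 2), integral_const_mul,
    integral_const_mul] at hI
  linarith

/-! ### The exterior local energy estimate -/

/-- The coefficients `h^{αβ}` are smooth and symmetric, and for `|x| > ρ` they differ from the
Minkowski ones by at most `κ_j` in the `j`-th dyadic annulus, with `|x| ∂h` bounded likewise. -/
structure NearFlat (K : Set (Space n)) (ρ : ℝ) (κ : ℕ → ℝ)
    (h : Fin (n + 1) → Fin (n + 1) → SpaceTime n → ℝ) : Prop where
  one_le : 1 ≤ ρ
  smooth : ∀ α β, Smooth K (h α β)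
  symm : ∀ p ∈ region K, ∀ α β, h α β p = h β α p
  nonneg : ∀ j, 0 ≤ κ j
  close : ∀ α β, ∀ p ∈ region K, ρ < ‖p.2‖ → |h α β p - minkowski n α β| ≤ κ (dyIdx p.2)
  deriv : ∀ α β γ, ∀ p ∈ region K, ρ < ‖p.2‖ → ‖p.2‖ * |dd K γ (h α β) p| ≤ κ (dyIdx p.2)

/-- The energy density `|∂w|²`. -/
def engy (K : Set (Space n)) (w : SpaceTime n → ℝ) (p : SpaceTime n) : ℝ :=
  ∑ α, dd K α w p ^ 2

/-- The principal part `h^{αβ} ∂_α ∂_β w`. -/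
def source (K : Set (Space n)) (h : Fin (n + 1) → Fin (n + 1) → SpaceTime n → ℝ)
    (w : SpaceTime n → ℝ) (p : SpaceTime n) : ℝ :=
  ∑ α, ∑ β, h α β p * dd K α (dd K β w) p

/-- The quantity `|∂w| + (|x|² + 1)^{-1/2} |w|`, which bounds the multipliers. -/
def vsum (K : Set (Space n)) (w : SpaceTime n → ℝ) (p : SpaceTime n) : ℝ :=
  ∑ α, |dd K α w p| + qf 1 p * |w p|

/-- The local energy density at the dyadic scale `2^J`. -/
def shell (K : Set (Space n)) (w : SpaceTime n → ℝ) (J : ℕ) : SpaceTime n → ℝ :=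
  Set.indicator {p | ‖p.2‖ ≤ 2 ^ (J + 1)}
    (fun p => (2 ^ J)⁻¹ * (engy K w p + ((2 ^ J) ^ 2)⁻¹ * w p ^ 2))

lemma engy_nonneg (w : SpaceTime n → ℝ) (p : SpaceTime n) : 0 ≤ engy K w p :=
  Finset.sum_nonneg fun _ _ => sq_nonneg _

lemma vsum_nonneg (w : SpaceTime n → ℝ) (p : SpaceTime n) : 0 ≤ vsum K w p :=
  add_nonneg (Finset.sum_nonneg fun _ _ => abs_nonneg _)
    (mul_nonneg (qf_pos one_pos p).le (abs_nonneg _))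

lemma shell_nonneg (w : SpaceTime n → ℝ) (J : ℕ) (p : SpaceTime n) : 0 ≤ shell K w J p := by
  refine Set.indicator_nonneg (fun p _ => ?_) p
  have := engy_nonneg (K := K) w p
  positivity

lemma abs_dd_le_sqrt (w : SpaceTime n → ℝ) (p : SpaceTime n) (α : Fin (n + 1)) :
    |dd K α w p| ≤ √(engy K w p) := by
  rw [← Real.sqrt_sq_eq_abs]
  exact Real.sqrt_le_sqrt (Finset.single_le_sum (f := fun α => dd K α w p ^ 2)
    (fun _ _ => sq_nonneg _) (Finset.mem_univ α))

section Supp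

variable {B : Set (Space n)} {w : SpaceTime n → ℝ} {h : Fin (n + 1) → Fin (n + 1) → SpaceTime n → ℝ}

lemma continuousOn_engy (hK : IsClosed K) (hw : CD K 1 w) : ContinuousOn (engy K w) (region K) :=
  continuousOn_finsetSum _ fun α _ =>
    (ContDiffOn.continuousOn (CD.dd (m := 0) hK hw α)).pow 2

lemma continuousOn_vsum (hK : IsClosed K) (hw : CD K 1 w) : ContinuousOn (vsum K w) (region K) :=
  (continuousOn_finsetSum _ fun α _ =>
    (ContDiffOn.continuousOn (CD.dd (m := 0) hK hw α)).abs).add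
    ((smooth_qf one_pos).continuousOn.mul hw.continuousOn.abs)

lemma continuousOn_source (hK : IsClosed K) (hh : ∀ α β, Smooth K (h α β)) (hw : CD K 2 w) :
    ContinuousOn (source K h w) (region K) :=
  continuousOn_finsetSum _ fun α _ => continuousOn_finsetSum _ fun β _ =>
    (hh α β).continuousOn.mul
      (ContDiffOn.continuousOn (CD.dd (m := 0) hK (CD.dd (m := 1) hK hw β) α))

lemma suppIn_engy (hB : IsClosed B) (h0 : SuppIn K B w) : SuppIn K B (engy K w) :=
  SuppIn.sum fun α _ p hp h => by simp [dd, (h0.along hB (coordField α)) p hp h]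

lemma integrableOn_shell (hK : IsClosed K) (hB : IsCompact B) (hBK : B ⊆ Kᶜ) (hw : CD K 1 w)
    (h0 : SuppIn K B w) (J : ℕ) (T : ℝ) : IntegrableOn (shell K w J) (Set.Icc 0 T ×ˢ Kᶜ) := by
  refine IntegrableOn.indicator ?_ (measurableSet_le (by fun_prop) measurable_const)
  exact integrableOn_slab hK hB hBK (continuousOn_const.mul ((continuousOn_engy hK hw).add
    (continuousOn_const.mul (hw.continuousOn.pow 2))))
    (fun p hp h => by simp [suppIn_engy hB.isClosed h0 p hp h, h0 p hp h]) T

end Supp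

lemma dd_current_eq (hK : IsClosed K) {h : Fin (n + 1) → Fin (n + 1) → SpaceTime n → ℝ}
    {X : Fin (n + 1) → SpaceTime n → ℝ} {q w : SpaceTime n → ℝ} (c : ℝ)
    (hh : ∀ α β, Smooth K (h α β)) (hX : ∀ α, Smooth K (X α)) (hq : Smooth K q) (hw : CD K 2 w)
    (hsymm : ∀ p ∈ region K, ∀ α β, h α β p = h β α p) {p : SpaceTime n} (hp : p ∈ region K) :
    ∑ α, dd K α (current K h X q c w α) p =
      source K h w p * (∑ γ, X γ p * dd K γ w p + c * (q p * w p)) +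
      bulk (fun α β => h α β p) (fun α μ ν => dd K α (h μ ν) p) (fun α γ => dd K α (X γ) p)
        (fun γ => X γ p) (fun α => dd K α q p) (fun α => dd K α w p) c (q p) (w p)
        (∑ α, dd K α (dd K α q) p) := by
  rw [dd_current hK c hh hX hq hw hsymm hp]
  unfold bulk source
  ring

lemma cd_current (hK : IsClosed K) {h : Fin (n + 1) → Fin (n + 1) → SpaceTime n → ℝ}
    {X : Fin (n + 1) → SpaceTime n → ℝ} {q w : SpaceTime n → ℝ} (c : ℝ)
    (hh : ∀ α β, Smooth K (h α β)) (hX : ∀ α, Smooth K (X α)) (hq : Smooth K q) (hw : CD K 2 w)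
    (α : Fin (n + 1)) : CD K 1 (current K h X q c w α) := by
  have hs : ∀ {f}, Smooth K f → CD K 1 f := fun hf => hf.of_le (by exact_mod_cast le_top)
  have hd : ∀ β, CD K 1 (dd K β w) := fun β => CD.dd (m := 1) hK hw β
  have hw1 : CD K 1 w := hw.of_le (by norm_num)
  unfold AFWave.current
  refine ((ContDiffOn.sum fun β _ => (hs (hh α β)).mul (hd β)).mul
    ((ContDiffOn.sum fun γ _ => (hs (hX γ)).mul (hd γ)).add
      (contDiffOn_const.mul ((hs hq).mul hw1)))).sub (contDiffOn_const.mul ((hs (hX α)).mul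
      (ContDiffOn.sum fun μ _ => ContDiffOn.sum fun ν _ => (hs (hh μ ν)).mul
        ((hd μ).mul (hd ν))))) |>.sub (contDiffOn_const.mul ((hw1.mul hw1).mul
        (hs (hq.dd hK α))))

lemma SuppIn.current {B : Set (Space n)} (hB : IsClosed B)
    {h : Fin (n + 1) → Fin (n + 1) → SpaceTime n → ℝ}
    {X : Fin (n + 1) → SpaceTime n → ℝ} {q w : SpaceTime n → ℝ} (c : ℝ) (h0 : SuppIn K B w)
    (α : Fin (n + 1)) : SuppIn K B (current K h X q c w α) := fun p hp hpB => by
  have h1 : ∀ β, dd K β w p = 0 := fun β => h0.along hB (coordField β) p hp hpB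
  simp [AFWave.current, h1, h0 p hp hpB]

namespace NearFlat

variable {ρ : ℝ} {κ : ℕ → ℝ} {h : Fin (n + 1) → Fin (n + 1) → SpaceTime n → ℝ}

/-- The deviation of the bulk term from its Minkowski value is controlled by the local energy
densities. -/
lemma abs_bulk_sub_le_sum (H : NearFlat K ρ κ h) {w : SpaceTime n → ℝ}
    {DX : Fin (n + 1) → Fin (n + 1) → ℝ} {X Dq : Fin (n + 1) → ℝ} {c q e : ℝ} {m : ℕ}
    {p : SpaceTime n} (hp : p ∈ region K) (hρ : ρ < ‖p.2‖) (hm : dyIdx p.2 < m)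
    (hX : ∀ α, |X α| ≤ 1) (hDX : ∀ α β, |DX α β| ≤ 2 / ‖p.2‖)
    (hDq : ∀ α, |Dq α| ≤ 1 / ‖p.2‖ ^ 2) (hq0 : 0 ≤ q) (hq : q ≤ 1 / ‖p.2‖) (hc : 0 ≤ c)
    (hcn : c ≤ n + 1) :
    |bulk (fun α β => h α β p) (fun α μ ν => dd K α (h μ ν) p) DX X Dq (fun α => dd K α w p) c q
        (w p) e - bulk (fun α β => minkowski n α β) 0 DX X Dq (fun α => dd K α w p) c q (w p) e| ≤
      9 * (n + 1 : ℝ) ^ 3 * ∑ J ∈ Finset.range m, κ J * shell K w J p := by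
  set r := ‖p.2‖ with hr
  have hr1 : 1 < r := H.one_le.trans_lt hρ
  have hr0 : 0 < r := by linarith
  set J := dyIdx p.2 with hJ
  have hE := engy_nonneg (K := K) w p
  set D := √(engy K w p + w p ^ 2 / r ^ 2) with hD
  have hDsq : D ^ 2 = engy K w p + w p ^ 2 / r ^ 2 := Real.sq_sqrt (by positivity)
  have hmain := abs_bulk_sub_le (P := fun α β => h α β p - minkowski n α β)
    (Dh := fun α μ ν => dd K α (h μ ν) p) (Δq := e) (w := w p) (d := fun α => dd K α w p)
    (D := D) (H.nonneg J) hr0 (Real.sqrt_nonneg _) (fun α β => H.close α β p hp hρ)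
    (fun α μ ν => by
      rw [le_div_iff₀ hr0, mul_comm]
      exact H.deriv μ ν α p hp hρ) hX hDX hDq
    (fun α => (abs_dd_le_sqrt w p α).trans (Real.sqrt_le_sqrt (by
      have : 0 ≤ w p ^ 2 / r ^ 2 := by positivity
      linarith)))
    (by
      rw [← Real.sqrt_sq_eq_abs]
      calc √(w p ^ 2) = √(r ^ 2 * (w p ^ 2 / r ^ 2)) := by congr 1; field_simp
        _ = r * √(w p ^ 2 / r ^ 2) := by rw [Real.sqrt_mul (sq_nonneg r), Real.sqrt_sq hr0.le]
        _ ≤ r * D :=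
          mul_le_mul_of_nonneg_left (Real.sqrt_le_sqrt (le_add_of_nonneg_left hE)) hr0.le)
    hq0 hq hc hcn
  simp only [add_sub_cancel] at hmain
  refine hmain.trans ?_
  gcongr
  have hJr : (2 : ℝ) ^ J ≤ r := two_pow_dyIdx_le hr1.le
  have hJr' : r ≤ 2 ^ (J + 1) := (lt_two_pow_dyIdx p.2).le
  have hκJ := H.nonneg J
  calc κ J / r * D ^ 2 ≤ κ J * shell K w J p := by
        have hs : shell K w J p = (2 ^ J)⁻¹ * (engy K w p + ((2 ^ J) ^ 2)⁻¹ * w p ^ 2) :=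
          Set.indicator_of_mem (s := {p : SpaceTime n | ‖p.2‖ ≤ 2 ^ (J + 1)}) hJr' _
        rw [hs, hDsq, div_eq_mul_inv, div_eq_mul_inv, mul_assoc, mul_comm (w p ^ 2)]
        gcongr
    _ ≤ ∑ J ∈ Finset.range m, κ J * shell K w J p :=
        Finset.single_le_sum (f := fun J => κ J * shell K w J p)
          (fun i _ => mul_nonneg (H.nonneg i) (shell_nonneg w i p)) (Finset.mem_range.2 hm)

section

variable {B : Set (Space n)} {w : SpaceTime n → ℝ}

/-- The energy estimate, from the multiplier `∂_t w`. -/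
lemma energy_le (H : NearFlat K ρ κ h) (hK : IsClosed K) (hB : IsCompact B) (hBK : B ⊆ Kᶜ)
    (hBρ : ∀ x ∈ B, ρ < ‖x‖) (hw : CD K 2 w) (h0 : SuppIn K B w) {T : ℝ} (hT : 0 ≤ T)
    (hκ : ∀ j, κ j ≤ 1 / (8 * (n + 1 : ℝ) ^ 2)) {m : ℕ} (hm : ∀ x ∈ B, dyIdx x < m) :
    ∫ x in Kᶜ, engy K w (T, x) ≤ 4 * ((∫ x in Kᶜ, engy K w (0, x)) +
      (∫ p in Set.Icc 0 T ×ˢ Kᶜ, |source K h w p| * vsum K w p) +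
      9 * (n + 1 : ℝ) ^ 3 * ∑ J ∈ Finset.range m, κ J * ∫ p in Set.Icc 0 T ×ˢ Kᶜ, shell K w J p) := by
  set N : ℝ := (n : ℝ) + 1 with hN
  have hN1 : 1 ≤ N := by rw [hN]; linarith [(Nat.cast_nonneg n : (0 : ℝ) ≤ n)]
  set X : Fin (n + 1) → SpaceTime n → ℝ := fun γ _ => if γ = 0 then 1 else 0 with hX
  have hXs : ∀ γ, Smooth K (X γ) := fun γ => contDiffOn_const
  have hqs : Smooth K (fun _ : SpaceTime n => (0 : ℝ)) := contDiffOn_const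
  set J := current K h X (fun _ => 0) 0 w with hJ
  have hw1 : CD K 1 w := hw.of_le (by norm_num)
  have hJc : ∀ α, CD K 1 (J α) := fun α => cd_current hK 0 H.smooth hXs hqs hw α
  have hJs : ∀ α, SuppIn K B (J α) := fun α => h0.current hB.isClosed 0 α
  have hdiv := integral_divergence hK hB hBK hJc hJs hT
  have hmeas := measurableSet_region_slab hK T
  -- the flux through the time slices
  have hJ0 : ∀ p ∈ region K, |J 0 p + 1 / 2 * engy K w p| ≤ 1 / 4 * engy K w p := by
    intro p hp
    by_cases hpB : p.2 ∈ B
    · have hρ := hBρ _ hpB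
      have hsplit : J 0 p + 1 / 2 * engy K w p =
          (∑ β, (h 0 β p - minkowski n 0 β) * dd K β w p) * dd K 0 w p -
          1 / 2 * ∑ μ, ∑ ν, (h μ ν p - minkowski n μ ν) * (dd K μ w p * dd K ν w p) := by
        have e1 : ∑ β, minkowski n 0 β * dd K β w p = - dd K 0 w p := by
          simp [minkowski_apply, sp]
        have e2 : ∑ μ, ∑ ν, minkowski n μ ν * (dd K μ w p * dd K ν w p) =
            engy K w p - 2 * dd K 0 w p ^ 2 := by
          simp only [minkowski_apply, ite_mul, zero_mul, Finset.sum_ite_eq, Finset.mem_univ,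
            if_true, engy]
          rw [Fin.sum_univ_succ, Fin.sum_univ_succ]
          simp only [sp, Fin.succ_ne_zero, if_true, if_false]
          rw [Finset.sum_congr rfl fun i _ => show (2 * (1 : ℝ) - 1) *
            (dd K (Fin.succ i) w p * dd K (Fin.succ i) w p) = dd K (Fin.succ i) w p ^ 2 by ring]
          ring
        simp only [sub_mul, Finset.sum_sub_distrib, e1, e2]
        simp only [hJ, current, hX, ite_mul, one_mul, zero_mul, Finset.sum_ite_eq', Finset.mem_univ,
          if_true, mul_zero, add_zero, zero_div, sub_zero]
        ring
      have hk := hκ (dyIdx p.2)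
      have hk0 := H.nonneg (dyIdx p.2)
      have hE := engy_nonneg (K := K) w p
      have hsq : √(engy K w p) * √(engy K w p) = engy K w p := Real.mul_self_sqrt hE
      set k := κ (dyIdx p.2)
      set D := √(engy K w p)
      have hD0 : 0 ≤ D := Real.sqrt_nonneg _
      have b1 : |(∑ β, (h 0 β p - minkowski n 0 β) * dd K β w p) * dd K 0 w p| ≤
          ((n + 1 : ℕ) * (k * D)) * D := by
        rw [abs_mul]
        refine mul_le_mul (abs_sum_le_card fun β => ?_) (abs_dd_le_sqrt w p 0) (abs_nonneg _)
          (by positivity)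
        rw [abs_mul]
        exact mul_le_mul (H.close 0 β p hp hρ) (abs_dd_le_sqrt w p β) (abs_nonneg _) hk0
      have b2 : |∑ μ, ∑ ν, (h μ ν p - minkowski n μ ν) * (dd K μ w p * dd K ν w p)| ≤
          (n + 1 : ℕ) * ((n + 1 : ℕ) * (k * (D * D))) :=
        abs_sum_le_card fun μ => abs_sum_le_card fun ν => by
          rw [abs_mul, abs_mul]
          exact mul_le_mul (H.close μ ν p hp hρ) (mul_le_mul (abs_dd_le_sqrt w p μ)
            (abs_dd_le_sqrt w p ν) (abs_nonneg _) hD0) (by positivity) hk0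
      rw [hsplit]
      push_cast at b1 b2
      rw [← hN] at b1 b2
      have b3 : N * (k * D) * D ≤ N ^ 2 * k * engy K w p := by
        rw [← hsq]
        have : N * (k * (D * D)) ≤ N ^ 2 * (k * (D * D)) :=
          mul_le_mul_of_nonneg_right (by nlinarith) (by positivity)
        linarith
      have b4 : N * (N * (k * (D * D))) = N ^ 2 * k * engy K w p := by rw [hsq]; ring
      have b5 : N ^ 2 * k ≤ 1 / 8 := by
        rw [le_div_iff₀ (by positivity)] at hk
        linarith
      have b6 : N ^ 2 * k * engy K w p ≤ 1 / 8 * engy K w p := mul_le_mul_of_nonneg_right b5 hE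
      rw [abs_le] at b1 b2 ⊢
      constructor <;> linarith [b1.1, b1.2, b2.1, b2.2]
    · rw [hJs 0 p hp hpB, suppIn_engy hB.isClosed h0 p hp hpB]
      simp
  have iJ : ∀ {t : ℝ}, 0 ≤ t → IntegrableOn (fun x => J 0 (t, x)) Kᶜ := fun ht =>
    integrableOn_slice hK hB hBK (hJc 0).continuousOn (hJs 0) ht
  have iE : ∀ {t : ℝ}, 0 ≤ t → IntegrableOn (fun x => engy K w (t, x)) Kᶜ := fun ht =>
    integrableOn_slice hK hB hBK (continuousOn_engy hK hw1) (suppIn_engy hB.isClosed h0) ht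
  have hup : ∫ x in Kᶜ, J 0 (T, x) ≤ ∫ x in Kᶜ, (-(1 / 4)) * engy K w (T, x) :=
    setIntegral_mono_on (iJ hT) ((iE hT).const_mul _) hK.measurableSet.compl fun x hx => by
      have := (abs_le.1 (hJ0 (T, x) ⟨hT, hx⟩)).2
      linarith
  have hlo : ∫ x in Kᶜ, (-1) * engy K w (0, x) ≤ ∫ x in Kᶜ, J 0 (0, x) :=
    setIntegral_mono_on ((iE le_rfl).const_mul _) (iJ le_rfl) hK.measurableSet.compl fun x hx => by
      have := (abs_le.1 (hJ0 (0, x) ⟨le_refl (0 : ℝ), hx⟩)).1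
      have := engy_nonneg (K := K) w (0, x)
      linarith
  rw [integral_const_mul] at hup hlo
  -- the bulk
  have hpt : ∀ p ∈ (Set.Icc 0 T ×ˢ Kᶜ : Set (SpaceTime n)), -(|source K h w p| * vsum K w p +
      9 * N ^ 3 * ∑ J ∈ Finset.range m, κ J * shell K w J p) ≤ ∑ α, dd K α (J α) p := by
    intro p hpT
    have hp := slab_subset T hpT
    by_cases hpB : p.2 ∈ B
    · have hρ := hBρ _ hpB
      have hr0 : 0 < ‖p.2‖ := lt_of_lt_of_le one_pos (H.one_le.trans hρ.le)
      rw [hJ, dd_current_eq hK 0 H.smooth hXs hqs hw H.symm hp]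
      have hb := H.abs_bulk_sub_le_sum (w := w) (DX := fun α γ => dd K α (X γ) p)
        (X := fun γ => X γ p) (Dq := fun α => dd K α (fun _ => 0) p) (c := 0) (q := 0)
        (e := ∑ α, dd K α (dd K α fun _ => 0) p) hp hρ (hm _ hpB)
        (fun α => by simp only [hX]; split_ifs <;> simp)
        (fun α β => by
          have : dd K α (X β) p = 0 := along_const _ _
          rw [this, abs_zero]; positivity)
        (fun α => by
          have : dd K α (fun _ => (0 : ℝ)) p = 0 := along_const _ _
          rw [this, abs_zero]; positivity) le_rfl (by positivity) le_rfl (by positivity)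
      have hz : bulk (fun α β => minkowski n α β) 0 (fun α γ => dd K α (X γ) p)
          (fun γ => X γ p) (fun α => dd K α (fun _ => 0) p) (fun α => dd K α w p) 0 0 (w p)
          (∑ α, dd K α (dd K α fun _ => 0) p) = 0 := by
        have : ∀ α β, dd K α (X β) p = 0 := fun α β => along_const _ _
        simp [bulk, this]
      rw [hz, sub_zero] at hb
      have hs : |source K h w p * (∑ γ, X γ p * dd K γ w p + 0 * (0 * w p))| ≤
          |source K h w p| * vsum K w p := by
        rw [abs_mul]
        gcongr
        simp only [hX, ite_mul, one_mul, zero_mul, Finset.sum_ite_eq', Finset.mem_univ, if_true,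
          add_zero]
        have := Finset.single_le_sum (f := fun α => |dd K α w p|) (fun _ _ => abs_nonneg _)
          (Finset.mem_univ 0)
        exact this.trans (le_add_of_nonneg_right
          (mul_nonneg (qf_pos one_pos p).le (abs_nonneg _)))
      have h1 := (abs_le.1 hs).1
      have h2 := (abs_le.1 hb).1
      linarith
    · rw [Finset.sum_eq_zero fun α _ => (hJs α).along hB.isClosed (coordField α) p hp hpB]
      have h1 : 0 ≤ ∑ J ∈ Finset.range m, κ J * shell K w J p :=
        Finset.sum_nonneg fun i _ => mul_nonneg (H.nonneg i) (shell_nonneg w i p)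
      have h2 := mul_nonneg (abs_nonneg (source K h w p)) (vsum_nonneg (K := K) w p)
      have : 0 ≤ N ^ 3 := by positivity
      nlinarith
  have iS : ∀ i, IntegrableOn (shell K w i) (Set.Icc 0 T ×ˢ Kᶜ) := fun i =>
    integrableOn_shell hK hB hBK hw1 h0 i T
  have iV : IntegrableOn (fun p => |source K h w p| * vsum K w p) (Set.Icc 0 T ×ˢ Kᶜ) :=
    integrableOn_slab hK hB hBK ((continuousOn_source hK H.smooth hw).abs.mul
      (continuousOn_vsum hK hw1)) (fun p hp h => by
        have h1 : ∀ β, dd K β w p = 0 := fun β => h0.along hB.isClosed (coordField β) p hp h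
        simp [vsum, h1, h0 p hp h]) T
  have iD : IntegrableOn (fun p => ∑ α, dd K α (J α) p) (Set.Icc 0 T ×ˢ Kᶜ) :=
    integrable_finsetSum _ fun α _ => integrableOn_slab hK hB hBK
      (ContDiffOn.continuousOn (CD.dd (m := 0) hK (hJc α) α)) ((hJs α).along hB.isClosed _) T
  have iSum : IntegrableOn (fun p => ∑ J ∈ Finset.range m, κ J * shell K w J p)
      (Set.Icc 0 T ×ˢ Kᶜ) := integrable_finsetSum _ fun i _ => (iS i).const_mul _
  have hI := setIntegral_mono_on (iV.add (iSum.const_mul (9 * N ^ 3))).neg iD hmeas hpt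
  simp only [Pi.neg_apply, Pi.add_apply] at hI
  rw [integral_neg, integral_add iV (iSum.const_mul _), integral_const_mul,
    integral_finsetSum _ fun i _ => (iS i).const_mul _, hdiv] at hI
  simp only [integral_const_mul] at hI
  linarith

end

end NearFlat

/-- The positive bulk term at scale `l` dominates the local energy density on `r ≤ 2 l`. -/
lemma main_term_ge {E w q r l : ℝ} (hE : 0 ≤ E) (hl : 0 < l) (hq : 0 < q) (hr0 : 0 ≤ r)
    (hr : r ≤ 2 * l) (hql : q ^ 2 * (r ^ 2 + l ^ 2) = 1) :
    1 / 64 * (l⁻¹ * (E + (l ^ 2)⁻¹ * w ^ 2)) ≤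
      1 / 2 * l ^ 2 * q ^ 3 * E + 3 / 2 * l ^ 2 * q ^ 5 * w ^ 2 := by
  have ha : (11 / 25 : ℝ) ≤ q * l := by
    have h1 : 1 ≤ 5 * (q * l) ^ 2 := by
      have : r ^ 2 ≤ 4 * l ^ 2 := by nlinarith
      nlinarith [mul_le_mul_of_nonneg_left this (sq_nonneg q)]
    have h0 : 0 < q * l := by positivity
    nlinarith
  set a := q * l with hadef
  have hqa : q = a / l := by rw [hadef]; field_simp
  have e1 : 1 / 2 * l ^ 2 * q ^ 3 * E = 1 / 2 * a ^ 3 * (l⁻¹ * E) := by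
    rw [hqa]; field_simp
  have e2 : 3 / 2 * l ^ 2 * q ^ 5 * w ^ 2 = 3 / 2 * a ^ 5 * (l⁻¹ * ((l ^ 2)⁻¹ * w ^ 2)) := by
    rw [hqa]; field_simp
  have a3 : (11 / 25 : ℝ) ^ 3 ≤ a ^ 3 := by gcongr
  have a5 : (11 / 25 : ℝ) ^ 5 ≤ a ^ 5 := by gcongr
  rw [e1, e2, mul_add, mul_add]
  gcongr
  · norm_num at a3; linarith
  · norm_num at a5; linarith

namespace NearFlat

variable {ρ : ℝ} {κ : ℕ → ℝ} {h : Fin (n + 1) → Fin (n + 1) → SpaceTime n → ℝ}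
  {B : Set (Space n)} {w : SpaceTime n → ℝ}

/-- The flux of the Morawetz current through a time slice, after Hardy's inequality. -/
lemma abs_flux_le (H : NearFlat K ρ κ h) (hn : 3 ≤ n) (hK : IsClosed K) (hB : IsCompact B)
    (hBK : B ⊆ Kᶜ) (hBρ : ∀ x ∈ B, ρ < ‖x‖) (hw : CD K 2 w) (h0 : SuppIn K B w)
    (hκ : ∀ j, κ j ≤ 1 / (8 * (n + 1 : ℝ) ^ 2)) {l t : ℝ} (hl : 1 ≤ l) (ht : 0 ≤ t) :
    |∫ x in Kᶜ, current K h (fun γ p => xc γ p * qf l p) (qf l) (((n : ℝ) - 1) / 2) w 0 (t, x)| ≤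
      15 * (n + 1 : ℝ) ^ 2 * ∫ x in Kᶜ, engy K w (t, x) := by
  have hl0 : 0 < l := by linarith
  set N : ℝ := (n : ℝ) + 1 with hN
  have hn3 : (3 : ℝ) ≤ n := by exact_mod_cast hn
  have hN1 : 1 ≤ N := by rw [hN]; linarith
  have hw1 : CD K 1 w := hw.of_le (by norm_num)
  set c : ℝ := ((n : ℝ) - 1) / 2 with hc
  have hXs : ∀ γ, Smooth K (fun p => xc γ p * qf (n := n) l p) := fun γ =>
    (smooth_xc γ).mul (smooth_qf hl0)
  have hJc := cd_current hK c H.smooth hXs (smooth_qf hl0) hw 0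
  have hJs := h0.current hB.isClosed (h := h) (X := fun γ p => xc γ p * qf l p) (q := qf l) c 0
  have hpt : ∀ p ∈ region K, |current K h (fun γ p => xc γ p * qf l p) (qf l) c w 0 p| ≤
      3 * N ^ 2 * (engy K w p + qf l p ^ 2 * w p ^ 2) := by
    intro p hp
    by_cases hpB : p.2 ∈ B
    · have hρ := hBρ _ hpB
      have hE := engy_nonneg (K := K) w p
      have hsq : √(engy K w p) * √(engy K w p) = engy K w p := Real.mul_self_sqrt hE
      have hq0 := qf_pos hl0 p
      have hqr := qf_mul_norm_le hl0 p
      have hdq : dd K 0 (qf l) p = 0 := by rw [dd_qf hK hl0 0 hp, xc_zero]; ring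
      simp only [current, xc_zero, hdq, zero_mul, mul_zero, sub_zero]
      set D := √(engy K w p)
      set q := qf l p
      have hD0 : 0 ≤ D := Real.sqrt_nonneg _
      have b1 : |∑ β, h 0 β p * dd K β w p| ≤ (n + 1 : ℕ) * (2 * D) :=
        abs_sum_le_card fun β => by
          rw [abs_mul]
          refine mul_le_mul ?_ (abs_dd_le_sqrt w p β) (abs_nonneg _) two_pos.le
          have h1 := H.close 0 β p hp hρ
          have h2 := hκ (dyIdx p.2)
          have h3 : |minkowski n 0 β| ≤ 1 := by
            rw [minkowski_apply, sp]
            split_ifs <;> norm_num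
          have h4 : 1 / (8 * N ^ 2) ≤ 1 := by
            rw [div_le_one (by positivity)]
            nlinarith
          have h5 := abs_sub_abs_le_abs_sub (h 0 β p) (minkowski n 0 β)
          linarith
      have b2 : |∑ γ, xc γ p * q * dd K γ w p| ≤ (n + 1 : ℕ) * (1 * D) :=
        abs_sum_le_card fun γ => by
          rw [abs_mul, abs_mul, abs_of_pos hq0]
          refine mul_le_mul ?_ (abs_dd_le_sqrt w p γ) (abs_nonneg _) zero_le_one
          have := mul_le_mul_of_nonneg_right (abs_xc_le γ p) hq0.le
          linarith
      have b3 : |c * (q * w p)| ≤ N * (q * |w p|) := by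
        rw [abs_mul, abs_mul, abs_of_pos hq0, abs_of_nonneg (by rw [hc]; linarith)]
        gcongr
        rw [hc, hN]; linarith
      push_cast at b1 b2
      rw [← hN] at b1 b2
      rw [abs_mul]
      calc _ ≤ (N * (2 * D)) * (N * (1 * D) + N * (q * |w p|)) :=
            mul_le_mul b1 ((abs_add_le _ _).trans (add_le_add b2 b3)) (abs_nonneg _) (by positivity)
        _ = 2 * N ^ 2 * (D * D + D * (q * |w p|)) := by ring
        _ ≤ 2 * N ^ 2 * (D * D + (1 / 2 * (D * D) + 1 / 2 * (q ^ 2 * w p ^ 2))) := by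
            gcongr
            have h1 : (q * |w p|) ^ 2 = q ^ 2 * w p ^ 2 := by rw [mul_pow, sq_abs]
            have h2 := sq_nonneg (D - q * |w p|)
            rw [sub_sq, h1] at h2
            linarith
        _ ≤ 3 * N ^ 2 * (engy K w p + q ^ 2 * w p ^ 2) := by
            rw [hsq]
            have : 0 ≤ N ^ 2 * (q ^ 2 * w p ^ 2) := by positivity
            linarith
    · rw [hJs p hp hpB, suppIn_engy hB.isClosed h0 p hp hpB, h0 p hp hpB]
      simp
  have iJ : IntegrableOn (fun x => current K h (fun γ p => xc γ p * qf l p) (qf l) c w 0 (t, x)) Kᶜ :=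
    integrableOn_slice hK hB hBK hJc.continuousOn hJs ht
  have iE : IntegrableOn (fun x => engy K w (t, x)) Kᶜ :=
    integrableOn_slice hK hB hBK (continuousOn_engy hK hw1) (suppIn_engy hB.isClosed h0) ht
  have iq : IntegrableOn (fun x => qf l (t, x) ^ 2 * w (t, x) ^ 2) Kᶜ :=
    integrableOn_slice (f := fun p => qf l p ^ 2 * w p ^ 2) hK hB hBK
      (((smooth_qf hl0).continuousOn.pow 2).mul (hw1.continuousOn.pow 2))
      (fun p hp h => by simp [h0 p hp h]) ht
  have hI := setIntegral_mono_on iJ.abs ((iE.add iq).const_mul (3 * N ^ 2)) hK.measurableSet.compl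
    fun x hx => hpt (t, x) ⟨ht, hx⟩
  simp only [Pi.add_apply] at hI
  rw [integral_const_mul, integral_add iE iq] at hI
  have hH := hardy hn hK hB hBK hw1 h0 hl0 ht
  refine (abs_integral_le_integral_abs).trans (hI.trans ?_)
  have hH' : ∫ x in Kᶜ, qf l (t, x) ^ 2 * w (t, x) ^ 2 ≤ 4 * ∫ x in Kᶜ, engy K w (t, x) := hH
  have : 0 ≤ N ^ 2 := by positivity
  nlinarith

/-- The Morawetz estimate at scale `2^i`, from the multiplier
`q (x · ∇w + (n - 1) / 2 w)` with `q = (|x|² + 4^i)^{-1/2}`. -/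
lemma morawetz_le (H : NearFlat K ρ κ h) (hn : 3 ≤ n) (hK : IsClosed K) (hB : IsCompact B)
    (hBK : B ⊆ Kᶜ) (hBρ : ∀ x ∈ B, ρ < ‖x‖) (hw : CD K 2 w) (h0 : SuppIn K B w) {T : ℝ}
    (hT : 0 ≤ T) (hκ : ∀ j, κ j ≤ 1 / (8 * (n + 1 : ℝ) ^ 2)) {m : ℕ}
    (hm : ∀ x ∈ B, dyIdx x < m) (i : ℕ) :
    ∫ p in Set.Icc 0 T ×ˢ Kᶜ, shell K w i p ≤ 64 * (15 * (n + 1 : ℝ) ^ 2 *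
        ((∫ x in Kᶜ, engy K w (T, x)) + ∫ x in Kᶜ, engy K w (0, x)) +
      (n + 1 : ℝ) * (∫ p in Set.Icc 0 T ×ˢ Kᶜ, |source K h w p| * vsum K w p) +
      9 * (n + 1 : ℝ) ^ 3 * ∑ J ∈ Finset.range m, κ J * ∫ p in Set.Icc 0 T ×ˢ Kᶜ, shell K w J p) := by
  set l : ℝ := 2 ^ i with hldef
  have hl : 1 ≤ l := one_le_pow₀ (by norm_num)
  have hl0 : 0 < l := by linarith
  set N : ℝ := (n : ℝ) + 1 with hN
  have hn3 : (3 : ℝ) ≤ n := by exact_mod_cast hn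
  have hN1 : 1 ≤ N := by rw [hN]; linarith
  have hw1 : CD K 1 w := hw.of_le (by norm_num)
  set c : ℝ := ((n : ℝ) - 1) / 2 with hc
  set X : Fin (n + 1) → SpaceTime n → ℝ := fun γ p => xc γ p * qf l p with hX
  have hqs : Smooth K (qf (n := n) l) := smooth_qf hl0
  have hXs : ∀ γ, Smooth K (X γ) := fun γ => (smooth_xc γ).mul hqs
  set J := current K h X (qf l) c w with hJ
  have hJc : ∀ α, CD K 1 (J α) := fun α => cd_current hK c H.smooth hXs hqs hw α
  have hJs : ∀ α, SuppIn K B (J α) := fun α => h0.current hB.isClosed c α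
  have hdiv := integral_divergence hK hB hBK hJc hJs hT
  have hmeas := measurableSet_region_slab hK T
  have hFT := (abs_le.1 (H.abs_flux_le hn hK hB hBK hBρ hw h0 hκ hl hT)).2
  have hF0 := (abs_le.1 (H.abs_flux_le hn hK hB hBK hBρ hw h0 hκ hl le_rfl)).1
  have hpt : ∀ p ∈ (Set.Icc 0 T ×ˢ Kᶜ : Set (SpaceTime n)), 1 / 64 * shell K w i p -
      (N * (|source K h w p| * vsum K w p) +
      9 * N ^ 3 * ∑ J ∈ Finset.range m, κ J * shell K w J p) ≤ ∑ α, dd K α (J α) p := by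
    intro p hpT
    have hp := slab_subset T hpT
    have hE := engy_nonneg (K := K) w p
    by_cases hpB : p.2 ∈ B
    · have hρ := hBρ _ hpB
      have hr0 : 0 < ‖p.2‖ := lt_of_lt_of_le one_pos (H.one_le.trans hρ.le)
      have hq0 := qf_pos hl0 p
      have hql := qf_sq hl0 p
      have hqr := qf_mul_norm_le hl0 p
      have hqr' : qf l p ≤ 1 / ‖p.2‖ := by rwa [le_div_iff₀ hr0]
      have hq3 : qf l p ^ 3 * ‖p.2‖ ≤ 1 / ‖p.2‖ ^ 2 := by
        rw [le_div_iff₀ (by positivity)]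
        calc qf l p ^ 3 * ‖p.2‖ * ‖p.2‖ ^ 2 = (qf l p * ‖p.2‖) ^ 3 := by ring
          _ ≤ 1 := pow_le_one₀ (by positivity) hqr
      have hDX : ∀ α γ, dd K α (X γ) p =
          (if α = γ then sp α else 0) * qf l p - xc α p * xc γ p * qf l p ^ 3 := fun α γ =>
        dd_xc_mul_qf hK hl0 α γ hp
      rw [hJ, dd_current_eq hK c H.smooth hXs hqs hw H.symm hp]
      simp only [hDX, dd_qf hK hl0 _ hp, sum_dd_dd_qf hK hl0 hp]
      have hb := H.abs_bulk_sub_le_sum (w := w)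
        (DX := fun α γ => (if α = γ then sp α else 0) * qf l p - xc α p * xc γ p * qf l p ^ 3)
        (X := fun γ => X γ p) (Dq := fun α => -(xc α p * qf l p ^ 3)) (c := c) (q := qf l p)
        (e := -(n * qf l p ^ 3) + 3 * ‖p.2‖ ^ 2 * qf l p ^ 5) hp hρ (hm _ hpB)
        (fun α => by
          rw [hX, abs_mul, abs_of_pos hq0]
          have := mul_le_mul_of_nonneg_right (abs_xc_le α p) hq0.le
          linarith)
        (fun α β => by
          have h1 : |(if α = β then sp α else 0) * qf l p| ≤ 1 / ‖p.2‖ := by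
            rw [abs_mul, abs_of_pos hq0]
            refine le_trans (mul_le_of_le_one_left hq0.le ?_) hqr'
            unfold sp
            split_ifs <;> norm_num
          have h2 : |xc α p * xc β p * qf l p ^ 3| ≤ 1 / ‖p.2‖ := by
            rw [abs_mul, abs_mul, abs_of_pos (by positivity : 0 < qf l p ^ 3)]
            calc |xc α p| * |xc β p| * qf l p ^ 3 ≤ ‖p.2‖ * ‖p.2‖ * qf l p ^ 3 := by
                  gcongr
                  · exact abs_xc_le α p
                  · exact abs_xc_le β p
              _ = (qf l p ^ 3 * ‖p.2‖) * ‖p.2‖ := by ring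
              _ ≤ 1 / ‖p.2‖ ^ 2 * ‖p.2‖ := by gcongr
              _ = 1 / ‖p.2‖ := by field_simp
          rw [show 2 / ‖p.2‖ = 1 / ‖p.2‖ + 1 / ‖p.2‖ by ring]
          rw [abs_le] at h1 h2 ⊢
          constructor <;> linarith [h1.1, h1.2, h2.1, h2.2])
        (fun α => by
          rw [abs_neg, abs_mul, abs_of_pos (by positivity : 0 < qf l p ^ 3)]
          have := mul_le_mul_of_nonneg_right (abs_xc_le α p) (by positivity : 0 ≤ qf l p ^ 3)
          linarith) hq0.le hqr' (by rw [hc]; linarith) (by rw [hc]; linarith)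
      have hmain := bulk_minkowski_ge hn (x := fun α => xc α p) (d := fun α => dd K α w p)
        (w := w p) (xc_zero p) (sum_xc_sq p) hq0 hql
      have hshell : 1 / 64 * shell K w i p ≤ 1 / 2 * l ^ 2 * qf l p ^ 3 * (∑ α, dd K α w p ^ 2) +
          3 / 2 * l ^ 2 * qf l p ^ 5 * w p ^ 2 := by
        by_cases hpi : ‖p.2‖ ≤ 2 ^ (i + 1)
        · have hs : shell K w i p = l⁻¹ * (engy K w p + (l ^ 2)⁻¹ * w p ^ 2) :=
            Set.indicator_of_mem (s := {p : SpaceTime n | ‖p.2‖ ≤ 2 ^ (i + 1)}) hpi _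
          rw [hs]
          refine main_term_ge hE hl0 hq0 hr0.le ?_ hql
          rwa [hldef, ← pow_succ']
        · have hs : shell K w i p = 0 :=
            Set.indicator_of_notMem (s := {p : SpaceTime n | ‖p.2‖ ≤ 2 ^ (i + 1)}) hpi _
          rw [hs, mul_zero]
          have : 0 ≤ ∑ α, dd K α w p ^ 2 := hE
          positivity
      have hs : |source K h w p * (∑ γ, X γ p * dd K γ w p + c * (qf l p * w p))| ≤
          N * (|source K h w p| * vsum K w p) := by
        rw [abs_mul, mul_left_comm N]
        refine mul_le_mul_of_nonneg_left ?_ (abs_nonneg _)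
        refine (abs_add_le _ _).trans ?_
        rw [vsum, mul_add]
        refine add_le_add ?_ ?_
        · refine (Finset.abs_sum_le_sum_abs _ _).trans ?_
          have h1 : ∑ γ, |X γ p * dd K γ w p| ≤ ∑ γ, |dd K γ w p| := by
            refine Finset.sum_le_sum fun γ _ => ?_
            rw [abs_mul]
            refine mul_le_of_le_one_left (abs_nonneg _) ?_
            rw [hX, abs_mul, abs_of_pos hq0]
            have := mul_le_mul_of_nonneg_right (abs_xc_le γ p) hq0.le
            linarith
          have h2 : 0 ≤ ∑ γ, |dd K γ w p| := Finset.sum_nonneg fun _ _ => abs_nonneg _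
          exact h1.trans (le_mul_of_one_le_left h2 hN1)
        · rw [abs_mul, abs_mul, abs_of_pos hq0, abs_of_nonneg (by rw [hc]; linarith)]
          gcongr
          · rw [hc, hN]; linarith
          · exact qf_anti one_pos hl p
      have h1 := (abs_le.1 hs).1
      have h2 := (abs_le.1 hb).1
      linarith
    · rw [Finset.sum_eq_zero fun α _ => (hJs α).along hB.isClosed (coordField α) p hp hpB]
      have h1 : 0 ≤ ∑ J ∈ Finset.range m, κ J * shell K w J p :=
        Finset.sum_nonneg fun i _ => mul_nonneg (H.nonneg i) (shell_nonneg w i p)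
      have h2 := mul_nonneg (abs_nonneg (source K h w p)) (vsum_nonneg (K := K) w p)
      have h3 : shell K w i p = 0 := by
        simp [shell, suppIn_engy hB.isClosed h0 p hp hpB, h0 p hp hpB]
      have : 0 ≤ N ^ 3 := by positivity
      rw [h3]
      nlinarith
  have iS : ∀ i, IntegrableOn (shell K w i) (Set.Icc 0 T ×ˢ Kᶜ) := fun i =>
    integrableOn_shell hK hB hBK hw1 h0 i T
  have iV : IntegrableOn (fun p => |source K h w p| * vsum K w p) (Set.Icc 0 T ×ˢ Kᶜ) :=
    integrableOn_slab hK hB hBK ((continuousOn_source hK H.smooth hw).abs.mul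
      (continuousOn_vsum hK hw1)) (fun p hp h => by
        have h1 : ∀ β, dd K β w p = 0 := fun β => h0.along hB.isClosed (coordField β) p hp h
        simp [vsum, h1, h0 p hp h]) T
  have iD : IntegrableOn (fun p => ∑ α, dd K α (J α) p) (Set.Icc 0 T ×ˢ Kᶜ) :=
    integrable_finsetSum _ fun α _ => integrableOn_slab hK hB hBK
      (ContDiffOn.continuousOn (CD.dd (m := 0) hK (hJc α) α)) ((hJs α).along hB.isClosed _) T
  have iSum : IntegrableOn (fun p => ∑ J ∈ Finset.range m, κ J * shell K w J p)
      (Set.Icc 0 T ×ˢ Kᶜ) := integrable_finsetSum _ fun i _ => (iS i).const_mul _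
  have iA : IntegrableOn (fun p => N * (|source K h w p| * vsum K w p) +
      9 * N ^ 3 * ∑ J ∈ Finset.range m, κ J * shell K w J p) (Set.Icc 0 T ×ˢ Kᶜ) :=
    (iV.const_mul N).add (iSum.const_mul (9 * N ^ 3))
  have hI := setIntegral_mono_on (((iS i).const_mul (1 / 64)).sub iA) iD hmeas hpt
  simp only [Pi.sub_apply] at hI
  rw [integral_sub ((iS i).const_mul _) iA, integral_add (iV.const_mul _) (iSum.const_mul _),
    integral_const_mul, integral_const_mul, integral_const_mul,
    integral_finsetSum _ fun i _ => (iS i).const_mul _, hdiv] at hI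
  simp only [integral_const_mul] at hI
  linarith

/-- The local energy estimate for compactly supported functions in the exterior region, in which
the coefficients are close to the Minkowski ones. -/
theorem exterior_estimate (H : NearFlat K ρ κ h) (hn : 3 ≤ n) (hK : IsClosed K) (hB : IsCompact B)
    (hBK : B ⊆ Kᶜ) (hBρ : ∀ x ∈ B, ρ < ‖x‖) (hw : CD K 2 w) (h0 : SuppIn K B w) {T : ℝ}
    (hT : 0 ≤ T)
    (hκ : ∀ m, ∑ j ∈ Finset.range m, κ j ≤ 1 / (80000 * (n + 1 : ℝ) ^ 5)) :
    (∫ x in Kᶜ, engy K w (T, x) ≤ 80000 * (n + 1 : ℝ) ^ 5 * ((∫ x in Kᶜ, engy K w (0, x)) +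
        ∫ p in Set.Icc 0 T ×ˢ Kᶜ, |source K h w p| * vsum K w p)) ∧
      ∀ i, ∫ p in Set.Icc 0 T ×ˢ Kᶜ, shell K w i p ≤ 80000 * (n + 1 : ℝ) ^ 5 *
        ((∫ x in Kᶜ, engy K w (0, x)) +
        ∫ p in Set.Icc 0 T ×ˢ Kᶜ, |source K h w p| * vsum K w p) := by
  obtain ⟨Rb, hRb⟩ := hB.isBounded.exists_norm_le
  obtain ⟨m, hm⟩ : ∃ m, ∀ x ∈ B, dyIdx x < m := ⟨Nat.log 2 ⌊Rb⌋₊ + 1, fun x hx =>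
    Nat.lt_succ_of_le (Nat.log_mono_right (Nat.floor_mono (hRb x hx)))⟩
  have hN1 : (1 : ℝ) ≤ n + 1 := by linarith [(Nat.cast_nonneg n : (0 : ℝ) ≤ n)]
  have hκ' : ∀ j, κ j ≤ 1 / (8 * (n + 1 : ℝ) ^ 2) := fun j => by
    have h1 := (Finset.single_le_sum (f := κ) (fun i _ => H.nonneg i)
      (Finset.self_mem_range_succ j)).trans (hκ (j + 1))
    refine h1.trans ?_
    have : (n + 1 : ℝ) ^ 2 ≤ (n + 1 : ℝ) ^ 5 := pow_le_pow_right₀ hN1 (by norm_num)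
    gcongr
    norm_num
  have hE := H.energy_le hK hB hBK hBρ hw h0 hT hκ' hm
  have hM := H.morawetz_le hn hK hB hBK hBρ hw h0 hT hκ' hm
  have hA0 : 0 ≤ ∫ x in Kᶜ, engy K w (0, x) := integral_nonneg fun _ => engy_nonneg _ _
  have hR0 : 0 ≤ ∫ p in Set.Icc 0 T ×ˢ Kᶜ, |source K h w p| * vsum K w p :=
    integral_nonneg fun _ => mul_nonneg (abs_nonneg _) (vsum_nonneg _ _)
  set N : ℝ := (n : ℝ) + 1 with hN
  set A := ∫ x in Kᶜ, engy K w (0, x)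
  set R := ∫ p in Set.Icc 0 T ×ˢ Kᶜ, |source K h w p| * vsum K w p
  set s := ∑ J ∈ Finset.range m, κ J * ∫ p in Set.Icc 0 T ×ˢ Kᶜ, shell K w J p with hs
  have hs0 : 0 ≤ s := Finset.sum_nonneg fun i _ => mul_nonneg (H.nonneg i)
    (integral_nonneg fun _ => shell_nonneg _ _ _)
  have p1 : N ≤ N ^ 5 := le_self_pow₀ hN1 (by norm_num)
  have p2 : N ^ 2 ≤ N ^ 5 := pow_le_pow_right₀ hN1 (by norm_num)
  have p3 : N ^ 3 ≤ N ^ 5 := pow_le_pow_right₀ hN1 (by norm_num)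
  have p0 : 0 < N ^ 5 := by positivity
  have hC : ∀ i, ∫ p in Set.Icc 0 T ×ˢ Kᶜ, shell K w i p ≤ 40000 * N ^ 5 * (A + R + s) := by
    intro i
    refine (hM i).trans ?_
    have h1 : 15 * N ^ 2 * ((∫ x in Kᶜ, engy K w (T, x)) + A) ≤
        15 * N ^ 2 * (4 * (A + R + 9 * N ^ 3 * s) + A) := by gcongr
    have e1 : 15 * N ^ 2 * (4 * (A + R + 9 * N ^ 3 * s) + A) =
        75 * (N ^ 2 * A) + 60 * (N ^ 2 * R) + 540 * (N ^ 5 * s) := by ring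
    have q1 := mul_le_mul_of_nonneg_right p2 hA0
    have q2 := mul_le_mul_of_nonneg_right p2 hR0
    have q3 := mul_le_mul_of_nonneg_right p1 hR0
    have q4 := mul_le_mul_of_nonneg_right p3 hs0
    have q5 : 0 ≤ N ^ 5 * A := by positivity
    have q6 : 0 ≤ N ^ 5 * R := by positivity
    have q7 : 0 ≤ N ^ 5 * s := by positivity
    linarith
  -- the sum on the right is absorbed
  have hsle : s ≤ A + R := by
    have h1 : s ≤ ∑ J ∈ Finset.range m, κ J * (40000 * N ^ 5 * (A + R + s)) :=
      Finset.sum_le_sum fun i _ => mul_le_mul_of_nonneg_left (hC i) (H.nonneg i)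
    rw [← Finset.sum_mul] at h1
    have h2 : (∑ J ∈ Finset.range m, κ J) * (40000 * N ^ 5 * (A + R + s)) ≤
        1 / (80000 * N ^ 5) * (40000 * N ^ 5 * (A + R + s)) := by gcongr; exact hκ m
    have h3 : 1 / (80000 * N ^ 5) * (40000 * N ^ 5 * (A + R + s)) = (A + R + s) / 2 := by
      field_simp; ring
    linarith
  refine ⟨hE.trans ?_, fun i => (hC i).trans ?_⟩
  · have q1 := mul_le_mul_of_nonneg_right p3 hs0
    have q2 := mul_le_mul_of_nonneg_left hsle p0.le
    have q3 : 1 * (A + R) ≤ N ^ 5 * (A + R) :=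
      mul_le_mul_of_nonneg_right (hN1.trans p1) (by positivity)
    linarith
  · have := mul_le_mul_of_nonneg_left hsle (by positivity : 0 ≤ 40000 * N ^ 5)
    linarith

end NearFlat

/-! ### Pointwise bounds for the commuted equation -/

/-- The words in the fields `Z` of length at most `k` with at most `j` rotations. -/
def lowW (n k j : ℕ) : Finset (List (ZIndex n)) :=
  (wordsLe (ZIndex n) k).filter fun b => rot b ≤ j

lemma mem_lowW {k j : ℕ} {b : List (ZIndex n)} : b ∈ lowW n k j ↔ b.length ≤ k ∧ rot b ≤ j := by
  rw [lowW, Finset.mem_filter, mem_wordsLe]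

/-- The sum of `|∂_α Z^b u|` over the words `b` in `W`. -/
def grad (K : Set (Space n)) (W : Finset (List (ZIndex n))) (u : SpaceTime n → ℝ)
    (p : SpaceTime n) : ℝ :=
  ∑ b ∈ W, ∑ α, |dd K α (zw K b u) p|

lemma grad_nonneg (W : Finset (List (ZIndex n))) (u : SpaceTime n → ℝ) (p : SpaceTime n) :
    0 ≤ grad K W u p :=
  Finset.sum_nonneg fun _ _ => Finset.sum_nonneg fun _ _ => abs_nonneg _

lemma zw_cz_cons (γ : Fin (n + 1)) (b : List (ZIndex n)) (u : SpaceTime n → ℝ) :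
    zw K (cz γ :: b) u = dd K γ (zw K b u) := zz_cz γ (zw K b u)

lemma exists_tail {κ : ℕ → ℝ} (hs : Summable κ) {δ : ℝ} (hδ : 0 < δ) :
    ∃ J₀, ∀ m, ∑ j ∈ Finset.range m, (if J₀ ≤ j then κ j else 0) ≤ δ := by
  obtain ⟨s, hs⟩ := summable_iff_vanishing_norm.1 hs δ hδ
  refine ⟨s.sup id + 1, fun m => ?_⟩
  rw [← Finset.sum_filter]
  refine (le_abs_self _).trans (hs _ ?_).le
  rw [Finset.disjoint_left]
  intro j hj hjs
  have := Finset.le_sup (f := id) hjs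
  have := (Finset.mem_filter.1 hj).2
  simp only [id] at *
  omega

lemma le_dyIdx {J : ℕ} {x : Space n} (h : 2 ^ J < ‖x‖) : J ≤ dyIdx x := by
  have := (pow_lt_pow_iff_right₀ (by norm_num : (1 : ℝ) < 2)).1 (h.trans (lt_two_pow_dyIdx x))
  omega

lemma exists_sum_decW {ι : Type*} (t : Finset ι) {ρ : ℝ} {s : ℕ} {f : ι → SpaceTime n → ℝ}
    (h : ∀ i ∈ t, DecW K ρ s (f i)) : ∃ κ : ℕ → ℝ, Summable κ ∧ (∀ j, 0 ≤ κ j) ∧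
      ∀ i ∈ t, ∀ p ∈ region K, ρ < ‖p.2‖ → ‖p.2‖ ^ s * |f i p| ≤ κ (dyIdx p.2) := by
  classical
  induction t using Finset.induction_on with
  | empty => exact ⟨0, summable_zero, fun _ => le_rfl, by simp⟩
  | insert i t hi ih =>
    obtain ⟨κ, h1, h2, h3⟩ := ih fun i hi => h i (Finset.mem_insert_of_mem hi)
    obtain ⟨κ', h1', h2', h3'⟩ := h i (Finset.mem_insert_self _ _)
    refine ⟨fun j => κ j + κ' j, h1.add h1', fun j => add_nonneg (h2 j) (h2' j),
      fun l hl p hp hr => ?_⟩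
    rcases Finset.mem_insert.1 hl with rfl | hl
    · exact (h3' p hp hr).trans (le_add_of_nonneg_left (h2 _))
    · exact (h3 l hl p hp hr).trans (le_add_of_nonneg_right (h2' _))

/-- `h^{αβ} ∂_α ∂_β Z^a u - Z^a □ u` is of first order in the `Z^b u`, with coefficients
in `𝒜₁`. -/
lemma FarMetric.exists_source_zw {ρ : ℝ} {g : MatrixField n} (hg : FarMetric K ρ g)
    (a : List (ZIndex n)) : ∃ κ : ℕ → ℝ, Summable κ ∧ (∀ j, 0 ≤ κ j) ∧
      ∀ k, a.length ≤ k → ∀ u, CD K (k + 2) u → ∀ p ∈ region K, ρ < ‖p.2‖ →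
        ‖p.2‖ * |source K (fun α β p => (g p)⁻¹ α β) (zw K a u) p - zw K a (box K g u) p| ≤
          κ (dyIdx p.2) * grad K (lowW n k (rot a)) u p := by
  obtain ⟨Φ, hΦ, e⟩ := hg.exists_box_zw a
  have hΨ := hΦ.add (LinOp.sum Finset.univ fun β _ => LinOp.term (α := β) (b := a)
    (c := fun p => (-1) * boxLower K g β p)
    (show Sym K ρ 1 _ from (hg.lower β).const_mul hg.closed (-1)) ⟨le_rfl, le_rfl⟩)
  obtain ⟨κ, h1, h2, h3⟩ := hΨ.bound_sym (lowW n a.length (rot a)) fun α b hb => mem_lowW.2 hb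
  refine ⟨κ, h1, h2, fun k hk u hu p hp hr => ?_⟩
  have hza : CD K 2 (zw K a u) := CD.zw hg.closed a (hu.of_le (by omega))
  have h4 := e u (hu.of_le (by omega)) p hp
  rw [box_eq hg.closed hg.lorentz hza hp] at h4
  have h5 : source K (fun α β p => (g p)⁻¹ α β) (zw K a u) p - zw K a (box K g u) p =
      Φ u p + ∑ β, (-1) * boxLower K g β p * dd K β (zw K a u) p := by
    simp only [source, neg_mul, one_mul, Finset.sum_neg_distrib]
    linarith
  rw [h5]
  refine (h3 u p hp hr).trans ?_
  refine mul_le_mul_of_nonneg_left (Finset.sum_le_sum_of_subset_of_nonneg ?_ fun _ _ _ =>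
    Finset.sum_nonneg fun _ _ => abs_nonneg _) (h2 _)
  intro b hb
  rw [mem_lowW] at hb ⊢
  omega

/-- Far out, the metric and the commutators are as small as required. -/
lemma FarMetric.exists_commuted {ρ₀ : ℝ} {g : MatrixField n} (hg : FarMetric K ρ₀ g) (k : ℕ)
    {δ : ℝ} (hδ : 0 < δ) : ∃ ρ ≥ ρ₀, ∃ κ : ℕ → ℝ,
      NearFlat K ρ κ (fun α β p => (g p)⁻¹ α β) ∧ (∀ m, ∑ j ∈ Finset.range m, κ j ≤ δ) ∧
      ∀ u, CD K (k + 2) u → ∀ a : List (ZIndex n), a.length ≤ k → ∀ p ∈ region K, ρ < ‖p.2‖ →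
        ‖p.2‖ * |source K (fun α β p => (g p)⁻¹ α β) (zw K a u) p - zw K a (box K g u) p| ≤
          κ (dyIdx p.2) * grad K (lowW n k (rot a)) u p := by
  obtain ⟨κ₁, s₁, p₁, b₁⟩ := exists_sum_decW (Finset.univ : Finset (Fin (n + 1) × Fin (n + 1)))
    fun i _ => (hg.inv i.1 i.2).decW
  obtain ⟨κ₂, s₂, p₂, b₂⟩ := exists_sum_decW
    (Finset.univ : Finset ((Fin (n + 1) × Fin (n + 1)) × Fin (n + 1)))
    fun i _ => ((hg.inv i.1.1 i.1.2).dd hg.closed i.2).decW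
  choose κ₃ s₃ p₃ b₃ using hg.exists_source_zw
  set κ := fun j => κ₁ j + κ₂ j + ∑ a ∈ wordsLe (ZIndex n) k, κ₃ a j with hκ
  have hp3 : ∀ j, 0 ≤ ∑ a ∈ wordsLe (ZIndex n) k, κ₃ a j := fun j =>
    Finset.sum_nonneg fun a _ => p₃ a j
  have hκs : Summable κ := (s₁.add s₂).add (summable_sum fun a _ => s₃ a)
  have hκ0 : ∀ j, 0 ≤ κ j := fun j => add_nonneg (add_nonneg (p₁ j) (p₂ j)) (hp3 j)
  obtain ⟨J₀, hJ₀⟩ := exists_tail hκs hδ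
  have hk : ∀ {p : SpaceTime n}, max ρ₀ (2 ^ J₀) < ‖p.2‖ →
      ρ₀ < ‖p.2‖ ∧ (if J₀ ≤ dyIdx p.2 then κ (dyIdx p.2) else 0) = κ (dyIdx p.2) := fun h =>
    ⟨(le_max_left _ _).trans_lt h, if_pos (le_dyIdx ((le_max_right _ _).trans_lt h))⟩
  refine ⟨max ρ₀ (2 ^ J₀), le_max_left _ _, fun j => if J₀ ≤ j then κ j else 0,
    ⟨hg.one_le.trans (le_max_left _ _), fun α β => smooth_inverse hg.lorentz α β, ?_, ?_, ?_, ?_⟩,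
    hJ₀, ?_⟩
  · intro p hp α β
    have : ((g p)⁻¹).IsSymm := by
      have h1 := hg.lorentz.symm p hp
      rw [Matrix.IsSymm, Matrix.transpose_nonsing_inv, h1.eq]
    exact (this.apply α β).symm
  · intro j
    split_ifs
    exacts [hκ0 j, le_rfl]
  · intro α β p hp hr
    obtain ⟨hr, e⟩ := hk hr
    rw [e]
    have := b₁ (α, β) (Finset.mem_univ _) p hp hr
    rw [pow_zero, one_mul] at this
    have := p₂ (dyIdx p.2)
    have := hp3 (dyIdx p.2)
    simp only [hκ]
    linarith
  · intro α β γ p hp hr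
    obtain ⟨hr, e⟩ := hk hr
    rw [e]
    have := b₂ ((α, β), γ) (Finset.mem_univ _) p hp hr
    rw [pow_one] at this
    have := p₁ (dyIdx p.2)
    have := hp3 (dyIdx p.2)
    simp only [hκ]
    linarith
  · intro u hu a ha p hp hr
    obtain ⟨hr, e⟩ := hk hr
    beta_reduce
    rw [e]
    refine (b₃ a k ha u hu p hp hr).trans (mul_le_mul_of_nonneg_right ?_ (grad_nonneg _ _ _))
    have h1 := Finset.single_le_sum (f := fun a => κ₃ a (dyIdx p.2)) (fun a _ => p₃ a _)
      (mem_wordsLe.2 ha)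
    have := p₁ (dyIdx p.2)
    have := p₂ (dyIdx p.2)
    simp only [hκ]
    linarith

/-- A word with rotations is controlled by `|x|` times words with one rotation less. -/
lemma exists_pull_bound (hK : IsClosed K) (k : ℕ) : ∃ C : ℝ, 0 ≤ C ∧ ∀ u, CD K (k + 2) u →
    ∀ (j : ℕ) (a : List (ZIndex n)), a.length ≤ k + 1 → rot a = j + 1 → ∀ p ∈ region K,
      1 ≤ ‖p.2‖ → |zw K a u p| ≤ C * (‖p.2‖ * grad K (lowW n k j) u p) := by
  classical
  have h1 : ∀ a : List (ZIndex n), ∃ C : ℝ, 0 ≤ C ∧ (a.length ≤ k + 1 → ∀ u, CD K (k + 2) u →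
      ∀ j : ℕ, rot a = j + 1 → ∀ p ∈ region K, 1 ≤ ‖p.2‖ →
      |zw K a u p| ≤ C * (‖p.2‖ * grad K (lowW n k j) u p)) := by
    intro a
    by_cases ha : 1 ≤ rot a
    · obtain ⟨Φ, hΦ, e⟩ := exists_linOp_pull (K := K) hK a ha
      set A : Set (SpaceTime n) := {p | p ∈ region K ∧ 1 ≤ ‖p.2‖}
      have h2 := hΦ.mul_left (fun p => ‖p.2‖⁻¹)
        (Cf' := fun c => ∃ C : ℝ, ∀ p ∈ A, |c p| ≤ C) (by
          rintro c ⟨c₀, d, h⟩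
          refine ⟨|c₀| + ∑ l, |d l|, fun p hp => ?_⟩
          have hr : 0 < ‖p.2‖ := one_pos.trans_le hp.2
          beta_reduce
          rw [h p hp.1, abs_mul, abs_of_pos (inv_pos.2 hr), inv_mul_le_iff₀ hr, mul_add]
          refine (abs_add_le _ _).trans (add_le_add (le_mul_of_one_le_left (abs_nonneg _) hp.2) ?_)
          rw [Finset.mul_sum]
          refine (Finset.abs_sum_le_sum_abs _ _).trans (Finset.sum_le_sum fun l _ => ?_)
          rw [abs_mul, mul_comm]
          exact mul_le_mul_of_nonneg_right (abs_coord_le _ _) (abs_nonneg _))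
      obtain ⟨C, hC, hb⟩ := h2.bound (A := A) (fun c hc => hc)
        (lowW n (a.length - 1) (rot a - 1)) fun α b hb => mem_lowW.2 (by omega)
      refine ⟨C, hC, fun hak u hu j hj p hp hr => ?_⟩
      have h3 := hb u p ⟨hp, hr⟩
      have hr0 : 0 < ‖p.2‖ := one_pos.trans_le hr
      rw [e u (hu.of_le (by omega)) p hp]
      rw [abs_mul, abs_of_pos (inv_pos.2 hr0), inv_mul_le_iff₀ hr0] at h3
      refine h3.trans ?_
      rw [mul_left_comm]
      have : ∑ b ∈ lowW n (a.length - 1) (rot a - 1), ∑ α, |dd K α (zw K b u) p| ≤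
          grad K (lowW n k j) u p :=
        Finset.sum_le_sum_of_subset_of_nonneg (fun b hb => by rw [mem_lowW] at hb ⊢; omega)
          fun _ _ _ => Finset.sum_nonneg fun _ _ => abs_nonneg _
      gcongr
    · exact ⟨0, le_rfl, fun _ u _ j hj => by omega⟩
  choose C hC h using h1
  refine ⟨∑ a ∈ wordsLe (ZIndex n) (k + 1), C a, Finset.sum_nonneg fun a _ => hC a,
    fun u hu j a ha hj p hp hr => (h a ha u hu j hj p hp hr).trans ?_⟩
  refine mul_le_mul_of_nonneg_right (Finset.single_le_sum (fun a _ => hC a) (mem_wordsLe.2 ha)) ?_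
  exact mul_nonneg (norm_nonneg _) (grad_nonneg _ _ _)

/-- On a bounded set the derivatives `∂ Z^b u` are controlled by the `∂ ∂^c u`. -/
lemma exists_near_grad (hK : IsClosed K) (k : ℕ) (R : ℝ) : ∃ C : ℝ, 0 ≤ C ∧
    ∀ u, CD K (k + 1) u → ∀ b : List (ZIndex n), b.length ≤ k → ∀ α, ∀ p ∈ region K, ‖p.2‖ ≤ R →
      |dd K α (zw K b u) p| ≤ C * grad K (lowW n k 0) u p := by
  classical
  have h1 : ∀ i : List (ZIndex n) × Fin (n + 1), ∃ C : ℝ, 0 ≤ C ∧ (i.1.length ≤ k →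
      ∀ u, CD K (k + 1) u → ∀ p ∈ region K, ‖p.2‖ ≤ R →
      |dd K i.2 (zw K i.1 u) p| ≤ C * grad K (lowW n k 0) u p) := by
    rintro ⟨b, α⟩
    obtain ⟨Φ, hΦ, e⟩ := exists_linOp_near (K := K) hK b α
    obtain ⟨C, hC, hb⟩ := hΦ.bound (A := {p | p ∈ region K ∧ ‖p.2‖ ≤ R}) (by
      rintro c ⟨f, hf, h⟩
      obtain ⟨C, hC⟩ := (isCompact_closedBall (0 : Space n) R).exists_bound_of_continuousOn
        hf.continuous.continuousOn
      exact ⟨C, fun p hp => by rw [h p hp.1]; exact hC _ (by simpa using hp.2)⟩)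
      (lowW n b.length 0) fun α c hc => mem_lowW.2 (by omega)
    refine ⟨C, hC, fun hbk u hu p hp hr => ?_⟩
    dsimp only at hbk ⊢
    rw [e u (hu.of_le (by omega)) p hp]
    refine (hb u p ⟨hp, hr⟩).trans (mul_le_mul_of_nonneg_left ?_ hC)
    exact Finset.sum_le_sum_of_subset_of_nonneg (fun b hb => by rw [mem_lowW] at hb ⊢; omega)
      fun _ _ _ => Finset.sum_nonneg fun _ _ => abs_nonneg _
  choose C hC h using h1
  refine ⟨∑ i ∈ wordsLe (ZIndex n) k ×ˢ Finset.univ, C i, Finset.sum_nonneg fun a _ => hC a,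
    fun u hu b hb α p hp hr => (h (b, α) hb u hu p hp hr).trans ?_⟩
  exact mul_le_mul_of_nonneg_right (Finset.single_le_sum (fun a _ => hC a)
    (Finset.mem_product.2 ⟨mem_wordsLe.2 hb, Finset.mem_univ α⟩)) (grad_nonneg _ _ _)

/-- On a bounded set the functions `Z^b u` are controlled by the `∂^c u`. -/
lemma exists_near_zw (hK : IsClosed K) (k : ℕ) (R : ℝ) : ∃ C : ℝ, 0 ≤ C ∧
    ∀ u, CD K (k + 2) u → ∀ b : List (ZIndex n), b.length ≤ k → ∀ p ∈ region K, ‖p.2‖ ≤ R →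
      |zw K b u p| ≤ C * ∑ c ∈ lowW n k 0, |zw K c u p| := by
  classical
  -- the coefficients of the fields are bounded on bounded sets
  have hz : ∀ i : ZIndex n × Fin (n + 1), ∃ C : ℝ, 0 ≤ C ∧
      ∀ p : SpaceTime n, ‖p.2‖ ≤ R → |zCoef i.1 i.2 p| ≤ C := by
    rintro ⟨i, γ⟩
    obtain ⟨c₀, c, h⟩ := zCoef_affine i γ
    refine ⟨|c₀| + ∑ l, |c l| * |R|, by positivity, fun p hp => ?_⟩
    dsimp only
    rw [h p]
    refine (abs_add_le _ _).trans (add_le_add le_rfl ((Finset.abs_sum_le_sum_abs _ _).trans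
      (Finset.sum_le_sum fun l _ => ?_)))
    rw [abs_mul]
    exact mul_le_mul_of_nonneg_left ((abs_coord_le _ _).trans (hp.trans (le_abs_self R)))
      (abs_nonneg _)
  choose Cz hCz hz using hz
  have hsum0 : ∀ (m : ℕ) (u : SpaceTime n → ℝ) (p : SpaceTime n),
      0 ≤ ∑ c ∈ lowW n m 0, |zw K c u p| := fun m u p => Finset.sum_nonneg fun _ _ => abs_nonneg _
  rcases k with _ | k
  · refine ⟨1, zero_le_one, fun u _ b hb p hp hr => ?_⟩
    rw [one_mul]
    have hb0 : b = [] := by simpa using hb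
    exact Finset.single_le_sum (f := fun c => |zw K c u p|) (fun _ _ => abs_nonneg _)
      (mem_lowW.2 (by simp [hb0]))
  obtain ⟨C, hC, h⟩ := exists_near_grad (K := K) hK k R
  have hgrad : ∀ (u : SpaceTime n → ℝ) (p : SpaceTime n), grad K (lowW n k 0) u p ≤
      (n + 1) * ∑ c ∈ lowW n (k + 1) 0, |zw K c u p| := by
    intro u p
    rw [grad, Finset.sum_comm]
    calc ∑ α, ∑ b ∈ lowW n k 0, |dd K α (zw K b u) p| ≤
        ∑ _α : Fin (n + 1), ∑ c ∈ lowW n (k + 1) 0, |zw K c u p| := by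
          refine Finset.sum_le_sum fun α _ => ?_
          have e : ∑ b ∈ lowW n k 0, |dd K α (zw K b u) p| =
              ∑ c ∈ (lowW n k 0).image (cz α :: ·), |zw K c u p| := by
            rw [Finset.sum_image fun b _ b' _ h => (List.cons.inj h).2]
            simp only [zw_cz_cons]
          rw [e]
          refine Finset.sum_le_sum_of_subset_of_nonneg ?_ fun _ _ _ => abs_nonneg _
          intro c hc
          obtain ⟨b, hb, rfl⟩ := Finset.mem_image.1 hc
          rw [mem_lowW] at hb ⊢
          simp only [List.length_cons, rot_cz_cons]
          omega
      _ = _ := by simp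
  set D := ∑ i, Cz i with hD
  have hD0 : 0 ≤ D := Finset.sum_nonneg fun i _ => hCz i
  refine ⟨1 + (n + 1) * (D * (C * (n + 1))), by positivity, fun u hu b hb p hp hr => ?_⟩
  rw [add_mul, one_mul]
  rcases b with _ | ⟨i, b⟩
  · exact le_add_of_le_of_nonneg (Finset.single_le_sum (f := fun c => |zw K c u p|)
      (fun _ _ => abs_nonneg _) (mem_lowW.2 (by simp))) (mul_nonneg (by positivity) (hsum0 _ _ _))
  · refine le_add_of_nonneg_of_le (hsum0 _ _ _) ?_
    have e : zw K (i :: b) u p = ∑ γ, zCoef i γ p * dd K γ (zw K b u) p := zz_eq_sum i _ p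
    rw [e]
    have : |∑ γ, zCoef i γ p * dd K γ (zw K b u) p| ≤ (n + 1 : ℕ) *
        (D * (C * ((n + 1) * ∑ c ∈ lowW n (k + 1) 0, |zw K c u p|))) :=
      abs_sum_le_card fun γ => by
        rw [abs_mul]
        have h1 : |zCoef i γ p| ≤ D := (hz (i, γ) p hr).trans
          (Finset.single_le_sum (fun i _ => hCz i) (Finset.mem_univ _))
        have h2 := h u (hu.of_le (by omega)) b (by simpa using hb) γ p hp hr
        exact mul_le_mul h1 (h2.trans (mul_le_mul_of_nonneg_left (hgrad u p) hC))
          (abs_nonneg _) hD0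
    refine this.trans (le_of_eq ?_)
    push_cast
    ring

/-! ### Cutoff functions -/

/-- The characteristic function of the ball of radius `3 ρ`, which contains the inner transition
region of the cutoffs. -/
def near (ρ : ℝ) (x : Space n) : ℝ := if ‖x‖ ≤ 3 * ρ then 1 else 0

lemma near_nonneg (ρ : ℝ) (x : Space n) : 0 ≤ near ρ x := by
  unfold near; split_ifs <;> norm_num

lemma exists_smoothTransition_bound : ∃ M : ℝ, 0 ≤ M ∧ ∀ s,
    |deriv Real.smoothTransition s| ≤ M ∧ |deriv (deriv Real.smoothTransition) s| ≤ M ∧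
    (1 < s → deriv Real.smoothTransition s = 0 ∧ deriv (deriv Real.smoothTransition) s = 0) := by
  have hσ : ContDiff ℝ ∞ Real.smoothTransition := Real.smoothTransition.contDiff
  have hc1 : ContDiff ℝ ∞ (deriv Real.smoothTransition) := by
    have := (contDiff_infty_iff_deriv.1 hσ).2
    exact this
  have hc2 : Continuous (deriv (deriv Real.smoothTransition)) :=
    ((contDiff_infty_iff_deriv.1 hc1).2).continuous
  have hlo : ∀ s < 0, Real.smoothTransition =ᶠ[nhds s] fun _ => 0 := fun s hs => by
    filter_upwards [gt_mem_nhds hs] with y hy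
    exact Real.smoothTransition.zero_of_nonpos hy.le
  have hhi : ∀ s > 1, Real.smoothTransition =ᶠ[nhds s] fun _ => 1 := fun s hs => by
    filter_upwards [lt_mem_nhds hs] with y hy
    exact Real.smoothTransition.one_of_one_le hy.le
  have hz : ∀ s, (s < 0 ∨ 1 < s) → deriv Real.smoothTransition s = 0 ∧
      deriv (deriv Real.smoothTransition) s = 0 := by
    rintro s (hs | hs)
    · have h := (hlo s hs).deriv
      refine ⟨by rw [h.eq_of_nhds]; simp, ?_⟩
      rw [h.deriv.eq_of_nhds]; simp
    · have h := (hhi s hs).deriv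
      refine ⟨by rw [h.eq_of_nhds]; simp, ?_⟩
      rw [h.deriv.eq_of_nhds]; simp
  obtain ⟨M₁, h1⟩ := (isCompact_Icc (a := (0 : ℝ)) (b := 1)).exists_bound_of_continuousOn
    hc1.continuous.continuousOn
  obtain ⟨M₂, h2⟩ := (isCompact_Icc (a := (0 : ℝ)) (b := 1)).exists_bound_of_continuousOn
    hc2.continuousOn
  refine ⟨max 0 (max M₁ M₂), le_max_left _ _, fun s => ?_⟩
  by_cases hs : s ∈ Set.Icc (0 : ℝ) 1
  · exact ⟨(h1 s hs).trans ((le_max_left _ _).trans (le_max_right _ _)),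
      (h2 s hs).trans ((le_max_right _ _).trans (le_max_right _ _)),
      fun h => absurd hs.2 (not_le.2 h)⟩
  · have := hz s (by
      rw [Set.mem_Icc, not_and_or, not_le, not_le] at hs
      exact hs)
    rw [this.1, this.2]
    simp

lemma dd_comp_real (hK : IsClosed K) {Z : ℝ → ℝ} {z : ℝ} {f : SpaceTime n → ℝ}
    {p : SpaceTime n} (hp : p ∈ region K) (hf : DifferentiableOn ℝ f (region K))
    (hZ : HasDerivAt Z z (f p)) (α : Fin (n + 1)) :
    dd K α (fun q => Z (f q)) p = z * dd K α f p := by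
  have h := hZ.comp_hasFDerivWithinAt p (hf p hp).hasFDerivWithinAt
  simp only [dd, along]
  have e : fderivWithin ℝ (fun q => Z (f q)) (region K) p = z • fderivWithin ℝ f (region K) p :=
    h.fderivWithin (uniqueDiffOn_region hK p hp)
  rw [e]
  rfl

/-- Cutoffs to `|x| ≥ 2 ρ` and to a large ball. The outer transition is logarithmic, so that the
derivatives there gain the factor `ε` over the scaling bound. -/
lemma exists_cutoff (hK : IsClosed K) {ρ : ℝ} (hρ : 1 ≤ ρ) : ∃ C : ℝ, 0 ≤ C ∧
    ∀ ε : ℝ, 0 < ε → ε ≤ 1 → ∃ ζ : Space n → ℝ, ContDiff ℝ ∞ ζ ∧ (∀ x, 0 ≤ ζ x ∧ ζ x ≤ 1) ∧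
      (∀ x, ‖x‖ ≤ 2 * ρ → ζ x = 0) ∧
      (∀ x, 3 * ρ ≤ ‖x‖ → ε * Real.log (1 + ‖x‖ ^ 2) ≤ 1 → ζ x = 1) ∧
      (∃ R, ∀ x, R < ‖x‖ → ζ x = 0) ∧
      (∀ p ∈ region K, 1 ≤ ‖p.2‖ → ∀ α,
        |dd K α (fun q => ζ q.2) p| ≤ C * (near ρ p.2 + ε / ‖p.2‖)) ∧
      ∀ p ∈ region K, 1 ≤ ‖p.2‖ → ∀ α β,
        |dd K α (dd K β (fun q => ζ q.2)) p| ≤ C * (near ρ p.2 + ε / ‖p.2‖ ^ 2) := by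
  obtain ⟨M, hM0, hM⟩ := exists_smoothTransition_bound
  refine ⟨36 * ρ ^ 2 * (M + 2 * M ^ 2) + 6 * ρ * M + 12 * M, by positivity, fun ε hε hε1 => ?_⟩
  set σ := Real.smoothTransition with hσ
  have hσc : ContDiff ℝ ∞ σ := Real.smoothTransition.contDiff
  have hσ1 : ∀ s, HasDerivAt σ (deriv σ s) s := fun s =>
    (hσc.differentiable (by simp) s).hasDerivAt
  have hσ2 : ∀ s, HasDerivAt (deriv σ) (deriv (deriv σ) s) s := fun s =>
    ((contDiff_infty_iff_deriv.1 hσc).2.differentiable (by simp) s).hasDerivAt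
  set a : ℝ := 4 * ρ ^ 2 with ha
  set A : ℝ → ℝ := fun s => σ (s - a) with hA
  set A1 : ℝ → ℝ := fun s => deriv σ (s - a) with hA1
  set A2 : ℝ → ℝ := fun s => deriv (deriv σ) (s - a) with hA2
  set y : ℝ → ℝ := fun s => ε * Real.log (1 + s) - 1 with hy
  set B : ℝ → ℝ := fun s => 1 - σ (y s) with hB
  set B1 : ℝ → ℝ := fun s => -(deriv σ (y s) * (ε * (1 + s)⁻¹)) with hB1
  set B2 : ℝ → ℝ := fun s => -(deriv (deriv σ) (y s) * (ε * (1 + s)⁻¹) * (ε * (1 + s)⁻¹) +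
    deriv σ (y s) * (ε * (-1 / (1 + s) ^ 2))) with hB2
  have dA : ∀ s, HasDerivAt A (A1 s) s := fun s =>
    (hσ1 (s - a)).comp_sub_const s a
  have dA1 : ∀ s, HasDerivAt A1 (A2 s) s := fun s =>
    (hσ2 (s - a)).comp_sub_const s a
  have dy : ∀ s, 0 ≤ s → HasDerivAt y (ε * (1 + s)⁻¹) s := fun s hs => by
    have := ((((hasDerivAt_id s).const_add 1).log (by simp; linarith)).const_mul ε).sub_const 1
    rwa [one_div] at this
  have dinv : ∀ s : ℝ, 0 ≤ s → HasDerivAt (fun s => ε * (1 + s)⁻¹) (ε * (-1 / (1 + s) ^ 2)) s :=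
    fun s hs => (((hasDerivAt_id s).const_add 1).fun_inv (by simp; linarith)).const_mul ε
  have dB : ∀ s, 0 ≤ s → HasDerivAt B (B1 s) s := fun s hs =>
    ((hσ1 (y s)).comp s (dy s hs)).const_sub 1
  have dB1 : ∀ s, 0 ≤ s → HasDerivAt B1 (B2 s) s := fun s hs =>
    (((hσ2 (y s)).comp s (dy s hs)).mul (dinv s hs)).neg
  set Z1 : ℝ → ℝ := fun s => A1 s * B s + A s * B1 s with hZ1
  set Z2 : ℝ → ℝ := fun s => (A2 s * B s + A1 s * B1 s) + (A1 s * B1 s + A s * B2 s) with hZ2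
  have dZ : ∀ s, 0 ≤ s → HasDerivAt (fun s => A s * B s) (Z1 s) s := fun s hs =>
    (dA s).mul (dB s hs)
  have dZ1 : ∀ s, 0 ≤ s → HasDerivAt Z1 (Z2 s) s := fun s hs =>
    ((dA1 s).mul (dB s hs)).add ((dA s).mul (dB1 s hs))
  have bA : ∀ s, 0 ≤ A s ∧ A s ≤ 1 := fun s =>
    ⟨Real.smoothTransition.nonneg _, Real.smoothTransition.le_one _⟩
  have bB : ∀ s, 0 ≤ B s ∧ B s ≤ 1 := fun s =>
    ⟨sub_nonneg.2 (Real.smoothTransition.le_one _), sub_le_self _ (Real.smoothTransition.nonneg _)⟩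
  have hnear : ∀ x : Space n, 1 < ‖x‖ ^ 2 - a ∨ near ρ x = 1 := fun x => by
    by_cases h : ‖x‖ ≤ 3 * ρ
    · exact Or.inr (if_pos h)
    · left
      push Not at h
      nlinarith
  have bA1 : ∀ x : Space n, |A1 (‖x‖ ^ 2)| ≤ M * near ρ x ∧ |A2 (‖x‖ ^ 2)| ≤ M * near ρ x :=
    fun x => by
      rcases hnear x with h | h
      · have := (hM _).2.2 h
        simp only [hA1, hA2]
        rw [this.1, this.2, abs_zero]
        exact ⟨mul_nonneg hM0 (near_nonneg _ _), mul_nonneg hM0 (near_nonneg _ _)⟩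
      · rw [h, mul_one]
        exact ⟨(hM _).1, (hM _).2.1⟩
  have bB1 : ∀ s, 0 ≤ s → |B1 s| ≤ M * (ε * (1 + s)⁻¹) := fun s hs => by
    have h1 : 0 ≤ ε * (1 + s)⁻¹ := by positivity
    simp only [hB1]
    rw [abs_neg, abs_mul, abs_of_nonneg h1]
    exact mul_le_mul_of_nonneg_right (hM _).1 h1
  have bB2 : ∀ s, 0 ≤ s → |B2 s| ≤ 2 * M * (ε * ((1 + s)⁻¹) ^ 2) := fun s hs => by
    have h1 : 0 ≤ ε * (1 + s)⁻¹ := by positivity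
    have h2 : 0 ≤ ε * ((1 + s)⁻¹) ^ 2 := by positivity
    simp only [hB2]
    rw [abs_neg]
    refine (abs_add_le _ _).trans ?_
    have e1 : |deriv (deriv σ) (y s) * (ε * (1 + s)⁻¹) * (ε * (1 + s)⁻¹)| ≤
        M * (ε * ((1 + s)⁻¹) ^ 2) := by
      rw [abs_mul, abs_mul, abs_of_nonneg h1, mul_assoc]
      refine mul_le_mul (hM _).2.1 ?_ (mul_nonneg h1 h1) hM0
      have : ε * (1 + s)⁻¹ * (ε * (1 + s)⁻¹) = ε * (ε * ((1 + s)⁻¹) ^ 2) := by ring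
      rw [this]
      exact mul_le_of_le_one_left h2 hε1
    have e2 : |deriv σ (y s) * (ε * (-1 / (1 + s) ^ 2))| ≤ M * (ε * ((1 + s)⁻¹) ^ 2) := by
      have : ε * (-1 / (1 + s) ^ 2) = -(ε * ((1 + s)⁻¹) ^ 2) := by rw [inv_pow]; ring
      rw [this, abs_mul, abs_neg, abs_of_nonneg h2]
      exact mul_le_mul_of_nonneg_right (hM _).1 h2
    linarith
  have bZ1 : ∀ x : Space n, |Z1 (‖x‖ ^ 2)| ≤ M * near ρ x + M * (ε * (1 + ‖x‖ ^ 2)⁻¹) := fun x => by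
    refine (abs_add_le _ _).trans (add_le_add ?_ ?_)
    · rw [abs_mul, abs_of_nonneg (bB _).1]
      exact (mul_le_of_le_one_right (abs_nonneg _) (bB _).2).trans (bA1 x).1
    · rw [abs_mul, abs_of_nonneg (bA _).1]
      exact (mul_le_of_le_one_left (abs_nonneg _) (bA _).2).trans (bB1 _ (sq_nonneg _))
  have bZ2 : ∀ x : Space n, |Z2 (‖x‖ ^ 2)| ≤ (M + 2 * M ^ 2) * near ρ x +
      2 * M * (ε * ((1 + ‖x‖ ^ 2)⁻¹) ^ 2) := fun x => by
    have e1 : |A2 (‖x‖ ^ 2) * B (‖x‖ ^ 2)| ≤ M * near ρ x := by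
      rw [abs_mul, abs_of_nonneg (bB _).1]
      exact (mul_le_of_le_one_right (abs_nonneg _) (bB _).2).trans (bA1 x).2
    have e2 : |A1 (‖x‖ ^ 2) * B1 (‖x‖ ^ 2)| ≤ M ^ 2 * near ρ x := by
      rw [abs_mul]
      have h1 : |B1 (‖x‖ ^ 2)| ≤ M := (bB1 _ (sq_nonneg _)).trans (mul_le_of_le_one_right hM0
        (mul_le_one₀ hε1 (by positivity) (inv_le_one_of_one_le₀ (by nlinarith [sq_nonneg ‖x‖]))))
      calc _ ≤ (M * near ρ x) * M :=
            mul_le_mul (bA1 x).1 h1 (abs_nonneg _) (mul_nonneg hM0 (near_nonneg _ _))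
        _ = _ := by ring
    have e3 : |A (‖x‖ ^ 2) * B2 (‖x‖ ^ 2)| ≤ 2 * M * (ε * ((1 + ‖x‖ ^ 2)⁻¹) ^ 2) := by
      rw [abs_mul, abs_of_nonneg (bA _).1]
      exact (mul_le_of_le_one_left (abs_nonneg _) (bA _).2).trans (bB2 _ (sq_nonneg _))
    refine (abs_add_le _ _).trans ?_
    have f1 := abs_add_le (A2 (‖x‖ ^ 2) * B (‖x‖ ^ 2)) (A1 (‖x‖ ^ 2) * B1 (‖x‖ ^ 2))
    have f2 := abs_add_le (A1 (‖x‖ ^ 2) * B1 (‖x‖ ^ 2)) (A (‖x‖ ^ 2) * B2 (‖x‖ ^ 2))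
    linarith
  have hs := (smooth_normSq (K := K) (n := n)).diff
  have dζ : ∀ p ∈ region K, ∀ α, dd K α (fun q => A (‖q.2‖ ^ 2) * B (‖q.2‖ ^ 2)) p =
      Z1 (‖p.2‖ ^ 2) * (2 * xc α p) := fun p hp α => by
    rw [dd_comp_real (Z := fun s => A s * B s) (f := fun q => ‖q.2‖ ^ 2) hK hp hs
      (dZ _ (sq_nonneg _)), dd_normSq hK α hp]
  have dZ1s : DifferentiableOn ℝ (fun q : SpaceTime n => Z1 (‖q.2‖ ^ 2)) (region K) := fun p hp =>
    (HasDerivAt.comp_hasFDerivWithinAt (h₂ := Z1) p (dZ1 _ (sq_nonneg _))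
      (hs p hp).hasFDerivWithinAt).differentiableWithinAt
  have ddζ : ∀ p ∈ region K, ∀ α β, dd K α (dd K β (fun q => A (‖q.2‖ ^ 2) * B (‖q.2‖ ^ 2))) p =
      Z2 (‖p.2‖ ^ 2) * (2 * xc α p) * (2 * xc β p) +
        Z1 (‖p.2‖ ^ 2) * (2 * (if α = β then sp α else 0)) := fun p hp α β => by
    have e1 : dd K α (dd K β (fun q => A (‖q.2‖ ^ 2) * B (‖q.2‖ ^ 2))) p =
        dd K α (fun q => Z1 (‖q.2‖ ^ 2) * (2 * xc β q)) p :=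
      along_congr (fun q hq => dζ q hq β) hp
    have e2 := dd_comp_real (Z := Z1) (f := fun q => ‖q.2‖ ^ 2) hK hp hs
      (dZ1 _ (sq_nonneg _)) α
    have e3 := dd_xc hK α β hp
    rw [e1, dd, along_mul hK dZ1s ((smooth_xc β).diff.const_mul 2) hp,
      along_const_mul hK _ (smooth_xc β).diff hp]
    rw [dd_normSq hK α hp] at e2
    rw [dd] at e2 e3
    rw [e2, e3]
  have hrr : ∀ r : ℝ, 1 ≤ r → r * (1 + r ^ 2)⁻¹ ≤ 1 / r := fun r hr => by
    rw [← div_eq_mul_inv, div_le_div_iff₀ (by positivity) (by linarith)]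
    nlinarith
  refine ⟨fun x => A (‖x‖ ^ 2) * B (‖x‖ ^ 2), ?_, fun x => ⟨mul_nonneg (bA _).1 (bB _).1,
    mul_le_one₀ (bA _).2 (bB _).1 (bB _).2⟩, fun x hx => ?_, fun x hx hx' => ?_, ?_, ?_, ?_⟩
  · have h1 : ContDiff ℝ ∞ (fun x : Space n => ‖x‖ ^ 2) := contDiff_id.norm_sq ℝ
    have h2 : ContDiff ℝ ∞ (fun x : Space n => y (‖x‖ ^ 2)) :=
      (contDiff_const.mul ((contDiff_const.add h1).log fun x => by positivity)).sub contDiff_const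
    exact (hσc.comp (h1.sub contDiff_const)).mul (contDiff_const.sub (hσc.comp h2))
  · have : A (‖x‖ ^ 2) = 0 := Real.smoothTransition.zero_of_nonpos (by
      nlinarith [norm_nonneg x])
    simp only [this, zero_mul]
  · have h1 : A (‖x‖ ^ 2) = 1 := Real.smoothTransition.one_of_one_le (by
      nlinarith [norm_nonneg x])
    have h2 : σ (y (‖x‖ ^ 2)) = 0 := Real.smoothTransition.zero_of_nonpos (by
      simp only [hy]; linarith)
    simp only [h1, hB, h2, sub_zero, mul_one]
  · refine ⟨Real.exp (2 / ε), fun x hx => ?_⟩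
    have h1 : 1 < ‖x‖ := (Real.one_lt_exp_iff.2 (by positivity)).trans hx
    have h2 : 2 / ε ≤ Real.log (1 + ‖x‖ ^ 2) := by
      rw [Real.le_log_iff_exp_le (by positivity)]
      nlinarith
    have h3 : σ (y (‖x‖ ^ 2)) = 1 := Real.smoothTransition.one_of_one_le (by
      rw [div_le_iff₀ hε] at h2
      simp only [hy]; linarith)
    simp only [hB, h3, sub_self, mul_zero]
  · intro p hp hr α
    rw [dζ p hp α, abs_mul]
    have hr0 : 0 < ‖p.2‖ := by linarith
    have h1 : |2 * xc α p| ≤ 2 * ‖p.2‖ := by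
      rw [abs_mul, abs_two]
      exact mul_le_mul_of_nonneg_left (abs_xc_le α p) two_pos.le
    have h2 : near ρ p.2 * ‖p.2‖ ≤ near ρ p.2 * (3 * ρ) := by
      unfold near; split_ifs with h
      · simpa using h
      · simp
    have h3 := hrr _ hr
    have h4 : ε * (‖p.2‖ * (1 + ‖p.2‖ ^ 2)⁻¹) ≤ ε / ‖p.2‖ := by
      rw [div_eq_mul_one_div]
      exact mul_le_mul_of_nonneg_left h3 hε.le
    have h5 := near_nonneg ρ p.2
    calc _ ≤ (M * near ρ p.2 + M * (ε * (1 + ‖p.2‖ ^ 2)⁻¹)) * (2 * ‖p.2‖) :=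
          mul_le_mul (bZ1 p.2) h1 (abs_nonneg _) (by positivity)
      _ = 2 * M * (near ρ p.2 * ‖p.2‖) + 2 * M * (ε * (‖p.2‖ * (1 + ‖p.2‖ ^ 2)⁻¹)) := by ring
      _ ≤ 2 * M * (near ρ p.2 * (3 * ρ)) + 2 * M * (ε / ‖p.2‖) := by gcongr
      _ = 6 * ρ * M * near ρ p.2 + 2 * M * (ε / ‖p.2‖) := by ring
      _ ≤ (36 * ρ ^ 2 * (M + 2 * M ^ 2) + 6 * ρ * M + 12 * M) * near ρ p.2 +
          (36 * ρ ^ 2 * (M + 2 * M ^ 2) + 6 * ρ * M + 12 * M) * (ε / ‖p.2‖) := by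
          have q1 : 0 ≤ 36 * ρ ^ 2 * (M + 2 * M ^ 2) := by positivity
          have q2 : 0 ≤ 6 * ρ * M := by positivity
          gcongr <;> linarith
      _ = _ := by ring
  · intro p hp hr α β
    rw [ddζ p hp α β]
    have hr0 : 0 < ‖p.2‖ := by linarith
    have h5 := near_nonneg ρ p.2
    have h2 : near ρ p.2 * ‖p.2‖ ^ 2 ≤ near ρ p.2 * (3 * ρ) ^ 2 := by
      unfold near; split_ifs with h
      · rw [one_mul, one_mul]
        gcongr
      · simp
    have h3 : ε * (1 + ‖p.2‖ ^ 2)⁻¹ ≤ ε / ‖p.2‖ ^ 2 := by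
      rw [div_eq_mul_inv]
      gcongr
      linarith
    have h4 : ε * (‖p.2‖ * (1 + ‖p.2‖ ^ 2)⁻¹) ^ 2 ≤ ε / ‖p.2‖ ^ 2 := by
      have := pow_le_pow_left₀ (by positivity) (hrr _ hr) 2
      rw [div_pow, one_pow] at this
      rw [div_eq_mul_one_div]
      exact mul_le_mul_of_nonneg_left this hε.le
    have hx : ∀ α, |2 * xc α p| ≤ 2 * ‖p.2‖ := fun α => by
      rw [abs_mul, abs_two]
      exact mul_le_mul_of_nonneg_left (abs_xc_le α p) two_pos.le
    have hδ : |2 * (if α = β then sp α else 0)| ≤ 2 := by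
      unfold sp
      split_ifs <;> norm_num
    have e1 : |Z2 (‖p.2‖ ^ 2) * (2 * xc α p) * (2 * xc β p)| ≤ ((M + 2 * M ^ 2) * near ρ p.2 +
        2 * M * (ε * ((1 + ‖p.2‖ ^ 2)⁻¹) ^ 2)) * (2 * ‖p.2‖) * (2 * ‖p.2‖) := by
      rw [abs_mul, abs_mul]
      exact mul_le_mul (mul_le_mul (bZ2 p.2) (hx α) (abs_nonneg _) (by positivity)) (hx β)
        (abs_nonneg _) (by positivity)
    have e2 : |Z1 (‖p.2‖ ^ 2) * (2 * (if α = β then sp α else 0))| ≤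
        (M * near ρ p.2 + M * (ε * (1 + ‖p.2‖ ^ 2)⁻¹)) * 2 := by
      rw [abs_mul]
      exact mul_le_mul (bZ1 p.2) hδ (abs_nonneg _) (by positivity)
    calc _ ≤ ((M + 2 * M ^ 2) * near ρ p.2 + 2 * M * (ε * ((1 + ‖p.2‖ ^ 2)⁻¹) ^ 2)) *
            (2 * ‖p.2‖) * (2 * ‖p.2‖) + (M * near ρ p.2 + M * (ε * (1 + ‖p.2‖ ^ 2)⁻¹)) * 2 :=
          (abs_add_le _ _).trans (add_le_add e1 e2)
      _ = 4 * (M + 2 * M ^ 2) * (near ρ p.2 * ‖p.2‖ ^ 2) + 2 * M * near ρ p.2 +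
          8 * M * (ε * (‖p.2‖ * (1 + ‖p.2‖ ^ 2)⁻¹) ^ 2) + 2 * M * (ε * (1 + ‖p.2‖ ^ 2)⁻¹) := by
          ring
      _ ≤ 4 * (M + 2 * M ^ 2) * (near ρ p.2 * (3 * ρ) ^ 2) + 2 * M * near ρ p.2 +
          8 * M * (ε / ‖p.2‖ ^ 2) + 2 * M * (ε / ‖p.2‖ ^ 2) := by gcongr
      _ = (36 * ρ ^ 2 * (M + 2 * M ^ 2) + 2 * M) * near ρ p.2 + 10 * M * (ε / ‖p.2‖ ^ 2) := by ring
      _ ≤ (36 * ρ ^ 2 * (M + 2 * M ^ 2) + 6 * ρ * M + 12 * M) * near ρ p.2 +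
          (36 * ρ ^ 2 * (M + 2 * M ^ 2) + 6 * ρ * M + 12 * M) * (ε / ‖p.2‖ ^ 2) := by
          have q1 : 0 ≤ 36 * ρ ^ 2 * (M + 2 * M ^ 2) := by positivity
          have q2 : 0 ≤ 6 * ρ * M := by positivity
          gcongr <;> linarith
      _ = _ := by ring

/-- The words in the fields `Z` of length at most `k` with exactly `j` rotations. -/
def topW (n k j : ℕ) : Finset (List (ZIndex n)) :=
  (wordsLe (ZIndex n) k).filter fun b => rot b = j

lemma mem_topW {k j : ℕ} {b : List (ZIndex n)} : b ∈ topW n k j ↔ b.length ≤ k ∧ rot b = j := by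
  rw [topW, Finset.mem_filter, mem_wordsLe]

/-- The function `ζ Z^a u`. -/
def cut (K : Set (Space n)) (ζ : Space n → ℝ) (u : SpaceTime n → ℝ) (a : List (ZIndex n))
    (p : SpaceTime n) : ℝ :=
  ζ p.2 * zw K a u p

lemma grad_lowW_succ (k j : ℕ) (u : SpaceTime n → ℝ) (p : SpaceTime n) :
    grad K (lowW n k (j + 1)) u p = grad K (topW n k (j + 1)) u p + grad K (lowW n k j) u p := by
  classical
  have h : lowW n k (j + 1) = topW n k (j + 1) ∪ lowW n k j := by
    ext b
    rw [Finset.mem_union, mem_lowW, mem_topW, mem_lowW]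
    omega
  rw [h, grad, Finset.sum_union]
  · rfl
  · rw [Finset.disjoint_left]
    intro b hb hb'
    rw [mem_topW] at hb
    rw [mem_lowW] at hb'
    omega

lemma dd_mul (hK : IsClosed K) {f g : SpaceTime n → ℝ} (hf : DifferentiableOn ℝ f (region K))
    (hg : DifferentiableOn ℝ g (region K)) (α : Fin (n + 1)) {p : SpaceTime n}
    (hp : p ∈ region K) :
    dd K α (fun q => f q * g q) p = f p * dd K α g p + dd K α f p * g p := by
  rw [dd, along_mul hK hf hg hp, dd, dd]
  ring

/-- The Leibniz rule for the principal part. -/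
lemma source_mul (hK : IsClosed K) {h : Fin (n + 1) → Fin (n + 1) → SpaceTime n → ℝ}
    {z v : SpaceTime n → ℝ} (hz : Smooth K z) (hv : CD K 2 v) {p : SpaceTime n}
    (hp : p ∈ region K) :
    source K h (fun q => z q * v q) p = z p * source K h v p +
      ∑ α, ∑ β, h α β p * (dd K α z p * dd K β v p + dd K β z p * dd K α v p +
        dd K α (dd K β z) p * v p) := by
  have hvd : DifferentiableOn ℝ v (region K) := CD.differentiableOn (m := 1) hv
  have hdv : ∀ β, DifferentiableOn ℝ (dd K β v) (region K) := fun β =>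
    CD.differentiableOn (m := 0) (CD.dd hK hv β)
  have h1 : ∀ α β, dd K α (dd K β (fun q => z q * v q)) p = z p * dd K α (dd K β v) p +
      (dd K α z p * dd K β v p + dd K β z p * dd K α v p + dd K α (dd K β z) p * v p) := by
    intro α β
    have e : dd K α (dd K β (fun q => z q * v q)) p =
        dd K α (fun q => z q * dd K β v q + dd K β z q * v q) p :=
      along_congr (fun q hq => dd_mul hK hz.diff hvd β hq) hp
    rw [e, dd, along_add hK (hz.diff.fun_mul (hdv β)) ((hz.dd hK β).diff.fun_mul hvd) hp]
    have e1 := dd_mul hK hz.diff (hdv β) α hp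
    have e2 := dd_mul hK (hz.dd hK β).diff hvd α hp
    rw [dd] at e1 e2
    rw [e1, e2]
    ring
  simp only [source, h1, mul_add, Finset.sum_add_distrib, Finset.mul_sum]
  congr 1
  exact Finset.sum_congr rfl fun α _ => Finset.sum_congr rfl fun β _ => by ring

lemma NearFlat.abs_le_two {ρ : ℝ} {κ : ℕ → ℝ}
    {h : Fin (n + 1) → Fin (n + 1) → SpaceTime n → ℝ} (H : NearFlat K ρ κ h) (hκ : ∀ j, κ j ≤ 1)
    (α β : Fin (n + 1)) {p : SpaceTime n} (hp : p ∈ region K) (hr : ρ < ‖p.2‖) :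
    |h α β p| ≤ 2 := by
  have h1 := H.close α β p hp hr
  have h2 := hκ (dyIdx p.2)
  have h3 : |minkowski n α β| ≤ 1 := by
    rw [minkowski_apply, sp]
    split_ifs <;> norm_num
  have h5 := abs_sub_abs_le_abs_sub (h α β p) (minkowski n α β)
  linarith

/-- The equation satisfied by the cut off functions `ζ Z^a u`, with all the errors. -/
lemma NearFlat.exists_cut_bound {ρ : ℝ} {κ : ℕ → ℝ} {g : MatrixField n}
    (H : NearFlat K ρ κ (fun α β p => (g p)⁻¹ α β)) (hK : IsClosed K) (hκ : ∀ j, κ j ≤ 1) (k : ℕ)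
    (Hc : ∀ u, CD K (k + 2) u → ∀ a : List (ZIndex n), a.length ≤ k → ∀ p ∈ region K, ρ < ‖p.2‖ →
      ‖p.2‖ * |source K (fun α β p => (g p)⁻¹ α β) (zw K a u) p - zw K a (box K g u) p| ≤
        κ (dyIdx p.2) * grad K (lowW n k (rot a)) u p) :
    ∃ C : ℝ, 0 ≤ C ∧ ∀ ε : ℝ, 0 < ε → ε ≤ 1 → ∃ ζ : Space n → ℝ, ContDiff ℝ ∞ ζ ∧
      (∀ x, ‖x‖ ≤ 2 * ρ → ζ x = 0) ∧
      (∀ x, 3 * ρ ≤ ‖x‖ → ε * Real.log (1 + ‖x‖ ^ 2) ≤ 1 → ζ x = 1) ∧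
      (∃ R, ∀ x, R < ‖x‖ → ζ x = 0) ∧
      ∀ u, CD K (k + 2) u → ∀ (j : ℕ) (a : List (ZIndex n)), a.length ≤ k → rot a = j + 1 →
        ∀ p ∈ region K, ρ < ‖p.2‖ →
        |source K (fun α β p => (g p)⁻¹ α β) (cut K ζ u a) p| ≤ |zw K a (box K g u) p| +
          κ (dyIdx p.2) / ‖p.2‖ * ((∑ b ∈ topW n k (j + 1), ∑ α, |dd K α (cut K ζ u b) p|) +
            grad K (lowW n k j) u p) + C * ((near ρ p.2 + ε) * grad K (lowW n k j) u p) ∧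
        ∀ α, |dd K α (cut K ζ u a) p| ≤ |dd K α (zw K a u) p| + C * grad K (lowW n k j) u p := by
  obtain ⟨Cz, hCz, hcut⟩ := exists_cutoff (n := n) hK H.one_le
  obtain ⟨Cp, hCp, hpull⟩ := exists_pull_bound (n := n) hK k
  set N : ℝ := ((n + 1 : ℕ) : ℝ) with hN
  set m : ℝ := ((wordsLe (ZIndex n) k).card : ℝ) with hm
  have hρ := H.one_le
  refine ⟨m * (N * (Cz * Cp)) + N * (N * (2 * (Cz * Cp * 3 * (3 * ρ)))) + Cz * Cp * (3 * ρ + 1),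
    by positivity, fun ε hε hε1 => ?_⟩
  obtain ⟨ζ, hζ, h01, hz0, hz1, hzR, hd1, hd2⟩ := hcut ε hε hε1
  refine ⟨ζ, hζ, hz0, hz1, hzR, fun u hu j a ha hj p hp hr => ?_⟩
  have hr1 : 1 ≤ ‖p.2‖ := hρ.trans hr.le
  have hr0 : 0 < ‖p.2‖ := by linarith
  set G := grad K (lowW n k j) u p with hG
  have hG0 : 0 ≤ G := grad_nonneg _ _ _
  set r := ‖p.2‖ with hrdef
  set ν := near ρ p.2 with hν
  have hν0 : 0 ≤ ν := near_nonneg ρ p.2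
  have hνr : ν * r ≤ 3 * ρ * ν := by
    rw [hν]
    unfold near
    split_ifs with h
    · simpa using h
    · simp
  have hzs : Smooth K (fun q : SpaceTime n => ζ q.2) := (hζ.comp contDiff_snd).contDiffOn
  have hzw : ∀ b : List (ZIndex n), b.length ≤ k → CD K 2 (zw K b u) := fun b hb =>
    CD.zw hK b (hu.of_le (by omega))
  -- the terms in which a derivative falls on the cutoff
  have hdz : ∀ b ∈ topW n k (j + 1), ∀ α, |dd K α (fun q => ζ q.2) p * zw K b u p| ≤
      Cz * Cp * ((ν * r + ε) * G) := by
    intro b hb α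
    rw [mem_topW] at hb
    rw [abs_mul]
    calc _ ≤ (Cz * (ν + ε / r)) * (Cp * (r * G)) :=
          mul_le_mul (hd1 p hp hr1 α) (hpull u hu j b (by omega) hb.2 p hp hr1) (abs_nonneg _)
            (by positivity)
      _ = Cz * Cp * ((ν * r + ε) * G) := by field_simp
  have hdcut : ∀ b ∈ topW n k (j + 1), ∀ α, dd K α (cut K ζ u b) p =
      ζ p.2 * dd K α (zw K b u) p + dd K α (fun q => ζ q.2) p * zw K b u p := fun b hb α =>
    dd_mul hK hzs.diff (CD.differentiableOn (m := 1) (hzw b (mem_topW.1 hb).1)) α hp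
  have ha' : a ∈ topW n k (j + 1) := mem_topW.2 ⟨ha, hj⟩
  have hκ0 := H.nonneg (dyIdx p.2)
  have hκ1 := hκ (dyIdx p.2)
  set κp := κ (dyIdx p.2)
  constructor
  · have e1 : source K (fun α β p => (g p)⁻¹ α β) (cut K ζ u a) p =
        ζ p.2 * source K (fun α β p => (g p)⁻¹ α β) (zw K a u) p +
        ∑ α, ∑ β, (g p)⁻¹ α β * (dd K α (fun q => ζ q.2) p * dd K β (zw K a u) p +
          dd K β (fun q => ζ q.2) p * dd K α (zw K a u) p +
          dd K α (dd K β (fun q => ζ q.2)) p * zw K a u p) := source_mul hK hzs (hzw a ha) hp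
    -- cross terms
    have hc1 : ∀ α β, |dd K α (fun q => ζ q.2) p * dd K β (zw K a u) p| ≤
        Cz * Cp * (3 * ρ) * ((ν + ε) * G) := by
      intro α β
      rw [abs_mul, ← zw_cz_cons]
      calc _ ≤ (Cz * (ν + ε / r)) * (Cp * (r * G)) :=
            mul_le_mul (hd1 p hp hr1 α) (hpull u hu j (cz β :: a) (by simpa using ha)
              (by simpa using hj) p hp hr1) (abs_nonneg _) (by positivity)
        _ = Cz * Cp * ((ν * r + ε) * G) := by field_simp
        _ ≤ Cz * Cp * ((3 * ρ * ν + 3 * ρ * ε) * G) := by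
            gcongr
            nlinarith
        _ = _ := by ring
    have hc2 : ∀ α β, |dd K α (dd K β (fun q => ζ q.2)) p * zw K a u p| ≤
        Cz * Cp * (3 * ρ) * ((ν + ε) * G) := by
      intro α β
      rw [abs_mul]
      have hεr : ε / r ≤ 3 * ρ * ε := by
        rw [div_le_iff₀ hr0]
        nlinarith [mul_le_mul_of_nonneg_left hr1 hε.le, mul_le_mul_of_nonneg_left hρ hε.le,
          mul_nonneg hε.le hr0.le]
      calc _ ≤ (Cz * (ν + ε / r ^ 2)) * (Cp * (r * G)) :=
            mul_le_mul (hd2 p hp hr1 α β) (hpull u hu j a (by omega) hj p hp hr1) (abs_nonneg _)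
              (by positivity)
        _ = Cz * Cp * ((ν * r + ε / r) * G) := by field_simp
        _ ≤ Cz * Cp * ((3 * ρ * ν + 3 * ρ * ε) * G) := by gcongr
        _ = _ := by ring
    have hcross : |∑ α, ∑ β, (g p)⁻¹ α β * (dd K α (fun q => ζ q.2) p * dd K β (zw K a u) p +
          dd K β (fun q => ζ q.2) p * dd K α (zw K a u) p +
          dd K α (dd K β (fun q => ζ q.2)) p * zw K a u p)| ≤
        N * (N * (2 * (Cz * Cp * 3 * (3 * ρ) * ((ν + ε) * G)))) :=
      abs_sum_le_card fun α => abs_sum_le_card fun β => by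
        rw [abs_mul]
        refine mul_le_mul (H.abs_le_two hκ α β hp hr) ?_ (abs_nonneg _) two_pos.le
        refine (abs_add_three _ _ _).trans ?_
        linarith [hc1 α β, hc1 β α, hc2 α β]
    -- the commutator
    have hcomm : |ζ p.2 * (source K (fun α β p => (g p)⁻¹ α β) (zw K a u) p -
        zw K a (box K g u) p)| ≤
        κp / r * (ζ p.2 * grad K (topW n k (j + 1)) u p + G) := by
      rw [abs_mul, abs_of_nonneg (h01 _).1]
      have h1 := Hc u hu a ha p hp hr
      rw [hj, grad_lowW_succ] at h1
      have h2 : |source K (fun α β p => (g p)⁻¹ α β) (zw K a u) p - zw K a (box K g u) p| ≤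
          κp / r * (grad K (topW n k (j + 1)) u p + G) := by
        rw [div_mul_eq_mul_div, le_div_iff₀ hr0, mul_comm]
        exact h1
      calc _ ≤ ζ p.2 * (κp / r * (grad K (topW n k (j + 1)) u p + G)) :=
            mul_le_mul_of_nonneg_left h2 (h01 _).1
        _ = κp / r * (ζ p.2 * grad K (topW n k (j + 1)) u p + ζ p.2 * G) := by ring
        _ ≤ _ := by
            gcongr
            exact mul_le_of_le_one_left hG0 (h01 _).2
    have htop : ζ p.2 * grad K (topW n k (j + 1)) u p ≤
        (∑ b ∈ topW n k (j + 1), ∑ α, |dd K α (cut K ζ u b) p|) +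
          m * (N * (Cz * Cp * ((ν * r + ε) * G))) := by
      rw [grad, Finset.mul_sum]
      have hcard : ((topW n k (j + 1)).card : ℝ) ≤ m := by
        rw [hm]
        exact_mod_cast Finset.card_le_card (Finset.filter_subset _ _)
      calc ∑ b ∈ topW n k (j + 1), ζ p.2 * ∑ α, |dd K α (zw K b u) p|
          ≤ ∑ b ∈ topW n k (j + 1), ((∑ α, |dd K α (cut K ζ u b) p|) +
            N * (Cz * Cp * ((ν * r + ε) * G))) := by
            refine Finset.sum_le_sum fun b hb => ?_
            rw [Finset.mul_sum]
            have : N * (Cz * Cp * ((ν * r + ε) * G)) =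
                ∑ _α : Fin (n + 1), (Cz * Cp * ((ν * r + ε) * G)) := by simp [hN]
            rw [this, ← Finset.sum_add_distrib]
            refine Finset.sum_le_sum fun α _ => ?_
            have h1 := hdz b hb α
            have h2 : ζ p.2 * |dd K α (zw K b u) p| = |ζ p.2 * dd K α (zw K b u) p| := by
              rw [abs_mul, abs_of_nonneg (h01 _).1]
            have h3 : ζ p.2 * dd K α (zw K b u) p = dd K α (cut K ζ u b) p -
                dd K α (fun q => ζ q.2) p * zw K b u p := by rw [hdcut b hb α]; ring
            rw [h2, h3]
            have h4 := abs_sub_le (dd K α (cut K ζ u b) p) 0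
              (dd K α (fun q => ζ q.2) p * zw K b u p)
            rw [sub_zero, zero_sub, abs_neg] at h4
            linarith
        _ = (∑ b ∈ topW n k (j + 1), ∑ α, |dd K α (cut K ζ u b) p|) +
            (topW n k (j + 1)).card * (N * (Cz * Cp * ((ν * r + ε) * G))) := by
            rw [Finset.sum_add_distrib, Finset.sum_const, nsmul_eq_mul]
        _ ≤ _ := by gcongr
    have herr : κp / r * (m * (N * (Cz * Cp * ((ν * r + ε) * G)))) ≤
        m * (N * (Cz * Cp)) * ((ν + ε) * G) := by
      have h1 : κp / r * (ν * r + ε) ≤ ν + ε := by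
        have e : κp / r * (ν * r + ε) = κp * ν + κp * (ε / r) := by field_simp
        rw [e]
        have h2 : ε / r ≤ ε := div_le_self hε.le hr1
        have h3 : 0 ≤ ε / r := by positivity
        have h4 := mul_le_of_le_one_left hν0 hκ1
        have h5 := mul_le_of_le_one_left h3 hκ1
        linarith
      calc _ = m * (N * (Cz * Cp)) * ((κp / r * (ν * r + ε)) * G) := by ring
        _ ≤ _ := by gcongr
    have hζF : |ζ p.2 * zw K a (box K g u) p| ≤ |zw K a (box K g u) p| := by
      rw [abs_mul, abs_of_nonneg (h01 _).1]
      exact mul_le_of_le_one_left (abs_nonneg _) (h01 _).2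
    have e2 : source K (fun α β p => (g p)⁻¹ α β) (cut K ζ u a) p = ζ p.2 * zw K a (box K g u) p +
        ζ p.2 * (source K (fun α β p => (g p)⁻¹ α β) (zw K a u) p - zw K a (box K g u) p) +
        ∑ α, ∑ β, (g p)⁻¹ α β * (dd K α (fun q => ζ q.2) p * dd K β (zw K a u) p +
          dd K β (fun q => ζ q.2) p * dd K α (zw K a u) p +
          dd K α (dd K β (fun q => ζ q.2)) p * zw K a u p) := by rw [e1]; ring
    rw [e2]
    refine (abs_add_three _ _ _).trans ?_
    have h6 := mul_le_mul_of_nonneg_left htop (by positivity : 0 ≤ κp / r)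
    have h7 : 0 ≤ Cz * Cp * (3 * ρ + 1) * ((ν + ε) * G) := by positivity
    have h8 : (m * (N * (Cz * Cp)) + N * (N * (2 * (Cz * Cp * 3 * (3 * ρ)))) +
        Cz * Cp * (3 * ρ + 1)) * ((ν + ε) * G) = m * (N * (Cz * Cp)) * ((ν + ε) * G) +
        N * (N * (2 * (Cz * Cp * 3 * (3 * ρ) * ((ν + ε) * G)))) +
        Cz * Cp * (3 * ρ + 1) * ((ν + ε) * G) := by ring
    rw [h8]
    rw [mul_add] at h6 hcomm ⊢
    linarith
  · intro α
    rw [hdcut a ha' α]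
    refine (abs_add_le _ _).trans (add_le_add ?_ ((hdz a ha' α).trans ?_))
    · rw [abs_mul, abs_of_nonneg (h01 _).1]
      exact mul_le_of_le_one_left (abs_nonneg _) (h01 _).2
    · have hν1 : ν ≤ 1 := by
        rw [hν]; unfold near; split_ifs <;> norm_num
      have h1 : ν * r + ε ≤ 3 * ρ + 1 := by nlinarith
      calc Cz * Cp * ((ν * r + ε) * G) ≤ Cz * Cp * ((3 * ρ + 1) * G) := by gcongr
        _ = Cz * Cp * (3 * ρ + 1) * G := by ring
        _ ≤ _ := by
            gcongr
            have : 0 ≤ m * (N * (Cz * Cp)) + N * (N * (2 * (Cz * Cp * 3 * (3 * ρ)))) := by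
              positivity
            linarith

/-! ### Mixed norms -/

/-- `f` is measurable on `M`, and so is its restriction to each time slice. -/
structure Meas (K : Set (Space n)) (f : SpaceTime n → ℝ) : Prop where
  prod : AEMeasurable f (volume.restrict (region K))
  slice : ∀ t, 0 ≤ t → AEMeasurable (fun x => f (t, x)) (volume.restrict Kᶜ)

lemma measurableSet_region (hK : IsClosed K) : MeasurableSet (region K) :=
  measurableSet_Ici.prod hK.measurableSet.compl

lemma Meas.of_continuousOn (hK : IsClosed K) {f : SpaceTime n → ℝ}
    (hf : ContinuousOn f (region K)) : Meas K f :=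
  ⟨hf.aemeasurable (measurableSet_region hK), fun _ ht =>
    (continuousOn_slice hf ht).aemeasurable hK.measurableSet.compl⟩

lemma Meas.mul {f g : SpaceTime n → ℝ} (hf : Meas K f) (hg : Meas K g) :
    Meas K (fun p => f p * g p) :=
  ⟨hf.prod.mul hg.prod, fun t ht => (hf.slice t ht).mul (hg.slice t ht)⟩

lemma Meas.of_space {φ : Space n → ℝ} (hφ : Measurable φ) : Meas K (fun p => φ p.2) :=
  ⟨(hφ.comp measurable_snd).aemeasurable, fun _ _ => hφ.aemeasurable⟩

lemma lintegral_slab {S : Set ℝ} {F : SpaceTime n → ℝ≥0∞}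
    (hF : AEMeasurable F (volume.restrict (S ×ˢ Kᶜ))) :
    ∫⁻ p in S ×ˢ Kᶜ, F p = ∫⁻ t in S, ∫⁻ x in Kᶜ, F (t, x) := by
  rw [Measure.volume_eq_prod, ← Measure.prod_restrict] at hF ⊢
  exact lintegral_prod _ hF

lemma eLpNorm_two_sq {α : Type*} [MeasurableSpace α] (μ : Measure α) (f : α → ℝ) :
    eLpNorm f 2 μ ^ 2 = ∫⁻ x, ‖f x‖ₑ ^ 2 ∂μ := by
  have := eLpNorm_nnreal_pow_eq_lintegral (f := f) (μ := μ) (p := 2) (by norm_num)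
  simpa using this

lemma eLpNorm_two_sq' {α : Type*} [MeasurableSpace α] (μ : Measure α) (f : α → ℝ≥0∞) :
    eLpNorm f 2 μ ^ 2 = ∫⁻ x, f x ^ 2 ∂μ := by
  have := eLpNorm_nnreal_pow_eq_lintegral (f := f) (μ := μ) (p := 2) (by norm_num)
  simpa using this

lemma eLpNorm_two_eq {α : Type*} [MeasurableSpace α] (μ : Measure α) (f : α → ℝ) :
    eLpNorm f 2 μ = (∫⁻ x, ‖f x‖ₑ ^ 2 ∂μ) ^ (1 / 2 : ℝ) := by
  rw [← eLpNorm_two_sq, ← ENNReal.rpow_natCast, ← ENNReal.rpow_mul]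
  norm_num

/-- The `L²` norm of a time slice. -/
def sl (K : Set (Space n)) (f : SpaceTime n → ℝ) (t : ℝ) : ℝ≥0∞ :=
  eLpNorm (fun x => f (t, x)) 2 (volume.restrict Kᶜ)

lemma Meas.sl {f : SpaceTime n → ℝ} (hf : Meas K f) :
    AEMeasurable (sl K f) (volume.restrict (Set.Ici (0 : ℝ))) := by
  have h : AFWave.sl K f = fun t => (∫⁻ x in Kᶜ, ‖f (t, x)‖ₑ ^ 2) ^ (1 / 2 : ℝ) := by
    funext t
    exact eLpNorm_two_eq _ _
  rw [h]
  have h1 := hf.prod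
  rw [region, Measure.volume_eq_prod, ← Measure.prod_restrict] at h1
  exact ((h1.enorm.pow_const 2).lintegral_prod_right').pow_const _

lemma mixedNorm_one (f : SpaceTime n → ℝ) :
    mixedNorm K 1 f = ∫⁻ t in Set.Ici (0 : ℝ), sl K f t := by
  rw [mixedNorm, eLpNorm_one_eq_lintegral_enorm]
  simp only [enorm_eq_self]
  rfl

lemma ae_sl_le_mixedNorm_top (f : SpaceTime n → ℝ) :
    ∀ᵐ t ∂(volume.restrict (Set.Ici (0 : ℝ))), sl K f t ≤ mixedNorm K ⊤ f := by
  have h := ae_le_eLpNormEssSup (f := sl K f) (μ := volume.restrict (Set.Ici (0 : ℝ)))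
  rw [mixedNorm, eLpNorm_exponent_top]
  exact h

lemma mixedNorm_top_le {f : SpaceTime n → ℝ} {c : ℝ≥0∞} (h : ∀ t, 0 ≤ t → sl K f t ≤ c) :
    mixedNorm K ⊤ f ≤ c := by
  rw [mixedNorm, eLpNorm_exponent_top, eLpNormEssSup]
  refine essSup_le_of_ae_le _ ?_
  filter_upwards [ae_restrict_mem measurableSet_Ici] with t ht
  exact h t ht

lemma mixedNorm_two_sq {f : SpaceTime n → ℝ} (hf : Meas K f) :
    mixedNorm K 2 f ^ 2 = ∫⁻ p in region K, ‖f p‖ₑ ^ 2 := by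
  rw [mixedNorm, eLpNorm_two_sq', region, lintegral_slab (hf.prod.enorm.pow_const 2)]
  simp only [eLpNorm_two_sq]

lemma sl_le_sum {ι : Type*} {s : Finset ι} {f : SpaceTime n → ℝ} {F : ι → SpaceTime n → ℝ}
    (hF : ∀ i ∈ s, Meas K (F i)) (hK : IsClosed K) {C : ℝ≥0} {t : ℝ} (ht : 0 ≤ t)
    (h : ∀ x ∈ Kᶜ, |f (t, x)| ≤ C * ∑ i ∈ s, |F i (t, x)|) :
    sl K f t ≤ C * ∑ i ∈ s, sl K (F i) t := by
  have h1 : sl K f t ≤ C • eLpNorm (∑ i ∈ s, fun x => |F i (t, x)|) 2 (volume.restrict Kᶜ) := by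
    refine eLpNorm_le_nnreal_smul_eLpNorm_of_ae_le_mul ?_ 2
    filter_upwards [ae_restrict_mem hK.measurableSet.compl] with x hx
    rw [Finset.sum_apply, ← NNReal.coe_le_coe]
    push_cast
    rw [Real.norm_eq_abs, Real.norm_eq_abs,
      abs_of_nonneg (a := ∑ i ∈ s, |F i (t, x)|) (Finset.sum_nonneg fun i _ => abs_nonneg _)]
    exact h x hx
  refine h1.trans ?_
  rw [ENNReal.smul_def, smul_eq_mul]
  gcongr
  refine (eLpNorm_sum_le (fun i hi => ?_) (by norm_num)).trans (Finset.sum_le_sum fun i hi => ?_)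
  · exact ((hF i hi).slice t ht).abs.aestronglyMeasurable
  · exact le_of_eq (eLpNorm_norm (fun x => F i (t, x)))

lemma mixedNorm_le_sum {ι : Type*} {s : Finset ι} {f : SpaceTime n → ℝ}
    {F : ι → SpaceTime n → ℝ} (hF : ∀ i ∈ s, Meas K (F i)) (hK : IsClosed K) {C : ℝ≥0}
    {q : ℝ≥0∞} (hq : 1 ≤ q) (h : ∀ p ∈ region K, |f p| ≤ C * ∑ i ∈ s, |F i p|) :
    mixedNorm K q f ≤ C * ∑ i ∈ s, mixedNorm K q (F i) := by
  have h1 : mixedNorm K q f ≤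
      C • eLpNorm (∑ i ∈ s, sl K (F i)) q (volume.restrict (Set.Ici (0 : ℝ))) := by
    refine eLpNorm_le_nnreal_smul_eLpNorm_of_ae_le_mul' ?_ q
    filter_upwards [ae_restrict_mem measurableSet_Ici] with t ht
    rw [enorm_eq_self, enorm_eq_self, Finset.sum_apply]
    exact sl_le_sum hF hK ht fun x hx => h (t, x) ⟨ht, hx⟩
  refine h1.trans ?_
  rw [ENNReal.smul_def, smul_eq_mul]
  gcongr
  exact eLpNorm_sum_le (fun i hi => (hF i hi).sl.aestronglyMeasurable) hq

lemma mixedNorm_mono {f g : SpaceTime n → ℝ} (hK : IsClosed K) {q : ℝ≥0∞}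
    (h : ∀ p ∈ region K, |f p| ≤ |g p|) : mixedNorm K q f ≤ mixedNorm K q g := by
  refine eLpNorm_mono_enorm_ae ?_
  filter_upwards [ae_restrict_mem measurableSet_Ici] with t ht
  rw [enorm_eq_self, enorm_eq_self]
  refine eLpNorm_mono_ae ?_
  filter_upwards [ae_restrict_mem hK.measurableSet.compl] with x hx
  exact h (t, x) ⟨ht, hx⟩

lemma mixedNorm_congr {f g : SpaceTime n → ℝ} (hK : IsClosed K) {q : ℝ≥0∞}
    (h : ∀ p ∈ region K, f p = g p) : mixedNorm K q f = mixedNorm K q g :=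
  le_antisymm (mixedNorm_mono hK fun p hp => (congrArg _ (h p hp)).le)
    (mixedNorm_mono hK fun p hp => (congrArg _ (h p hp)).ge)

lemma ellInf_le_sum {φ : ℕ → Space n → ℝ} (hφ : IsDyadicPartition φ) {ι : Type*} {s : Finset ι}
    {f : SpaceTime n → ℝ} {F : ι → SpaceTime n → ℝ} (hF : ∀ i ∈ s, Meas K (F i))
    (hK : IsClosed K) {C : ℝ≥0} {σ : ℝ} (h : ∀ p ∈ region K, |f p| ≤ C * ∑ i ∈ s, |F i p|) :
    ellInf φ σ (mixedNorm K 2) f ≤ C * ∑ i ∈ s, ellInf φ σ (mixedNorm K 2) (F i) := by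
  refine iSup_le fun j => ?_
  have h1 : mixedNorm K 2 (fun p => φ j p.2 * f p) ≤
      C * ∑ i ∈ s, mixedNorm K 2 (fun p => φ j p.2 * F i p) := by
    refine mixedNorm_le_sum (fun i hi => (Meas.of_space
      (hφ.smooth j).continuous.measurable).mul (hF i hi)) hK (by norm_num) fun p hp => ?_
    simp only [abs_mul, ← Finset.mul_sum]
    rw [mul_left_comm]
    exact mul_le_mul_of_nonneg_left (h p hp) (abs_nonneg _)
  calc _ ≤ (2 : ℝ≥0∞) ^ ((j : ℝ) * σ) *
        (C * ∑ i ∈ s, mixedNorm K 2 (fun p => φ j p.2 * F i p)) := by gcongr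
    _ = C * ∑ i ∈ s, (2 : ℝ≥0∞) ^ ((j : ℝ) * σ) * mixedNorm K 2 (fun p => φ j p.2 * F i p) := by
        rw [mul_left_comm, Finset.mul_sum]
    _ ≤ _ := by
        gcongr with i hi
        exact le_iSup (fun j : ℕ => (2 : ℝ≥0∞) ^ ((j : ℝ) * σ) *
          mixedNorm K 2 (fun p => φ j p.2 * F i p)) j

/-- The Cauchy-Schwarz inequality in space for the integral of a product. -/
lemma lintegral_mul_le (hK : IsClosed K) {f V : SpaceTime n → ℝ}
    (hf : ContinuousOn f (region K)) (hV : ContinuousOn V (region K)) {T : ℝ} {S : ℝ≥0∞}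
    (hS : ∀ t ∈ Set.Icc 0 T, sl K V t ≤ S) :
    ∫⁻ p in Set.Icc 0 T ×ˢ Kᶜ, ‖f p * V p‖ₑ ≤ (∫⁻ t in Set.Icc 0 T, sl K f t) * S := by
  have hm : AEMeasurable (fun p => ‖f p * V p‖ₑ) (volume.restrict (Set.Icc 0 T ×ˢ Kᶜ)) :=
    ((hf.mul hV).mono (slab_subset T)).aemeasurable (measurableSet_region_slab hK T) |>.enorm
  rw [lintegral_slab hm]
  have h1 : ∀ t ∈ Set.Icc 0 T, ∫⁻ x in Kᶜ, ‖f (t, x) * V (t, x)‖ₑ ≤ sl K f t * S := by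
    intro t ht
    have hft := (continuousOn_slice hf ht.1).aemeasurable (μ := volume) hK.measurableSet.compl
    have hVt := (continuousOn_slice hV ht.1).aemeasurable (μ := volume) hK.measurableSet.compl
    have hH := ENNReal.lintegral_mul_le_Lp_mul_Lq (volume.restrict Kᶜ) (p := 2) (q := 2)
      Real.HolderConjugate.two_two hft.enorm hVt.enorm
    have e : ∀ g : Space n → ℝ, (∫⁻ x in Kᶜ, ‖g x‖ₑ ^ (2 : ℝ)) ^ (1 / (2 : ℝ)) =
        eLpNorm g 2 (volume.restrict Kᶜ) := fun g => by
      rw [eLpNorm_two_eq]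
      simp
    rw [e (fun x => f (t, x)), e (fun x => V (t, x))] at hH
    simp only [enorm_mul]
    refine hH.trans ?_
    exact mul_le_mul_right (hS t ht) _
  calc _ ≤ ∫⁻ t in Set.Icc 0 T, sl K f t * S :=
        setLIntegral_mono_ae' measurableSet_Icc (Filter.Eventually.of_forall h1)
    _ = _ := by
        refine lintegral_mul_const'' _ ?_
        exact (Meas.of_continuousOn hK hf).sl.mono_measure
          (Measure.restrict_mono Set.Icc_subset_Ici_self le_rfl)

/-! ### The exterior estimate for the cut off functions -/

/-- The exterior estimate in terms of integrals over `[0, ∞]`. The right side `X` is finite, which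
allows its parts to be absorbed. -/
lemma NearFlat.exterior_lintegral {ρ : ℝ} {κ : ℕ → ℝ}
    {h : Fin (n + 1) → Fin (n + 1) → SpaceTime n → ℝ} {B : Set (Space n)} {w : SpaceTime n → ℝ}
    (H : NearFlat K ρ κ h) (hn : 3 ≤ n) (hK : IsClosed K) (hB : IsCompact B)
    (hBK : B ⊆ Kᶜ) (hBρ : ∀ x ∈ B, ρ < ‖x‖) (hw : CD K 2 w) (h0 : SuppIn K B w) (T : ℝ)
    (hκ : ∀ m, ∑ j ∈ Finset.range m, κ j ≤ 1 / (80000 * (n + 1 : ℝ) ^ 5)) :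
    ∃ X : ℝ≥0∞, X ≠ ⊤ ∧ X = (∫⁻ x in Kᶜ, ENNReal.ofReal (engy K w (0, x))) +
        (∫⁻ p in Set.Icc 0 T ×ˢ Kᶜ, ENNReal.ofReal (|source K h w p| * vsum K w p)) ∧
      (∀ t ∈ Set.Icc 0 T, ∫⁻ x in Kᶜ, ENNReal.ofReal (engy K w (t, x)) ≤
        ENNReal.ofReal (80000 * (n + 1 : ℝ) ^ 5) * X) ∧
      (0 ≤ T → ∀ i, ∫⁻ p in Set.Icc 0 T ×ˢ Kᶜ, ENNReal.ofReal (shell K w i p) ≤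
        ENNReal.ofReal (80000 * (n + 1 : ℝ) ^ 5) * X) := by
  have hw1 : CD K 1 w := hw.of_le (by norm_num)
  have iE : ∀ {t : ℝ}, 0 ≤ t → IntegrableOn (fun x => engy K w (t, x)) Kᶜ := fun ht =>
    integrableOn_slice hK hB hBK (continuousOn_engy hK hw1) (suppIn_engy hB.isClosed h0) ht
  have cE : ∀ {t : ℝ}, 0 ≤ t → ENNReal.ofReal (∫ x in Kᶜ, engy K w (t, x)) =
      ∫⁻ x in Kᶜ, ENNReal.ofReal (engy K w (t, x)) := fun ht =>
    ofReal_integral_eq_lintegral_ofReal (iE ht) (Filter.Eventually.of_forall fun _ =>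
      engy_nonneg _ _)
  have iV : ∀ T, IntegrableOn (fun p => |source K h w p| * vsum K w p) (Set.Icc 0 T ×ˢ Kᶜ) :=
    integrableOn_slab hK hB hBK ((continuousOn_source hK H.smooth hw).abs.mul
      (continuousOn_vsum hK hw1)) (fun p hp h => by
        have h1 : ∀ β, dd K β w p = 0 := fun β => h0.along hB.isClosed (coordField β) p hp h
        simp [vsum, h1, h0 p hp h])
  have nV : ∀ p, 0 ≤ |source K h w p| * vsum K w p := fun p =>
    mul_nonneg (abs_nonneg _) (vsum_nonneg _ _)
  have cV : ∀ T, ENNReal.ofReal (∫ p in Set.Icc 0 T ×ˢ Kᶜ, |source K h w p| * vsum K w p) =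
      ∫⁻ p in Set.Icc 0 T ×ˢ Kᶜ, ENNReal.ofReal (|source K h w p| * vsum K w p) := fun T =>
    ofReal_integral_eq_lintegral_ofReal (iV T) (Filter.Eventually.of_forall nV)
  have hX : ∀ t, ENNReal.ofReal ((∫ x in Kᶜ, engy K w (0, x)) +
      ∫ p in Set.Icc 0 t ×ˢ Kᶜ, |source K h w p| * vsum K w p) =
      (∫⁻ x in Kᶜ, ENNReal.ofReal (engy K w (0, x))) +
        (∫⁻ p in Set.Icc 0 t ×ˢ Kᶜ, ENNReal.ofReal (|source K h w p| * vsum K w p)) := fun t => by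
    rw [ENNReal.ofReal_add (integral_nonneg fun _ => engy_nonneg _ _) (integral_nonneg nV), cV,
      cE le_rfl]
  have hC : (0 : ℝ) ≤ 80000 * (n + 1 : ℝ) ^ 5 := by positivity
  refine ⟨_, by rw [← hX]; exact ENNReal.ofReal_ne_top, rfl, fun t ht => ?_, fun hT i => ?_⟩
  · have h1 := (H.exterior_estimate hn hK hB hBK hBρ hw h0 ht.1 hκ).1
    rw [← cE ht.1]
    refine (ENNReal.ofReal_le_ofReal h1).trans ?_
    rw [ENNReal.ofReal_mul hC, hX]
    gcongr
    exact ht.2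
  · have h1 := (H.exterior_estimate hn hK hB hBK hBρ hw h0 hT hκ).2 i
    rw [← hX, ← ENNReal.ofReal_mul hC, ← ofReal_integral_eq_lintegral_ofReal
      (integrableOn_shell hK hB hBK hw1 h0 i T)
      (Filter.Eventually.of_forall fun _ => shell_nonneg _ _ _)]
    exact ENNReal.ofReal_le_ofReal h1

lemma enorm_sq_eq (x : ℝ) : ‖x‖ₑ ^ 2 = ENNReal.ofReal (x ^ 2) := by
  rw [← ofReal_norm, ← ENNReal.ofReal_pow (norm_nonneg _), Real.norm_eq_abs, sq_abs]

lemma vsum_sq_le (w : SpaceTime n → ℝ) (p : SpaceTime n) :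
    vsum K w p ^ 2 ≤ 2 * (n + 1) * engy K w p + 2 * (qf 1 p ^ 2 * w p ^ 2) := by
  have h1 : (∑ α, |dd K α w p|) ^ 2 ≤ (n + 1 : ℕ) * ∑ α, |dd K α w p| ^ 2 := by
    simpa using sq_sum_le_card_mul_sum_sq (s := Finset.univ) (f := fun α => |dd K α w p|)
  simp only [sq_abs] at h1
  have h2 : (qf 1 p * |w p|) ^ 2 = qf 1 p ^ 2 * w p ^ 2 := by rw [mul_pow, sq_abs]
  have h3 := add_sq_le (a := ∑ α, |dd K α w p|) (b := qf 1 p * |w p|)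
  rw [h2] at h3
  push_cast at h1
  rw [vsum, engy]
  linarith

/-- The `L²` norm of the multiplier is bounded by the energy, by Hardy's inequality. -/
lemma sl_vsum_sq_le (hn : 3 ≤ n) (hK : IsClosed K) {B : Set (Space n)} (hB : IsCompact B)
    (hBK : B ⊆ Kᶜ) {w : SpaceTime n → ℝ} (hw : CD K 1 w) (h0 : SuppIn K B w) {t : ℝ} (ht : 0 ≤ t) :
    sl K (vsum K w) t ^ 2 ≤
      ENNReal.ofReal (10 * (n + 1 : ℝ)) * ∫⁻ x in Kᶜ, ENNReal.ofReal (engy K w (t, x)) := by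
  have iE : IntegrableOn (fun x => engy K w (t, x)) Kᶜ :=
    integrableOn_slice hK hB hBK (continuousOn_engy hK hw) (suppIn_engy hB.isClosed h0) ht
  have iq : IntegrableOn (fun x => qf 1 (t, x) ^ 2 * w (t, x) ^ 2) Kᶜ :=
    integrableOn_slice (f := fun p => qf 1 p ^ 2 * w p ^ 2) hK hB hBK
      (((smooth_qf one_pos).continuousOn.pow 2).mul (hw.continuousOn.pow 2))
      (fun p hp h => by simp [h0 p hp h]) ht
  have hH : ∫ x in Kᶜ, qf 1 (t, x) ^ 2 * w (t, x) ^ 2 ≤ 4 * ∫ x in Kᶜ, engy K w (t, x) :=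
    hardy hn hK hB hBK hw h0 one_pos ht
  have hE0 : 0 ≤ ∫ x in Kᶜ, engy K w (t, x) := integral_nonneg fun _ => engy_nonneg _ _
  have hn0 : (0 : ℝ) ≤ n := Nat.cast_nonneg n
  rw [sl, eLpNorm_two_sq]
  have h1 : ∫⁻ x in Kᶜ, ‖vsum K w (t, x)‖ₑ ^ 2 ≤ ∫⁻ x in Kᶜ, ENNReal.ofReal
      (2 * (n + 1) * engy K w (t, x) + 2 * (qf 1 (t, x) ^ 2 * w (t, x) ^ 2)) :=
    lintegral_mono fun x => by
      rw [enorm_sq_eq]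
      exact ENNReal.ofReal_le_ofReal (vsum_sq_le w (t, x))
  refine h1.trans ?_
  have iS : IntegrableOn (fun x => 2 * (n + 1) * engy K w (t, x) +
      2 * (qf 1 (t, x) ^ 2 * w (t, x) ^ 2)) Kᶜ := (iE.const_mul _).add (iq.const_mul _)
  rw [← ofReal_integral_eq_lintegral_ofReal iS
    (Filter.Eventually.of_forall fun x => by
      have := engy_nonneg (K := K) w (t, x)
      simp only [Pi.zero_apply]
      positivity),
    ← ofReal_integral_eq_lintegral_ofReal iE (Filter.Eventually.of_forall fun _ => engy_nonneg _ _),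
    ← ENNReal.ofReal_mul (by positivity), integral_add (iE.const_mul _) (iq.const_mul _),
    integral_const_mul, integral_const_mul]
  refine ENNReal.ofReal_le_ofReal ?_
  nlinarith

lemma le_shell_dyIdx (w : SpaceTime n → ℝ) {p : SpaceTime n} (hr : 1 ≤ ‖p.2‖) :
    (engy K w p + w p ^ 2 / ‖p.2‖ ^ 2) / ‖p.2‖ ≤ shell K w (dyIdx p.2) p := by
  have hE := engy_nonneg (K := K) w p
  have hr0 : 0 < ‖p.2‖ := by linarith
  have hJr := two_pow_dyIdx_le hr
  have hs : shell K w (dyIdx p.2) p =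
      (2 ^ dyIdx p.2)⁻¹ * (engy K w p + ((2 ^ dyIdx p.2) ^ 2)⁻¹ * w p ^ 2) :=
    Set.indicator_of_mem (s := {q : SpaceTime n | ‖q.2‖ ≤ 2 ^ (dyIdx p.2 + 1)})
      (lt_two_pow_dyIdx p.2).le _
  rw [hs, div_eq_inv_mul, div_eq_inv_mul]
  gcongr

/-- If `A` is finite, the part of the error that is small relative to `A` and the part that is linear
in `S ≲ A^{1/2}` can both be absorbed. -/
lemma absorb {A P Q S c r : ℝ≥0∞} (hA : A ≠ ⊤) (hc : c ≠ ⊤) (h : A ≤ P + Q * S + r * A)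
    (hS : S ^ 2 ≤ c * A) (hr : r ≤ 1 / 2) : A ≤ 4 * P + 4 * c * Q ^ 2 := by
  by_cases hP : P = ⊤
  · simp [hP]
  have hS' : S ≠ ⊤ := by
    rintro rfl
    rw [ENNReal.top_pow (by norm_num), top_le_iff] at hS
    exact ENNReal.mul_ne_top hc hA hS
  by_cases hc0 : c = 0
  · have : S = 0 := by
      rw [hc0, zero_mul] at hS
      simpa using hS
    rw [this, mul_zero, add_zero] at h
    have h2 : A ≤ P + 1 / 2 * A := h.trans (by gcongr)
    lift A to ℝ≥0 using hA
    lift P to ℝ≥0 using hP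
    have h3 : (A : ℝ≥0∞) ≤ 2 * P := by
      have e : (1 / 2 : ℝ≥0∞) = ((1 / 2 : ℝ≥0) : ℝ≥0∞) := by simp
      rw [e] at h2
      norm_cast at h2 ⊢
      rw [← NNReal.coe_le_coe] at h2 ⊢
      push_cast at h2 ⊢
      linarith
    refine h3.trans (le_add_of_le_of_nonneg ?_ zero_le)
    gcongr
    norm_num
  by_cases hQ : Q = ⊤
  · have : 4 * c * Q ^ 2 = ⊤ := by
      rw [hQ, ENNReal.top_pow (by norm_num), ENNReal.mul_top (by simp [hc0])]
    rw [this, add_top]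
    exact le_top
  have h2 : A ≤ P + Q * S + 1 / 2 * A := h.trans (by gcongr)
  lift A to ℝ≥0 using hA
  lift P to ℝ≥0 using hP
  lift Q to ℝ≥0 using hQ
  lift S to ℝ≥0 using hS'
  lift c to ℝ≥0 using hc
  have e : (1 / 2 : ℝ≥0∞) = ((1 / 2 : ℝ≥0) : ℝ≥0∞) := by simp
  rw [e] at h2
  norm_cast at h2 hS ⊢
  rw [← NNReal.coe_le_coe] at h2 hS ⊢
  push_cast at h2 hS ⊢
  have hc0' : 0 < (c : ℝ) := by
    rw [NNReal.coe_pos]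
    exact pos_iff_ne_zero.2 fun h => hc0 (by simp [h])
  -- `Q S ≤ c Q² + S² / (4 c) ≤ c Q² + A / 4`
  have h3 : (Q : ℝ) * S ≤ c * Q ^ 2 + A / 4 := by
    have h4 : 0 ≤ (2 * c * Q - S : ℝ) ^ 2 := sq_nonneg _
    have h5 : 4 * c * ((Q : ℝ) * S) ≤ 4 * c * (c * Q ^ 2 + A / 4) := by nlinarith
    exact le_of_mul_le_mul_left h5 (by positivity)
  linarith

/-- The local energy density of the `Z^b u`, `b ∈ W`, in the `J`-th dyadic annulus outside the ball
of radius `ρ`. -/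
def gsh (K : Set (Space n)) (ρ : ℝ) (W : Finset (List (ZIndex n))) (u : SpaceTime n → ℝ) (J : ℕ) :
    SpaceTime n → ℝ :=
  Set.indicator {p | ρ < ‖p.2‖ ∧ dyIdx p.2 = J}
    (fun p => (2 ^ J)⁻¹ * ∑ b ∈ W, ∑ α, dd K α (zw K b u) p ^ 2)

lemma gsh_nonneg (ρ : ℝ) (W : Finset (List (ZIndex n))) (u : SpaceTime n → ℝ) (J : ℕ)
    (p : SpaceTime n) : 0 ≤ gsh K ρ W u J p :=
  Set.indicator_nonneg (fun p _ => mul_nonneg (by positivity)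
    (Finset.sum_nonneg fun _ _ => Finset.sum_nonneg fun _ _ => sq_nonneg _)) p

lemma grad_sq_le (W : Finset (List (ZIndex n))) (u : SpaceTime n → ℝ) (p : SpaceTime n) :
    grad K W u p ^ 2 ≤ W.card * (n + 1) * ∑ b ∈ W, ∑ α, dd K α (zw K b u) p ^ 2 := by
  have h1 : ∀ b, (∑ α, |dd K α (zw K b u) p|) ^ 2 ≤ (n + 1 : ℕ) * ∑ α, dd K α (zw K b u) p ^ 2 :=
    fun b => by
      simpa using sq_sum_le_card_mul_sum_sq (s := Finset.univ)
        (f := fun α => |dd K α (zw K b u) p|)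
  refine (sq_sum_le_card_mul_sum_sq (s := W) (f := fun b => ∑ α, |dd K α (zw K b u) p|)).trans ?_
  rw [mul_assoc]
  gcongr
  rw [Finset.mul_sum]
  refine Finset.sum_le_sum fun b _ => (h1 b).trans (le_of_eq ?_)
  push_cast
  ring

lemma grad_sq_div_le {ρ : ℝ} (W : Finset (List (ZIndex n))) (u : SpaceTime n → ℝ)
    {p : SpaceTime n} (h1 : 1 ≤ ‖p.2‖) (hr : ρ < ‖p.2‖) :
    grad K W u p ^ 2 / ‖p.2‖ ≤ W.card * (n + 1) * gsh K ρ W u (dyIdx p.2) p := by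
  have hs : gsh K ρ W u (dyIdx p.2) p =
      (2 ^ dyIdx p.2)⁻¹ * ∑ b ∈ W, ∑ α, dd K α (zw K b u) p ^ 2 :=
    Set.indicator_of_mem (s := {q : SpaceTime n | ρ < ‖q.2‖ ∧ dyIdx q.2 = dyIdx p.2}) ⟨hr, rfl⟩ _
  have h2 := two_pow_dyIdx_le h1
  have h3 : 0 ≤ ∑ b ∈ W, ∑ α, dd K α (zw K b u) p ^ 2 :=
    Finset.sum_nonneg fun _ _ => Finset.sum_nonneg fun _ _ => sq_nonneg _
  rw [hs, div_eq_inv_mul]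
  calc ‖p.2‖⁻¹ * grad K W u p ^ 2 ≤ (2 ^ dyIdx p.2)⁻¹ *
        (W.card * (n + 1) * ∑ b ∈ W, ∑ α, dd K α (zw K b u) p ^ 2) := by
        gcongr
        exact grad_sq_le W u p
    _ = _ := by ring

/-- Young's inequality for the product of the source bound with the multiplier. -/
lemma source_mul_le {s F D G V U k ν C e η : ℝ} (hs : s ≤ F + k * (D + G) + C * ((ν + e) * G))
    (hDU : D ≤ U) (hVU : V ≤ U) (hV : 0 ≤ V) (hG : 0 ≤ G) (hk : 0 ≤ k) (hν : 0 ≤ ν)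
    (hC : 0 ≤ C) (hη : 0 < η) :
    s * V ≤ F * V + C * e * (G * V) + k * (2 * U ^ 2) + k * G ^ 2 +
      C * η⁻¹ * (ν * G ^ 2) + C * η * (ν * U ^ 2) := by
  have hU : 0 ≤ U := hV.trans hVU
  have h1 := mul_le_mul_of_nonneg_right hs hV
  have h2 : (D + G) * V ≤ 2 * U ^ 2 + G ^ 2 := by
    have e1 : D * V ≤ U * U := mul_le_mul hDU hVU hV hU
    have e2 : G * V ≤ G * U := mul_le_mul_of_nonneg_left hVU hG
    nlinarith [sq_nonneg (G - U)]
  have h3 : G * V ≤ η⁻¹ * G ^ 2 + η * U ^ 2 := by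
    have e2 : G * V ≤ G * U := mul_le_mul_of_nonneg_left hVU hG
    have e3 : G * U = η⁻¹ * (G * (η * U)) := by field_simp
    have e4 : η⁻¹ * (G * (η * U)) ≤ η⁻¹ * (G ^ 2 + (η * U) ^ 2) := by
      refine mul_le_mul_of_nonneg_left ?_ (by positivity)
      nlinarith [sq_nonneg (G - η * U), sq_nonneg G, sq_nonneg (η * U)]
    have e5 : η⁻¹ * (G ^ 2 + (η * U) ^ 2) = η⁻¹ * G ^ 2 + η * U ^ 2 := by field_simp
    linarith
  have h4 := mul_le_mul_of_nonneg_left h2 hk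
  have h5 := mul_le_mul_of_nonneg_left h3 (mul_nonneg hC hν)
  linarith

lemma lintegral_ofReal_sum_le {α ι : Type*} [MeasurableSpace α] {μ : Measure α} {s : Finset ι}
    {c : ι → ℝ} {f : ι → α → ℝ} {Q : ℝ≥0∞} (hc : ∀ i ∈ s, 0 ≤ c i)
    (hf0 : ∀ i ∈ s, ∀ x, 0 ≤ f i x) (hf : ∀ i ∈ s, AEMeasurable (f i) μ)
    (hQ : ∀ i ∈ s, ∫⁻ x, ENNReal.ofReal (f i x) ∂μ ≤ Q) :
    ∫⁻ x, ENNReal.ofReal (∑ i ∈ s, c i * f i x) ∂μ ≤ ENNReal.ofReal (∑ i ∈ s, c i) * Q := by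
  have h1 : ∀ x, ENNReal.ofReal (∑ i ∈ s, c i * f i x) =
      ∑ i ∈ s, ENNReal.ofReal (c i) * ENNReal.ofReal (f i x) := fun x => by
    rw [ENNReal.ofReal_sum_of_nonneg fun i hi => mul_nonneg (hc i hi) (hf0 i hi x)]
    exact Finset.sum_congr rfl fun i hi => ENNReal.ofReal_mul (hc i hi)
  simp only [h1]
  rw [lintegral_finsetSum' _ fun i hi => (hf i hi).ennreal_ofReal.const_mul _,
    ENNReal.ofReal_sum_of_nonneg hc, Finset.sum_mul]
  refine Finset.sum_le_sum fun i hi => ?_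
  rw [lintegral_const_mul'' _ (hf i hi).ennreal_ofReal]
  gcongr
  exact hQ i hi

lemma lintegral_ofReal_add_le {α : Type*} [MeasurableSpace α] {μ : Measure α} {f g : α → ℝ}
    {P Q : ℝ≥0∞} (hf : AEMeasurable f μ) (h1 : ∫⁻ x, ENNReal.ofReal (f x) ∂μ ≤ P)
    (h2 : ∫⁻ x, ENNReal.ofReal (g x) ∂μ ≤ Q) :
    ∫⁻ x, ENNReal.ofReal (f x + g x) ∂μ ≤ P + Q := by
  calc _ ≤ ∫⁻ x, (ENNReal.ofReal (f x) + ENNReal.ofReal (g x)) ∂μ :=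
        lintegral_mono fun x => ENNReal.ofReal_add_le
    _ = _ := lintegral_add_left' hf.ennreal_ofReal _
    _ ≤ _ := add_le_add h1 h2

lemma measurable_dyIdx : Measurable (dyIdx : Space n → ℕ) :=
  (measurable_from_top (f := Nat.log 2)).comp (Nat.measurable_floor.comp measurable_norm)

lemma measurableSet_gsh (ρ : ℝ) (J : ℕ) :
    MeasurableSet {p : SpaceTime n | ρ < ‖p.2‖ ∧ dyIdx p.2 = J} :=
  (measurableSet_lt measurable_const measurable_snd.norm).inter
    ((measurable_dyIdx.comp measurable_snd) (measurableSet_singleton J))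

/-- The data term of the far estimate. -/
def farData (K : Set (Space n)) (ρ : ℝ) (k : ℕ) (u : SpaceTime n → ℝ) : ℝ≥0∞ :=
  ∫⁻ x in {x : Space n | ρ < ‖x‖},
    ENNReal.ofReal (∑ b ∈ wordsLe (ZIndex n) k, ∑ α, dd K α (zw K b u) (0, x) ^ 2)

/-- The local energy in the exterior region of words with at most `j` rotations. -/
def farLocal (K : Set (Space n)) (ρ : ℝ) (k j : ℕ) (u : SpaceTime n → ℝ) : ℝ≥0∞ :=
  ⨆ J, ∫⁻ p in region K, ENNReal.ofReal (gsh K ρ (lowW n k j) u J p)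

/-- The forcing term, together with the energy of words with at most `j` rotations. -/
def farForce (K : Set (Space n)) (g : MatrixField n) (k j : ℕ) (u : SpaceTime n → ℝ) : ℝ≥0∞ :=
  ∑ a ∈ wordsLe (ZIndex n) k, mixedNorm K 1 (zw K a (box K g u)) +
    ∑ b ∈ lowW n k j, ∑ α, mixedNorm K ⊤ (dd K α (zw K b u))

lemma continuousOn_grad (hK : IsClosed K) {W : Finset (List (ZIndex n))} {u : SpaceTime n → ℝ}
    {k : ℕ} (hu : CD K (k + 2) u) (hW : ∀ b ∈ W, b.length ≤ k) :
    ContinuousOn (grad K W u) (region K) :=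
  continuousOn_finsetSum _ fun b hb => continuousOn_finsetSum _ fun α _ =>
    (ContDiffOn.continuousOn (CD.dd (m := 0) hK (CD.zw hK b
      (hu.of_le (by have := hW b hb; omega))) α)).abs

lemma continuousOn_dd_zw (hK : IsClosed K) {u : SpaceTime n → ℝ}
    {k : ℕ} (hu : CD K (k + 2) u) {b : List (ZIndex n)} (hb : b.length ≤ k) (α : Fin (n + 1)) :
    ContinuousOn (dd K α (zw K b u)) (region K) :=
  ContDiffOn.continuousOn (CD.dd (m := 0) hK (CD.zw hK b (hu.of_le (by omega))) α)

lemma aemeasurable_gsh (hK : IsClosed K) {u : SpaceTime n → ℝ} {k : ℕ} (hu : CD K (k + 2) u)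
    (ρ : ℝ) {W : Finset (List (ZIndex n))} (hW : ∀ b ∈ W, b.length ≤ k) (J : ℕ) :
    AEMeasurable (gsh K ρ W u J) (volume.restrict (region K)) := by
  refine AEMeasurable.indicator ?_ (measurableSet_gsh ρ J)
  exact (continuousOn_const.mul (continuousOn_finsetSum _ fun b hb => continuousOn_finsetSum _
    fun α _ => (continuousOn_dd_zw hK hu (hW b hb) α).pow 2)).aemeasurable (measurableSet_region hK)

lemma lintegral_sl_grad_le (hK : IsClosed K) {u : SpaceTime n → ℝ} {k j : ℕ}
    (hu : CD K (k + 2) u) {T : ℝ} :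
    ∫⁻ t in Set.Icc 0 T, sl K (grad K (lowW n k j) u) t ≤
      ENNReal.ofReal T * ∑ b ∈ lowW n k j, ∑ α, mixedNorm K ⊤ (dd K α (zw K b u)) := by
  set S := ∑ b ∈ lowW n k j, ∑ α, mixedNorm K ⊤ (dd K α (zw K b u)) with hS
  have hM : ∀ i ∈ lowW n k j ×ˢ (Finset.univ : Finset (Fin (n + 1))),
      Meas K (dd K i.2 (zw K i.1 u)) := fun i hi =>
    Meas.of_continuousOn hK (continuousOn_dd_zw hK hu
      (mem_lowW.1 (Finset.mem_product.1 hi).1).1 i.2)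
  have h1 : ∀ᵐ t ∂(volume.restrict (Set.Icc 0 T)), sl K (grad K (lowW n k j) u) t ≤ S := by
    have h2 : ∀ᵐ t ∂(volume.restrict (Set.Icc 0 T)),
        ∀ i ∈ lowW n k j ×ˢ (Finset.univ : Finset (Fin (n + 1))),
        sl K (dd K i.2 (zw K i.1 u)) t ≤ mixedNorm K ⊤ (dd K i.2 (zw K i.1 u)) := by
      rw [Filter.eventually_all_finset]
      intro i hi
      exact ae_mono (Measure.restrict_mono Set.Icc_subset_Ici_self le_rfl)
        (ae_sl_le_mixedNorm_top _)
    filter_upwards [h2, ae_restrict_mem measurableSet_Icc] with t ht htT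
    refine (sl_le_sum (C := 1) hM hK htT.1 fun x _ => ?_).trans ?_
    · rw [NNReal.coe_one, one_mul, abs_of_nonneg (grad_nonneg _ _ _), grad, Finset.sum_product]
    · rw [ENNReal.coe_one, one_mul, hS, ← Finset.sum_product']
      exact Finset.sum_le_sum ht
  calc _ ≤ ∫⁻ _t in Set.Icc 0 T, S := lintegral_mono_ae h1
    _ = _ := by
        rw [setLIntegral_const, Real.volume_Icc, sub_zero, mul_comm]

lemma engy_cut_le {W : Finset (List (ZIndex n))} {u w : SpaceTime n → ℝ} {k : ℕ} {C : ℝ}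
    {a : List (ZIndex n)} (ha : a.length ≤ k) (hW : W ⊆ wordsLe (ZIndex n) k) {p : SpaceTime n}
    (h : ∀ α, |dd K α w p| ≤ |dd K α (zw K a u) p| + C * grad K W u p) :
    engy K w p ≤ (2 + 2 * (n + 1) * C ^ 2 * (W.card * (n + 1))) *
      ∑ b ∈ wordsLe (ZIndex n) k, ∑ α, dd K α (zw K b u) p ^ 2 := by
  set Sg := ∑ b ∈ wordsLe (ZIndex n) k, ∑ α, dd K α (zw K b u) p ^ 2 with hSg
  have h1 : ∑ α, dd K α (zw K a u) p ^ 2 ≤ Sg :=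
    Finset.single_le_sum (f := fun b => ∑ α, dd K α (zw K b u) p ^ 2)
      (fun _ _ => Finset.sum_nonneg fun _ _ => sq_nonneg _) (mem_wordsLe.2 ha)
  have h2 : grad K W u p ^ 2 ≤ W.card * (n + 1) * Sg := by
    refine (grad_sq_le W u p).trans ?_
    gcongr
    exact Finset.sum_le_sum_of_subset_of_nonneg hW fun _ _ _ =>
      Finset.sum_nonneg fun _ _ => sq_nonneg _
  have h3 : engy K w p ≤ ∑ α, (2 * dd K α (zw K a u) p ^ 2 + 2 * C ^ 2 * grad K W u p ^ 2) := by
    refine Finset.sum_le_sum fun α _ => ?_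
    have h4 := h α
    have h5 : |dd K α w p| ^ 2 ≤ (|dd K α (zw K a u) p| + C * grad K W u p) ^ 2 := by gcongr
    rw [sq_abs] at h5
    refine h5.trans ((add_sq_le).trans (le_of_eq ?_))
    rw [sq_abs]
    ring
  refine h3.trans ?_
  rw [Finset.sum_add_distrib, ← Finset.mul_sum, Finset.sum_const, Finset.card_univ,
    Fintype.card_fin, nsmul_eq_mul]
  push_cast
  have h6 := mul_le_mul_of_nonneg_left h2 (by positivity : (0 : ℝ) ≤ 2 * (n + 1) * C ^ 2)
  linarith

/-- The pointwise form of the error terms, with the dyadic sums made explicit. -/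
lemma source_mul_vsum_le {ρ : ℝ} {κ : ℕ → ℝ} {W L : Finset (List (ZIndex n))}
    {u : SpaceTime n → ℝ} {w : List (ZIndex n) → SpaceTime n → ℝ} {a : List (ZIndex n)}
    {s F C e η : ℝ} {p : SpaceTime n} {m m₁ : ℕ} (hρ : 1 ≤ ρ) (hr : ρ < ‖p.2‖)
    (hκ0 : ∀ j, 0 ≤ κ j) (ha : a ∈ W) (hC : 0 ≤ C) (hη : 0 < η)
    (hs : s ≤ F + κ (dyIdx p.2) / ‖p.2‖ * ((∑ b ∈ W, ∑ α, |dd K α (w b) p|) + grad K L u p) +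
      C * ((near ρ p.2 + e) * grad K L u p))
    (hm : dyIdx p.2 < m) (hm₁ : ‖p.2‖ ≤ 3 * ρ → dyIdx p.2 < m₁) :
    s * vsum K (w a) p ≤ F * vsum K (w a) p + (C * e * (grad K L u p * vsum K (w a) p) +
      (∑ J ∈ Finset.range m, 4 * (n + 1) * W.card * κ J * ∑ b ∈ W, shell K (w b) J p +
      (∑ J ∈ Finset.range m, L.card * (n + 1) * κ J * gsh K ρ L u J p +
      (∑ J ∈ Finset.range m₁, C * η⁻¹ * (3 * ρ * (L.card * (n + 1))) * gsh K ρ L u J p +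
      ∑ J ∈ Finset.range m₁, C * η * (3 * ρ * (2 * (n + 1) * W.card)) *
        ∑ b ∈ W, shell K (w b) J p)))) := by
  set G := grad K L u p with hG
  set r := ‖p.2‖ with hrdef
  have hr1 : 1 ≤ r := hρ.trans hr.le
  have hr0 : 0 < r := by linarith
  set U := ∑ b ∈ W, vsum K (w b) p with hU
  have hV := vsum_nonneg (K := K) (w a) p
  have hG0 : 0 ≤ G := grad_nonneg _ _ _
  have hDU : (∑ b ∈ W, ∑ α, |dd K α (w b) p|) ≤ U := Finset.sum_le_sum fun b _ =>
    le_add_of_nonneg_right (mul_nonneg (qf_pos one_pos p).le (abs_nonneg _))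
  have hVU : vsum K (w a) p ≤ U :=
    Finset.single_le_sum (f := fun b => vsum K (w b) p) (fun _ _ => vsum_nonneg _ _) ha
  have hκJ := hκ0 (dyIdx p.2)
  have hmain := source_mul_le hs hDU hVU hV hG0 (by positivity) (near_nonneg ρ p.2) hC hη
  set SJ : ℕ → ℝ := fun J => ∑ b ∈ W, shell K (w b) J p with hSJ
  have hSJ0 : ∀ J, 0 ≤ SJ J := fun J => Finset.sum_nonneg fun _ _ => shell_nonneg _ _ _
  -- the multipliers are controlled by the local energy densities
  have hU2 : U ^ 2 / r ≤ 2 * (n + 1) * W.card * SJ (dyIdx p.2) := by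
    have h1 : ∀ b, vsum K (w b) p ^ 2 / r ≤ 2 * (n + 1) * shell K (w b) (dyIdx p.2) p := by
      intro b
      have h2 := vsum_sq_le (K := K) (w b) p
      have h3 : qf 1 p ^ 2 ≤ 1 / r ^ 2 := by
        rw [le_div_iff₀ (by positivity), ← mul_pow]
        exact pow_le_one₀ (mul_nonneg (qf_pos one_pos p).le hr0.le) (qf_mul_norm_le one_pos p)
      have h4 : qf 1 p ^ 2 * w b p ^ 2 ≤ w b p ^ 2 / r ^ 2 := by
        rw [div_eq_mul_one_div, mul_comm]
        exact mul_le_mul_of_nonneg_left h3 (sq_nonneg _)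
      have h5 : vsum K (w b) p ^ 2 ≤ 2 * (n + 1) * (engy K (w b) p + w b p ^ 2 / r ^ 2) := by
        have : 0 ≤ (n : ℝ) * (w b p ^ 2 / r ^ 2) := by positivity
        linarith
      calc vsum K (w b) p ^ 2 / r ≤ 2 * (n + 1) * (engy K (w b) p + w b p ^ 2 / r ^ 2) / r := by
            gcongr
        _ = 2 * (n + 1) * ((engy K (w b) p + w b p ^ 2 / r ^ 2) / r) := by ring
        _ ≤ _ := by
            gcongr
            exact le_shell_dyIdx (w b) hr1
    calc U ^ 2 / r ≤ (W.card * ∑ b ∈ W, vsum K (w b) p ^ 2) / r := by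
          gcongr
          exact sq_sum_le_card_mul_sum_sq
      _ = W.card * ∑ b ∈ W, vsum K (w b) p ^ 2 / r := by rw [mul_div_assoc, Finset.sum_div]
      _ ≤ W.card * ∑ b ∈ W, 2 * (n + 1) * shell K (w b) (dyIdx p.2) p := by
          gcongr with b hb
          exact h1 b
      _ = _ := by rw [← Finset.mul_sum]; ring
  have hG2 : G ^ 2 / r ≤ L.card * (n + 1) * gsh K ρ L u (dyIdx p.2) p := grad_sq_div_le L u hr1 hr
  have t1 : κ (dyIdx p.2) / r * (2 * U ^ 2) ≤
      ∑ J ∈ Finset.range m, 4 * (n + 1) * W.card * κ J * SJ J := by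
    calc κ (dyIdx p.2) / r * (2 * U ^ 2) = 2 * κ (dyIdx p.2) * (U ^ 2 / r) := by ring
      _ ≤ 2 * κ (dyIdx p.2) * (2 * (n + 1) * W.card * SJ (dyIdx p.2)) := by gcongr
      _ = 4 * (n + 1) * W.card * κ (dyIdx p.2) * SJ (dyIdx p.2) := by ring
      _ ≤ _ := Finset.single_le_sum (f := fun J => 4 * (n + 1) * W.card * κ J * SJ J)
          (fun J _ => mul_nonneg (mul_nonneg (by positivity) (hκ0 J)) (hSJ0 J))
          (Finset.mem_range.2 hm)
  have t2 : κ (dyIdx p.2) / r * G ^ 2 ≤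
      ∑ J ∈ Finset.range m, L.card * (n + 1) * κ J * gsh K ρ L u J p := by
    calc κ (dyIdx p.2) / r * G ^ 2 = κ (dyIdx p.2) * (G ^ 2 / r) := by ring
      _ ≤ κ (dyIdx p.2) * (L.card * (n + 1) * gsh K ρ L u (dyIdx p.2) p) := by gcongr
      _ = L.card * (n + 1) * κ (dyIdx p.2) * gsh K ρ L u (dyIdx p.2) p := by ring
      _ ≤ _ := Finset.single_le_sum (f := fun J => L.card * (n + 1) * κ J * gsh K ρ L u J p)
          (fun J _ => mul_nonneg (mul_nonneg (by positivity) (hκ0 J)) (gsh_nonneg _ _ _ _ _))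
          (Finset.mem_range.2 hm)
  have t3 : near ρ p.2 * G ^ 2 ≤
      ∑ J ∈ Finset.range m₁, 3 * ρ * (L.card * (n + 1)) * gsh K ρ L u J p := by
    have h0 : ∀ J, 0 ≤ 3 * ρ * (L.card * (n + 1)) * gsh K ρ L u J p := fun J =>
      mul_nonneg (by positivity) (gsh_nonneg _ _ _ _ _)
    by_cases hnr : ‖p.2‖ ≤ 3 * ρ
    · rw [near, if_pos hnr, one_mul]
      calc G ^ 2 = r * (G ^ 2 / r) := by field_simp
        _ ≤ 3 * ρ * (L.card * (n + 1) * gsh K ρ L u (dyIdx p.2) p) := by gcongr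
        _ = 3 * ρ * (L.card * (n + 1)) * gsh K ρ L u (dyIdx p.2) p := by ring
        _ ≤ _ := Finset.single_le_sum (f := fun J => 3 * ρ * (L.card * (n + 1)) * gsh K ρ L u J p)
            (fun J _ => h0 J) (Finset.mem_range.2 (hm₁ hnr))
    · rw [near, if_neg hnr, zero_mul]
      exact Finset.sum_nonneg fun J _ => h0 J
  have t4 : near ρ p.2 * U ^ 2 ≤
      ∑ J ∈ Finset.range m₁, 3 * ρ * (2 * (n + 1) * W.card) * SJ J := by
    have h0 : ∀ J, 0 ≤ 3 * ρ * (2 * (n + 1) * W.card) * SJ J := fun J =>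
      mul_nonneg (by positivity) (hSJ0 J)
    by_cases hnr : ‖p.2‖ ≤ 3 * ρ
    · rw [near, if_pos hnr, one_mul]
      calc U ^ 2 = r * (U ^ 2 / r) := by field_simp
        _ ≤ 3 * ρ * (2 * (n + 1) * W.card * SJ (dyIdx p.2)) := by
            gcongr
        _ = 3 * ρ * (2 * (n + 1) * W.card) * SJ (dyIdx p.2) := by ring
        _ ≤ _ := Finset.single_le_sum (f := fun J => 3 * ρ * (2 * (n + 1) * W.card) * SJ J)
            (fun J _ => h0 J) (Finset.mem_range.2 (hm₁ hnr))
    · rw [near, if_neg hnr, zero_mul]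
      exact Finset.sum_nonneg fun J _ => h0 J
  have t3' := mul_le_mul_of_nonneg_left t3 (by positivity : 0 ≤ C * η⁻¹)
  have t4' := mul_le_mul_of_nonneg_left t4 (by positivity : 0 ≤ C * η)
  rw [Finset.mul_sum] at t3' t4'
  simp only [← mul_assoc (C * η⁻¹), ← mul_assoc (C * η)] at t3' t4'
  simp only [← mul_assoc] at t3' t4' hmain t1 t2 ⊢
  linarith

lemma exists_dyIdx_lt (R : ℝ) : ∃ m, ∀ x : Space n, 1 ≤ ‖x‖ → ‖x‖ ≤ R → dyIdx x < m := by
  obtain ⟨m, hm⟩ := pow_unbounded_of_one_lt R (one_lt_two (α := ℝ))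
  refine ⟨m, fun x h1 h2 => ?_⟩
  have h3 : (2 : ℝ) ^ dyIdx x < 2 ^ m := (two_pow_dyIdx_le h1).trans_lt (h2.trans_lt hm)
  exact (pow_lt_pow_iff_right₀ one_lt_two).1 h3

lemma aemeasurable_shell (hK : IsClosed K) {w : SpaceTime n → ℝ} (hw : CD K 1 w) (J : ℕ) :
    AEMeasurable (shell K w J) (volume.restrict (region K)) := by
  refine AEMeasurable.indicator ?_ (measurableSet_le measurable_snd.norm measurable_const)
  exact (continuousOn_const.mul ((continuousOn_engy hK hw).add
    (continuousOn_const.mul (hw.continuousOn.pow 2)))).aemeasurable (measurableSet_region hK)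

lemma lintegral_ofReal_abs_mul {μ : Measure (SpaceTime n)} (f V : SpaceTime n → ℝ)
    (hV : ∀ p, 0 ≤ V p) :
    ∫⁻ p, ENNReal.ofReal (|f p| * V p) ∂μ = ∫⁻ p, ‖f p * V p‖ₑ ∂μ := by
  refine lintegral_congr fun p => ?_
  rw [← ofReal_norm, Real.norm_eq_abs, abs_mul, abs_of_nonneg (hV p)]

/-- The space-time integral of the error terms, for functions supported in a compact set outside
the ball of radius `ρ`. Here `A` bounds the local energies of the functions `w b`, and `S` bounds
their multipliers. -/
lemma lintegral_source_mul_vsum_le {ρ : ℝ} {κ : ℕ → ℝ}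
    {h : Fin (n + 1) → Fin (n + 1) → SpaceTime n → ℝ} {g : MatrixField n}
    {W : Finset (List (ZIndex n))} {k j m₁ : ℕ} {B : Set (Space n)}
    {u : SpaceTime n → ℝ} {w : List (ZIndex n) → SpaceTime n → ℝ} {a : List (ZIndex n)}
    {F : SpaceTime n → ℝ} {C e η δ T : ℝ} {A S : ℝ≥0∞} (H : NearFlat K ρ κ h)
    (hK : IsClosed K) (hB : IsCompact B) (hBρ : ∀ x ∈ B, ρ < ‖x‖)
    (hu : CD K (k + 2) u) (hw : ∀ b ∈ W, CD K 2 (w b)) (h0 : SuppIn K B (w a))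
    (ha : a ∈ W) (hC : 0 ≤ C) (hη : 0 < η) (he : 0 ≤ e) (heT : e * T ≤ 1)
    (hF : ContinuousOn F (region K))
    (hFn : mixedNorm K 1 F ≤ ∑ a ∈ wordsLe (ZIndex n) k, mixedNorm K 1 (zw K a (box K g u)))
    (hs : ∀ p ∈ region K, ρ < ‖p.2‖ → |source K h (w a) p| ≤ |F p| +
      κ (dyIdx p.2) / ‖p.2‖ * ((∑ b ∈ W, ∑ α, |dd K α (w b) p|) + grad K (lowW n k j) u p) +
      C * ((near ρ p.2 + e) * grad K (lowW n k j) u p))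
    (hκ : ∀ m, ∑ j ∈ Finset.range m, κ j ≤ δ)
    (hm₁ : ∀ x : Space n, 1 ≤ ‖x‖ → ‖x‖ ≤ 3 * ρ → dyIdx x < m₁)
    (hA : ∀ i, ∫⁻ p in Set.Icc 0 T ×ˢ Kᶜ, ENNReal.ofReal (∑ b ∈ W, shell K (w b) i p) ≤ A)
    (hS : ∀ t ∈ Set.Icc 0 T, sl K (vsum K (w a)) t ≤ S) :
    ∫⁻ p in Set.Icc 0 T ×ˢ Kᶜ, ENNReal.ofReal (|source K h (w a) p| * vsum K (w a) p) ≤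
      (1 + ENNReal.ofReal C) * farForce K g k j u * S +
      ENNReal.ofReal (4 * (n + 1) * W.card * δ + m₁ * (C * η * (3 * ρ * (2 * (n + 1) * W.card)))) *
        A +
      ENNReal.ofReal ((lowW n k j).card * (n + 1) * δ +
        m₁ * (C * η⁻¹ * (3 * ρ * ((lowW n k j).card * (n + 1))))) * farLocal K ρ k j u := by
  set L := lowW n k j with hL
  set Q := Set.Icc 0 T ×ˢ Kᶜ with hQ
  have hρ := H.one_le
  have hQm : MeasurableSet Q := measurableSet_region_slab hK T
  have hLl : ∀ b ∈ L, b.length ≤ k := fun b hb => (mem_lowW.1 hb).1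
  obtain ⟨R, hR⟩ := hB.isBounded.exists_norm_le
  obtain ⟨m, hm⟩ := exists_dyIdx_lt (n := n) R
  have hwa : CD K 1 (w a) := (hw a ha).of_le (by norm_num)
  have cG := continuousOn_grad hK hu hLl
  have cV := continuousOn_vsum hK hwa
  have hμ : volume.restrict Q ≤ (volume.restrict (region K) : Measure (SpaceTime n)) :=
    Measure.restrict_mono (slab_subset T) le_rfl
  have mF : AEMeasurable (fun p => |F p| * vsum K (w a) p) (volume.restrict Q) :=
    ((hF.abs.mul cV).aemeasurable (measurableSet_region hK)).mono_measure hμ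
  have mG : AEMeasurable (fun p => C * e * (grad K L u p * vsum K (w a) p)) (volume.restrict Q) :=
    ((continuousOn_const.mul (cG.mul cV)).aemeasurable (measurableSet_region hK)).mono_measure hμ
  have mg : ∀ J, AEMeasurable (gsh K ρ L u J) (volume.restrict Q) := fun J =>
    (aemeasurable_gsh hK hu ρ hLl J).mono_measure hμ
  have ms : ∀ J, AEMeasurable (fun p => ∑ b ∈ W, shell K (w b) J p) (volume.restrict Q) :=
    fun J => Finset.aemeasurable_fun_sum _ fun b hb =>
      (aemeasurable_shell hK ((hw b hb).of_le (by norm_num)) J).mono_measure hμ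
  have ns : ∀ J p, 0 ≤ ∑ b ∈ W, shell K (w b) J p := fun J p =>
    Finset.sum_nonneg fun _ _ => shell_nonneg _ _ _
  have ng : ∀ J p, 0 ≤ gsh K ρ L u J p := fun J p => gsh_nonneg _ _ _ _ _
  have bg : ∀ J, ∫⁻ p in Q, ENNReal.ofReal (gsh K ρ L u J p) ≤ farLocal K ρ k j u := fun J =>
    (lintegral_mono' hμ le_rfl).trans (le_iSup (fun J => ∫⁻ p in region K,
      ENNReal.ofReal (gsh K ρ (lowW n k j) u J p)) J)
  have hκ0 := H.nonneg
  have i1 : ∫⁻ p in Q, ENNReal.ofReal (|F p| * vsum K (w a) p) ≤ mixedNorm K 1 F * S := by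
    rw [lintegral_ofReal_abs_mul _ _ fun p => vsum_nonneg _ _]
    refine (lintegral_mul_le hK hF cV hS).trans ?_
    rw [mixedNorm_one]
    gcongr
    exact Set.Icc_subset_Ici_self
  have i2 : ∫⁻ p in Q, ENNReal.ofReal (C * e * (grad K L u p * vsum K (w a) p)) ≤
      ENNReal.ofReal C * (∑ b ∈ L, ∑ α, mixedNorm K ⊤ (dd K α (zw K b u))) * S := by
    simp only [ENNReal.ofReal_mul (mul_nonneg hC he)]
    have mGV : AEMeasurable (fun p => grad K L u p * vsum K (w a) p) (volume.restrict Q) :=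
      ((cG.mul cV).aemeasurable (measurableSet_region hK)).mono_measure hμ
    rw [lintegral_const_mul'' _ mGV.ennreal_ofReal]
    have h1 := lintegral_ofReal_abs_mul (μ := volume.restrict Q) (grad K L u) (vsum K (w a))
      fun p => vsum_nonneg _ _
    simp only [abs_of_nonneg (grad_nonneg _ _ _)] at h1
    rw [h1]
    calc _ ≤ ENNReal.ofReal (C * e) * ((ENNReal.ofReal T *
          ∑ b ∈ L, ∑ α, mixedNorm K ⊤ (dd K α (zw K b u))) * S) := by
          gcongr
          refine (lintegral_mul_le hK cG cV hS).trans ?_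
          gcongr
          exact lintegral_sl_grad_le hK hu
      _ = ENNReal.ofReal C * ENNReal.ofReal (e * T) *
          (∑ b ∈ L, ∑ α, mixedNorm K ⊤ (dd K α (zw K b u))) * S := by
          rw [ENNReal.ofReal_mul hC, ENNReal.ofReal_mul he]
          ring
      _ ≤ ENNReal.ofReal C * 1 *
          (∑ b ∈ L, ∑ α, mixedNorm K ⊤ (dd K α (zw K b u))) * S := by
          gcongr
          exact ENNReal.ofReal_le_one.2 heT
      _ = _ := by rw [mul_one]
  have hcρ : 0 ≤ C * η := by positivity
  have i3 := lintegral_ofReal_sum_le (μ := volume.restrict Q) (s := Finset.range m)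
    (c := fun J => 4 * (n + 1) * W.card * κ J) (fun J _ => mul_nonneg (by positivity) (hκ0 J))
    (fun J _ => ns J) (fun J _ => ms J) fun J _ => hA J
  have i4 := lintegral_ofReal_sum_le (μ := volume.restrict Q) (s := Finset.range m)
    (c := fun J => L.card * (n + 1) * κ J) (fun J _ => mul_nonneg (by positivity) (hκ0 J))
    (fun J _ => ng J) (fun J _ => mg J) fun J _ => bg J
  have i5 := lintegral_ofReal_sum_le (μ := volume.restrict Q) (s := Finset.range m₁)
    (c := fun _ => C * η⁻¹ * (3 * ρ * (L.card * (n + 1)))) (fun _ _ => by positivity)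
    (fun J _ => ng J) (fun J _ => mg J) fun J _ => bg J
  have i6 := lintegral_ofReal_sum_le (μ := volume.restrict Q) (s := Finset.range m₁)
    (c := fun _ => C * η * (3 * ρ * (2 * (n + 1) * W.card))) (fun _ _ => by positivity)
    (fun J _ => ns J) (fun J _ => ms J) fun J _ => hA J
  have msum : ∀ {f : ℕ → SpaceTime n → ℝ} {s : Finset ℕ} {c : ℕ → ℝ},
      (∀ J, AEMeasurable (f J) (volume.restrict Q)) →
      AEMeasurable (fun p => ∑ J ∈ s, c J * f J p) (volume.restrict Q) := fun hf =>
    Finset.aemeasurable_fun_sum _ fun J _ => (hf J).const_mul _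
  have hpt : ∀ p ∈ Q, |source K h (w a) p| * vsum K (w a) p ≤ _ := fun p hp => by
    by_cases hpB : p.2 ∈ B
    · have hr := hBρ p.2 hpB
      exact source_mul_vsum_le (m := m) hρ hr hκ0 ha hC hη (hs p (slab_subset T hp) hr)
        (hm p.2 (hρ.trans hr.le) (hR p.2 hpB)) (hm₁ p.2 (hρ.trans hr.le))
    · have h1 : ∀ β, dd K β (w a) p = 0 := fun β =>
        h0.along hB.isClosed (coordField β) p (slab_subset T hp) hpB
      have h2 : vsum K (w a) p = 0 := by simp [vsum, h1, h0 p (slab_subset T hp) hpB]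
      rw [h2]
      simp only [mul_zero, zero_add]
      have a1 : 0 ≤ ∑ J ∈ Finset.range m, 4 * (n + 1) * W.card * κ J *
          ∑ b ∈ W, shell K (w b) J p := Finset.sum_nonneg fun J _ =>
        mul_nonneg (mul_nonneg (by positivity) (hκ0 J)) (ns J p)
      have a2 : 0 ≤ ∑ J ∈ Finset.range m, L.card * (n + 1) * κ J * gsh K ρ L u J p :=
        Finset.sum_nonneg fun J _ => mul_nonneg (mul_nonneg (by positivity) (hκ0 J)) (ng J p)
      have a3 : 0 ≤ ∑ J ∈ Finset.range m₁, C * η⁻¹ * (3 * ρ * (L.card * (n + 1))) *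
          gsh K ρ L u J p := Finset.sum_nonneg fun J _ => mul_nonneg (by positivity) (ng J p)
      have a4 : 0 ≤ ∑ J ∈ Finset.range m₁, C * η * (3 * ρ * (2 * (n + 1) * W.card)) *
          ∑ b ∈ W, shell K (w b) J p :=
        Finset.sum_nonneg fun J _ => mul_nonneg (by positivity) (ns J p)
      exact add_nonneg a1 (add_nonneg a2 (add_nonneg a3 a4))
  refine (setLIntegral_mono_ae' hQm (Filter.Eventually.of_forall fun p hp =>
    ENNReal.ofReal_le_ofReal (hpt p hp))).trans ?_
  refine (lintegral_ofReal_add_le mF i1 (lintegral_ofReal_add_le mG i2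
    (lintegral_ofReal_add_le (msum ms) i3 (lintegral_ofReal_add_le (msum mg) i4
      (lintegral_ofReal_add_le (msum mg) i5 i6))))).trans ?_
  have d1 : ∑ J ∈ Finset.range m, 4 * (n + 1) * W.card * κ J ≤ 4 * (n + 1) * W.card * δ := by
    rw [← Finset.mul_sum]
    exact mul_le_mul_of_nonneg_left (hκ m) (by positivity)
  have d2 : ∑ J ∈ Finset.range m, L.card * (n + 1) * κ J ≤ L.card * (n + 1) * δ := by
    rw [← Finset.mul_sum]
    exact mul_le_mul_of_nonneg_left (hκ m) (by positivity)
  have hδ : 0 ≤ δ := by simpa using hκ 0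
  rw [ENNReal.ofReal_add (by positivity) (by positivity),
    ENNReal.ofReal_add (by positivity) (by positivity)]
  have hff : mixedNorm K 1 F ≤ farForce K g k j u := hFn.trans le_self_add
  have hfg : ∑ b ∈ L, ∑ α, mixedNorm K ⊤ (dd K α (zw K b u)) ≤ farForce K g k j u :=
    le_add_self
  simp only [Finset.sum_const, Finset.card_range, nsmul_eq_mul]
  calc _ ≤ farForce K g k j u * S + (ENNReal.ofReal C * farForce K g k j u * S +
        (ENNReal.ofReal (4 * (n + 1) * W.card * δ) * A +
        (ENNReal.ofReal (L.card * (n + 1) * δ) * farLocal K ρ k j u +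
        (ENNReal.ofReal (m₁ * (C * η⁻¹ * (3 * ρ * (L.card * (n + 1))))) * farLocal K ρ k j u +
        ENNReal.ofReal (m₁ * (C * η * (3 * ρ * (2 * (n + 1) * W.card)))) * A)))) := by gcongr
    _ = _ := by ring

lemma lintegral_engy_cut_le {ρ : ℝ} {W : Finset (List (ZIndex n))} {u w : SpaceTime n → ℝ} {k : ℕ}
    {C : ℝ} {a : List (ZIndex n)} {B : Set (Space n)} (hK : IsClosed K) (hB : IsClosed B)
    (hBρ : ∀ x ∈ B, ρ < ‖x‖) (h0 : SuppIn K B w) (ha : a.length ≤ k)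
    (hW : W ⊆ wordsLe (ZIndex n) k)
    (h : ∀ p ∈ region K, ρ < ‖p.2‖ → ∀ α,
      |dd K α w p| ≤ |dd K α (zw K a u) p| + C * grad K W u p) :
    ∫⁻ x in Kᶜ, ENNReal.ofReal (engy K w (0, x)) ≤
      ENNReal.ofReal (2 + 2 * (n + 1) * C ^ 2 * (W.card * (n + 1))) * farData K ρ k u := by
  set c := 2 + 2 * (n + 1) * C ^ 2 * (W.card * (n + 1)) with hc
  have hS : MeasurableSet {x : Space n | ρ < ‖x‖} := measurableSet_lt measurable_const
    measurable_norm
  have h1 : ∀ x ∈ Kᶜ, ENNReal.ofReal (engy K w (0, x)) ≤ Set.indicator {x : Space n | ρ < ‖x‖}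
      (fun x => ENNReal.ofReal c * ENNReal.ofReal (∑ b ∈ wordsLe (ZIndex n) k,
        ∑ α, dd K α (zw K b u) (0, x) ^ 2)) x := by
    intro x hx
    have hp : ((0 : ℝ), x) ∈ region K := ⟨Set.mem_Ici.2 le_rfl, hx⟩
    by_cases hxB : x ∈ B
    · have hr := hBρ x hxB
      rw [Set.indicator_of_mem (by exact hr), ← ENNReal.ofReal_mul (by positivity)]
      exact ENNReal.ofReal_le_ofReal (engy_cut_le ha hW (h _ hp hr))
    · rw [suppIn_engy hB h0 (0, x) hp hxB, ENNReal.ofReal_zero]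
      exact zero_le
  refine (setLIntegral_mono_ae' hK.measurableSet.compl (Filter.Eventually.of_forall h1)).trans ?_
  refine (lintegral_mono' Measure.restrict_le_self le_rfl).trans ?_
  rw [lintegral_indicator hS, farData, lintegral_const_mul' _ _ ENNReal.ofReal_ne_top]

/-- The exterior estimate for the cut off functions `ζ Z^a u`, `a` with `j + 1` rotations. The
constant does not depend on the cutoff parameter `ε` and on the time `T`, as long as `ε T ≤ 1`. -/
lemma NearFlat.exists_far_cut {ρ : ℝ} {κ : ℕ → ℝ} {g : MatrixField n}
    (H : NearFlat K ρ κ (fun α β p => (g p)⁻¹ α β)) (hn : 3 ≤ n) (hK : IsClosed K)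
    (hKρ : ∀ x ∈ K, ‖x‖ ≤ ρ) (k j : ℕ)
    (hκ : ∀ m, ∑ j ∈ Finset.range m, κ j ≤ 1 / (80000 * (n + 1 : ℝ) ^ 5 *
      (64 * (n + 1) * ((wordsLe (ZIndex n) k).card + 1) ^ 2)))
    (hbox : ∀ u, CD K (k + 2) u → CD K k (box K g u))
    (Hc : ∀ u, CD K (k + 2) u → ∀ a : List (ZIndex n), a.length ≤ k → ∀ p ∈ region K, ρ < ‖p.2‖ →
      ‖p.2‖ * |source K (fun α β p => (g p)⁻¹ α β) (zw K a u) p - zw K a (box K g u) p| ≤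
        κ (dyIdx p.2) * grad K (lowW n k (rot a)) u p) :
    ∃ C : ℝ≥0∞, C ≠ ⊤ ∧ ∀ ε : ℝ, 0 < ε → ε ≤ 1 → ∃ ζ : Space n → ℝ, ContDiff ℝ ∞ ζ ∧
      (∀ x, 3 * ρ ≤ ‖x‖ → ε * Real.log (1 + ‖x‖ ^ 2) ≤ 1 → ζ x = 1) ∧
      ∀ u, CD K (k + 2) u → ∀ T : ℝ, 0 ≤ T → ε * T ≤ 1 → ∀ a ∈ topW n k (j + 1),
        (∀ t ∈ Set.Icc 0 T, ∫⁻ x in Kᶜ, ENNReal.ofReal (engy K (cut K ζ u a) (t, x)) ≤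
          C * (farData K ρ k u + farLocal K ρ k j u + farForce K g k j u ^ 2)) ∧
        ∀ i, ∫⁻ p in Set.Icc 0 T ×ˢ Kᶜ, ENNReal.ofReal (shell K (cut K ζ u a) i p) ≤
          C * (farData K ρ k u + farLocal K ρ k j u + farForce K g k j u ^ 2) := by
  have hρ := H.one_le
  set N : ℝ := (n : ℝ) + 1 with hN
  have hN1 : 1 ≤ N := by rw [hN]; have := Nat.cast_nonneg (α := ℝ) n; linarith
  set D : ℝ := 80000 * N ^ 5 with hD
  have hD1 : 1 ≤ D := by
    have := one_le_pow₀ hN1 (n := 5)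
    linarith
  set δ : ℝ := 1 / (D * (64 * N * ((wordsLe (ZIndex n) k).card + 1) ^ 2)) with hδ
  have hδ0 : 0 ≤ δ := by positivity
  have hbig : 1 ≤ 64 * N * (((wordsLe (ZIndex n) k).card : ℝ) + 1) ^ 2 := by
    have h1 : (1 : ℝ) ≤ ((wordsLe (ZIndex n) k).card : ℝ) + 1 := by
      have := Nat.cast_nonneg (α := ℝ) (wordsLe (ZIndex n) k).card
      linarith
    have h2 := one_le_pow₀ h1 (n := 2)
    nlinarith
  have hδD : δ ≤ 1 / D := by
    rw [hδ]
    apply one_div_le_one_div_of_le (by positivity)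
    exact le_mul_of_one_le_right (by positivity) hbig
  have hδ1 : δ ≤ 1 := hδD.trans (by rw [div_le_one (by positivity)]; exact hD1)
  have hκ1 : ∀ i, κ i ≤ 1 := fun i =>
    (Finset.single_le_sum (f := κ) (fun i _ => H.nonneg i)
      (Finset.mem_range.2 (Nat.lt_succ_self i))).trans ((hκ _).trans hδ1)
  obtain ⟨C₀, hC₀, hcut⟩ := H.exists_cut_bound hK hκ1 k Hc
  obtain ⟨m₁, hm₁⟩ := exists_dyIdx_lt (n := n) (3 * ρ)
  set W := topW n k (j + 1) with hW
  set L := lowW n k j with hL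
  have hWs : W ⊆ wordsLe (ZIndex n) k := Finset.filter_subset _ _
  have hLs : L ⊆ wordsLe (ZIndex n) k := fun b hb => mem_wordsLe.2 (mem_lowW.1 hb).1
  set M : ℝ := (W.card : ℝ) with hM
  have hM0 : 0 ≤ M := Nat.cast_nonneg _
  have hMm : M ≤ ((wordsLe (ZIndex n) k).card : ℝ) := by
    rw [hM]
    exact_mod_cast Finset.card_le_card hWs
  -- `η` is chosen to absorb the terms near the boundary of the cutoff
  set X : ℝ := D * M * (m₁ * (C₀ * (3 * ρ * (2 * N * M)))) with hX
  have hX0 : 0 ≤ X := by positivity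
  set η : ℝ := 1 / (8 * X + 1) with hη
  have hη0 : 0 < η := by positivity
  have hab : 2 * D * M * (4 * N * M * δ + m₁ * (C₀ * η * (3 * ρ * (2 * N * M)))) ≤ 1 / 2 := by
    have h1 : 2 * D * M * (4 * N * M * δ) ≤ 1 / 4 := by
      rw [hδ]
      have h2 : M * M ≤ ((wordsLe (ZIndex n) k).card + 1) ^ 2 := by nlinarith
      calc 2 * D * M * (4 * N * M * (1 / (D * (64 * N * ((wordsLe (ZIndex n) k).card + 1) ^ 2))))
          = 1 / 8 * (M * M / ((wordsLe (ZIndex n) k).card + 1) ^ 2) := by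
            field_simp
            ring
        _ ≤ 1 / 8 * 1 := by
            gcongr
            exact div_le_one_of_le₀ h2 (by positivity)
        _ ≤ 1 / 4 := by norm_num
    have h2 : 2 * D * M * (m₁ * (C₀ * η * (3 * ρ * (2 * N * M)))) ≤ 1 / 4 := by
      calc 2 * D * M * (m₁ * (C₀ * η * (3 * ρ * (2 * N * M)))) = 2 * X * η := by
            rw [hX]; ring
        _ = 2 * X / (8 * X + 1) := by rw [hη]; ring
        _ ≤ 1 / 4 := by
            rw [div_le_iff₀ (by positivity)]
            linarith
    rw [mul_add]
    linarith
  set c5 : ℝ := 2 + 2 * N * C₀ ^ 2 * (L.card * N) with hc5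
  set c6 : ℝ := L.card * N * δ + m₁ * (C₀ * η⁻¹ * (3 * ρ * (L.card * N))) with hc6
  set c0 : ℝ≥0∞ := 2 * ENNReal.ofReal D * ENNReal.ofReal M with hc0
  set c1 : ℝ≥0∞ := 1 + ENNReal.ofReal C₀ with hc1
  set c2 : ℝ≥0∞ := ENNReal.ofReal (10 * N) with hc2
  set P₀ : ℝ≥0∞ := 4 * (c0 * ENNReal.ofReal c5) + 4 * (c0 * ENNReal.ofReal c6) +
    4 * c2 * (c0 * c1) ^ 2 with hP₀
  have t0 : c0 ≠ ⊤ := ENNReal.mul_ne_top (ENNReal.mul_ne_top (by norm_num)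
    ENNReal.ofReal_ne_top) ENNReal.ofReal_ne_top
  have t1 : c1 ≠ ⊤ := ENNReal.add_ne_top.2 ⟨ENNReal.one_ne_top, ENNReal.ofReal_ne_top⟩
  have t2 : c2 ≠ ⊤ := ENNReal.ofReal_ne_top
  refine ⟨P₀, ?_, fun ε hε hε1 => ?_⟩
  · have t4 : (4 : ℝ≥0∞) ≠ ⊤ := by norm_num
    refine ENNReal.add_ne_top.2 ⟨ENNReal.add_ne_top.2 ⟨?_, ?_⟩, ?_⟩
    · exact ENNReal.mul_ne_top t4 (ENNReal.mul_ne_top t0 ENNReal.ofReal_ne_top)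
    · exact ENNReal.mul_ne_top t4 (ENNReal.mul_ne_top t0 ENNReal.ofReal_ne_top)
    · exact ENNReal.mul_ne_top (ENNReal.mul_ne_top t4 t2)
        (ENNReal.pow_ne_top (ENNReal.mul_ne_top t0 t1))
  obtain ⟨ζ, hζ, hz0, hz1, ⟨R, hzR⟩, hbd⟩ := hcut ε hε hε1
  refine ⟨ζ, hζ, hz1, fun u hu T hT hεT => ?_⟩
  set w := cut K ζ u with hw
  set B : Set (Space n) := {x | 2 * ρ ≤ ‖x‖} ∩ Metric.closedBall 0 R with hBdef
  have hB : IsCompact B := (isCompact_closedBall 0 R).inter_left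
    (isClosed_le continuous_const continuous_norm)
  have hBρ : ∀ x ∈ B, ρ < ‖x‖ := fun x hx => lt_of_lt_of_le (by linarith) hx.1
  have hBK : B ⊆ Kᶜ := fun x hx hxK => (hBρ x hx).not_ge (hKρ x hxK)
  have hw2 : ∀ b ∈ W, CD K 2 (w b) := fun b hb =>
    ContDiffOn.mul (Smooth.cd (f := fun q => ζ q.2) (hζ.comp contDiff_snd).contDiffOn 2)
      (CD.zw hK b (hu.of_le (by have := (mem_topW.1 hb).1; omega)))
  have hw1 : ∀ b ∈ W, CD K 1 (w b) := fun b hb => (hw2 b hb).of_le (by norm_num)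
  have h0 : ∀ b, SuppIn K B (w b) := fun b p hp hpB => by
    have : ζ p.2 = 0 := by
      by_contra hne
      refine hpB ⟨?_, ?_⟩
      · by_contra h
        exact hne (hz0 _ (not_le.1 h).le)
      · rw [mem_closedBall_zero_iff]
        by_contra h
        exact hne (hzR _ (not_le.1 h))
    rw [hw, cut, this, zero_mul]
  set E : List (ZIndex n) → ℝ≥0∞ := fun a =>
    ⨆ t ∈ Set.Icc 0 T, ∫⁻ x in Kᶜ, ENNReal.ofReal (engy K (w a) (t, x)) with hE
  set I : List (ZIndex n) → ℝ≥0∞ := fun a =>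
    ⨆ i, ∫⁻ p in Set.Icc 0 T ×ˢ Kᶜ, ENNReal.ofReal (shell K (w a) i p) with hI
  set A : ℝ≥0∞ := ∑ a ∈ W, (E a + I a) with hA
  have hEA : ∀ a ∈ W, ∀ t ∈ Set.Icc 0 T,
      ∫⁻ x in Kᶜ, ENNReal.ofReal (engy K (w a) (t, x)) ≤ A := fun a ha t ht =>
    (le_iSup₂ (f := fun t (_ : t ∈ Set.Icc 0 T) =>
      ∫⁻ x in Kᶜ, ENNReal.ofReal (engy K (w a) (t, x))) t ht).trans
      (le_self_add.trans (Finset.single_le_sum (f := fun a => E a + I a)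
        (fun _ _ => zero_le) ha))
  have hIA : ∀ a ∈ W, ∀ i, ∫⁻ p in Set.Icc 0 T ×ˢ Kᶜ, ENNReal.ofReal (shell K (w a) i p) ≤ A :=
    fun a ha i =>
    (le_iSup (fun i => ∫⁻ p in Set.Icc 0 T ×ˢ Kᶜ, ENNReal.ofReal (shell K (w a) i p)) i).trans
      (le_add_self.trans (Finset.single_le_sum (f := fun a => E a + I a)
        (fun _ _ => zero_le) ha))
  suffices hfin : A ≤ P₀ * (farData K ρ k u + farLocal K ρ k j u + farForce K g k j u ^ 2) from
    fun a ha => ⟨fun t ht => (hEA a ha t ht).trans hfin, fun i => (hIA a ha i).trans hfin⟩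
  have hext : ∀ a ∈ W, ∃ X : ℝ≥0∞, X ≠ ⊤ ∧ X = _ ∧ _ ∧ _ := fun a ha =>
    H.exterior_lintegral hn hK hB hBK hBρ (hw2 a ha) (h0 a) T fun m => (hκ m).trans hδD
  have hEI : ∀ a ∈ W, ∃ X : ℝ≥0∞, X ≠ ⊤ ∧
      X = (∫⁻ x in Kᶜ, ENNReal.ofReal (engy K (w a) (0, x))) +
        (∫⁻ p in Set.Icc 0 T ×ˢ Kᶜ,
          ENNReal.ofReal (|source K (fun α β p => (g p)⁻¹ α β) (w a) p| * vsum K (w a) p)) ∧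
      E a + I a ≤ 2 * ENNReal.ofReal D * X := by
    intro a ha
    obtain ⟨X, hX, hXe, hX1, hX2⟩ := hext a ha
    refine ⟨X, hX, hXe, ?_⟩
    have e1 : E a ≤ ENNReal.ofReal D * X := iSup₂_le hX1
    have e2 : I a ≤ ENNReal.ofReal D * X := iSup_le (hX2 hT)
    calc E a + I a ≤ ENNReal.ofReal D * X + ENNReal.ofReal D * X := add_le_add e1 e2
      _ = _ := by ring
  have hAtop : A ≠ ⊤ := by
    refine ENNReal.sum_ne_top.2 fun a ha => ?_
    obtain ⟨X, hX, -, h⟩ := hEI a ha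
    exact ne_top_of_le_ne_top (ENNReal.mul_ne_top (ENNReal.mul_ne_top (by norm_num)
      ENNReal.ofReal_ne_top) hX) h
  set S : ℝ≥0∞ := (c2 * A) ^ (1 / 2 : ℝ) with hS
  have hS2 : S ^ 2 = c2 * A := by
    rw [hS, ← ENNReal.rpow_natCast, ← ENNReal.rpow_mul]
    norm_num
  have hSl : ∀ a ∈ W, ∀ t ∈ Set.Icc 0 T, sl K (vsum K (w a)) t ≤ S := by
    intro a ha t ht
    have h1 := sl_vsum_sq_le hn hK hB hBK (hw1 a ha) (h0 a) ht.1
    have h2 : sl K (vsum K (w a)) t ^ 2 ≤ S ^ 2 := by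
      rw [hS2]
      refine h1.trans ?_
      gcongr
      exact hEA a ha t ht
    exact (ENNReal.pow_le_pow_left_iff two_ne_zero).1 h2
  have hAsum : ∀ i, ∫⁻ p in Set.Icc 0 T ×ˢ Kᶜ,
      ENNReal.ofReal (∑ b ∈ W, shell K (w b) i p) ≤ A := by
    intro i
    simp only [ENNReal.ofReal_sum_of_nonneg fun b _ => shell_nonneg (w b) i _]
    rw [lintegral_finsetSum' _ fun b hb => ((aemeasurable_shell hK (hw1 b hb) i).mono_measure
      (Measure.restrict_mono (slab_subset T) le_rfl)).ennreal_ofReal]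
    refine Finset.sum_le_sum fun b hb => le_trans ?_ le_add_self
    exact le_iSup (fun i => ∫⁻ p in Set.Icc 0 T ×ˢ Kᶜ, ENNReal.ofReal (shell K (w b) i p)) i
  have hmain : ∀ a ∈ W, E a + I a ≤ 2 * ENNReal.ofReal D *
      (ENNReal.ofReal c5 * farData K ρ k u + (c1 * farForce K g k j u * S +
        ENNReal.ofReal (4 * N * M * δ + m₁ * (C₀ * η * (3 * ρ * (2 * N * M)))) * A +
        ENNReal.ofReal c6 * farLocal K ρ k j u)) := by
    intro a ha
    obtain ⟨X, -, hXe, h⟩ := hEI a ha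
    refine h.trans ?_
    rw [hXe]
    have ha' := mem_topW.1 ha
    gcongr
    · exact lintegral_engy_cut_le hK hB.isClosed hBρ (h0 a) ha'.1 hLs fun p hp hr =>
        (hbd u hu j a ha'.1 ha'.2 p hp hr).2
    · exact lintegral_source_mul_vsum_le (F := zw K a (box K g u)) H hK hB hBρ hu hw2 (h0 a) ha
        hC₀ hη0 hε.le hεT
        (ContDiffOn.continuousOn (CD.zw (m := 0) hK a
          ((hbox u hu).of_le (by omega))))
        (Finset.single_le_sum (f := fun a => mixedNorm K 1 (zw K a (box K g u)))
          (fun _ _ => zero_le) (mem_wordsLe.2 ha'.1))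
        (fun p hp hr => (hbd u hu j a ha'.1 ha'.2 p hp hr).1) hκ hm₁ hAsum (hSl a ha)
  have hr : c0 * ENNReal.ofReal (4 * N * M * δ + m₁ * (C₀ * η * (3 * ρ * (2 * N * M)))) ≤ 1 / 2 := by
    have e2 : (2 : ℝ≥0∞) = ENNReal.ofReal 2 := by simp
    have e3 : (1 / 2 : ℝ≥0∞) = ENNReal.ofReal (1 / 2) := by
      rw [one_div, one_div, ENNReal.ofReal_inv_of_pos two_pos, ← e2]
    rw [hc0, e3, e2, ← ENNReal.ofReal_mul (by norm_num), ← ENNReal.ofReal_mul (by positivity),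
      ← ENNReal.ofReal_mul (by positivity)]
    exact ENNReal.ofReal_le_ofReal hab
  have hAle : A ≤ (c0 * (ENNReal.ofReal c5 * farData K ρ k u) +
      c0 * (ENNReal.ofReal c6 * farLocal K ρ k j u)) + (c0 * c1 * farForce K g k j u) * S +
      c0 * ENNReal.ofReal (4 * N * M * δ + m₁ * (C₀ * η * (3 * ρ * (2 * N * M)))) * A := by
    refine (Finset.sum_le_sum hmain).trans (le_of_eq ?_)
    rw [Finset.sum_const, nsmul_eq_mul, hc0, hM, ENNReal.ofReal_natCast]
    ring
  refine (absorb hAtop t2 hAle hS2.le hr).trans ?_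
  calc 4 * (c0 * (ENNReal.ofReal c5 * farData K ρ k u) +
        c0 * (ENNReal.ofReal c6 * farLocal K ρ k j u)) +
        4 * c2 * (c0 * c1 * farForce K g k j u) ^ 2
      = 4 * (c0 * ENNReal.ofReal c5) * farData K ρ k u +
        4 * (c0 * ENNReal.ofReal c6) * farLocal K ρ k j u +
        4 * c2 * (c0 * c1) ^ 2 * farForce K g k j u ^ 2 := by ring
    _ ≤ P₀ * farData K ρ k u + P₀ * farLocal K ρ k j u + P₀ * farForce K g k j u ^ 2 := by
        gcongr
        · exact le_self_add.trans le_self_add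
        · exact le_add_self.trans le_self_add
        · exact le_add_self
    _ = _ := by ring

/-! ### Removal of the cutoff -/

/-- The set where the cutoffs with parameter `ε = 1 / (m + 1)` are equal to one. -/
def plateau (n : ℕ) (ρ : ℝ) (m : ℕ) : Set (Space n) :=
  {x | 3 * ρ < ‖x‖ ∧ 1 / (m + 1 : ℝ) * Real.log (1 + ‖x‖ ^ 2) < 1}

lemma isOpen_plateau (ρ : ℝ) (m : ℕ) : IsOpen (plateau n ρ m) := by
  refine IsOpen.and (isOpen_lt continuous_const continuous_norm) (isOpen_lt ?_ continuous_const)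
  refine continuous_const.mul (Continuous.log (by fun_prop) fun x => ?_)
  positivity

lemma plateau_mono (ρ : ℝ) : Monotone (plateau n ρ) := by
  rintro m m' h x ⟨h1, h2⟩
  refine ⟨h1, lt_of_le_of_lt ?_ h2⟩
  have h3 : (m : ℝ) ≤ m' := by exact_mod_cast h
  have h4 : 0 ≤ Real.log (1 + ‖x‖ ^ 2) := Real.log_nonneg (by nlinarith [sq_nonneg ‖x‖])
  gcongr

lemma exists_mem_plateau {ρ : ℝ} {x : Space n} (hx : 3 * ρ < ‖x‖) : ∃ m, x ∈ plateau n ρ m := by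
  obtain ⟨m, hm⟩ := exists_nat_gt (Real.log (1 + ‖x‖ ^ 2))
  refine ⟨m, hx, ?_⟩
  rw [one_div, inv_mul_lt_iff₀ (by positivity)]
  linarith

lemma iUnion_plateau (ρ : ℝ) : ⋃ m, plateau n ρ m = {x : Space n | 3 * ρ < ‖x‖} := by
  ext x
  rw [Set.mem_iUnion]
  exact ⟨fun ⟨m, hm⟩ => hm.1, exists_mem_plateau⟩

lemma iUnion_slab_plateau (ρ : ℝ) :
    ⋃ m : ℕ, Set.Icc (0 : ℝ) m ×ˢ plateau n ρ m = Set.Ici 0 ×ˢ {x : Space n | 3 * ρ < ‖x‖} := by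
  ext ⟨t, x⟩
  rw [Set.mem_iUnion]
  constructor
  · rintro ⟨m, ht, hx⟩
    exact ⟨ht.1, hx.1⟩
  · rintro ⟨ht, hx⟩
    obtain ⟨m, hm⟩ := exists_mem_plateau hx
    obtain ⟨m', hm'⟩ := exists_nat_ge t
    refine ⟨max m m', ⟨ht, hm'.trans (by exact_mod_cast le_max_right _ _)⟩,
      plateau_mono ρ (le_max_left _ _) hm⟩

lemma cut_eventuallyEq {ρ : ℝ} {m : ℕ} {ζ : Space n → ℝ}
    (hζ : ∀ x, 3 * ρ ≤ ‖x‖ → 1 / (m + 1 : ℝ) * Real.log (1 + ‖x‖ ^ 2) ≤ 1 → ζ x = 1)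
    (u : SpaceTime n → ℝ) (a : List (ZIndex n)) {p : SpaceTime n} (hp : p.2 ∈ plateau n ρ m) :
    cut K ζ u a =ᶠ[nhds p] zw K a u := by
  filter_upwards [continuous_snd.continuousAt.preimage_mem_nhds
    ((isOpen_plateau ρ m).mem_nhds hp)] with q hq
  rw [cut, hζ q.2 hq.1.le hq.2.le, one_mul]

/-- The exterior estimate for the functions `Z^a u`, `a` with `j + 1` rotations, in terms of the
initial data, the forcing term, and the local energies of words with at most `j` rotations. -/
lemma FarMetric.exists_far_estimate {ρ₀ : ℝ} {g : MatrixField n} (hg : FarMetric K ρ₀ g)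
    (hn : 3 ≤ n) (k j : ℕ) : ∃ ρ ≥ ρ₀,
      (∀ α β, ∀ p ∈ region K, ρ < ‖p.2‖ → |(g p)⁻¹ α β - minkowski n α β| ≤ 1 / 2) ∧
      ∃ C : ℝ≥0∞, C ≠ ⊤ ∧ ∀ u, CD K (k + 2) u → ∀ a ∈ topW n k (j + 1),
        (∀ t, 0 ≤ t → ∫⁻ x in {x | 3 * ρ < ‖x‖}, ENNReal.ofReal (engy K (zw K a u) (t, x)) ≤
          C * (farData K ρ k u + farLocal K ρ k j u + farForce K g k j u ^ 2)) ∧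
        ∀ i, ∫⁻ p in Set.Ici 0 ×ˢ {x | 3 * ρ < ‖x‖}, ENNReal.ofReal (shell K (zw K a u) i p) ≤
          C * (farData K ρ k u + farLocal K ρ k j u + farForce K g k j u ^ 2) := by
  obtain ⟨ρ, hρ, κ, H, hκ, Hc⟩ := hg.exists_commuted k (δ := 1 / (80000 * (n + 1 : ℝ) ^ 5 *
      (64 * (n + 1) * ((wordsLe (ZIndex n) k).card + 1) ^ 2))) (by positivity)
  obtain ⟨C, hC, hmain⟩ := H.exists_far_cut hn hg.closed (fun x hx => (hg.bound x hx).trans hρ)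
    k j hκ (fun u hu => CD.box hg.closed hg.lorentz (fun β => (hg.lower β).smooth) hu) Hc
  refine ⟨ρ, hρ, fun α β p hp hr => ?_, C, hC, fun u hu a ha => ?_⟩
  · refine (H.close α β p hp hr).trans ((Finset.single_le_sum (f := κ) (fun i _ => H.nonneg i)
      (Finset.mem_range.2 (Nat.lt_succ_self (dyIdx p.2)))).trans ((hκ _).trans ?_))
    have h1 : (1 : ℝ) ≤ (n + 1 : ℝ) ^ 5 := one_le_pow₀ (by linarith [Nat.cast_nonneg (α := ℝ) n])
    have h2 : (1 : ℝ) ≤ 64 * (n + 1) * (((wordsLe (ZIndex n) k).card : ℝ) + 1) ^ 2 := by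
      have h3 : (1 : ℝ) ≤ (((wordsLe (ZIndex n) k).card : ℝ) + 1) ^ 2 :=
        one_le_pow₀ (by linarith [Nat.cast_nonneg (α := ℝ) (wordsLe (ZIndex n) k).card])
      nlinarith [Nat.cast_nonneg (α := ℝ) n]
    refine one_div_le_one_div_of_le two_pos ?_
    nlinarith
  set Q := farData K ρ k u + farLocal K ρ k j u + farForce K g k j u ^ 2
  have hρ1 := H.one_le
  have hPK : ∀ m, plateau n ρ m ⊆ Kᶜ := fun m x hx hxK => by
    have := (hg.bound x hxK).trans hρ
    have := hx.1
    linarith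
  have hm1 : ∀ m : ℕ, (0 : ℝ) < 1 / (m + 1 : ℝ) := fun m => by positivity
  have hm2 : ∀ m : ℕ, 1 / (m + 1 : ℝ) ≤ 1 := fun m => by
    rw [div_le_one (by positivity)]
    linarith [Nat.cast_nonneg (α := ℝ) m]
  choose ζ hζ hz1 hbd using fun m : ℕ => hmain (1 / (m + 1 : ℝ)) (hm1 m) (hm2 m)
  have hb := fun m : ℕ => hbd m u hu m (Nat.cast_nonneg m) (by
    rw [one_div, inv_mul_le_iff₀ (by positivity)]
    linarith) a ha
  have heng : ∀ (m : ℕ) (p : SpaceTime n), 0 ≤ p.1 → p.2 ∈ plateau n ρ m →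
      engy K (cut K (ζ m) u a) p = engy K (zw K a u) p := fun m p hp1 hp =>
    Finset.sum_congr rfl fun α _ => by
      rw [dd, along_congr_of_eventuallyEq
        ((cut_eventuallyEq (hz1 m) u a hp).filter_mono nhdsWithin_le_nhds) ⟨hp1, hPK m hp⟩, dd]
  refine ⟨fun t ht => ?_, fun i => ?_⟩
  · rw [← iUnion_plateau, setLIntegral_iUnion_of_directed _
      (directed_of_isDirected_le (plateau_mono ρ))]
    refine iSup_le fun m => ?_
    obtain ⟨m', hm'⟩ := exists_nat_ge t
    have hmm := plateau_mono (n := n) ρ (le_max_left m m')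
    refine le_trans ?_ ((hb (max m m')).1 t ⟨ht, hm'.trans (by exact_mod_cast le_max_right _ _)⟩)
    calc _ ≤ ∫⁻ x in plateau n ρ (max m m'), ENNReal.ofReal (engy K (zw K a u) (t, x)) :=
          lintegral_mono_set hmm
      _ = ∫⁻ x in plateau n ρ (max m m'),
          ENNReal.ofReal (engy K (cut K (ζ (max m m')) u a) (t, x)) :=
          setLIntegral_congr_fun (isOpen_plateau _ _).measurableSet fun x hx => by
            simp only [heng _ (t, x) ht hx]
      _ ≤ _ := lintegral_mono_set (hPK _)
  · have hmono : Monotone fun m : ℕ => Set.Icc (0 : ℝ) m ×ˢ plateau n ρ m := fun m m' h =>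
      Set.prod_mono (Set.Icc_subset_Icc_right (by exact_mod_cast h)) (plateau_mono ρ h)
    rw [← iUnion_slab_plateau, setLIntegral_iUnion_of_directed _
      (directed_of_isDirected_le hmono)]
    refine iSup_le fun m => le_trans ?_ ((hb m).2 i)
    calc _ = ∫⁻ p in Set.Icc (0 : ℝ) m ×ˢ plateau n ρ m,
          ENNReal.ofReal (shell K (cut K (ζ m) u a) i p) :=
          setLIntegral_congr_fun (measurableSet_Icc.prod (isOpen_plateau _ _).measurableSet)
            fun p hp => by
              have h1 : cut K (ζ m) u a p = zw K a u p :=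
                (cut_eventuallyEq (hz1 m) u a hp.2).eq_of_nhds
              simp only [shell, Set.indicator, heng m p hp.1.1 hp.2, h1]
      _ ≤ _ := lintegral_mono_set (Set.prod_mono le_rfl (hPK m))

/-! ### Traces at the initial time -/

/-- Minkowski's inequality `‖∫ h(s, ·) ds‖_{L²} ≤ ∫ ‖h(s, ·)‖_{L²} ds`, in squared form. -/
lemma lintegral_lintegral_sq_le {α β : Type*} [MeasurableSpace α] [MeasurableSpace β]
    {μ : Measure α} {ν : Measure β} [SFinite μ] [SFinite ν] {h : α → β → ℝ≥0∞}
    (hh : Measurable (Function.uncurry h)) :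
    ∫⁻ x, (∫⁻ s, h s x ∂μ) ^ 2 ∂ν ≤ (∫⁻ s, (∫⁻ x, h s x ^ 2 ∂ν) ^ (1 / 2 : ℝ) ∂μ) ^ 2 := by
  have hs : ∀ s, Measurable (h s) := fun s => hh.comp measurable_prodMk_left
  have hx : ∀ x, Measurable fun s => h s x := fun x => hh.comp measurable_prodMk_right
  have hH : Measurable fun x => ∫⁻ s, h s x ∂μ := hh.lintegral_prod_left'
  set N : α → ℝ≥0∞ := fun s => (∫⁻ x, h s x ^ 2 ∂ν) ^ (1 / 2 : ℝ) with hN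
  have hNm : Measurable N := (Measurable.lintegral_prod_right' (hh.pow_const 2)).pow_const _
  have hCS : ∀ s s', ∫⁻ x, h s x * h s' x ∂ν ≤ N s * N s' := by
    intro s s'
    have := ENNReal.lintegral_mul_le_Lp_mul_Lq ν (p := 2) (q := 2) Real.HolderConjugate.two_two
      (hs s).aemeasurable (hs s').aemeasurable
    simpa [hN] using this
  have h1 : ∀ s, ∫⁻ x, h s x * ∫⁻ s', h s' x ∂μ ∂ν ≤ N s * ∫⁻ s', N s' ∂μ := by
    intro s
    calc ∫⁻ x, h s x * ∫⁻ s', h s' x ∂μ ∂ν = ∫⁻ x, ∫⁻ s', h s x * h s' x ∂μ ∂ν :=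
          lintegral_congr fun x => (lintegral_const_mul _ (hx x)).symm
      _ = ∫⁻ s', ∫⁻ x, h s x * h s' x ∂ν ∂μ := lintegral_lintegral_swap
          ((((hs s).comp measurable_fst).mul
            (hh.comp measurable_swap)).aemeasurable)
      _ ≤ ∫⁻ s', N s * N s' ∂μ := lintegral_mono fun s' => hCS s s'
      _ = _ := lintegral_const_mul _ hNm
  calc ∫⁻ x, (∫⁻ s, h s x ∂μ) ^ 2 ∂ν = ∫⁻ x, ∫⁻ s, h s x * ∫⁻ s', h s' x ∂μ ∂μ ∂ν :=
        lintegral_congr fun x => by rw [lintegral_mul_const _ (hx x), sq]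
    _ = ∫⁻ s, ∫⁻ x, h s x * ∫⁻ s', h s' x ∂μ ∂ν ∂μ := lintegral_lintegral_swap
        (((hh.comp measurable_swap).mul (hH.comp measurable_fst)).aemeasurable)
    _ ≤ ∫⁻ s, N s * ∫⁻ s', N s' ∂μ ∂μ := lintegral_mono h1
    _ = _ := by rw [lintegral_mul_const _ hNm, sq]

/-- The initial value of `f` is controlled by `f` and `∂_t f` in `L¹_t L²_x`. -/
lemma sl_zero_le (hK : IsClosed K) {f : SpaceTime n → ℝ} (hf : CD K 1 f) :
    sl K f 0 ≤ mixedNorm K 1 f + mixedNorm K 1 (dd K 0 f) := by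
  have hfc := hf.continuousOn
  have hd : ContinuousOn (dd K 0 f) (region K) := ContDiffOn.continuousOn (CD.dd (m := 0) hK hf 0)
  have hfd : DifferentiableOn ℝ f (region K) := CD.differentiableOn (m := 0) hf
  set I : Set ℝ := Set.Icc 0 1 with hI
  -- the derivative, extended by zero to a measurable function
  set h : ℝ → Space n → ℝ≥0∞ := fun s x => (I ×ˢ Kᶜ).indicator (fun p => ‖dd K 0 f p‖ₑ) (s, x)
    with hh
  have hQ : MeasurableSet (I ×ˢ Kᶜ) := measurableSet_region_slab hK 1
  have hm : Measurable (Function.uncurry h) := by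
    have h1 : ContinuousOn (fun p => ‖dd K 0 f p‖ₑ) (I ×ˢ Kᶜ) :=
      continuous_enorm.comp_continuousOn (hd.mono (slab_subset 1))
    classical
    have h2 := h1.measurable_piecewise (g := 0) continuousOn_const hQ
    rwa [Set.piecewise_eq_indicator] at h2
  set H : Space n → ℝ≥0∞ := fun x => ∫⁻ s, h s x with hH
  have hHm : Measurable H := hm.lintegral_prod_left'
  have hpt : ∀ t ∈ I, ∀ x ∈ Kᶜ, ‖f (0, x)‖ₑ ≤ ‖f (t, x)‖ₑ + H x := by
    intro t ht x hx
    have hFTC : ∫ s in (0 : ℝ)..t, dd K 0 f (s, x) = f (t, x) - f (0, x) := by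
      refine intervalIntegral.integral_eq_sub_of_hasDerivAt_of_le ht.1
        (continuousOn_timeLine hfc hx t) (fun s hs =>
          (hasDerivWithinAt_time (p := (s, x)) ⟨hs.1.le, hx⟩ hfd).hasDerivAt (Ici_mem_nhds hs.1)) ?_
      refine ContinuousOn.intervalIntegrable ?_
      rw [Set.uIcc_of_le ht.1]
      exact continuousOn_timeLine hd hx t
    have h1 : f (0, x) = f (t, x) - ∫ s in (0 : ℝ)..t, dd K 0 f (s, x) := by rw [hFTC]; ring
    rw [h1]
    refine (enorm_sub_le).trans (add_le_add le_rfl ?_)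
    rw [intervalIntegral.integral_of_le ht.1]
    refine (enorm_integral_le_lintegral_enorm _).trans ?_
    rw [← lintegral_indicator measurableSet_Ioc]
    refine lintegral_mono fun s => ?_
    by_cases hs : s ∈ Set.Ioc 0 t
    · rw [Set.indicator_of_mem hs, hh]
      simp only
      rw [Set.indicator_of_mem (show (s, x) ∈ I ×ˢ Kᶜ from ⟨⟨hs.1.le, hs.2.trans ht.2⟩, hx⟩)]
    · rw [Set.indicator_of_notMem hs]
      exact zero_le
  have hHn : eLpNorm H 2 (volume.restrict Kᶜ) ≤ mixedNorm K 1 (dd K 0 f) := by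
    rw [← ENNReal.pow_le_pow_left_iff two_ne_zero, eLpNorm_two_sq']
    refine (lintegral_lintegral_sq_le hm).trans ?_
    rw [mixedNorm_one, ← lintegral_indicator measurableSet_Ici]
    refine pow_le_pow_left' ?_ 2
    refine lintegral_mono fun s => ?_
    by_cases hs : s ∈ I
    · rw [Set.indicator_of_mem (show s ∈ Set.Ici 0 from hs.1), sl, eLpNorm_two_eq]
      gcongr with x
      rw [hh]
      exact Set.indicator_le_self _ _ _
    · have : ∀ x, h s x = 0 := fun x => Set.indicator_of_notMem (fun hp => hs hp.1) _
      simp [this]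
  have hsl : ∀ t ∈ I, sl K f 0 ≤ sl K f t + mixedNorm K 1 (dd K 0 f) := by
    intro t ht
    refine le_trans ?_ (add_le_add le_rfl hHn)
    have h1 : sl K f 0 ≤ eLpNorm ((fun x => ‖f (t, x)‖ₑ) + H) 2 (volume.restrict Kᶜ) := by
      refine eLpNorm_mono_enorm_ae ?_
      filter_upwards [ae_restrict_mem hK.measurableSet.compl] with x hx
      rw [enorm_eq_self]
      exact hpt t ht x hx
    refine h1.trans ((eLpNorm_add_le ?_ hHm.aestronglyMeasurable (by norm_num)).trans ?_)
    · exact ((continuousOn_slice hfc ht.1).aemeasurable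
        hK.measurableSet.compl).enorm.aestronglyMeasurable
    · exact add_le_add (le_of_eq (eLpNorm_enorm _)) le_rfl
  have h1 : ∫⁻ _t in I, sl K f 0 ≤ ∫⁻ t in I, (sl K f t + mixedNorm K 1 (dd K 0 f)) :=
    setLIntegral_mono_ae' measurableSet_Icc (Filter.Eventually.of_forall hsl)
  rw [lintegral_add_right _ measurable_const, setLIntegral_const, setLIntegral_const, hI,
    Real.volume_Icc] at h1
  simp only [sub_zero, ENNReal.ofReal_one, mul_one] at h1
  refine h1.trans (add_le_add ?_ le_rfl)
  rw [mixedNorm_one]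
  exact lintegral_mono_set Set.Icc_subset_Ici_self

/-- At the initial time, the derivative along a spatial field is that of the initial value. -/
lemma zz_some_zero (hK : IsClosed K) {f : SpaceTime n → ℝ} (hf : DifferentiableOn ℝ f (region K))
    (y : YIndex n) {x : Space n} (hx : x ∈ Kᶜ) :
    zz K (some y) f (0, x) = along Kᶜ (yField y) (fun x => f (0, x)) x := by
  have hp : ((0 : ℝ), x) ∈ region K := ⟨Set.mem_Ici.2 le_rfl, hx⟩
  have h1 := hasFDerivAt_space hK hp hf
  rw [along, h1.hasFDerivWithinAt.fderivWithin (hK.isOpen_compl.uniqueDiffWithinAt hx)]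
  rfl

lemma zw_some_zero (hK : IsClosed K) {f : SpaceTime n → ℝ} (c : List (YIndex n))
    (hf : CD K c.length f) {x : Space n} (hx : x ∈ Kᶜ) :
    zw K (c.map some) f (0, x) = iterAlong Kᶜ yField c (fun x => f (0, x)) x := by
  induction c generalizing x with
  | nil => rfl
  | cons y c ih =>
    have h1 : CD K 1 (zw K (c.map some) f) := CD.zw hK _ (hf.of_le (by simp; omega))
    change zz K (some y) (zw K (c.map some) f) (0, x) = along Kᶜ (yField y) _ x
    rw [zz_some_zero hK (CD.differentiableOn (m := 0) h1) y hx, along, along]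
    congr 1
    exact fderivWithin_congr (fun x hx => ih (hf.of_le (by simp)) hx) (ih (hf.of_le (by simp)) hx)

/-! ### The initial data of the derivatives -/

/-- The number of time derivatives in a word. -/
def tim (b : List (ZIndex n)) : ℕ := b.countP Option.isNone

lemma tim_cons (i : ZIndex n) (b : List (ZIndex n)) :
    tim (i :: b) = tim b + if i.isNone then 1 else 0 := List.countP_cons

lemma tim_le_length (b : List (ZIndex n)) : tim b ≤ b.length := List.countP_le_length

lemma exists_map_some {b : List (ZIndex n)} (h : tim b = 0) :
    ∃ c : List (YIndex n), b = c.map some := by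
  induction b with
  | nil => exact ⟨[], rfl⟩
  | cons i b ih =>
    rw [tim_cons] at h
    obtain ⟨c, rfl⟩ := ih (by omega)
    rcases i with _ | y
    · simp at h
    · exact ⟨y :: c, rfl⟩

/-- `∂_t` commutes with the fields `Z`, so that a time derivative can be moved to the front. -/
lemma exists_dd_zero_zw (hK : IsClosed K) {b : List (ZIndex n)} (h : 1 ≤ tim b) :
    ∃ b' : List (ZIndex n), b'.length + 1 = b.length ∧ tim b' + 1 = tim b ∧
      ∀ u, CD K b.length u → Set.EqOn (zw K b u) (dd K 0 (zw K b' u)) (region K) := by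
  induction b with
  | nil => simp [tim] at h
  | cons i b ih =>
    rcases i with _ | y
    · exact ⟨b, by simp, by simp [tim_cons], fun u _ p _ => rfl⟩
    · rw [tim_cons] at h
      obtain ⟨b', h1, h2, h3⟩ := ih (by simpa using h)
      refine ⟨some y :: b', by simp [h1], by simp [tim_cons, ← h2], fun u hu p hp => ?_⟩
      simp only [List.length_cons] at hu
      have h4 := dd_zz hK (f := zw K b' u) (CD.zw hK b' (hu.of_le (by omega))) 0 (some y) hp
      simp only [strC_zero, zero_mul, Finset.sum_const_zero, add_zero] at h4
      change zz K (some y) (zw K b u) p = dd K 0 (zz K (some y) (zw K b' u)) p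
      rw [h4]
      exact along_congr (h3 u (hu.of_le (by omega))) hp

/-- The quantities that determine all derivatives at a point: the derivatives of `u` and
`∂_t u` along spatial fields, and the derivatives of `□ u`. -/
def dataAt (K : Set (Space n)) (g : MatrixField n) (k : ℕ) (u : SpaceTime n → ℝ)
    (p : SpaceTime n) : ℝ :=
  ∑ c ∈ wordsLe (YIndex n) k, ∑ γ, |dd K γ (zw K (c.map some) u) p| +
    ∑ c ∈ (wordsLe (ZIndex n) k).filter (fun c => c.length < k), |zw K c (box K g u) p|

lemma dataAt_nonneg (g : MatrixField n) (k : ℕ) (u : SpaceTime n → ℝ) (p : SpaceTime n) :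
    0 ≤ dataAt K g k u p :=
  add_nonneg (Finset.sum_nonneg fun _ _ => Finset.sum_nonneg fun _ _ => abs_nonneg _)
    (Finset.sum_nonneg fun _ _ => abs_nonneg _)

lemma abs_le_dataAt_of_tim_eq_zero (g : MatrixField n) {k : ℕ} (u : SpaceTime n → ℝ)
    (p : SpaceTime n) {b : List (ZIndex n)} (hb : b.length ≤ k) (h0 : tim b = 0)
    (α : Fin (n + 1)) : |dd K α (zw K b u) p| ≤ dataAt K g k u p := by
  obtain ⟨c, rfl⟩ := exists_map_some h0
  refine le_trans ?_ (le_add_of_nonneg_right (Finset.sum_nonneg fun _ _ => abs_nonneg _))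
  refine le_trans ?_ (Finset.single_le_sum
    (f := fun c : List (YIndex n) => ∑ γ, |dd K γ (zw K (c.map some) u) p|)
    (fun _ _ => Finset.sum_nonneg fun _ _ => abs_nonneg _)
    (mem_wordsLe.2 (by simpa using hb)))
  exact Finset.single_le_sum (f := fun γ => |dd K γ (zw K (c.map some) u) p|)
    (fun _ _ => abs_nonneg _) (Finset.mem_univ α)

/-- If the principal part is close to the Minkowski one, it can be solved for `∂_t² v`. -/
lemma abs_dd_zero_zero_le {h : Fin (n + 1) → Fin (n + 1) → SpaceTime n → ℝ}
    {v : SpaceTime n → ℝ} {p : SpaceTime n} {B : ℝ}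
    (hh : ∀ α β, |h α β p - minkowski n α β| ≤ 1 / 2)
    (hB : ∀ α β, α ≠ 0 ∨ β ≠ 0 → |dd K α (dd K β v) p| ≤ B) (hB0 : 0 ≤ B) :
    |dd K 0 (dd K 0 v) p| ≤ 2 * |source K h v p| + 4 * (n + 1) ^ 2 * B := by
  set X := dd K 0 (dd K 0 v) p with hX
  have hm : ∀ α β, |minkowski n α β| ≤ 1 := by
    intro α β
    rw [minkowski, Matrix.diagonal_apply]
    split_ifs
    · refine Fin.cases ?_ (fun i => ?_) α <;> simp
    · simp
  have h00 : 1 / 2 ≤ |h 0 0 p| := by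
    have h1 := abs_le.1 (hh 0 0)
    have h2 : minkowski n 0 0 = -1 := by simp [minkowski]
    rw [h2] at h1
    rw [abs_of_neg (by linarith)]
    linarith
  have hh2 : ∀ α β, |h α β p| ≤ 2 := fun α β => by
    have h1 := abs_add_le (h α β p - minkowski n α β) (minkowski n α β)
    rw [sub_add_cancel] at h1
    linarith [hh α β, hm α β]
  have e1 : h 0 0 p * X = source K h v p -
      ∑ α, ∑ β, if α = 0 ∧ β = 0 then 0 else h α β p * dd K α (dd K β v) p := by
    have e2 : ∑ α : Fin (n + 1), ∑ β : Fin (n + 1), (if α = 0 ∧ β = 0 then h α β p *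
        dd K α (dd K β v) p else 0) = h 0 0 p * X := by
      rw [Finset.sum_eq_single 0 (fun α _ hα => by simp [hα]) (by simp),
        Finset.sum_eq_single 0 (fun β _ hβ => by simp [hβ]) (by simp)]
      simp [hX]
    rw [← e2, source, ← Finset.sum_sub_distrib]
    refine Finset.sum_congr rfl fun α _ => ?_
    rw [← Finset.sum_sub_distrib]
    refine Finset.sum_congr rfl fun β _ => ?_
    split_ifs <;> simp
  have e3 : |∑ α, ∑ β, if α = 0 ∧ β = 0 then 0 else h α β p * dd K α (dd K β v) p| ≤
      ∑ _α : Fin (n + 1), ∑ _β : Fin (n + 1), 2 * B := by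
    refine (Finset.abs_sum_le_sum_abs _ _).trans (Finset.sum_le_sum fun α _ =>
      (Finset.abs_sum_le_sum_abs _ _).trans (Finset.sum_le_sum fun β _ => ?_))
    split_ifs with h0
    · simpa using hB0
    · rw [abs_mul]
      exact mul_le_mul (hh2 α β) (hB α β (by tauto)) (abs_nonneg _) two_pos.le
  simp only [Finset.sum_const, Finset.card_univ, Fintype.card_fin, nsmul_eq_mul] at e3
  push_cast at e3
  have e4 : |h 0 0 p| * |X| ≤ |source K h v p| + (n + 1) * ((n + 1) * (2 * B)) := by
    rw [← abs_mul, e1]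
    exact (abs_sub _ _).trans (add_le_add le_rfl e3)
  have e5 := mul_le_mul_of_nonneg_right h00 (abs_nonneg X)
  nlinarith

/-- All first derivatives of the `Z^b u` are controlled by those quantities. Time derivatives are
removed one after the other, by means of the equation. -/
lemma FarMetric.exists_abs_le_dataAt {ρ₀ ρ : ℝ} {g : MatrixField n} (hg : FarMetric K ρ₀ g)
    (hρ : ρ₀ ≤ ρ)
    (hh : ∀ α β, ∀ p ∈ region K, ρ < ‖p.2‖ → |(g p)⁻¹ α β - minkowski n α β| ≤ 1 / 2) (k : ℕ) :
    ∀ m ≤ k, ∃ C : ℝ, 0 ≤ C ∧ ∀ u, CD K (k + 2) u → ∀ p ∈ region K, ρ < ‖p.2‖ →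
      ∀ b : List (ZIndex n), b.length ≤ m → ∀ α,
        |dd K α (zw K b u) p| ≤ C * dataAt K g k u p := by
  have hK := hg.closed
  have hρ1 := hg.one_le
  intro m
  induction m with
  | zero =>
    intro _
    refine ⟨1, zero_le_one, fun u _ p _ _ b hb α => ?_⟩
    rw [one_mul]
    have := tim_le_length b
    exact abs_le_dataAt_of_tim_eq_zero g u p (by omega) (by omega) α
  | succ m ih =>
    intro hm
    obtain ⟨C, hC, hind⟩ := ih (by omega)
    -- the commutators
    have hcomm : ∃ D : ℝ, 0 ≤ D ∧ ∀ u, CD K (k + 2) u → ∀ p ∈ region K, ρ < ‖p.2‖ →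
        ∀ b : List (ZIndex n), b.length ≤ m →
          |source K (fun α β p => (g p)⁻¹ α β) (zw K b u) p| ≤ D * dataAt K g k u p := by
      choose κ hs h0 hb using hg.exists_source_zw
      have hT : ∀ b, 0 ≤ ∑' i, κ b i := fun b => tsum_nonneg (h0 b)
      refine ⟨1 + ∑ b ∈ wordsLe (ZIndex n) m, (∑' i, κ b i) *
        ((wordsLe (ZIndex n) m).card * ((n + 1) * C)), add_nonneg zero_le_one
        (Finset.sum_nonneg fun b _ => mul_nonneg (hT b) (by positivity)),
        fun u hu p hp hr b hbm => ?_⟩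
      set P := dataAt K g k u p with hP
      have hP0 : 0 ≤ P := dataAt_nonneg g k u p
      have h1 := hb b b.length le_rfl u (hu.of_le (by omega)) p hp (hρ.trans_lt hr)
      have hG : grad K (lowW n b.length (rot b)) u p ≤
          (wordsLe (ZIndex n) m).card * ((n + 1) * C) * P := by
        have hsub : lowW n b.length (rot b) ⊆ wordsLe (ZIndex n) m := fun c hc =>
          mem_wordsLe.2 ((mem_lowW.1 hc).1.trans hbm)
        calc _ ≤ ∑ c ∈ wordsLe (ZIndex n) m, ∑ α, |dd K α (zw K c u) p| :=
              Finset.sum_le_sum_of_subset_of_nonneg hsub fun _ _ _ =>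
                Finset.sum_nonneg fun _ _ => abs_nonneg _
          _ ≤ ∑ _c ∈ wordsLe (ZIndex n) m, ∑ _α : Fin (n + 1), C * P :=
              Finset.sum_le_sum fun c hc => Finset.sum_le_sum fun α _ =>
                hind u hu p hp hr c (mem_wordsLe.1 hc) α
          _ = _ := by
              simp only [Finset.sum_const, Finset.card_univ, Fintype.card_fin, nsmul_eq_mul]
              push_cast
              ring
      have h2 : |source K (fun α β p => (g p)⁻¹ α β) (zw K b u) p - zw K b (box K g u) p| ≤
          (∑' i, κ b i) * ((wordsLe (ZIndex n) m).card * ((n + 1) * C)) * P := by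
        have h3 : |source K (fun α β p => (g p)⁻¹ α β) (zw K b u) p - zw K b (box K g u) p| ≤
            ‖p.2‖ * |source K (fun α β p => (g p)⁻¹ α β) (zw K b u) p - zw K b (box K g u) p| :=
          le_mul_of_one_le_left (abs_nonneg _) (by linarith)
        refine h3.trans (h1.trans ?_)
        rw [mul_assoc]
        exact mul_le_mul ((hs b).le_tsum _ fun i _ => h0 b i) hG (grad_nonneg _ _ _) (hT b)
      have h3 : |zw K b (box K g u) p| ≤ P :=
        (Finset.single_le_sum (f := fun c => |zw K c (box K g u) p|) (fun _ _ => abs_nonneg _)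
          (Finset.mem_filter.2 ⟨mem_wordsLe.2 (by omega), by omega⟩)).trans
          (le_add_of_nonneg_left (Finset.sum_nonneg fun _ _ =>
            Finset.sum_nonneg fun _ _ => abs_nonneg _))
      have h4 := Finset.single_le_sum (f := fun b => (∑' i, κ b i) *
        ((wordsLe (ZIndex n) m).card * ((n + 1) * C))) (fun b _ => mul_nonneg (hT b)
        (by positivity)) (mem_wordsLe.2 hbm)
      have h5 := abs_add_le (source K (fun α β p => (g p)⁻¹ α β) (zw K b u) p -
        zw K b (box K g u) p) (zw K b (box K g u) p)
      rw [sub_add_cancel] at h5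
      have h6 := mul_le_mul_of_nonneg_right h4 hP0
      rw [add_mul, one_mul]
      linarith
    obtain ⟨D, hD, hsrc⟩ := hcomm
    -- induction on twice the number of time derivatives, `∂_α` counting half
    have hstep : ∀ ν : ℕ, ∃ E : ℝ, 0 ≤ E ∧ ∀ u, CD K (k + 2) u → ∀ p ∈ region K, ρ < ‖p.2‖ →
        ∀ b : List (ZIndex n), b.length ≤ m + 1 → ∀ α, 2 * tim b + (if α = 0 then 1 else 0) ≤ ν →
        |dd K α (zw K b u) p| ≤ E * dataAt K g k u p := by
      intro ν
      induction ν with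
      | zero =>
        refine ⟨1, zero_le_one, fun u _ p _ _ b hb α hν => ?_⟩
        rw [one_mul]
        exact abs_le_dataAt_of_tim_eq_zero g u p (by omega) (by omega) α
      | succ ν ihν =>
        obtain ⟨E, hE, hν⟩ := ihν
        refine ⟨1 + E + 2 * D + 4 * (n + 1) ^ 2 * E, by positivity,
          fun u hu p hp hr b hb α hb2 => ?_⟩
        set P := dataAt K g k u p with hP
        have hP0 : 0 ≤ P := dataAt_nonneg g k u p
        have hc1 : 0 ≤ E * P := by positivity
        have hc2 : 0 ≤ 2 * D * P := by positivity
        have hc3 : 0 ≤ 4 * (n + 1 : ℝ) ^ 2 * E * P := by positivity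
        rw [add_mul, add_mul, add_mul, one_mul]
        by_cases h0 : tim b = 0
        · have := abs_le_dataAt_of_tim_eq_zero (K := K) g u p (hb.trans hm) h0 α
          linarith
        obtain ⟨b', hl, ht, he⟩ := exists_dd_zero_zw hK (Nat.one_le_iff_ne_zero.2 h0)
        have hv : CD K 2 (zw K b' u) := CD.zw hK b' (hu.of_le (by omega))
        have e1 : ∀ α, dd K α (zw K b u) p = dd K α (dd K 0 (zw K b' u)) p := fun α =>
          along_congr (he u (hu.of_le (by omega))) hp
        rw [e1]
        have hz : ∀ β, zw K (cz β :: b') u = dd K β (zw K b' u) := fun β => zz_cz β _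
        by_cases hα : α = 0
        · subst hα
          rw [if_pos rfl] at hb2
          have hbound : ∀ α β, α ≠ 0 → |dd K α (dd K β (zw K b' u)) p| ≤ E * P := by
            intro α β hα
            rw [← hz β]
            refine hν u hu p hp hr (cz β :: b') (by simp; omega) α ?_
            rw [if_neg hα, tim_cons]
            split_ifs <;> omega
          have h7 := abs_dd_zero_zero_le (h := fun α β p => (g p)⁻¹ α β) (B := E * P)
            (fun α β => hh α β p hp hr)
            (fun α β h => by
              by_cases hα : α = 0
              · rw [dd_comm hK hv α β hp]
                exact hbound β α (h.resolve_left fun h => h hα)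
              · exact hbound α β hα) hc1
          have h8 := hsrc u hu p hp hr b' (by omega)
          linarith
        · rw [dd_comm hK hv α 0 hp, ← hz α]
          rw [if_neg hα] at hb2
          have hne : (cz α : ZIndex n).isNone = false := by
            obtain ⟨i, rfl⟩ := Fin.exists_succ_eq.2 hα
            rfl
          have := hν u hu p hp hr (cz α :: b') (by simp; omega) 0 (by
            rw [if_pos rfl, tim_cons, hne]
            simp
            omega)
          linarith
    obtain ⟨E, hE, h⟩ := hstep (2 * (m + 1) + 1)
    refine ⟨E, hE, fun u hu p hp hr b hb α => h u hu p hp hr b hb α ?_⟩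
    have := tim_le_length b
    split_ifs <;> omega

/-! ### Control of the data and of the forcing term -/

/-- `X` is bounded by a finite constant times `Y`. -/
def Ctrl {σ : Type*} (X Y : σ → ℝ≥0∞) : Prop := ∃ C : ℝ≥0∞, C ≠ ⊤ ∧ ∀ s, X s ≤ C * Y s

namespace Ctrl

variable {σ ι : Type*} {X X' Y Z : σ → ℝ≥0∞}

lemma of_le (h : ∀ s, X s ≤ Y s) : Ctrl X Y := ⟨1, by simp, fun s => by simpa using h s⟩

lemma trans (h : Ctrl X Y) (h' : Ctrl Y Z) : Ctrl X Z := by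
  obtain ⟨C, hC, h⟩ := h
  obtain ⟨C', hC', h'⟩ := h'
  refine ⟨C * C', ENNReal.mul_ne_top hC hC', fun s => (h s).trans ?_⟩
  rw [mul_assoc]
  exact mul_le_mul_right (h' s) C

lemma mono (h : Ctrl X' Y) (hX : ∀ s, X s ≤ X' s) : Ctrl X Y := (of_le hX).trans h

lemma add (h : Ctrl X Y) (h' : Ctrl X' Y) : Ctrl (fun s => X s + X' s) Y := by
  obtain ⟨C, hC, h⟩ := h
  obtain ⟨C', hC', h'⟩ := h'
  refine ⟨C + C', ENNReal.add_ne_top.2 ⟨hC, hC'⟩, fun s => ?_⟩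
  rw [add_mul]
  exact add_le_add (h s) (h' s)

lemma const_mul (h : Ctrl X Y) {c : ℝ≥0∞} (hc : c ≠ ⊤) : Ctrl (fun s => c * X s) Y := by
  obtain ⟨C, hC, h⟩ := h
  refine ⟨c * C, ENNReal.mul_ne_top hc hC, fun s => ?_⟩
  rw [mul_assoc]
  exact mul_le_mul_right (h s) c

lemma sum {t : Finset ι} {X : ι → σ → ℝ≥0∞} (h : ∀ i ∈ t, Ctrl (X i) Y) :
    Ctrl (fun s => ∑ i ∈ t, X i s) Y := by
  classical
  induction t using Finset.induction_on with
  | empty => exact of_le fun s => by simp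
  | insert i t hi ih =>
    simp only [Finset.sum_insert hi]
    exact (h i (Finset.mem_insert_self _ _)).add
      (ih fun j hj => h j (Finset.mem_insert_of_mem hj))

lemma pow (h : Ctrl X Y) (m : ℕ) : Ctrl (fun s => X s ^ m) (fun s => Y s ^ m) := by
  obtain ⟨C, hC, h⟩ := h
  refine ⟨C ^ m, ENNReal.pow_ne_top hC, fun s => ?_⟩
  rw [← mul_pow]
  exact pow_le_pow_left' (h s) m

lemma of_sq (h : Ctrl (fun s => X s ^ 2) (fun s => Y s ^ 2)) : Ctrl X Y := by
  obtain ⟨C, hC, h⟩ := h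
  refine ⟨C + 1, ENNReal.add_ne_top.2 ⟨hC, ENNReal.one_ne_top⟩, fun s => ?_⟩
  rw [← ENNReal.pow_le_pow_left_iff two_ne_zero, mul_pow]
  refine (h s).trans ?_
  gcongr
  calc C ≤ (C + 1) * 1 := by rw [mul_one]; exact le_self_add
    _ ≤ (C + 1) ^ 2 := by rw [sq]; gcongr; exact le_add_self

end Ctrl

/-- The right-hand side of the estimate: the initial data and the forcing term. -/
def rhs (K : Set (Space n)) (k : ℕ) (u F : SpaceTime n → ℝ) : ℝ≥0∞ :=
  sumUpTo k (fun a : List (YIndex n) =>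
      sobolevNorm K 1 (iterAlong Kᶜ yField a (initialValue u))) +
    sumUpTo k (fun a : List (YIndex n) =>
      eLpNorm (iterAlong Kᶜ yField a (initialVelocity K u)) 2 (volume.restrict Kᶜ)) +
    sumUpTo k (fun a : List (ZIndex n) => mixedNorm K 1 (zw K a F))

lemma le_sumUpTo {ι : Type*} [Fintype ι] {k : ℕ} (N : List ι → ℝ≥0∞) {a : List ι}
    (ha : a.length ≤ k) : N a ≤ sumUpTo k N := by
  rw [sumUpTo_eq]
  exact Finset.single_le_sum (fun _ _ => zero_le) (mem_wordsLe.2 ha)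

variable {k : ℕ} (u F : SpaceTime n → ℝ)

lemma sobolevNorm_le_rhs {a : List (YIndex n)} (ha : a.length ≤ k) :
    sobolevNorm K 1 (iterAlong Kᶜ yField a (initialValue u)) ≤ rhs K k u F :=
  (le_sumUpTo (fun a => sobolevNorm K 1 (iterAlong Kᶜ yField a (initialValue u))) ha).trans
    (le_self_add.trans le_self_add)

lemma eLpNorm_value_le_rhs {a : List (YIndex n)} (ha : a.length ≤ k) :
    eLpNorm (iterAlong Kᶜ yField a (initialValue u)) 2 (volume.restrict Kᶜ) ≤ rhs K k u F :=
  (le_sumUpTo (fun c : List (Fin n) => eLpNorm (iterAlong Kᶜ spaceField c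
    (iterAlong Kᶜ yField a (initialValue u))) 2 (volume.restrict Kᶜ)) (a := [])
    (by simp)).trans (sobolevNorm_le_rhs u F ha)

lemma eLpNorm_deriv_le_rhs {a : List (YIndex n)} (ha : a.length ≤ k) (i : Fin n) :
    eLpNorm (along Kᶜ (spaceField i) (iterAlong Kᶜ yField a (initialValue u))) 2
      (volume.restrict Kᶜ) ≤ rhs K k u F :=
  (le_sumUpTo (fun c : List (Fin n) => eLpNorm (iterAlong Kᶜ spaceField c
    (iterAlong Kᶜ yField a (initialValue u))) 2 (volume.restrict Kᶜ)) (a := [i])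
    (by simp)).trans (sobolevNorm_le_rhs u F ha)

lemma eLpNorm_velocity_le_rhs {a : List (YIndex n)} (ha : a.length ≤ k) :
    eLpNorm (iterAlong Kᶜ yField a (initialVelocity K u)) 2 (volume.restrict Kᶜ) ≤ rhs K k u F :=
  (le_sumUpTo (fun a => eLpNorm (iterAlong Kᶜ yField a (initialVelocity K u)) 2
    (volume.restrict Kᶜ)) ha).trans (le_add_self.trans le_self_add)

lemma mixedNorm_le_rhs {a : List (ZIndex n)} (ha : a.length ≤ k) :
    mixedNorm K 1 (zw K a F) ≤ rhs K k u F :=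
  (le_sumUpTo (fun a => mixedNorm K 1 (zw K a F)) ha).trans le_add_self

lemma iterAlong_map_inl (c : List (Fin n)) (f : Space n → ℝ) :
    iterAlong Kᶜ yField (c.map Sum.inl) f = iterAlong Kᶜ spaceField c f := by
  induction c with
  | nil => rfl
  | cons i c ih => exact congrArg (along Kᶜ (spaceField i)) ih

/-- The right-hand side of the local energy assumption is controlled as well. -/
lemma ctrl_assumption_rhs (K : Set (Space n)) (k : ℕ) :
    Ctrl (fun q : (SpaceTime n → ℝ) × (SpaceTime n → ℝ) =>
      sobolevNorm K (k + 1) (initialValue q.1) + sobolevNorm K k (initialVelocity K q.1) +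
        sumUpTo k (fun a : List (Fin (n + 1)) =>
          mixedNorm K 1 (iterAlong (region K) coordField a q.2)))
      (fun q => rhs K k q.1 q.2) := by
  refine Ctrl.add (Ctrl.add ?_ ?_) ?_
  · simp only [sobolevNorm, sumUpTo_eq]
    refine Ctrl.sum fun a ha => Ctrl.of_le fun q => ?_
    rw [mem_wordsLe] at ha
    cases a with
    | nil => exact eLpNorm_value_le_rhs q.1 q.2 (a := []) (by simp)
    | cons i a =>
      have := eLpNorm_deriv_le_rhs (K := K) q.1 q.2 (a := a.map Sum.inl) (k := k)
        (by simpa using ha) i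
      rwa [iterAlong_map_inl] at this
  · simp only [sobolevNorm, sumUpTo_eq]
    refine Ctrl.sum fun a ha => Ctrl.of_le fun q => ?_
    have := eLpNorm_velocity_le_rhs (K := K) q.1 q.2 (a := a.map Sum.inl) (k := k)
      (by simpa using mem_wordsLe.1 ha)
    rwa [iterAlong_map_inl] at this
  · simp only [sumUpTo_eq]
    refine Ctrl.sum fun a ha => Ctrl.of_le fun q => ?_
    rw [← zw_map_cz]
    exact mixedNorm_le_rhs q.1 q.2 (by simpa using mem_wordsLe.1 ha)

variable {u F}

lemma sl_zero_congr (hK : IsClosed K) {f : SpaceTime n → ℝ} {h : Space n → ℝ}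
    (hf : ∀ x ∈ Kᶜ, f (0, x) = h x) : sl K f 0 = eLpNorm h 2 (volume.restrict Kᶜ) :=
  eLpNorm_congr_ae (by filter_upwards [ae_restrict_mem hK.measurableSet.compl] with x hx
                       exact hf x hx)

lemma dd_zero_zw (hK : IsClosed K) (b : List (ZIndex n)) {u : SpaceTime n → ℝ}
    (hu : CD K (b.length + 1) u) :
    Set.EqOn (dd K 0 (zw K b u)) (zw K b (dd K 0 u)) (region K) := by
  induction b with
  | nil => exact fun p _ => rfl
  | cons i b ih =>
    intro p hp
    simp only [List.length_cons] at hu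
    have h4 := dd_zz hK (f := zw K b u) (CD.zw hK b (hu.of_le (by omega))) 0 i hp
    simp only [strC_zero, zero_mul, Finset.sum_const_zero, add_zero] at h4
    change dd K 0 (zz K i (zw K b u)) p = zz K i (zw K b (dd K 0 u)) p
    rw [h4]
    exact along_congr (ih (hu.of_le (by omega))) hp

lemma sl_dd_zero_le_rhs (hK : IsClosed K) (hu : CD K (k + 2) u) {c : List (YIndex n)}
    (hc : c.length ≤ k) (γ : Fin (n + 1)) : sl K (dd K γ (zw K (c.map some) u)) 0 ≤ rhs K k u F := by
  refine Fin.cases ?_ (fun i => ?_) γ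
  · rw [sl_zero_congr hK (h := iterAlong Kᶜ yField c (initialVelocity K u)) fun x hx => ?_]
    · exact eLpNorm_velocity_le_rhs u F hc
    · rw [dd_zero_zw hK _ (hu.of_le (by simp; omega)) ⟨Set.mem_Ici.2 le_rfl, hx⟩]
      exact zw_some_zero hK c (CD.dd hK (hu.of_le (by omega)) 0) hx
  · rw [sl_zero_congr hK (h := iterAlong Kᶜ yField (Sum.inl i :: c) (initialValue u))
      fun x hx => ?_]
    · exact eLpNorm_deriv_le_rhs u F hc i
    · exact zw_some_zero hK (Sum.inl i :: c) (hu.of_le (by simp; omega)) hx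

lemma sl_zw_box_zero_le_rhs (hK : IsClosed K) {g : MatrixField n} (hbox : CD K k (box K g u))
    (he : ∀ p ∈ region K, box K g u p = F p) {c : List (ZIndex n)} (hc : c.length < k) :
    sl K (zw K c (box K g u)) 0 ≤ 2 * rhs K k u F := by
  refine (sl_zero_le hK (CD.zw hK c (hbox.of_le (by omega)))).trans ?_
  have h1 : ∀ a : List (ZIndex n), a.length ≤ k → mixedNorm K 1 (zw K a (box K g u)) ≤
      rhs K k u F := fun a ha => by
    rw [mixedNorm_congr hK (zw_congr he a)]
    exact mixedNorm_le_rhs u F ha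
  rw [two_mul]
  exact add_le_add (h1 c hc.le) (h1 (none :: c) hc)

/-- The data term of the far estimate is controlled. -/
lemma FarMetric.ctrl_farData {ρ₀ ρ : ℝ} {g : MatrixField n} (hg : FarMetric K ρ₀ g)
    (hρ : ρ₀ ≤ ρ)
    (hh : ∀ α β, ∀ p ∈ region K, ρ < ‖p.2‖ → |(g p)⁻¹ α β - minkowski n α β| ≤ 1 / 2)
    (k : ℕ) (S : Set (SpaceTime n → ℝ)) :
    Ctrl (fun q : {q : (SpaceTime n → ℝ) × (SpaceTime n → ℝ) // IsSolution K g S k q.1 q.2} =>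
      farData K ρ k q.1.1) (fun q => rhs K k q.1.1 q.1.2 ^ 2) := by
  have hK := hg.closed
  obtain ⟨C, hC, hdata⟩ := hg.exists_abs_le_dataAt hρ hh k k le_rfl
  set R : Set (Space n) := {x | ρ < ‖x‖} with hR
  have hRm : MeasurableSet R := measurableSet_lt measurable_const measurable_norm
  have hRK : R ⊆ Kᶜ := fun x hx hxK => ((hg.bound x hxK).trans hρ).not_gt hx
  set cut : (SpaceTime n → ℝ) → SpaceTime n → ℝ := fun f p => R.indicator (fun _ => f p) p.2
    with hcut
  set I₁ := wordsLe (YIndex n) k ×ˢ (Finset.univ : Finset (Fin (n + 1)))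
  set I₂ := (wordsLe (ZIndex n) k).filter (fun c => c.length < k)
  have hbox : ∀ q : {q : (SpaceTime n → ℝ) × (SpaceTime n → ℝ) // IsSolution K g S k q.1 q.2},
      CD K k (box K g q.1.1) := fun q =>
    CD.box hK hg.lorentz (fun β => (hg.lower β).smooth) q.2.contDiffOn
  have key : ∀ b ∈ wordsLe (ZIndex n) k, ∀ α, Ctrl
      (fun q : {q : (SpaceTime n → ℝ) × (SpaceTime n → ℝ) // IsSolution K g S k q.1 q.2} =>
        sl K (cut (dd K α (zw K b q.1.1))) 0) (fun q => rhs K k q.1.1 q.1.2) := by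
    intro b hb α
    refine Ctrl.trans (Y := fun q => ∑ i ∈ I₁.disjSum I₂, sl K (Sum.elim
      (fun i => dd K i.2 (zw K (i.1.map some) q.1.1))
      (fun c => zw K c (box K g q.1.1)) i) 0) ?_ (Ctrl.sum fun i hi => ?_)
    · refine ⟨(C.toNNReal : ℝ≥0∞), ENNReal.coe_ne_top, fun q => ?_⟩
      refine sl_le_sum (fun i hi => ?_) hK le_rfl fun x hx => ?_
      · rcases i with i | c
        · have hi' := mem_wordsLe.1 (Finset.mem_product.1 (Finset.inl_mem_disjSum.1 hi)).1
          exact Meas.of_continuousOn hK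
            (continuousOn_dd_zw hK q.2.contDiffOn (by simpa using hi') i.2)
        · have hc := (Finset.mem_filter.1 (Finset.inr_mem_disjSum.1 hi)).2
          exact Meas.of_continuousOn hK (ContDiffOn.continuousOn
            (CD.zw (m := 0) hK c ((hbox q).of_le (by omega))))
      · rw [Real.coe_toNNReal C hC, Finset.sum_disjSum, Finset.sum_product]
        by_cases hxR : x ∈ R
        · have h1 := hdata q.1.1 q.2.contDiffOn (0, x) ⟨Set.mem_Ici.2 le_rfl, hx⟩ hxR b
            (mem_wordsLe.1 hb) α
          simp only [hcut, Set.indicator_of_mem hxR]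
          exact h1
        · simp only [hcut, Set.indicator_of_notMem hxR, abs_zero]
          exact mul_nonneg hC (dataAt_nonneg g k q.1.1 (0, x))
    · rcases i with i | c
      · have hi' := mem_wordsLe.1 (Finset.mem_product.1 (Finset.inl_mem_disjSum.1 hi)).1
        exact Ctrl.of_le fun q => sl_dd_zero_le_rhs hK q.2.contDiffOn hi' i.2
      · have hc := (Finset.mem_filter.1 (Finset.inr_mem_disjSum.1 hi)).2
        exact ⟨2, by norm_num, fun q => sl_zw_box_zero_le_rhs hK (hbox q) q.2.eqn hc⟩
  refine (Ctrl.sum (t := wordsLe (ZIndex n) k) fun b hb => Ctrl.sum (t := Finset.univ)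
    fun α _ => (key b hb α).pow 2).mono fun q => ?_
  have hsq : ∀ f : SpaceTime n → ℝ, sl K (cut f) 0 ^ 2 = ∫⁻ x in R, ENNReal.ofReal (f (0, x) ^ 2) := by
    intro f
    have h1 : ∀ x, ‖cut f (0, x)‖ₑ ^ 2 = R.indicator (fun x => ENNReal.ofReal (f (0, x) ^ 2)) x :=
      fun x => by
        by_cases hx : x ∈ R
        · simp only [hcut, Set.indicator_of_mem hx, enorm_sq_eq]
        · simp [hcut, Set.indicator_of_notMem hx]
    rw [sl, eLpNorm_two_sq]
    simp only [h1]
    rw [lintegral_indicator hRm, Measure.restrict_restrict hRm, Set.inter_eq_left.2 hRK]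
  have hm : ∀ b ∈ wordsLe (ZIndex n) k, ∀ α, AEMeasurable
      (fun x => ENNReal.ofReal (dd K α (zw K b q.1.1) (0, x) ^ 2)) (volume.restrict R) :=
    fun b hb α => (((continuousOn_slice (continuousOn_dd_zw hK q.2.contDiffOn
      (mem_wordsLe.1 hb) α) le_rfl).mono hRK).pow 2 |>.aemeasurable hRm).ennreal_ofReal
  rw [farData]
  simp only [hsq]
  rw [← hR]
  simp only [ENNReal.ofReal_sum_of_nonneg fun b (_ : b ∈ wordsLe (ZIndex n) k) =>
    Finset.sum_nonneg fun α (_ : α ∈ Finset.univ) => sq_nonneg (dd K α (zw K b q.1.1) (0, _)),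
    ENNReal.ofReal_sum_of_nonneg fun α (_ : α ∈ Finset.univ) =>
      sq_nonneg (dd K α (zw K _ q.1.1) (0, _))]
  rw [lintegral_finsetSum' _ fun b hb => Finset.aemeasurable_fun_sum _ fun α _ => hm b hb α]
  exact Finset.sum_le_sum fun b hb => (lintegral_finsetSum' _ fun α _ => hm b hb α).le

/-! ### Local energy norms near the obstacle and far from it -/

/-- The part of `f` with `|x| > r`. -/
def farPart (r : ℝ) (f : SpaceTime n → ℝ) (p : SpaceTime n) : ℝ :=
  (if r < ‖p.2‖ then 1 else 0) * f p

lemma Meas.farPart {f : SpaceTime n → ℝ} (hf : Meas K f) (r : ℝ) : Meas K (farPart r f) :=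
  (Meas.of_space (φ := fun x : Space n => if r < ‖x‖ then (1 : ℝ) else 0) (Measurable.ite
    (measurableSet_lt measurable_const measurable_norm) measurable_const measurable_const)).mul hf

lemma abs_le_add_farPart {ι : Type*} {s : Finset ι} {f : SpaceTime n → ℝ}
    {F : ι → SpaceTime n → ℝ} {C : ℝ≥0} {r : ℝ} {p : SpaceTime n}
    (h : ‖p.2‖ ≤ r → |f p| ≤ C * ∑ i ∈ s, |F i p|) :
    |f p| ≤ (C + 1 : ℝ≥0) * ∑ i ∈ s.disjSum {()}, |Sum.elim F (fun _ => farPart r f) i p| := by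
  rw [Finset.sum_disjSum]
  have h0 : 0 ≤ ∑ i ∈ s, |F i p| := Finset.sum_nonneg fun _ _ => abs_nonneg _
  have h1 : 0 ≤ |farPart r f p| := abs_nonneg _
  have hC : (0 : ℝ) ≤ C := C.2
  simp only [Sum.elim_inl, Sum.elim_inr, Finset.sum_singleton]
  push_cast
  by_cases hr : r < ‖p.2‖
  · have : farPart r f p = f p := by rw [farPart, if_pos hr, one_mul]
    rw [this] at h1 ⊢
    nlinarith [mul_nonneg hC h0, mul_nonneg hC h1]
  · nlinarith [h (not_lt.1 hr), mul_nonneg hC h1]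

lemma meas_disjSum {ι : Type*} {s : Finset ι} {f : SpaceTime n → ℝ} {F : ι → SpaceTime n → ℝ}
    (hF : ∀ i ∈ s, Meas K (F i)) (hf : Meas K f) (r : ℝ) :
    ∀ i ∈ s.disjSum {()}, Meas K (Sum.elim F (fun _ => farPart r f) i) := by
  rintro (i | i) hi
  · exact hF i (Finset.inl_mem_disjSum.1 hi)
  · exact hf.farPart r

lemma mixedNorm_split {ι : Type*} {s : Finset ι} {f : SpaceTime n → ℝ}
    {F : ι → SpaceTime n → ℝ} (hF : ∀ i ∈ s, Meas K (F i)) (hf : Meas K f) (hK : IsClosed K)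
    {C : ℝ≥0} {q : ℝ≥0∞} (hq : 1 ≤ q) {r : ℝ}
    (h : ∀ p ∈ region K, ‖p.2‖ ≤ r → |f p| ≤ C * ∑ i ∈ s, |F i p|) :
    mixedNorm K q f ≤ (C + 1 : ℝ≥0) *
      (∑ i ∈ s, mixedNorm K q (F i) + mixedNorm K q (farPart r f)) := by
  have := mixedNorm_le_sum (meas_disjSum hF hf r) hK hq fun p hp => abs_le_add_farPart (h p hp)
  rwa [Finset.sum_disjSum, Finset.sum_singleton] at this

lemma ellInf_split {φ : ℕ → Space n → ℝ} (hφ : IsDyadicPartition φ) {ι : Type*} {s : Finset ι}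
    {f : SpaceTime n → ℝ} {F : ι → SpaceTime n → ℝ} (hF : ∀ i ∈ s, Meas K (F i))
    (hf : Meas K f) (hK : IsClosed K) {C : ℝ≥0} {σ r : ℝ}
    (h : ∀ p ∈ region K, ‖p.2‖ ≤ r → |f p| ≤ C * ∑ i ∈ s, |F i p|) :
    ellInf φ σ (mixedNorm K 2) f ≤ (C + 1 : ℝ≥0) *
      (∑ i ∈ s, ellInf φ σ (mixedNorm K 2) (F i) + ellInf φ σ (mixedNorm K 2) (farPart r f)) := by
  have := ellInf_le_sum hφ (σ := σ) (meas_disjSum hF hf r) hK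
    fun p hp => abs_le_add_farPart (h p hp)
  rwa [Finset.sum_disjSum, Finset.sum_singleton] at this

lemma le_rpow_half {X Q : ℝ≥0∞} (h : X ^ 2 ≤ Q) : X ≤ Q ^ (1 / 2 : ℝ) := by
  rw [one_div, ENNReal.le_rpow_inv_iff two_pos]
  simpa using h

lemma rpow_half_sq (Q : ℝ≥0∞) : (Q ^ (1 / 2 : ℝ)) ^ 2 = Q := by
  rw [← ENNReal.rpow_natCast, ← ENNReal.rpow_mul]
  norm_num

lemma mixedNorm_farPart_sq_le {v : SpaceTime n → ℝ} {r : ℝ} {Q : ℝ≥0∞}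
    (hQ : ∀ t, 0 ≤ t → ∫⁻ x in {x | r < ‖x‖}, ENNReal.ofReal (engy K v (t, x)) ≤ Q)
    (α : Fin (n + 1)) : mixedNorm K ⊤ (farPart r (dd K α v)) ^ 2 ≤ Q := by
  have hR : MeasurableSet {x : Space n | r < ‖x‖} :=
    measurableSet_lt measurable_const measurable_norm
  rw [← rpow_half_sq Q]
  refine pow_le_pow_left' (mixedNorm_top_le fun t ht => le_rpow_half ?_) 2
  rw [sl, eLpNorm_two_sq]
  refine le_trans ?_ (hQ t ht)
  rw [← lintegral_indicator hR]
  refine (lintegral_mono' Measure.restrict_le_self fun x => ?_)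
  by_cases hx : r < ‖x‖
  · rw [Set.indicator_of_mem (by exact hx), enorm_sq_eq, farPart, if_pos hx, one_mul]
    exact ENNReal.ofReal_le_ofReal (Finset.single_le_sum (f := fun α => dd K α v (t, x) ^ 2)
      (fun _ _ => sq_nonneg _) (Finset.mem_univ α))
  · rw [farPart, if_neg hx]
    simp

/-- The dyadic weights of the local energy norms. -/
lemma two_rpow_sq (j m : ℕ) : ((2 : ℝ≥0∞) ^ ((j : ℝ) * (-(m : ℝ) / 2))) ^ 2 =
    ENNReal.ofReal (((2 ^ j) ^ m)⁻¹) := by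
  rw [ENNReal.ofReal_inv_of_pos (by positivity), ENNReal.ofReal_pow (by positivity),
    ENNReal.ofReal_pow (by positivity), ← ENNReal.rpow_natCast, ← ENNReal.rpow_mul,
    ← pow_mul, ← ENNReal.rpow_natCast, ← ENNReal.rpow_neg]
  congr 1
  · simp
  · push_cast
    ring

lemma weight_mul_mixedNorm_sq {φ : ℕ → Space n → ℝ} (hφ : IsDyadicPartition φ) (j m : ℕ)
    {f : SpaceTime n → ℝ} (hf : Meas K f) :
    ((2 : ℝ≥0∞) ^ ((j : ℝ) * (-(m : ℝ) / 2)) * mixedNorm K 2 (fun p => φ j p.2 * f p)) ^ 2 =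
      ∫⁻ p in region K, ENNReal.ofReal (((2 ^ j) ^ m)⁻¹ * (φ j p.2 * f p) ^ 2) := by
  have hc : (0 : ℝ) ≤ ((2 ^ j) ^ m)⁻¹ := by positivity
  rw [mul_pow, two_rpow_sq, mixedNorm_two_sq ((Meas.of_space
    (hφ.smooth j).continuous.measurable).mul hf), ← lintegral_const_mul' _ _ ENNReal.ofReal_ne_top]
  exact lintegral_congr fun p => by rw [ENNReal.ofReal_mul hc, enorm_sq_eq]

/-- Bounds of the local energy densities at all dyadic scales give a bound of an `ℓ_∞` norm. -/
lemma ellInf_farPart_sq_le {φ : ℕ → Space n → ℝ} (hφ : IsDyadicPartition φ) (hK : IsClosed K)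
    {m : ℕ} {f v : SpaceTime n → ℝ} {r : ℝ} {Q : ℝ≥0∞} (hf : Meas K f)
    (hs : ∀ j p, r < ‖p.2‖ → ‖p.2‖ ≤ 2 ^ (j + 1) → ((2 ^ j) ^ m)⁻¹ * f p ^ 2 ≤ shell K v j p)
    (hQ : ∀ j, ∫⁻ p in Set.Ici 0 ×ˢ {x | r < ‖x‖}, ENNReal.ofReal (shell K v j p) ≤ Q) :
    ellInf φ (-(m : ℝ) / 2) (mixedNorm K 2) (farPart r f) ^ 2 ≤ Q := by
  rw [← rpow_half_sq Q]
  refine pow_le_pow_left' (iSup_le fun j => le_rpow_half ?_) 2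
  rw [weight_mul_mixedNorm_sq hφ j m (hf.farPart r)]
  refine le_trans ?_ (hQ j)
  rw [← lintegral_indicator (measurableSet_Ici.prod
    (measurableSet_lt measurable_const measurable_norm)), ← lintegral_indicator]
  · refine lintegral_mono fun p => ?_
    by_cases hp : p ∈ region K
    · rw [Set.indicator_of_mem hp]
      by_cases hr : r < ‖p.2‖
      · rw [Set.indicator_of_mem (show p ∈ Set.Ici (0 : ℝ) ×ˢ {x : Space n | r < ‖x‖} from
          ⟨hp.1, hr⟩), farPart, if_pos hr, one_mul]
        refine ENNReal.ofReal_le_ofReal ?_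
        by_cases h0 : φ j p.2 = 0
        · rw [h0]
          simpa using shell_nonneg v j p
        · refine le_trans ?_ (hs j p hr (hφ.outer j _ h0))
          have h1 := (sq_le_one_iff_abs_le_one _).2 (hφ.abs_le_one j p.2)
          rw [mul_pow]
          gcongr
          exact mul_le_of_le_one_left (sq_nonneg _) h1
      · rw [farPart, if_neg hr]
        simp
    · rw [Set.indicator_of_notMem hp]
      exact zero_le
  · exact measurableSet_region hK

/-- The local energy in a dyadic annulus is controlled by the local energy norms. -/
lemma lintegral_gsh_le {φ : ℕ → Space n → ℝ} (hφ : IsDyadicPartition φ) {ψ : Space n → ℝ}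
    (hψ : Measurable ψ) {ρ : ℝ} (hψ1 : ∀ x, ρ < ‖x‖ → ψ x = 1) (hK : IsClosed K) {k : ℕ}
    {W : Finset (List (ZIndex n))} (hW : ∀ b ∈ W, b.length ≤ k) {u : SpaceTime n → ℝ}
    (hu : CD K (k + 2) u) (J : ℕ) :
    ∫⁻ p in region K, ENNReal.ofReal (gsh K ρ W u J p) ≤
      6 * ∑ b ∈ W, ∑ α, ellInf φ (-1 / 2) (mixedNorm K 2)
        (fun p => ψ p.2 * dd K α (zw K b u) p) ^ 2 := by
  set I := W ×ˢ (Finset.univ : Finset (Fin (n + 1)))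
  set f : List (ZIndex n) × Fin (n + 1) → SpaceTime n → ℝ :=
    fun i p => ψ p.2 * dd K i.2 (zw K i.1 u) p with hfdef
  have hf : ∀ i ∈ I, Meas K (f i) := fun i hi => (Meas.of_space hψ).mul
    (Meas.of_continuousOn hK (continuousOn_dd_zw hK hu (hW _ (Finset.mem_product.1 hi).1) i.2))
  set T := Finset.Icc (J - 1) (J + 1) with hT
  have hterm : ∀ j, ∀ i ∈ I, ∫⁻ p in region K,
      ENNReal.ofReal (((2 ^ j) ^ 1)⁻¹ * (φ j p.2 * f i p) ^ 2) ≤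
        ellInf φ (-1 / 2) (mixedNorm K 2) (f i) ^ 2 := by
    intro j i hi
    rw [← weight_mul_mixedNorm_sq hφ j 1 (hf i hi)]
    refine pow_le_pow_left' ?_ 2
    rw [Nat.cast_one]
    exact le_iSup (fun j : ℕ => (2 : ℝ≥0∞) ^ ((j : ℝ) * (-1 / 2)) *
      mixedNorm K 2 (fun p => φ j p.2 * f i p)) j
  have hpt : ∀ p, gsh K ρ W u J p ≤ ∑ j ∈ T, 2 * ∑ i ∈ I,
      ((2 ^ j) ^ 1)⁻¹ * (φ j p.2 * f i p) ^ 2 := by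
    intro p
    by_cases hp : ρ < ‖p.2‖ ∧ dyIdx p.2 = J
    · rw [gsh, Set.indicator_of_mem (by exact hp)]
      have h1 : ∑ b ∈ W, ∑ α, dd K α (zw K b u) p ^ 2 = ∑ i ∈ I, f i p ^ 2 := by
        rw [Finset.sum_product]
        simp only [hfdef, hψ1 _ hp.1, one_mul]
      rw [h1]
      set E := ∑ i ∈ I, f i p ^ 2 with hE
      have hE0 : 0 ≤ E := Finset.sum_nonneg fun _ _ => sq_nonneg _
      have h2 := hφ.sum_near p.2
      rw [hp.2] at h2
      calc (2 ^ J)⁻¹ * E = ∑ j ∈ T, φ j p.2 ^ 2 * ((2 ^ J)⁻¹ * E) := by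
            rw [← Finset.sum_mul, h2, one_mul]
        _ ≤ ∑ j ∈ T, φ j p.2 ^ 2 * (2 * (2 ^ j)⁻¹ * E) := by
            refine Finset.sum_le_sum fun j hj => ?_
            gcongr
            have h3 : (2 : ℝ) ^ j ≤ 2 ^ (J + 1) :=
              pow_le_pow_right₀ one_le_two (Finset.mem_Icc.1 hj).2
            rw [pow_succ] at h3
            rw [← div_eq_mul_inv, inv_le_iff_one_le_mul₀ (by positivity), div_mul_eq_mul_div,
              one_le_div (by positivity)]
            linarith
        _ = _ := by
            refine Finset.sum_congr rfl fun j _ => ?_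
            rw [hE, Finset.mul_sum, Finset.mul_sum, Finset.mul_sum]
            exact Finset.sum_congr rfl fun i _ => by ring
    · rw [gsh, Set.indicator_of_notMem (by exact hp)]
      exact Finset.sum_nonneg fun j _ => mul_nonneg two_pos.le
        (Finset.sum_nonneg fun i _ => by positivity)
  have hn0 : ∀ j, ∀ i ∈ I, ∀ p, 0 ≤ ((2 ^ j) ^ 1)⁻¹ * (φ j p.2 * f i p) ^ 2 :=
    fun j i _ p => by positivity
  have hm : ∀ j, ∀ i ∈ I, AEMeasurable (fun p => ((2 ^ j) ^ 1)⁻¹ * (φ j p.2 * f i p) ^ 2)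
      (volume.restrict (region K)) := fun j i hi =>
    ((((Meas.of_space (hφ.smooth j).continuous.measurable).mul (hf i hi)).prod).pow_const 2).const_mul _
  set Q := ∑ i ∈ I, ellInf φ (-1 / 2) (mixedNorm K 2) (f i) ^ 2 with hQ
  have hj : ∀ j, ∫⁻ p in region K, ENNReal.ofReal
      (∑ i ∈ I, ((2 ^ j) ^ 1)⁻¹ * (φ j p.2 * f i p) ^ 2) ≤ Q := by
    intro j
    simp only [ENNReal.ofReal_sum_of_nonneg fun i hi => hn0 j i hi _]
    rw [lintegral_finsetSum' _ fun i hi => (hm j i hi).ennreal_ofReal]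
    exact Finset.sum_le_sum fun i hi => hterm j i hi
  refine (lintegral_mono fun p => ENNReal.ofReal_le_ofReal (hpt p)).trans ?_
  refine (lintegral_ofReal_sum_le (fun _ _ => two_pos.le)
    (fun j _ p => Finset.sum_nonneg fun i hi => hn0 j i hi p)
    (fun j _ => Finset.aemeasurable_fun_sum _ fun i hi => hm j i hi) fun j _ => hj j).trans ?_
  rw [← Finset.sum_product']
  gcongr
  rw [Finset.sum_const, nsmul_eq_mul]
  have hcard : T.card ≤ 3 := by rw [hT, Nat.card_Icc]; omega
  calc ENNReal.ofReal (T.card * 2) ≤ ENNReal.ofReal (3 * 2) := by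
        gcongr
        exact_mod_cast hcard
    _ = 6 := by norm_num

/-! ### The induction on the number of rotations -/

section Induction

variable {φ : ℕ → Space n → ℝ} {ψ : Space n → ℝ} {g : MatrixField n}
  {S : Set (SpaceTime n → ℝ)} {k : ℕ}

lemma mixedNorm_dd_le_leNorm (w : SpaceTime n → ℝ) (α : Fin (n + 1)) :
    mixedNorm K ⊤ (dd K α w) ≤ leNorm φ ψ K w :=
  (Finset.single_le_sum (f := fun α => mixedNorm K ⊤ (dd K α w)) (fun _ _ => zero_le)
    (Finset.mem_univ α)).trans (le_self_add.trans le_self_add)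

lemma ellInf_dd_le_leNorm (w : SpaceTime n → ℝ) (α : Fin (n + 1)) :
    ellInf φ (-1 / 2) (mixedNorm K 2) (fun p => ψ p.2 * dd K α w p) ≤ leNorm φ ψ K w :=
  (Finset.single_le_sum (f := fun α => ellInf φ (-1 / 2) (mixedNorm K 2)
    (fun p => ψ p.2 * dd K α w p)) (fun _ _ => zero_le)
    (Finset.mem_univ α)).trans (le_add_self.trans le_self_add)

lemma ellInf_le_leNorm (w : SpaceTime n → ℝ) :
    ellInf φ (-3 / 2) (mixedNorm K 2) w ≤ leNorm φ ψ K w := le_add_self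

/-- The pairs `(u, F)` where `u` solves `□ u = F` at level `k`. -/
abbrev Sol (K : Set (Space n)) (g : MatrixField n) (S : Set (SpaceTime n → ℝ)) (k : ℕ) : Type :=
  {q : (SpaceTime n → ℝ) × (SpaceTime n → ℝ) // IsSolution K g S k q.1 q.2}

/-- The local energy norm of the words in `W` is controlled. -/
def LECtrl (φ : ℕ → Space n → ℝ) (ψ : Space n → ℝ) (K : Set (Space n)) (g : MatrixField n)
    (S : Set (SpaceTime n → ℝ)) (k : ℕ) (W : Finset (List (ZIndex n))) : Prop :=
  ∀ a ∈ W, Ctrl (fun q : Sol K g S k => leNorm φ ψ K (zw K a q.1.1))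
    (fun q => rhs K k q.1.1 q.1.2)

lemma LocalEnergyAssumption.ctrl (H2 : LocalEnergyAssumption φ ψ K g S) (k : ℕ) :
    LECtrl φ ψ K g S k (lowW n k 0) := by
  intro a ha
  obtain ⟨hl, h0⟩ := mem_lowW.1 ha
  obtain ⟨c, rfl⟩ := exists_map_cz (Nat.le_zero.1 h0)
  obtain ⟨C, hC⟩ := H2 k
  obtain ⟨D, hD, h⟩ := ctrl_assumption_rhs K k
  refine ⟨C * D, ENNReal.mul_ne_top ENNReal.coe_ne_top hD, fun q => ?_⟩
  dsimp only
  rw [zw_map_cz, mul_assoc]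
  refine (le_sumUpTo (fun c => leNorm φ ψ K (iterAlong (region K) coordField c q.1.1))
    (by simpa using hl)).trans ((hC q.1.1 q.1.2 q.2).trans ?_)
  exact mul_le_mul_right (h q.1) _

lemma ctrl_farForce {j : ℕ} (hK : IsClosed K) (h : LECtrl φ ψ K g S k (lowW n k j)) :
    Ctrl (fun q : Sol K g S k => farForce K g k j q.1.1) (fun q => rhs K k q.1.1 q.1.2) := by
  refine Ctrl.add (Ctrl.sum fun a ha => Ctrl.of_le fun q => ?_)
    (Ctrl.sum fun b hb => Ctrl.sum fun α _ => (h b hb).mono fun q => ?_)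
  · rw [mixedNorm_congr hK (zw_congr q.2.eqn a)]
    exact mixedNorm_le_rhs _ _ (mem_wordsLe.1 ha)
  · exact mixedNorm_dd_le_leNorm _ α

lemma ctrl_farLocal {j : ℕ} {ρ : ℝ} (hφ : IsDyadicPartition φ) (hψ : Measurable ψ)
    (hψ1 : ∀ x, ρ < ‖x‖ → ψ x = 1) (hK : IsClosed K) (h : LECtrl φ ψ K g S k (lowW n k j)) :
    Ctrl (fun q : Sol K g S k => farLocal K ρ k j q.1.1)
      (fun q => rhs K k q.1.1 q.1.2 ^ 2) := by
  refine Ctrl.mono ((Ctrl.sum fun b hb => Ctrl.sum (t := Finset.univ) fun α _ =>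
    (((h b hb).mono fun q => ellInf_dd_le_leNorm _ α).pow 2)).const_mul (c := 6) (by norm_num))
    fun q => ?_
  exact iSup_le fun J => lintegral_gsh_le hφ hψ hψ1 hK
    (fun b hb => (mem_lowW.1 hb).1) q.2.contDiffOn J

/-- The step of the induction: near the obstacle the derivatives with `j + 1` rotations are
controlled by coordinate derivatives, far away by the exterior estimate. -/
lemma FarMetric.leCtrl_succ {ρ₀ : ℝ} (hg : FarMetric K ρ₀ g) (hn : 3 ≤ n)
    (hφ : IsDyadicPartition φ) (hψ : Measurable ψ) (hψ0 : ∀ x, 0 ≤ ψ x)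
    (hψ1 : ∀ x, ρ₀ < ‖x‖ → ψ x = 1) {j : ℕ}
    (h0 : LECtrl φ ψ K g S k (lowW n k 0)) (hj : LECtrl φ ψ K g S k (lowW n k j)) :
    LECtrl φ ψ K g S k (topW n k (j + 1)) := by
  intro a ha
  have hK := hg.closed
  have hal := (mem_topW.1 ha).1
  obtain ⟨ρ, hρ, hh, C, hC, hfar⟩ := hg.exists_far_estimate hn k j
  have hρ1 := hg.one_le
  -- the right-hand side of the exterior estimate
  have hQ : Ctrl (fun q : Sol K g S k => C * (farData K ρ k q.1.1 + farLocal K ρ k j q.1.1 +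
      farForce K g k j q.1.1 ^ 2)) (fun q => rhs K k q.1.1 q.1.2 ^ 2) :=
    (((hg.ctrl_farData hρ hh k S).add (ctrl_farLocal hφ hψ
      (fun x hx => hψ1 x (hρ.trans_lt hx)) hK hj)).add ((ctrl_farForce hK hj).pow 2)).const_mul hC
  obtain ⟨C₁, hC₁, hgrad⟩ := exists_near_grad (n := n) hK k (3 * ρ)
  obtain ⟨C₂, hC₂, hval⟩ := exists_near_zw (n := n) hK k (3 * ρ)
  set I := lowW n k 0 ×ˢ (Finset.univ : Finset (Fin (n + 1)))
  have hI : ∀ i ∈ I, i.1 ∈ lowW n k 0 := fun i hi => (Finset.mem_product.1 hi).1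
  have hmd : ∀ (q : Sol K g S k) {b : List (ZIndex n)}, b.length ≤ k → ∀ α,
      Meas K (dd K α (zw K b q.1.1)) := fun q b hb α =>
    Meas.of_continuousOn hK (continuousOn_dd_zw hK q.2.contDiffOn hb α)
  have hmz : ∀ (q : Sol K g S k) {b : List (ZIndex n)}, b.length ≤ k →
      Meas K (zw K b q.1.1) := fun q b hb =>
    Meas.of_continuousOn hK (ContDiffOn.continuousOn (CD.zw (m := 0) hK b
      (CD.of_le q.2.contDiffOn (by omega))))
  have hmψ : ∀ (q : Sol K g S k) {b : List (ZIndex n)}, b.length ≤ k → ∀ α,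
      Meas K (fun p => ψ p.2 * dd K α (zw K b q.1.1) p) := fun q b hb α =>
    (Meas.of_space hψ).mul (hmd q hb α)
  have hng : ∀ (q : Sol K g S k) (α : Fin (n + 1)), ∀ p ∈ region K, ‖p.2‖ ≤ 3 * ρ →
      |dd K α (zw K a q.1.1) p| ≤ (C₁.toNNReal : ℝ) * ∑ i ∈ I, |dd K i.2 (zw K i.1 q.1.1) p| := by
    intro q α p hp hr
    rw [Real.coe_toNNReal _ hC₁, Finset.sum_product]
    exact hgrad q.1.1 (CD.of_le q.2.contDiffOn (by omega)) a hal α p hp hr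
  refine Ctrl.add (Ctrl.add (Ctrl.sum fun α _ => ?_) (Ctrl.sum fun α _ => ?_)) ?_
  · refine Ctrl.trans ⟨((C₁.toNNReal + 1 : ℝ≥0) : ℝ≥0∞), ENNReal.coe_ne_top,
      fun q : Sol K g S k => mixedNorm_split (r := 3 * ρ) (q := ⊤)
      (F := fun i => dd K i.2 (zw K i.1 q.1.1)) (fun i hi => hmd q (mem_lowW.1 (hI i hi)).1 i.2)
      (hmd q hal α) hK le_top (hng q α)⟩ (Ctrl.add (Ctrl.sum fun i hi =>
        (h0 i.1 (hI i hi)).mono fun q => mixedNorm_dd_le_leNorm _ i.2) (Ctrl.of_sq ?_))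
    exact hQ.mono fun q => mixedNorm_farPart_sq_le (hfar q.1.1 q.2.contDiffOn a ha).1 α
  · refine Ctrl.trans ⟨((C₁.toNNReal + 1 : ℝ≥0) : ℝ≥0∞), ENNReal.coe_ne_top,
      fun q : Sol K g S k => ellInf_split hφ (r := 3 * ρ)
      (F := fun i p => ψ p.2 * dd K i.2 (zw K i.1 q.1.1) p)
      (fun i hi => hmψ q (mem_lowW.1 (hI i hi)).1 i.2) (hmψ q hal α) hK fun p hp hr => ?_⟩
      (Ctrl.add (Ctrl.sum fun i hi =>
        (h0 i.1 (hI i hi)).mono fun q => ellInf_dd_le_leNorm _ i.2) (Ctrl.of_sq ?_))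
    · simp only [abs_mul, ← Finset.mul_sum, abs_of_nonneg (hψ0 _)]
      rw [mul_left_comm]
      exact mul_le_mul_of_nonneg_left (hng q α p hp hr) (hψ0 _)
    · refine hQ.mono fun q => ?_
      have := ellInf_farPart_sq_le (m := 1) hφ hK (hmψ q hal α) (v := zw K a q.1.1)
        (r := 3 * ρ) (fun i p hr hi => ?_) (hfar q.1.1 q.2.contDiffOn a ha).2
      · simpa using this
      · rw [hψ1 _ (by linarith), one_mul, pow_one, shell, Set.indicator_of_mem (by exact hi)]
        gcongr
        refine le_add_of_le_of_nonneg (Finset.single_le_sum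
          (f := fun α => dd K α (zw K a q.1.1) p ^ 2) (fun _ _ => sq_nonneg _)
          (Finset.mem_univ α)) (by positivity)
  · refine Ctrl.trans ⟨((C₂.toNNReal + 1 : ℝ≥0) : ℝ≥0∞), ENNReal.coe_ne_top,
      fun q : Sol K g S k => ellInf_split hφ (r := 3 * ρ) (s := lowW n k 0)
      (F := fun c => zw K c q.1.1)
      (fun c hc => hmz q (mem_lowW.1 hc).1) (hmz q hal) hK fun p hp hr => ?_⟩
      (Ctrl.add (Ctrl.sum fun c hc =>
        (h0 c hc).mono fun q => ellInf_le_leNorm _) (Ctrl.of_sq ?_))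
    · rw [Real.coe_toNNReal _ hC₂]
      exact hval q.1.1 q.2.contDiffOn a hal p hp hr
    · refine hQ.mono fun q => ?_
      have := ellInf_farPart_sq_le (m := 3) hφ hK (hmz q hal) (v := zw K a q.1.1)
        (r := 3 * ρ) (fun i p hr hi => ?_) (hfar q.1.1 q.2.contDiffOn a ha).2
      · simpa using this
      · rw [shell, Set.indicator_of_mem (by exact hi), pow_succ' ((2 : ℝ) ^ i), mul_inv,
          mul_assoc]
        gcongr
        exact le_add_of_nonneg_left (engy_nonneg _ _)

lemma FarMetric.leCtrl {ρ₀ : ℝ} (hg : FarMetric K ρ₀ g) (hn : 3 ≤ n)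
    (hφ : IsDyadicPartition φ) (hψ : Measurable ψ) (hψ0 : ∀ x, 0 ≤ ψ x)
    (hψ1 : ∀ x, ρ₀ < ‖x‖ → ψ x = 1) (H2 : LocalEnergyAssumption φ ψ K g S) (k j : ℕ) :
    LECtrl φ ψ K g S k (lowW n k j) := by
  induction j with
  | zero => exact H2.ctrl k
  | succ j ih =>
    intro a ha
    obtain ⟨h1, h2⟩ := mem_lowW.1 ha
    rcases Nat.le_succ_iff.1 h2 with h | h
    · exact ih a (mem_lowW.2 ⟨h1, h⟩)
    · exact hg.leCtrl_succ hn hφ hψ hψ0 hψ1 (H2.ctrl k) ih a (mem_topW.2 ⟨h1, h⟩)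

end Induction

end

end AFWave


theorem mainTheorem7 (n : ℕ) (hn : 3 ≤ n)
    -- the obstacle `K ⊂ B(0, R₀)`; `K = ∅` is the case without obstacle
    (R₀ : ℝ) (hR₀ : 0 ≤ R₀)
    (K : Set (AFWave.Space n)) (hK : IsCompact K) (hKR₀ : K ⊆ Metric.ball 0 R₀)
    -- the dyadic partition of unity
    (φ : ℕ → AFWave.Space n → ℝ) (hφ : AFWave.IsDyadicPartition φ)
    -- the metric
    (g : AFWave.MatrixField n) (hg : AFWave.IsLorentzianMetric K g)
    (H1 : AFWave.IsAsymptoticallyFlat φ K g)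
    -- the class of functions (all, or with a boundary condition) in which solutions are taken
    (S : Set (AFWave.SpaceTime n → ℝ))
    (R₁ : ℝ) (hR₁ : R₀ < R₁) (ψ : AFWave.Space n → ℝ) (hψ : AFWave.IsCutoff R₁ ψ)
    (H2 : AFWave.LocalEnergyAssumption φ ψ K g S) :
    ∀ k : ℕ, ∃ C : ℝ≥0, ∀ u F : AFWave.SpaceTime n → ℝ, AFWave.IsSolution K g S k u F →
      AFWave.sumUpTo k (fun a : List (AFWave.ZIndex n) =>
          AFWave.leNorm φ ψ K (AFWave.iterAlong (AFWave.region K) AFWave.zField a u)) ≤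
        C * (AFWave.sumUpTo k (fun a : List (AFWave.YIndex n) =>
              AFWave.sobolevNorm K 1
                (AFWave.iterAlong Kᶜ AFWave.yField a (AFWave.initialValue u)))
          + AFWave.sumUpTo k (fun a : List (AFWave.YIndex n) =>
              eLpNorm (AFWave.iterAlong Kᶜ AFWave.yField a (AFWave.initialVelocity K u)) 2
                (volume.restrict Kᶜ))
          + AFWave.sumUpTo k (fun a : List (AFWave.ZIndex n) =>
              AFWave.mixedNorm K 1
                (AFWave.iterAlong (AFWave.region K) AFWave.zField a F))) := by
  intro k
  obtain ⟨ρ, hρ, hfar⟩ := AFWave.exists_farMetric hφ hK.isClosed hg H1 (R := R₁ + 1) fun x hx => by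
    have := mem_ball_zero_iff.1 (hKR₀ hx)
    linarith
  have hLE := hfar.leCtrl hn hφ hψ.smooth.continuous.measurable hψ.nonneg
    (fun x hx => hψ.eq_one x (lt_of_le_of_lt hρ hx)) H2 k k
  -- a word of length at most `k` has at most `k` rotations
  obtain ⟨C, hC, h⟩ := AFWave.Ctrl.sum (t := AFWave.wordsLe (AFWave.ZIndex n) k) fun a ha =>
    hLE a (AFWave.mem_lowW.2 ⟨AFWave.mem_wordsLe.1 ha,
      (AFWave.rot_le_length a).trans (AFWave.mem_wordsLe.1 ha)⟩)
  refine ⟨C.toNNReal, fun u F hu => ?_⟩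
  rw [AFWave.sumUpTo_eq, ENNReal.coe_toNNReal hC]
  exact h ⟨(u, F), hu⟩
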